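/- Let $n\ge 2$ be an integer, $\mu>0$, $\gamma>1$, $K>0$, $P(\rho)=K\rho^\gamma$ and $p(v)=P(1/v)=Kv^{-\gamma}$. For $\rho_+,\rho_b,u_b>0$ put $m_b=\rho_b u_b$ and let $(\tilde\rho,\tilde u)$ be a classical stationary solution, with $\tilde\rho>0$, of the spherically symmetric isentropic Navier–Stokes equations on $r\ge 1$ with inflow data, $$\frac{(r^{n-1}\tilde\rho\tilde u)_r}{r^{n-1}}=0,\qquad \tilde\rho\tilde u\tilde u_r=\mu\Big(\frac{(r^{n-1}\tilde u)_r}{r^{n-1}}\Big)_r-P(\tilde\rho)_r,\qquad (\tilde\rho,\tilde u)(1)=(\rho_b,u_b),\quad \lim_{r\to\infty}(\tilde\rho,\tilde u)(r)=(\rho_+,0),$$ and put $\tilde v=1/\tilde\rho$. For $T>0$ and $t\in[0,T]$ let $S(t)=[-m_bt,\infty)$ and $\mathcal Q(t)=\{(x,\tau): 0\le\tau\le t,\ x\ge -m_b\tau\}$. Let $v,u$ be functions on $\mathcal Q(T)$ such that $v,u$ are $C^1$ and $u_{xx}$ exists and is continuous (all up to the boundary of $\mathcal Q(T)$). Let $$r=R(x,t)=\Big(1+n\int_{-m_bt}^x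 v(y,t)\,dy\Big)^{1/n},\qquad \phi=v-\tilde v(R),\qquad \psi=u-\tilde u(R),$$ where $\tilde v,\tilde u,\tilde v_r,\tilde u_r$ below are evaluated at $r=R(x,t)$. Suppose that $(\phi,\psi)$ solves in $\mathcal Q(T)$ the perturbation equations in Lagrangian mass coordinates $$\phi_t-(r^{n-1}\psi)_x=\frac{\tilde v_r\tilde u}{\tilde v}\phi-\tilde v_r\psi,$$ $$\psi_t-\mu r^{n-1}\Big(\frac{(r^{n-1}\psi)_x}{v}\Big)_x+r^{n-1}p'(v)\phi_x=\frac{\tilde u_r\tilde u}{\tilde v}\phi-\tilde v_r\frac{p'(v)-p'(\tilde v)}{v-\tilde v}v\phi-\tilde u_r\psi,$$ with $\phi=\psi=0$ at $x=-m_bt$, $t\in[0,T]$ (the second term on the right of the second equation being $0$ where $v=\tilde v$). Define $$N(t)=\sup_{0\le\tau\le t}\Big\{\|(\phi,\psi)\|_{L^2(S(\tau))}+\|r^{n-1}(\phi_x,\psi_x)\|_{L^2(S(\tau))}\Big\},$$ $$M^2(t)=\iint_{\mathcal Q(t)}\Big\{\frac{\psi^2}{r^2}+r^{2(n-1)}\psi_x^2+r^{2n-4}\phi_x^2+r^{4n-6}\psi_{xx}^2\Big\}dx\,d\tau+\int_0^t\{u_b\psi_x^2+u_b^3\phi_x^2\}(-m_b\tau,\tau)\,d\tau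 .$$ Then there is a constant $\alpha>0$ depending only on $\mu,\gamma,K,n$ such that for every $\rho_+\in(0,\alpha]$ there are constants $\varepsilon_0,\varepsilon,C(\rho_+)>0$ depending only on $\rho_+,\mu,\gamma,K,n$ with the following property. If $|\rho_b-\rho_+|\le u_b^2$ and $u_b<\varepsilon$, then for every $T>0$ and all such $(\tilde\rho,\tilde u)$ and $(v,u)$ with $$N(t)\le 2\varepsilon_0\ \ (0\le t\le T),\qquad \frac1{2\rho_+}\le v\le\frac2{\rho_+}\ \text{ on }\mathcal Q(T),$$ one has $$\sup_{0\le t\le T}N^2(t)+M^2(T)\le C(\rho_+)\Big\{1+\frac1{u_b^2}\Big\}N^2(0).$$ -/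

import Mathlib

open Set MeasureTheory Filter Topology
open scoped ENNReal

namespace InflowNS

noncomputable section

/-- The pressure `P(ρ) = K ρ ^ γ` as a function of the density. -/
def pressure (K γ : ℝ) (ρ : ℝ) : ℝ := K * ρ ^ γ

/-- The pressure `p(v) = P(1 / v)` as a function of the specific volume. -/
def pressureV (K γ : ℝ) (v : ℝ) : ℝ := pressure K γ v⁻¹

/-- Radial derivative on `[1, ∞)` (one-sided at `r = 1`). -/
def dr (f : ℝ → ℝ) (r : ℝ) : ℝ := derivWithin f (Ici 1) r

/-- `(ρs, us)` is a classical stationary solution, on `r ≥ 1`, of the spherically symmetric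
isentropic Navier-Stokes equations with boundary data `(ρb, ub)` and far-field state `(ρp, 0)`. -/
structure IsStationary (n : ℕ) (μ γ K ρp ρb ub : ℝ) (ρs us : ℝ → ℝ) : Prop where
  contDiffOn_density : ContDiffOn ℝ 1 ρs (Ici 1)
  contDiffOn_velocity : ContDiffOn ℝ 2 us (Ici 1)
  density_pos : ∀ r ∈ Ici (1 : ℝ), 0 < ρs r
  mass : ∀ r ∈ Ici (1 : ℝ), (r ^ (n - 1))⁻¹ * dr (fun s => s ^ (n - 1) * ρs s * us s) r = 0
  momentum : ∀ r ∈ Ici (1 : ℝ),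
    ρs r * us r * dr us r =
      μ * dr (fun s => dr (fun q => q ^ (n - 1) * us q) s / s ^ (n - 1)) r
        - dr (fun s => pressure K γ (ρs s)) r
  density_boundary : ρs 1 = ρb
  velocity_boundary : us 1 = ub
  density_farField : Tendsto ρs atTop (𝓝 ρp)
  velocity_farField : Tendsto us atTop (𝓝 0)

/-- The snapshot domain `S(t) = [-m t, ∞)`. -/
def snap (m t : ℝ) : Set ℝ := Ici (-(m * t))

/-- The space-time domain `Q(T) = {(x, t) : 0 ≤ t ≤ T, -m t ≤ x}`. Points are pairs `(x, t)`. -/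
def dom (m T : ℝ) : Set (ℝ × ℝ) := {z | z.2 ∈ Icc 0 T ∧ -(m * z.2) ≤ z.1}

/-- Partial derivative in `x` at `(x, t)`, taken within `S(t)` (one-sided at `x = -m t`). -/
def dx (m : ℝ) (f : ℝ × ℝ → ℝ) (z : ℝ × ℝ) : ℝ :=
  derivWithin (fun y => f (y, z.2)) (snap m z.2) z.1

/-- Partial derivative in `t`: the derivative within the convex body `Q(T)`, applied to the
direction `(0, 1)`. -/
def dt (m T : ℝ) (f : ℝ × ℝ → ℝ) (z : ℝ × ℝ) : ℝ :=
  fderivWithin ℝ f (dom m T) z (0, 1)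

/-- The radius `r = R(x, t) = (1 + n ∫_{-m t}^x v(y, t) dy) ^ (1 / n)` of the particle with
Lagrangian mass coordinate `x`. -/
def radius (n : ℕ) (m : ℝ) (v : ℝ × ℝ → ℝ) (z : ℝ × ℝ) : ℝ :=
  (1 + n * ∫ y in (-(m * z.2))..z.1, v (y, z.2)) ^ ((1 : ℝ) / n)

/-- The perturbation `φ(x, t) = v(x, t) - 1 / ρs (R(x, t))` of the specific volume. -/
def phi (n : ℕ) (m : ℝ) (ρs : ℝ → ℝ) (v : ℝ × ℝ → ℝ) (z : ℝ × ℝ) : ℝ :=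
  v z - (ρs (radius n m v z))⁻¹

/-- The perturbation `ψ(x, t) = u(x, t) - us (R(x, t))` of the velocity. -/
def psi (n : ℕ) (m : ℝ) (us : ℝ → ℝ) (v u : ℝ × ℝ → ℝ) (z : ℝ × ℝ) : ℝ :=
  u z - us (radius n m v z)

/-- The source term `(ṽ_r ũ / ṽ) φ - ṽ_r ψ`, with `ṽ = 1 / ρs`, at radius `r`. -/
def source1 (ρs us : ℝ → ℝ) (r φ ψ : ℝ) : ℝ :=
  dr (fun s => (ρs s)⁻¹) r * us r / (ρs r)⁻¹ * φ - dr (fun s => (ρs s)⁻¹) r * ψ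

/-- The source term `(ũ_r ũ / ṽ) φ - ṽ_r ((p'(v) - p'(ṽ)) / (v - ṽ)) v φ - ũ_r ψ`, with
`ṽ = 1 / ρs`, at radius `r`. It is used with `φ = v - ṽ`, so that the second summand vanishes
where `v = ṽ`. -/
def source2 (K γ : ℝ) (ρs us : ℝ → ℝ) (r v φ ψ : ℝ) : ℝ :=
  dr us r * us r / (ρs r)⁻¹ * φ
    - dr (fun s => (ρs s)⁻¹) r
        * ((deriv (pressureV K γ) v - deriv (pressureV K γ) (ρs r)⁻¹) / (v - (ρs r)⁻¹)) * v * φ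
    - dr us r * ψ

/-- `(v, u)` are classical on `Q(T)` (up to the boundary) and their perturbations
`(φ, ψ) = (v - ṽ, u - ũ)` of the stationary solution `(ρs, us)` solve the perturbation equations
in Lagrangian mass coordinates in `Q(T)`, with zero boundary values at `x = -m t`.
The relation `∂ₜ R = u` is a consequence of the first equation, and is not imposed. -/
structure IsSolution (n : ℕ) (μ γ K m T : ℝ) (ρs us : ℝ → ℝ) (v u : ℝ × ℝ → ℝ) : Prop where
  contDiffOn_v : ContDiffOn ℝ 1 v (dom m T)
  contDiffOn_u : ContDiffOn ℝ 1 u (dom m T)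
  differentiableOn_dx_u : ∀ t ∈ Icc 0 T, DifferentiableOn ℝ (fun x => dx m u (x, t)) (snap m t)
  continuousOn_dxx_u : ContinuousOn (dx m (dx m u)) (dom m T)
  mass : ∀ z ∈ dom m T,
    dt m T (phi n m ρs v) z
        - dx m (fun w => radius n m v w ^ (n - 1) * psi n m us v u w) z
      = source1 ρs us (radius n m v z) (phi n m ρs v z) (psi n m us v u z)
  momentum : ∀ z ∈ dom m T,
    dt m T (psi n m us v u) z
        - μ * radius n m v z ^ (n - 1)
            * dx m (fun w =>
                dx m (fun y => radius n m v y ^ (n - 1) * psi n m us v u y) w / v w) z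
        + radius n m v z ^ (n - 1) * deriv (pressureV K γ) (v z) * dx m (phi n m ρs v) z
      = source2 K γ ρs us (radius n m v z) (v z) (phi n m ρs v z) (psi n m us v u z)
  phi_boundary : ∀ t ∈ Icc 0 T, phi n m ρs v (-(m * t), t) = 0
  psi_boundary : ∀ t ∈ Icc 0 T, psi n m us v u (-(m * t), t) = 0

/-- `‖(f, g)(·, t)‖` in `L²(S(t))`, with value `∞` if it is not finite. -/
def normL2 (m : ℝ) (f g : ℝ × ℝ → ℝ) (t : ℝ) : ℝ≥0∞ :=
  (∫⁻ x in snap m t, ENNReal.ofReal (f (x, t) ^ 2 + g (x, t) ^ 2)) ^ ((1 : ℝ) / 2)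

/-- The energy norm `N(t)`, the supremum over `0 ≤ τ ≤ t` of
`‖(φ, ψ)‖_{L²(S(τ))} + ‖r^{n-1} (φ_x, ψ_x)‖_{L²(S(τ))}`. -/
def energyN (n : ℕ) (m : ℝ) (ρs us : ℝ → ℝ) (v u : ℝ × ℝ → ℝ) (t : ℝ) : ℝ≥0∞ :=
  ⨆ τ ∈ Icc 0 t,
    (normL2 m (phi n m ρs v) (psi n m us v u) τ
      + normL2 m (fun z => radius n m v z ^ (n - 1) * dx m (phi n m ρs v) z)
          (fun z => radius n m v z ^ (n - 1) * dx m (psi n m us v u) z) τ)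

/-- The squared dissipation norm `M²(t)`, including the boundary traces of `ψ_x` and `φ_x`. -/
def dissipM2 (n : ℕ) (m ub : ℝ) (ρs us : ℝ → ℝ) (v u : ℝ × ℝ → ℝ) (t : ℝ) : ℝ≥0∞ :=
  (∫⁻ z in dom m t, ENNReal.ofReal
      (psi n m us v u z ^ 2 / radius n m v z ^ 2
        + radius n m v z ^ (2 * (n - 1)) * dx m (psi n m us v u) z ^ 2
        + radius n m v z ^ (2 * n - 4) * dx m (phi n m ρs v) z ^ 2
        + radius n m v z ^ (4 * n - 6) * dx m (dx m (psi n m us v u)) z ^ 2))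
  + ∫⁻ τ in Icc 0 t, ENNReal.ofReal
      (ub * dx m (psi n m us v u) (-(m * τ), τ) ^ 2
        + ub ^ 3 * dx m (phi n m ρs v) (-(m * τ), τ) ^ 2)

end

end InflowNS

namespace InflowNS

/-! Write N = n - 1, m = ρ_b u_b, V for the stationary specific volume, R for the radius, and
measure the gradient of φ by G = R^N φ_x / v (`gradG`). The theorem comes from three energy
estimates with constants independent of m, coupled through a Hardy inequality that gains m³ and a
boundary trace that loses 1/m². Since m³ / m² = m is small the system closes, and the remaining 1/m²
in front of the data is the factor 1/u_b².

The profile. For small m the stationary momentum equation is singularly perturbed: w = V_r / r^N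
satisfies μ m w' = -a w - f with a bounded below and f = O(m² r^{-2N-1}). A first integral confines
V to [v_+/2, 2 v_+] and, thanks to |ρ_b - ρ_+| ≤ u_b², gives V_r(1) = O(m). Hence w is a boundary
layer of height and width of order m plus an algebraic tail of order m² (`Profile.abs_slope_le`).
The coefficients of the perturbation equations are then controlled by σ = `layerWeight`
(`exists_profileBounds`). As φ vanishes on the boundary, φ² ≤ (R - 1) ∫ v G², and ∫ σ (R - 1) dx =
O(m³); so ∫ σ φ² ≤ C m³ ∫ G² (`Flow.hardy`).

The energies. (0) ψ²/2 plus the relative potential energy dissipates (R^N ψ_x)² + (ψ/R)², with error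
C σ φ² (`Setting.exists_energy0_le`). (1) By the mass equation, G_t and ψ_t / μ have the same
viscous term R^N ((R^N ψ)_x / v)_x. It cancels in the derivative of μ G²/2 - ψ G up to a flux, and
the damping p'(v) v G² < 0 remains (`Setting.exists_energy1_le`). Inflow feeds in m μ G²/2 at the
boundary, where G = ψ_x / (m V(1)) because v is constant along it: the cost is (1/m) ∫ ψ_x² on the
boundary. (2) ∫ R^{2N} ψ_x² dissipates (R^{2N} ψ_xx)² and has a boundary term of good sign; its
cubic error is absorbed by the smallness of N(t) (`Setting.energy2_bound`).

Closing. Let E be the size of the data and B = ∬ G². The trace inequality with parameter κ m bounds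
(1/m) ∫ ψ_x² on the boundary by C κ^{-1} m^{-2} ∬ (R^N ψ_x)² + κ ∬ (R^{2N} ψ_xx)², up to less
singular terms. By (0) the first is at most C κ^{-1} m^{-2} (E + m³ B), by (2) the second at most C
κ (E + B). So (1) gives B ≤ C (1 + m^{-2}) E + B/2 once κ and then m are small (`exists_bootstrap`,
`Setting.exists_apriori`).

Two technical points. No decay of the fluxes at infinity is known, so every estimate is run with the
cutoff (1 - x/X)²; its error vanishes as X → ∞ because R^N = o(x). The flow is only C¹ with
continuous u_xx, so the mixed derivatives are obtained from the equation (`HasDt.of_mixed`) or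
avoided (`hasDerivWithinAt_integral_mul_sq`). The relation R_t = u is derived from the mass equation
(`mass_to_radius`). -/

/-! ### One-sided calculus on the moving domain. -/

/-- `f'` is the `x`-derivative of `f` on `dom m T`, one-sided at the left boundary. -/
def HasDx (m T : ℝ) (f f' : ℝ × ℝ → ℝ) : Prop :=
  ∀ x t, (x, t) ∈ dom m T →
    HasDerivWithinAt (fun y => f (y, t)) (f' (x, t)) (Ici (-(m * t))) x

/-- `f'` is the right `t`-derivative of `f` on `dom m T` before the final time. -/
def HasDt (m T : ℝ) (f f' : ℝ × ℝ → ℝ) : Prop :=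
  ∀ x t, (x, t) ∈ dom m T → t < T →
    HasDerivWithinAt (fun s => f (x, s)) (f' (x, t)) (Ici t) t

theorem mem_dom {m T x t : ℝ} : (x, t) ∈ dom m T ↔ (0 ≤ t ∧ t ≤ T) ∧ -(m * t) ≤ x := Iff.rfl

/-- The left boundary moves to the left, so a particle label that has entered stays in the domain.
Backward in time it may leave, which is why time derivatives are taken from the right. -/
theorem mem_dom_of_le {m T x t s : ℝ} (hm : 0 < m) (h : (x, t) ∈ dom m T) (hs : t ≤ s)
    (hT : s ≤ T) : (x, s) ∈ dom m T := by
  rw [mem_dom] at h ⊢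
  exact ⟨⟨h.1.1.trans hs, hT⟩, le_trans (neg_le_neg (by gcongr)) h.2⟩

/-- A continuous retraction of the plane onto `dom m T`. -/
noncomputable def retr (m T : ℝ) (z : ℝ × ℝ) : ℝ × ℝ :=
  (max z.1 (-(m * max 0 (min z.2 T))), max 0 (min z.2 T))

theorem continuous_retr (m T : ℝ) : Continuous (retr m T) := by
  unfold retr; fun_prop

theorem retr_mem {m T : ℝ} (hT : 0 ≤ T) (z : ℝ × ℝ) : retr m T z ∈ dom m T :=
  ⟨⟨le_max_left _ _, max_le hT (min_le_right _ _)⟩, le_max_right _ _⟩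

theorem retr_eq {m T : ℝ} {z : ℝ × ℝ} (hz : z ∈ dom m T) : retr m T z = z := by
  obtain ⟨⟨h1, h2⟩, h3⟩ := hz
  unfold retr
  rw [min_eq_left h2, max_eq_right h1, max_eq_left h3]

theorem continuous_comp_retr {m T : ℝ} (hT : 0 ≤ T) {f : ℝ × ℝ → ℝ}
    (hf : ContinuousOn f (dom m T)) : Continuous (fun z => f (retr m T z)) :=
  hf.comp_continuous (continuous_retr m T) (retr_mem hT)

theorem continuousOn_slice {m T t : ℝ} {f : ℝ × ℝ → ℝ} (hf : ContinuousOn f (dom m T))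
    (ht : t ∈ Icc 0 T) : ContinuousOn (fun x => f (x, t)) (Ici (-(m * t))) :=
  hf.comp (by fun_prop) (fun _ hx => ⟨ht, hx⟩)

theorem intervalIntegrable_slice {m T t a X : ℝ} {f : ℝ × ℝ → ℝ}
    (hf : ContinuousOn f (dom m T)) (ht : t ∈ Icc 0 T) (ha : -(m * t) ≤ a)
    (hX : -(m * t) ≤ X) : IntervalIntegrable (fun x => f (x, t)) volume a X := by
  apply ContinuousOn.intervalIntegrable
  exact (continuousOn_slice hf ht).mono (fun x hx => le_trans (le_min ha hX) hx.1)

theorem integral_slice_congr {m T t a X : ℝ} (f : ℝ × ℝ → ℝ)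
    (ht : t ∈ Icc 0 T) (ha : -(m * t) ≤ a)
    (hX : -(m * t) ≤ X) : ∫ x in a..X, f (x, t) = ∫ x in a..X, f (retr m T (x, t)) := by
  apply intervalIntegral.integral_congr
  intro x hx
  have : (x, t) ∈ dom m T := ⟨ht, le_trans (le_min ha hX) hx.1⟩
  simp only [retr_eq this]

theorem neg_mul_le {m t X : ℝ} (hm : 0 < m) (ht : 0 ≤ t) (hX : 0 ≤ X) : -(m * t) ≤ X := by
  have := mul_nonneg hm.le ht
  linarith

theorem boundary_mem {m T t : ℝ} (ht : t ∈ Icc 0 T) : (-(m * t), t) ∈ dom m T := ⟨ht, le_rfl⟩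

theorem continuous_integral_of_continuous {F : ℝ × ℝ → ℝ} (hF : Continuous F) {a b : ℝ → ℝ}
    (ha : Continuous a) (hb : Continuous b) :
    Continuous (fun τ => ∫ x in a τ..b τ, F (x, τ)) := by
  have h1 : Continuous (fun τ => ∫ x in (0:ℝ)..b τ, F (x, τ)) :=
    intervalIntegral.continuous_parametric_intervalIntegral_of_continuous
      (f := fun τ x => F (x, τ)) (by fun_prop) hb
  have h2 : Continuous (fun τ => ∫ x in (0:ℝ)..a τ, F (x, τ)) :=
    intervalIntegral.continuous_parametric_intervalIntegral_of_continuous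
      (f := fun τ x => F (x, τ)) (by fun_prop) ha
  refine (h1.sub h2).congr fun τ => ?_
  have hi : ∀ c d, IntervalIntegrable (fun x => F (x, τ)) volume c d := fun c d =>
    (by fun_prop : Continuous fun x => F (x, τ)).intervalIntegrable _ _
  exact intervalIntegral.integral_interval_sub_left (hi _ _) (hi _ _)

theorem continuousOn_integral_slice {m T X : ℝ} (hm : 0 < m) (hX : 0 ≤ X)
    {f : ℝ × ℝ → ℝ} (hf : ContinuousOn f (dom m T)) :
    ContinuousOn (fun t => ∫ x in -(m * t)..X, f (x, t)) (Icc 0 T) := by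
  by_cases hT : 0 ≤ T
  swap
  · rw [Icc_eq_empty hT]; exact continuousOn_empty _
  have hc : Continuous (fun t => ∫ x in -(m * t)..X, f (retr m T (x, t))) :=
    continuous_integral_of_continuous (continuous_comp_retr hT hf) (by fun_prop) (by fun_prop)
  refine hc.continuousOn.congr fun t ht => ?_
  exact integral_slice_congr f ht le_rfl (neg_mul_le hm ht.1 hX)

/-- The interval of integration collapses at `τ = t`, so the time dependence of the integrand is of
higher order and continuity of `F` suffices. -/
theorem hasDerivAt_integral_moving {F : ℝ × ℝ → ℝ} (hF : Continuous F) (c t : ℝ) :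
    HasDerivAt (fun τ => ∫ x in (c * t)..(c * τ), F (x, τ)) (c * F (c * t, t)) t := by
  rw [hasDerivAt_iff_isLittleO, Asymptotics.isLittleO_iff]
  intro e he
  have hpos : 0 < e / (|c| + 1) := by positivity
  have hc := Metric.continuousAt_iff.1 (hF.continuousAt (x := (c * t, t))) _ hpos
  obtain ⟨δ, hδ, H⟩ := hc
  have : ∀ᶠ τ in 𝓝 t, |τ - t| * (|c| + 1) < δ := by
    have : Tendsto (fun τ => |τ - t| * (|c| + 1)) (𝓝 t) (𝓝 (|t - t| * (|c| + 1))) := by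
      apply Continuous.tendsto; fun_prop
    apply this.eventually_lt_const
    simpa using hδ
  filter_upwards [this] with τ hτ
  have hi : IntervalIntegrable (fun x => F (x, τ)) volume (c * t) (c * τ) :=
    (by fun_prop : Continuous fun x => F (x, τ)).intervalIntegrable _ _
  have e1 : (∫ x in (c * t)..(c * τ), F (x, τ)) - (∫ x in (c * t)..(c * t), F (x, t))
      - (τ - t) • (c * F (c * t, t))
      = ∫ x in (c * t)..(c * τ), (F (x, τ) - F (c * t, t)) := by
    rw [intervalIntegral.integral_sub hi (by simp)]
    simp only [intervalIntegral.integral_same, intervalIntegral.integral_const, smul_eq_mul]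
    ring
  rw [e1]
  have h2 := intervalIntegral.norm_integral_le_of_norm_le_const (a := c * t) (b := c * τ)
    (f := fun x => F (x, τ) - F (c * t, t)) (C := e / (|c| + 1)) (by
      intro x hx
      have hx' : |x - c * t| ≤ |c * τ - c * t| := by
        have := uIoc_subset_uIcc hx
        rw [abs_sub_comm x, abs_sub_comm (c * τ)]
        rw [abs_sub_comm (c*t), abs_sub_comm (c*t)]
        exact Set.abs_sub_left_of_mem_uIcc this
      have hct : |c * τ - c * t| = |c| * |τ - t| := by rw [← abs_mul]; congr 1; ring
      have h0 : |c| * |τ - t| ≤ |τ - t| * (|c| + 1) := by nlinarith [abs_nonneg (τ - t)]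
      have h00 : |τ - t| ≤ |τ - t| * (|c| + 1) := by nlinarith [abs_nonneg (τ - t), abs_nonneg c]
      have := H (x := (x, τ)) (by
        rw [Prod.dist_eq, max_lt_iff, Real.dist_eq, Real.dist_eq]
        exact ⟨by linarith, by linarith⟩)
      rw [Real.dist_eq] at this
      exact this.le)
  refine h2.trans ?_
  have hct : |c * τ - c * t| = |c| * |τ - t| := by rw [← abs_mul]; congr 1; ring
  rw [hct, Real.norm_eq_abs, div_mul_eq_mul_div, div_le_iff₀ (by positivity)]
  nlinarith [mul_nonneg he.le (abs_nonneg (τ - t))]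

theorem HasDt.sub_eq_integral {m T : ℝ} (hm : 0 < m) {g h : ℝ × ℝ → ℝ}
    (hg : ContinuousOn g (dom m T)) (hh : ContinuousOn h (dom m T)) (hd : HasDt m T g h)
    {x t s : ℝ} (hx : (x, t) ∈ dom m T) (hts : t ≤ s) (hs : s ≤ T) :
    g (x, s) - g (x, t) = ∫ τ in t..s, h (x, τ) := by
  have hmem : ∀ τ ∈ Icc t s, (x, τ) ∈ dom m T := fun τ hτ =>
    mem_dom_of_le hm hx hτ.1 (hτ.2.trans hs)
  have hc : ∀ {f : ℝ × ℝ → ℝ}, ContinuousOn f (dom m T) →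
      ContinuousOn (fun τ => f (x, τ)) (Icc t s) := fun hf => hf.comp (by fun_prop) hmem
  rw [intervalIntegral.integral_eq_sub_of_hasDeriv_right_of_le hts (hc hg)]
  · intro τ hτ
    exact (hd x τ (hmem τ (Ioo_subset_Icc_self hτ)) (hτ.2.trans_le hs)).mono Ioi_subset_Ici_self
  · exact (hc hh).intervalIntegrable_of_Icc hts

theorem integral_swap_of_continuous {F : ℝ × ℝ → ℝ} (hF : Continuous F) (a b c d : ℝ) :
    ∫ x in a..b, ∫ y in c..d, F (x, y) = ∫ y in c..d, ∫ x in a..b, F (x, y) := by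
  apply intervalIntegral_intervalIntegral_swap (F := fun x y => F (x, y))
  refine (hF.continuousOn.integrableOn_compact (K := uIcc a b ×ˢ uIcc c d)
    (isCompact_uIcc.prod isCompact_uIcc)).mono_set ?_
  exact prod_mono uIoc_subset_uIcc uIoc_subset_uIcc

/-- Derivative at `τ = t` of the integral of a weighted time increment. -/
theorem HasDt.hasDerivWithinAt_integral_increment {m T : ℝ} (hm : 0 < m)
    {g h ξ : ℝ × ℝ → ℝ} (hξ : Continuous ξ)
    (hg : ContinuousOn g (dom m T)) (hh : ContinuousOn h (dom m T)) (hd : HasDt m T g h)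
    {t X : ℝ} (ht : t ∈ Ico 0 T) (hX : -(m * t) ≤ X) :
    HasDerivWithinAt (fun τ => ∫ x in -(m * t)..X, ξ (x, τ) * (g (x, τ) - g (x, t)))
      (∫ x in -(m * t)..X, ξ (x, t) * h (x, t)) (Ici t) t := by
  have hT : 0 ≤ T := ht.1.trans ht.2.le
  set H : ℝ × ℝ → ℝ := fun z => h (retr m T z) with hH
  have hHc : Continuous H := continuous_comp_retr hT hh
  -- Writing the increment as a time integral of `h` and exchanging the integrals turns the quantity
  -- into the integral of `M (σ, τ)` over `σ ∈ [t, τ]`, to which the collapsing-interval lemma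
  -- applies.
  set M : ℝ × ℝ → ℝ := fun z => ∫ x in -(m * t)..X, ξ (x, z.2) * H (x, z.1) with hM
  have hMc : Continuous M := by
    apply intervalIntegral.continuous_parametric_intervalIntegral_of_continuous'
      (f := fun (z : ℝ × ℝ) x => ξ (x, z.2) * H (x, z.1))
    have : Continuous (fun w : (ℝ × ℝ) × ℝ => ξ (w.2, w.1.2) * H (w.2, w.1.1)) := by fun_prop
    exact this
  have key := (hasDerivAt_integral_moving hMc 1 t).hasDerivWithinAt (s := Ici t)
  simp only [one_mul] at key
  have hval : M (t, t) = ∫ x in -(m * t)..X, ξ (x, t) * h (x, t) :=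
    (integral_slice_congr (fun z => ξ (z.1, t) * h z) ⟨ht.1, ht.2.le⟩ le_rfl hX |>.trans (by
      apply intervalIntegral.integral_congr
      intro x hx
      rw [uIcc_of_le hX] at hx
      have : (x, t) ∈ dom m T := ⟨⟨ht.1, ht.2.le⟩, hx.1⟩
      simp only [hH, retr_eq this])).symm
  rw [hval] at key
  have hev : Icc t T ∈ 𝓝[Ici t] t := Icc_mem_nhdsGE ht.2
  refine key.congr_of_eventuallyEq ?_ (by simp)
  filter_upwards [hev] with τ hτ
  have : ∀ x ∈ uIcc (-(m * t)) X, ξ (x, τ) * (g (x, τ) - g (x, t))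
      = ∫ σ in t..τ, ξ (x, τ) * H (x, σ) := by
    intro x hx
    rw [uIcc_of_le hX] at hx
    have hx0 : (x, t) ∈ dom m T := ⟨⟨ht.1, ht.2.le⟩, hx.1⟩
    rw [hd.sub_eq_integral hm hg hh hx0 hτ.1 hτ.2, intervalIntegral.integral_const_mul]
    congr 1
    apply intervalIntegral.integral_congr
    intro σ hσ
    rw [uIcc_of_le hτ.1] at hσ
    simp only [hH, retr_eq (mem_dom_of_le hm hx0 hσ.1 (hσ.2.trans hτ.2))]
  rw [intervalIntegral.integral_congr this]
  exact integral_swap_of_continuous (F := fun z => ξ (z.1, τ) * H (z.1, z.2)) (by fun_prop) _ _ _ _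

/-- Separates the fixed interval from the strip swept by the boundary; the strip integral runs to
the left, hence the minus sign. Inside it `g` is composed with `retr` to be continuous on the whole
plane. -/
theorem integral_split_moving {m T t τ X : ℝ} (hm : 0 < m) {g : ℝ × ℝ → ℝ}
    (hg : ContinuousOn g (dom m T)) (ht : 0 ≤ t) (hτ : t ≤ τ) (hτT : τ ≤ T) (hX : -(m * t) ≤ X) :
    ∫ x in -(m * τ)..X, g (x, τ)
      = (∫ x in -(m * t)..X, g (x, τ)) - ∫ x in (-m * t)..(-m * τ), g (retr m T (x, τ)) := by
  have hb : -(m * τ) ≤ -(m * t) := neg_le_neg (by gcongr)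
  have hτ' : τ ∈ Icc 0 T := ⟨ht.trans hτ, hτT⟩
  have e : ∫ x in (-m * t)..(-m * τ), g (retr m T (x, τ)) = ∫ x in (-m * t)..(-m * τ), g (x, τ) :=
    (integral_slice_congr g hτ' (by linarith) (by linarith)).symm
  rw [e, eq_sub_iff_add_eq, add_comm, neg_mul, neg_mul]
  exact intervalIntegral.integral_add_adjacent_intervals
    (intervalIntegrable_slice hg hτ' hb le_rfl) (intervalIntegrable_slice hg hτ' le_rfl (hb.trans hX))

/-- Leibniz rule on the moving domain. -/
theorem HasDt.hasDerivWithinAt_integral {m T : ℝ} (hm : 0 < m) {g h : ℝ × ℝ → ℝ}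
    (hg : ContinuousOn g (dom m T)) (hh : ContinuousOn h (dom m T)) (hd : HasDt m T g h)
    {t X : ℝ} (ht : t ∈ Ico 0 T) (hX : -(m * t) ≤ X) :
    HasDerivWithinAt (fun τ => ∫ x in -(m * τ)..X, g (x, τ))
      ((∫ x in -(m * t)..X, h (x, t)) + m * g (-(m * t), t)) (Ici t) t := by
  have hT : 0 ≤ T := ht.1.trans ht.2.le
  have ht' : t ∈ Icc 0 T := ⟨ht.1, ht.2.le⟩
  have h1 := hd.hasDerivWithinAt_integral_increment hm (ξ := fun _ => 1) continuous_const hg hh ht hX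
  have h2 := (hasDerivAt_integral_moving (continuous_comp_retr hT hg) (-m) t).hasDerivWithinAt
    (s := Ici t)
  have h3 := (h1.add_const (∫ x in -(m * t)..X, g (x, t))).sub h2
  have hb : retr m T (-m * t, t) = (-(m * t), t) := by
    rw [neg_mul]; exact retr_eq (boundary_mem ht')
  convert! h3.congr_of_eventuallyEq ?_ ?_ using 1
  · simp only [one_mul, hb]; ring
  · filter_upwards [Icc_mem_nhdsGE ht.2] with τ hτ
    rw [integral_split_moving hm hg ht.1 hτ.1 hτ.2 hX]
    simp only [one_mul, Pi.sub_apply]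
    congr 1
    rw [intervalIntegral.integral_sub]
    · ring
    · exact intervalIntegrable_slice hg ⟨ht.1.trans hτ.1, hτ.2⟩ (neg_le_neg (by gcongr; exact hτ.1))
        (le_trans (neg_le_neg (by gcongr; exact hτ.1)) hX)
    · exact intervalIntegrable_slice hg ht' le_rfl hX
  · simp


theorem HasDt.integral_sub_eq {m T : ℝ} (hm : 0 < m) {g h : ℝ × ℝ → ℝ}
    (hg : ContinuousOn g (dom m T)) (hh : ContinuousOn h (dom m T)) (hd : HasDt m T g h)
    {t X : ℝ} (ht : t ∈ Icc 0 T) (hX : 0 ≤ X) :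
    (∫ x in -(m * t)..X, g (x, t)) - ∫ x in (0:ℝ)..X, g (x, 0)
      = ∫ τ in (0:ℝ)..t, ((∫ x in -(m * τ)..X, h (x, τ)) + m * g (-(m * τ), τ)) := by
  have hsub : Icc 0 t ⊆ Icc 0 T := Icc_subset_Icc_right ht.2
  have hb : ContinuousOn (fun τ => g (-(m * τ), τ)) (Icc 0 T) :=
    hg.comp (by fun_prop) (fun τ hτ => boundary_mem hτ)
  rw [intervalIntegral.integral_eq_sub_of_hasDeriv_right_of_le
    (f := fun t => ∫ x in -(m * t)..X, g (x, t)) ht.1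
    ((continuousOn_integral_slice hm hX hg).mono hsub)]
  · simp
  · intro τ hτ
    exact (hd.hasDerivWithinAt_integral hm hg hh ⟨hτ.1.le, hτ.2.trans_le ht.2⟩
      (neg_mul_le hm hτ.1.le hX)).mono Ioi_subset_Ici_self
  · apply ContinuousOn.intervalIntegrable_of_Icc ht.1
    exact (((continuousOn_integral_slice hm hX hh).add (continuousOn_const.mul hb)).mono hsub)

theorem HasDx.integral_eq_sub {m T : ℝ} {f f' : ℝ × ℝ → ℝ} (hf' : ContinuousOn f' (dom m T))
    (hd : HasDx m T f f') {t a X : ℝ} (ht : t ∈ Icc 0 T) (ha : -(m * t) ≤ a) (haX : a ≤ X) :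
    ∫ x in a..X, f' (x, t) = f (X, t) - f (a, t) := by
  have hmem : ∀ x ∈ Icc a X, (x, t) ∈ dom m T := fun x hx => ⟨ht, ha.trans hx.1⟩
  apply intervalIntegral.integral_eq_sub_of_hasDeriv_right_of_le haX
    (f := fun x => f (x, t))
  · intro x hx
    exact ((hd x t (hmem x hx)).continuousWithinAt).mono (fun y hy => ha.trans hy.1)
  · intro x hx
    exact (hd x t (hmem x (Ioo_subset_Icc_self hx))).mono
      (fun y hy => ha.trans (hx.1.le.trans (le_of_lt hy)))
  · exact intervalIntegrable_slice hf' ht ha (ha.trans haX)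

/-- A product rule in which the first factor is merely continuous, because the second one vanishes
at the base point. It serves boundary terms containing ψ_x, whose time derivative is not available.
-/
theorem hasDerivWithinAt_mul_of_eq_zero {f g : ℝ → ℝ} {g' t : ℝ} {s : Set ℝ}
    (hf : ContinuousWithinAt f s t) (hg : HasDerivWithinAt g g' s t) (h0 : g t = 0) :
    HasDerivWithinAt (fun τ => f τ * g τ) (f t * g') s t := by
  rw [hasDerivWithinAt_iff_tendsto_slope] at hg ⊢
  have := (hf.mono_left (nhdsWithin_mono t (sdiff_subset (t := {t})))).mul hg
  refine this.congr fun τ => ?_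
  simp only [slope, vsub_eq_sub, h0, smul_eq_mul, mul_zero, sub_zero]
  ring

/-- Equality of mixed derivatives with only one of them given. The increment `f (y, s) - f (y, t)`
is its boundary value plus a double integral of `ftx`; differentiating this in `y` gives the
increment of `fx` as a time integral of `ftx`. -/
theorem HasDt.of_mixed {m T : ℝ} (hm : 0 < m) {f fx ft ftx : ℝ × ℝ → ℝ}
    (hf : ContinuousOn f (dom m T)) (hft : ContinuousOn ft (dom m T))
    (hftx : ContinuousOn ftx (dom m T)) (hdx : HasDx m T f fx) (hdt : HasDt m T f ft)
    (hdtx : HasDx m T ft ftx) : HasDt m T fx ftx := by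
  intro x t hxt htT
  have ht : t ∈ Icc 0 T := hxt.1
  have hT : 0 ≤ T := ht.1.trans ht.2
  set H : ℝ × ℝ → ℝ := fun z => ftx (retr m T z) with hH
  have hHc : Continuous H := continuous_comp_retr hT hftx
  have key : ∀ s ∈ Icc t T, fx (x, s) - fx (x, t) = ∫ τ in t..s, H (x, τ) := by
    intro s hs
    have hs' : s ∈ Icc 0 T := ⟨ht.1.trans hs.1, hs.2⟩
    have hbs : -(m * s) ≤ -(m * t) := neg_le_neg (by gcongr; exact hs.1)
    have h1 : ∀ y ∈ Ici (-(m * t)), f (y, s) - f (y, t)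
        = (f (-(m * t), s) - f (-(m * t), t)) + ∫ ξ in -(m * t)..y, ∫ τ in t..s, H (ξ, τ) := by
      intro y hy
      rw [integral_swap_of_continuous hHc,
        hdt.sub_eq_integral hm hf hft (⟨ht, hy⟩ : (y, t) ∈ dom m T) hs.1 hs.2,
        hdt.sub_eq_integral hm hf hft (boundary_mem ht) hs.1 hs.2]
      have hci : ∀ z, (z, t) ∈ dom m T →
          IntervalIntegrable (fun τ => ft (z, τ)) volume t s := fun z hz => by
        apply ContinuousOn.intervalIntegrable_of_Icc hs.1
        exact hft.comp (by fun_prop) (fun τ hτ => mem_dom_of_le hm hz hτ.1 (hτ.2.trans hs.2))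
      rw [← sub_eq_iff_eq_add', ← intervalIntegral.integral_sub
        (hci y ⟨ht, hy⟩) (hci _ (boundary_mem ht))]
      apply intervalIntegral.integral_congr
      intro τ hτ
      rw [uIcc_of_le hs.1] at hτ
      have hτ' : τ ∈ Icc 0 T := ⟨ht.1.trans hτ.1, hτ.2.trans hs.2⟩
      have hbτ : -(m * τ) ≤ -(m * t) := neg_le_neg (by gcongr; exact hτ.1)
      simp only
      rw [← hdtx.integral_eq_sub hftx hτ' hbτ hy]
      exact integral_slice_congr ftx hτ' hbτ (hbτ.trans hy)
    have hxb : -(m * t) ≤ x := hxt.2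
    have d1 : HasDerivWithinAt (fun y => f (y, s) - f (y, t)) (fx (x, s) - fx (x, t))
        (Ici (-(m * t))) x :=
      ((hdx x s ⟨hs', hbs.trans hxb⟩).mono (Ici_subset_Ici.2 hbs)).sub (hdx x t hxt)
    have hcc : Continuous (fun ξ => ∫ τ in t..s, H (ξ, τ)) :=
      intervalIntegral.continuous_parametric_intervalIntegral_of_continuous'
        (f := fun ξ τ => H (ξ, τ)) (by fun_prop) _ _
    have d2 := ((intervalIntegral.integral_hasDerivAt_right (hcc.intervalIntegrable (-(m * t)) x)
      (hcc.stronglyMeasurableAtFilter _ _) hcc.continuousAt).hasDerivWithinAt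
      (s := Ici (-(m * t)))).const_add (f (-(m * t), s) - f (-(m * t), t))
    have d2' := d2.congr_of_mem h1 hxb
    exact (uniqueDiffOn_Ici _ x hxb).eq_deriv _ d1 d2'
  have hHx : Continuous (fun τ => H (x, τ)) := by fun_prop
  have d := ((intervalIntegral.integral_hasDerivAt_right (hHx.intervalIntegrable t t)
      (hHx.stronglyMeasurableAtFilter _ _) hHx.continuousAt).hasDerivWithinAt
      (s := Ici t)).const_add (fx (x, t))
  have e : H (x, t) = ftx (x, t) := by simp only [hH, retr_eq hxt]
  rw [e] at d
  refine d.congr_of_eventuallyEq ?_ (by simp)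
  filter_upwards [Icc_mem_nhdsGE htT] with s hs
  rw [← key s hs]; ring

/-- Right derivative of a weighted Dirichlet integral on the moving domain; no mixed derivative
of `ψ` is needed. -/
theorem hasDerivWithinAt_integral_mul_sq {m T : ℝ} (hm : 0 < m)
    {a ax at' ψ ψx ψxx ψt : ℝ × ℝ → ℝ}
    (ha : ContinuousOn a (dom m T)) (hax : ContinuousOn ax (dom m T))
    (hat : ContinuousOn at' (dom m T)) (hψ : ContinuousOn ψ (dom m T))
    (hψx : ContinuousOn ψx (dom m T)) (hψxx : ContinuousOn ψxx (dom m T))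
    (hψt : ContinuousOn ψt (dom m T)) (dax : HasDx m T a ax) (dat : HasDt m T a at')
    (dψx : HasDx m T ψ ψx) (dψxx : HasDx m T ψx ψxx) (dψt : HasDt m T ψ ψt)
    {t X : ℝ} (ht : t ∈ Ico 0 T) (hX : -(m * t) ≤ X) (haX : ∀ τ ∈ Icc t T, a (X, τ) = 0) :
    HasDerivWithinAt (fun τ => ∫ x in -(m * τ)..X, a (x, τ) * ψx (x, τ) ^ 2)
      ((∫ x in -(m * t)..X, (at' (x, t) * ψx (x, t) ^ 2
          - 2 * (ax (x, t) * ψx (x, t) + a (x, t) * ψxx (x, t)) * ψt (x, t)))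
        - 2 * (a (-(m * t), t) * ψx (-(m * t), t)) * ψt (-(m * t), t)
        + m * (a (-(m * t), t) * ψx (-(m * t), t) ^ 2)) (Ici t) t := by
  have hT : 0 ≤ T := ht.1.trans ht.2.le
  have ht' : t ∈ Icc 0 T := ⟨ht.1, ht.2.le⟩
  have hbm := boundary_mem (m := m) ht'
  have hflux : ContinuousOn (fun z => ax z * ψx z + a z * ψxx z) (dom m T) := by fun_prop
  set P : ℝ × ℝ → ℝ := fun z => ψx (retr m T z) with hP
  set D : ℝ × ℝ → ℝ := fun z => (ax (retr m T z) * ψx (retr m T z)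
    + a (retr m T z) * ψxx (retr m T z)) with hD
  have hPc : Continuous P := continuous_comp_retr hT hψx
  have hDc : Continuous D := continuous_comp_retr hT hflux
  have i1 := dat.hasDerivWithinAt_integral_increment hm
    (ξ := fun z => P z * P (z.1, t)) (by fun_prop) ha hat ht hX
  have i2 := dψt.hasDerivWithinAt_integral_increment hm
    (ξ := fun z => D z + D (z.1, t)) (by fun_prop) hψ hψt ht hX
  have hsq : ContinuousOn (fun z => a z * ψx z ^ 2) (dom m T) := by fun_prop
  have i4 := (hasDerivAt_integral_moving (continuous_comp_retr hT hsq) (-m) t).hasDerivWithinAt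
    (s := Ici t)
  have hsub : ∀ τ ∈ Icc t T, (-(m * t), τ) ∈ dom m T := fun τ hτ =>
    mem_dom_of_le hm hbm hτ.1 hτ.2
  have cb : ContinuousWithinAt (fun τ => a (-(m * t), τ) * ψx (-(m * t), τ)
      + a (-(m * t), t) * ψx (-(m * t), t)) (Ici t) t := by
    have h0 : ContinuousOn (fun τ => a (-(m * t), τ) * ψx (-(m * t), τ)
      + a (-(m * t), t) * ψx (-(m * t), t)) (Icc t T) := by
      have h1 : ContinuousOn (fun τ => a (-(m * t), τ)) (Icc t T) := ha.comp (by fun_prop) hsub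
      have h2 : ContinuousOn (fun τ => ψx (-(m * t), τ)) (Icc t T) := hψx.comp (by fun_prop) hsub
      exact (h1.mul h2).add continuousOn_const
    exact (h0 t (left_mem_Icc.2 ht.2.le)).mono_of_mem_nhdsWithin (Icc_mem_nhdsGE ht.2)
  -- The boundary term of the integration by parts below: a continuous coefficient times an
  -- increment of `ψ` that vanishes at `τ = t`.
  have i3 := hasDerivWithinAt_mul_of_eq_zero cb
    ((dψt (-(m * t)) t hbm ht.2).sub_const (ψ (-(m * t), t))) (sub_self _)
  have tot := ((((i1.sub i2).sub i3).sub i4)).add_const (∫ x in -(m * t)..X, a (x, t) * ψx (x, t) ^ 2)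
  have hrx : ∀ x, -(m * t) ≤ x → retr m T (x, t) = (x, t) := fun x hx => retr_eq ⟨ht', hx⟩
  convert! tot.congr_of_eventuallyEq ?_ ?_ using 1
  · have hb : retr m T (-m * t, t) = (-(m * t), t) := by
      rw [neg_mul]; exact retr_eq hbm
    rw [hb, ← intervalIntegral.integral_sub]
    · have : ∫ x in -(m * t)..X, (at' (x, t) * ψx (x, t) ^ 2
          - 2 * (ax (x, t) * ψx (x, t) + a (x, t) * ψxx (x, t)) * ψt (x, t))
        = ∫ x in -(m * t)..X, (P (x, t) * P (x, t) * at' (x, t)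
          - (D (x, t) + D (x, t)) * ψt (x, t)) := by
        apply intervalIntegral.integral_congr
        intro x hx
        rw [uIcc_of_le hX] at hx
        simp only [hP, hD, hrx x hx.1]
        ring
      rw [this]
      ring
    · exact intervalIntegrable_slice (f := fun z => P z * P (z.1, t) * at' z) (by fun_prop) ht'
        le_rfl hX
    · exact intervalIntegrable_slice (f := fun z => (D z + D (z.1, t)) * ψt z) (by fun_prop) ht'
        le_rfl hX
  · filter_upwards [Icc_mem_nhdsGE ht.2] with τ hτ
    have hτ' : τ ∈ Icc 0 T := ⟨ht.1.trans hτ.1, hτ.2⟩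
    have hbτ : -(m * τ) ≤ -(m * t) := neg_le_neg (by gcongr; exact hτ.1)
    have hrτ : ∀ x, -(m * t) ≤ x → retr m T (x, τ) = (x, τ) := fun x hx =>
      retr_eq ⟨hτ', hbτ.trans hx⟩
    rw [integral_split_moving (g := fun z => a z * ψx z ^ 2) hm hsq ht.1 hτ.1 hτ.2 hX]
    simp only [Pi.sub_apply]
    -- integration by parts on the fixed interval
    have slt : ∀ {f : ℝ × ℝ → ℝ}, ContinuousOn f (dom m T) →
        ContinuousOn (fun x => f (x, t)) (Icc (-(m * t)) X) := fun hf =>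
      (continuousOn_slice hf ht').mono Icc_subset_Ici_self
    have slτ : ∀ {f : ℝ × ℝ → ℝ}, ContinuousOn f (dom m T) →
        ContinuousOn (fun x => f (x, τ)) (Icc (-(m * t)) X) := fun hf =>
      (continuousOn_slice hf hτ').mono (fun x hx => hbτ.trans hx.1)
    have ibp := intervalIntegral.integral_mul_deriv_eq_deriv_mul_of_hasDeriv_right
      (a := -(m * t)) (b := X)
      (u := fun x => a (x, τ) * ψx (x, τ) + a (x, t) * ψx (x, t))
      (u' := fun x => (ax (x, τ) * ψx (x, τ) + a (x, τ) * ψxx (x, τ))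
        + (ax (x, t) * ψx (x, t) + a (x, t) * ψxx (x, t)))
      (v := fun x => ψ (x, τ) - ψ (x, t)) (v' := fun x => ψx (x, τ) - ψx (x, t))
      (by rw [uIcc_of_le hX]; exact ((slτ ha).mul (slτ hψx)).add ((slt ha).mul (slt hψx)))
      (by rw [uIcc_of_le hX]; exact (slτ hψ).sub (slt hψ))
      (by
        intro x hx
        rw [min_eq_left hX, max_eq_right hX] at hx
        have m1 : (x, τ) ∈ dom m T := ⟨hτ', hbτ.trans hx.1.le⟩
        have m2 : (x, t) ∈ dom m T := ⟨ht', hx.1.le⟩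
        have s1 : Ioi x ⊆ Ici (-(m * τ)) := fun y hy => (hbτ.trans hx.1.le).trans (le_of_lt hy)
        have s2 : Ioi x ⊆ Ici (-(m * t)) := fun y hy => hx.1.le.trans (le_of_lt hy)
        exact (((dax x τ m1).mul (dψxx x τ m1)).mono s1).add
          (((dax x t m2).mul (dψxx x t m2)).mono s2))
      (by
        intro x hx
        rw [min_eq_left hX, max_eq_right hX] at hx
        have m1 : (x, τ) ∈ dom m T := ⟨hτ', hbτ.trans hx.1.le⟩
        have m2 : (x, t) ∈ dom m T := ⟨ht', hx.1.le⟩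
        have s1 : Ioi x ⊆ Ici (-(m * τ)) := fun y hy => (hbτ.trans hx.1.le).trans (le_of_lt hy)
        have s2 : Ioi x ⊆ Ici (-(m * t)) := fun y hy => hx.1.le.trans (le_of_lt hy)
        exact ((dψx x τ m1).mono s1).sub ((dψx x t m2).mono s2))
      (((slτ hflux).add (slt hflux)).intervalIntegrable_of_Icc hX)
      (((slτ hψx).sub (slt hψx)).intervalIntegrable_of_Icc hX)
    -- With primes for values at τ: a' p'² - a p² = p p' (a' - a) + (a' p' + a p)(p' - p). The first
    -- increment has a time derivative; in the second, p' - p is an x-derivative and is moved by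
    -- parts onto the increment of `ψ`.
    have e1 : ∫ x in -(m * t)..X, a (x, τ) * ψx (x, τ) ^ 2
        = (∫ x in -(m * t)..X, a (x, t) * ψx (x, t) ^ 2)
          + (∫ x in -(m * t)..X, P (x, τ) * P (x, t) * (a (x, τ) - a (x, t)))
          + ∫ x in -(m * t)..X, (a (x, τ) * ψx (x, τ) + a (x, t) * ψx (x, t))
            * (ψx (x, τ) - ψx (x, t)) := by
      have s1 : ContinuousOn (fun x => a (x, t) * ψx (x, t) ^ 2) (Icc (-(m * t)) X) := slt hsq
      have s2 : ContinuousOn (fun x => P (x, τ) * P (x, t) * (a (x, τ) - a (x, t)))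
          (Icc (-(m * t)) X) := by
        have c1 : ContinuousOn (fun x => P (x, τ) * P (x, t)) (Icc (-(m * t)) X) := by
          have hp1 : Continuous fun x => P (x, τ) := hPc.comp (by fun_prop)
          have hp2 : Continuous fun x => P (x, t) := hPc.comp (by fun_prop)
          exact (hp1.mul hp2).continuousOn
        exact c1.mul ((slτ ha).sub (slt ha))
      have s3 : ContinuousOn (fun x => (a (x, τ) * ψx (x, τ) + a (x, t) * ψx (x, t))
            * (ψx (x, τ) - ψx (x, t))) (Icc (-(m * t)) X) :=
        (((slτ ha).mul (slτ hψx)).add ((slt ha).mul (slt hψx))).mul ((slτ hψx).sub (slt hψx))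
      have j12 := (s1.intervalIntegrable_of_Icc (μ := volume) hX).add
        (s2.intervalIntegrable_of_Icc hX)
      rw [← intervalIntegral.integral_add (s1.intervalIntegrable_of_Icc hX)
        (s2.intervalIntegrable_of_Icc hX), ← intervalIntegral.integral_add
        (by simpa using! j12) (s3.intervalIntegrable_of_Icc hX)]
      apply intervalIntegral.integral_congr
      intro x hx
      rw [uIcc_of_le hX] at hx
      simp only [hP, hrx x hx.1, hrτ x hx.1]
      ring
    have e2 : ∫ x in -(m * t)..X, ((ax (x, τ) * ψx (x, τ) + a (x, τ) * ψxx (x, τ))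
        + (ax (x, t) * ψx (x, t) + a (x, t) * ψxx (x, t))) * (ψ (x, τ) - ψ (x, t))
        = ∫ x in -(m * t)..X, (D (x, τ) + D (x, t)) * (ψ (x, τ) - ψ (x, t)) := by
      apply intervalIntegral.integral_congr
      intro x hx
      rw [uIcc_of_le hX] at hx
      simp only [hD, hrx x hx.1, hrτ x hx.1]
    rw [e1, ibp, e2, haX τ hτ, haX t ⟨le_rfl, ht.2.le⟩]
    ring
  · simp


/-! ### The pressure law and its bounds on compact ranges of the specific volume. -/

theorem pressureV_eq (K γ : ℝ) {v : ℝ} (hv : 0 < v) : pressureV K γ v = K * v ^ (-γ) := by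
  unfold pressureV pressure
  rw [Real.inv_rpow hv.le, Real.rpow_neg hv.le]

theorem hasDerivAt_pressureV' (K γ : ℝ) {v : ℝ} (hv : 0 < v) :
    HasDerivAt (pressureV K γ) (-(γ * K * v ^ (-γ - 1))) v := by
  have h1 : HasDerivAt (fun v : ℝ => K * v ^ (-γ)) (K * (-γ * v ^ (-γ - 1))) v :=
    (Real.hasDerivAt_rpow_const (Or.inl hv.ne')).const_mul K
  have h2 := h1.congr_of_eventuallyEq (f₁ := pressureV K γ) (by
    filter_upwards [lt_mem_nhds hv] with w hw using pressureV_eq K γ hw)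
  exact h2.congr_deriv (by ring)

theorem deriv_pressureV (K γ : ℝ) {v : ℝ} (hv : 0 < v) :
    deriv (pressureV K γ) v = -(γ * K * v ^ (-γ - 1)) := (hasDerivAt_pressureV' K γ hv).deriv

theorem hasDerivAt_pressureV (K γ : ℝ) {v : ℝ} (hv : 0 < v) :
    HasDerivAt (pressureV K γ) (deriv (pressureV K γ) v) v := by
  rw [deriv_pressureV K γ hv]; exact hasDerivAt_pressureV' K γ hv

theorem continuousOn_deriv_pressureV (K γ : ℝ) :
    ContinuousOn (deriv (pressureV K γ)) (Ioi 0) := by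
  have : ContinuousOn (fun v : ℝ => -(γ * K * v ^ (-γ - 1))) (Ioi 0) := by
    refine (continuousOn_const.mul ?_).neg
    exact continuousOn_id.rpow_const (fun x hx => Or.inl (ne_of_gt hx))
  exact this.congr fun v hv => deriv_pressureV K γ hv

theorem continuousOn_pressureV (K γ : ℝ) : ContinuousOn (pressureV K γ) (Ioi 0) :=
  fun _ hv => (hasDerivAt_pressureV K γ hv).continuousAt.continuousWithinAt

/-- Quantitative monotonicity and smoothness of the pressure on `[a, b]`. -/
structure PressureBounds (K γ a b c C : ℝ) : Prop where
  pos : 0 < c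
  le : c ≤ C
  lower : ∀ v ∈ Icc a b, c ≤ -deriv (pressureV K γ) v
  upper : ∀ v ∈ Icc a b, -deriv (pressureV K γ) v ≤ C
  lip : ∀ v ∈ Icc a b, ∀ w ∈ Icc a b,
    |deriv (pressureV K γ) v - deriv (pressureV K γ) w| ≤ C * |v - w|

theorem exists_pressureBounds {K γ a b : ℝ} (hK : 0 < K) (hγ : 1 < γ) (ha : 0 < a) (hab : a ≤ b) :
    ∃ c C, PressureBounds K γ a b c C := by
  have hb : 0 < b := ha.trans_le hab
  have hg : 0 < γ := by linarith
  set c := γ * K * b ^ (-γ - 1)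
  set C1 := γ * K * a ^ (-γ - 1)
  set C2 := γ * K * ((γ + 1) * a ^ (-γ - 2))
  have hc : 0 < c := by positivity
  have hC1 : 0 < C1 := by positivity
  have hC2 : 0 < C2 := by positivity
  have mono : ∀ v w e : ℝ, 0 < v → v ≤ w → e ≤ 0 → w ^ e ≤ v ^ e := fun v w e hv hvw he =>
    Real.rpow_le_rpow_of_nonpos hv hvw he
  -- One constant serves for three purposes: `C1` bounds -p', `C2` is a Lipschitz constant of p',
  -- and adding `c` makes `c ≤ C` immediate.
  refine ⟨c, c + C1 + C2, hc, by linarith, ?_, ?_, ?_⟩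
  · intro v hv
    rw [deriv_pressureV K γ (ha.trans_le hv.1), neg_neg]
    have := mono v b (-γ - 1) (ha.trans_le hv.1) hv.2 (by linarith)
    simp only [c]; gcongr
  · intro v hv
    rw [deriv_pressureV K γ (ha.trans_le hv.1), neg_neg]
    have := mono a v (-γ - 1) ha hv.1 (by linarith)
    have : γ * K * v ^ (-γ - 1) ≤ C1 := by simp only [C1]; gcongr
    linarith
  · intro v hv w hw
    have h := (convex_Icc a b).norm_image_sub_le_of_norm_hasDerivWithin_le
      (f := fun v : ℝ => -(γ * K * v ^ (-γ - 1)))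
      (f' := fun v : ℝ => -(γ * K * ((-γ - 1) * v ^ (-γ - 1 - 1)))) (C := C2)
      (by
        intro x hx
        exact (((Real.hasDerivAt_rpow_const (Or.inl (ha.trans_le hx.1).ne')).const_mul
          (γ * K)).neg).hasDerivWithinAt)
      (by
        intro x hx
        have h1 := mono a x (-γ - 2) ha hx.1 (by linarith)
        have h2 : (0:ℝ) < x ^ (-γ - 2) := Real.rpow_pos_of_pos (ha.trans_le hx.1) _
        have e : -(γ * K * ((-γ - 1) * x ^ (-γ - 1 - 1))) = γ * K * ((γ + 1) * x ^ (-γ - 2)) := by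
          rw [show -γ - 1 - 1 = -γ - 2 by ring]; ring
        rw [e, Real.norm_eq_abs, abs_of_nonneg (by positivity)]
        simp only [C2]; gcongr)
      hw hv
    rw [deriv_pressureV K γ (ha.trans_le hv.1), deriv_pressureV K γ (ha.trans_le hw.1)]
    rw [Real.norm_eq_abs, Real.norm_eq_abs] at h
    refine h.trans ?_
    gcongr
    linarith

theorem PressureBounds.abs_sub_le {K γ a b c C : ℝ} (h : PressureBounds K γ a b c C) (ha : 0 < a)
    {v w : ℝ} (hv : v ∈ Icc a b) (hw : w ∈ Icc a b) :
    |pressureV K γ v - pressureV K γ w| ≤ C * |v - w| := by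
  have := (convex_Icc a b).norm_image_sub_le_of_norm_hasDerivWithin_le
      (f := pressureV K γ) (f' := deriv (pressureV K γ)) (C := C)
      (fun x hx => (hasDerivAt_pressureV K γ (ha.trans_le hx.1)).hasDerivWithinAt)
      (fun x hx => by
        have h1 := h.lower x hx; have h2 := h.upper x hx; have h3 := h.pos
        rw [Real.norm_eq_abs, abs_le]; constructor <;> linarith) hw hv
  simpa using this

theorem pressureV_strictAnti {K γ v w : ℝ} (hK : 0 < K) (hγ : 1 < γ) (hv : 0 < v) (hvw : v < w) :
    pressureV K γ w < pressureV K γ v := by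
  rw [pressureV_eq K γ hv, pressureV_eq K γ (hv.trans hvw)]
  have := Real.rpow_lt_rpow_of_neg hv hvw (by linarith : -γ < 0)
  gcongr

/-! ### Stationary profiles: the first integral of the momentum equation. -/

/-- The specific volume `V` of a stationary flow in dimension `N + 1` with mass flux `m`, together
with its first two derivatives, and the momentum equation it satisfies. -/
structure Profile (N : ℕ) (μ γ K m vp : ℝ) (V V1 V2 : ℝ → ℝ) : Prop where
  hasDeriv : ∀ r ∈ Ici (1:ℝ), HasDerivWithinAt V (V1 r) (Ici 1) r
  hasDeriv_one : ∀ r ∈ Ici (1:ℝ), HasDerivWithinAt V1 (V2 r) (Ici 1) r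
  continuousOn_two : ContinuousOn V2 (Ici 1)
  pos : ∀ r ∈ Ici (1:ℝ), 0 < V r
  ode : ∀ r ∈ Ici (1:ℝ), μ * m * (V2 r / r ^ N - N * V1 r / r ^ (N + 1))
    = deriv (pressureV K γ) (V r) * V1 r
      + m / r ^ N * (m * V1 r / r ^ N - N * m * V r / r ^ (N + 1))
  farField : Tendsto V atTop (𝓝 vp)

namespace Profile

variable {N : ℕ} {μ γ K m vp : ℝ} {V V1 V2 : ℝ → ℝ}

theorem continuousOn (P : Profile N μ γ K m vp V V1 V2) : ContinuousOn V (Ici 1) :=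
  fun r hr => (P.hasDeriv r hr).continuousWithinAt

theorem continuousOn_one (P : Profile N μ γ K m vp V V1 V2) : ContinuousOn V1 (Ici 1) :=
  fun r hr => (P.hasDeriv_one r hr).continuousWithinAt

theorem hasDerivWithinAt_inv_pow (k : ℕ) {r : ℝ} (hr : r ∈ Ici (1:ℝ)) (s : Set ℝ) :
    HasDerivWithinAt (fun r : ℝ => (r ^ k)⁻¹) (-(k : ℝ) / r ^ (k + 1)) s r := by
  have h0 : r ≠ 0 := by have : (1:ℝ) ≤ r := hr; positivity
  have h := (hasDerivAt_zpow (-(k : ℤ)) r (Or.inl h0)).hasDerivWithinAt (s := s)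
  have e : (fun r : ℝ => (r ^ k)⁻¹) = fun r : ℝ => r ^ (-(k : ℤ)) := by
    ext x; rw [zpow_neg, zpow_natCast]
  rw [e]
  refine h.congr_deriv ?_
  rw [show (-(k:ℤ) - 1) = -((k + 1 : ℕ) : ℤ) by push_cast; ring, zpow_neg, zpow_natCast]
  push_cast; ring

/-- The first integral of the momentum equation. -/
theorem hasDerivWithinAt_firstIntegral (P : Profile N μ γ K m vp V V1 V2) {r : ℝ}
    (hr : r ∈ Ici (1:ℝ)) :
    HasDerivWithinAt (fun r => μ * m * (V1 r * (r ^ N)⁻¹) - pressureV K γ (V r)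
      - m ^ 2 * (V r * (r ^ (2 * N))⁻¹)) (N * m ^ 2 * V r / r ^ (2 * N + 1)) (Ici 1) r := by
  have h0 : r ≠ 0 := by have : (1:ℝ) ≤ r := hr; positivity
  have h1 := ((P.hasDeriv_one r hr).mul (hasDerivWithinAt_inv_pow N hr (Ici 1))).const_mul (μ * m)
  have h2 := (hasDerivAt_pressureV K γ (P.pos r hr)).comp_hasDerivWithinAt r (P.hasDeriv r hr)
  have h3 := ((P.hasDeriv r hr).mul (hasDerivWithinAt_inv_pow (2 * N) hr (Ici 1))).const_mul (m ^ 2)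
  have := (h1.sub h2).sub h3
  refine this.congr_deriv ?_
  have ode := P.ode r hr
  have e1 : μ * m * (V2 r * (r ^ N)⁻¹ + V1 r * (-(N : ℝ) / r ^ (N + 1)))
      = μ * m * (V2 r / r ^ N - N * V1 r / r ^ (N + 1)) := by ring
  rw [e1, ode]
  push_cast
  have hN : r ^ N ≠ 0 := pow_ne_zero _ h0
  rw [show 2 * N = N + N by ring]
  simp only [pow_succ, pow_add]
  field_simp
  ring

/-- Convergence of `V` does not by itself force `V1` to tend to zero, but the mean value theorem on
[a, a + 1] gives arbitrarily far points where the slope is a difference of two values of `V` close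
to `vp`. Monotone quantities need no more. -/
theorem exists_far (P : Profile N μ γ K m vp V V1 V2) {e : ℝ} (he : 0 < e) (r0 : ℝ) :
    ∃ ξ, 1 ≤ ξ ∧ r0 ≤ ξ ∧ |V1 ξ| ≤ e ∧ |V ξ - vp| ≤ e := by
  have h1 : ∀ᶠ r in atTop, |V r - vp| < e / 2 := by
    have := Metric.tendsto_nhds.1 P.farField (e / 2) (by positivity)
    simpa [Real.dist_eq] using this
  obtain ⟨R, hR⟩ := eventually_atTop.1 h1
  set a := max R (max r0 1)
  have ha : 1 ≤ a := (le_max_right _ _).trans (le_max_right _ _)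
  obtain ⟨ξ, hξ, hs⟩ := exists_hasDerivAt_eq_slope V V1 (by linarith : a < a + 1)
    (P.continuousOn.mono (fun x hx => ha.trans hx.1))
    (fun x hx => (P.hasDeriv x (ha.trans hx.1.le)).hasDerivAt (Ici_mem_nhds (ha.trans_lt hx.1)))
  refine ⟨ξ, ha.trans hξ.1.le, ((le_max_left _ _).trans (le_max_right _ _)).trans hξ.1.le, ?_, ?_⟩
  · have e1 := hR a (le_max_left _ _)
    have e2 := hR (a + 1) ((le_max_left _ _).trans (by linarith : a ≤ a + 1))
    rw [hs]
    have : (V (a + 1) - V a) / (a + 1 - a) = (V (a + 1) - vp) - (V a - vp) := by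
      rw [add_sub_cancel_left]; ring
    rw [this, abs_le]; rw [abs_lt] at e1 e2
    constructor <;> linarith
  · exact (hR ξ ((le_max_left _ _).trans hξ.1.le)).le.trans (by linarith)

theorem exists_far_pressure (P : Profile N μ γ K m vp V V1 V2) (hvp : 0 < vp) {e : ℝ} (he : 0 < e)
    (r0 : ℝ) : ∃ ξ, 1 ≤ ξ ∧ r0 ≤ ξ ∧ |V1 ξ| ≤ e ∧ |pressureV K γ (V ξ) - pressureV K γ vp| ≤ e := by
  have hc := (hasDerivAt_pressureV K γ hvp).continuousAt
  obtain ⟨δ, hδ, H⟩ := Metric.continuousAt_iff.1 hc e he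
  obtain ⟨ξ, h1, h2, h3, h4⟩ := P.exists_far (e := min e (δ / 2)) (by positivity) r0
  refine ⟨ξ, h1, h2, h3.trans (min_le_left _ _), ?_⟩
  have := H (x := V ξ) (by
    rw [Real.dist_eq]; exact (h4.trans (min_le_right _ _)).trans_lt (by linarith))
  rw [Real.dist_eq] at this; exact this.le

theorem monotoneOn_Ici_of_deriv {f f' : ℝ → ℝ}
    (h : ∀ r ∈ Ici (1:ℝ), HasDerivWithinAt f (f' r) (Ici 1) r)
    (h0 : ∀ r ∈ Ici (1:ℝ), 0 ≤ f' r) : MonotoneOn f (Ici 1) := by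
  apply monotoneOn_of_hasDerivWithinAt_nonneg (convex_Ici 1) (f' := f')
  · exact fun r hr => (h r hr).continuousWithinAt
  · intro r hr
    exact (h r (interior_subset hr)).mono interior_subset
  · exact fun r hr => h0 r (interior_subset hr)

/-- The first integral is nondecreasing because its derivative is a positive multiple of `V`. Far
out the slope term is negligible, the kinetic term has a favourable sign, and the pressure tends to
its limit. -/
theorem firstIntegral_le (P : Profile N μ γ K m vp V V1 V2) (hμ : 0 < μ) (hm : 0 < m)
    (hvp : 0 < vp) {r : ℝ} (hr : r ∈ Ici (1:ℝ)) :
    μ * m * (V1 r * (r ^ N)⁻¹) - pressureV K γ (V r) - m ^ 2 * (V r * (r ^ (2 * N))⁻¹)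
      ≤ -pressureV K γ vp := by
  have mono := monotoneOn_Ici_of_deriv (fun r hr => P.hasDerivWithinAt_firstIntegral hr)
    (fun r hr => by
      have h1 : (1:ℝ) ≤ r := hr
      have := P.pos r hr
      positivity)
  apply le_of_forall_pos_le_add
  intro e he
  obtain ⟨ξ, h1, h2, h3, h4⟩ := P.exists_far_pressure hvp (e := e / (μ * m + 1)) (by positivity) r
  refine (mono hr h1 h2).trans ?_
  have hx : (0:ℝ) < (ξ ^ N)⁻¹ := by positivity
  have hx1 : (ξ ^ N)⁻¹ ≤ 1 := inv_le_one_of_one_le₀ (one_le_pow₀ h1)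
  have hV := P.pos ξ h1
  have hneg : 0 ≤ m ^ 2 * (V ξ * (ξ ^ (2 * N))⁻¹) := by positivity
  have hb : V1 ξ * (ξ ^ N)⁻¹ ≤ e / (μ * m + 1) := by
    calc V1 ξ * (ξ ^ N)⁻¹ ≤ |V1 ξ| * (ξ ^ N)⁻¹ := by gcongr; exact le_abs_self _
      _ ≤ |V1 ξ| * 1 := by gcongr
      _ ≤ _ := by rw [mul_one]; exact h3
  have hb2 : μ * m * (V1 ξ * (ξ ^ N)⁻¹) ≤ μ * m * (e / (μ * m + 1)) := by gcongr
  have hsum : μ * m * (e / (μ * m + 1)) + e / (μ * m + 1) = e := by field_simp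
  have := (abs_le.1 h4).1
  linarith

/-- Adding the corrector m² vp r^{-2N} reverses the monotonicity as long as `V ≤ 2 vp`: the
derivative becomes -N m² (2 vp - V) / r^{2N+1}. Comparison with far points then bounds the first
integral from below. -/
theorem le_firstIntegral (P : Profile N μ γ K m vp V V1 V2) (hμ : 0 < μ) (hm : 0 < m)
    (hvp : 0 < vp) (hN : 1 ≤ N) (hle : ∀ r ∈ Ici (1:ℝ), V r ≤ 2 * vp) {r : ℝ}
    (hr : r ∈ Ici (1:ℝ)) :
    -pressureV K γ vp - m ^ 2 * vp ≤
    μ * m * (V1 r * (r ^ N)⁻¹) - pressureV K γ (V r) - m ^ 2 * (V r * (r ^ (2 * N))⁻¹) := by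
  have mono := monotoneOn_Ici_of_deriv (fun r hr => 
      ((P.hasDerivWithinAt_firstIntegral hr).add
      ((hasDerivWithinAt_inv_pow (2 * N) hr (Ici 1)).const_mul (m ^ 2 * vp))).neg)
    (fun r hr => by
      have h1 : (1:ℝ) ≤ r := hr
      have h2 := hle r hr
      have e : -(N * m ^ 2 * V r / r ^ (2 * N + 1)
          + m ^ 2 * vp * (-((2 * N : ℕ) : ℝ) / r ^ (2 * N + 1)))
          = N * m ^ 2 * (2 * vp - V r) / r ^ (2 * N + 1) := by push_cast; ring
      rw [e]
      have : 0 ≤ 2 * vp - V r := by linarith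
      positivity)
  apply le_of_forall_pos_le_add
  intro e he
  set e' := e / (μ * m + 1 + m ^ 2 * (2 * vp)) with he'
  have hden : 0 < μ * m + 1 + m ^ 2 * (2 * vp) := by positivity
  have he'p : 0 < e' := by positivity
  obtain ⟨ξ, h1, h2, h3, h4⟩ := P.exists_far_pressure hvp he'p (max r (1 / e'))
  have hrξ := (le_max_left _ _).trans h2
  have hM := mono hr h1 hrξ
  simp only [Pi.neg_apply, Pi.add_apply] at hM
  have hx : (0:ℝ) < (ξ ^ N)⁻¹ := by positivity
  have hx1 : (ξ ^ N)⁻¹ ≤ 1 := inv_le_one_of_one_le₀ (one_le_pow₀ h1)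
  have hx2 : (ξ ^ (2 * N))⁻¹ ≤ e' := by
    have h5 : 1 / e' ≤ ξ := (le_max_right _ _).trans h2
    have h6 : ξ ≤ ξ ^ (2 * N) := le_self_pow₀ h1 (by omega)
    rw [inv_le_comm₀ (by positivity) he'p, ← one_div]
    exact h5.trans h6
  have hx3 : (0:ℝ) ≤ (ξ ^ (2 * N))⁻¹ := by positivity
  have hV := P.pos ξ h1
  have hV2 := hle ξ h1
  have t1 : V ξ * (ξ ^ (2 * N))⁻¹ ≤ 2 * vp * e' := by gcongr
  have t2 : m ^ 2 * (V ξ * (ξ ^ (2 * N))⁻¹) ≤ m ^ 2 * (2 * vp * e') := by gcongr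
  have t3 : (r ^ (2 * N))⁻¹ ≤ 1 := inv_le_one_of_one_le₀ (one_le_pow₀ hr)
  have t4 : m ^ 2 * vp * (r ^ (2 * N))⁻¹ ≤ m ^ 2 * vp := by
    have : 0 ≤ m ^ 2 * vp := by positivity
    nlinarith
  have t5 : 0 ≤ m ^ 2 * vp * (ξ ^ (2 * N))⁻¹ := by positivity
  have hb : -e' ≤ V1 ξ * (ξ ^ N)⁻¹ := by
    have : |V1 ξ * (ξ ^ N)⁻¹| ≤ e' := by
      rw [abs_mul, abs_of_pos hx]
      calc |V1 ξ| * (ξ ^ N)⁻¹ ≤ |V1 ξ| * 1 := by gcongr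
        _ ≤ _ := by rw [mul_one]; exact h3
    exact (abs_le.1 this).1
  have hb2 : μ * m * (-e') ≤ μ * m * (V1 ξ * (ξ ^ N)⁻¹) := by gcongr
  have hsum : μ * m * e' + e' + m ^ 2 * (2 * vp * e') = e := by
    rw [he']; field_simp
  have := (abs_le.1 h4).2
  linarith

end Profile
-- Stationary profiles: barriers and the boundary layer.
namespace Profile

variable {N : ℕ} {μ γ K m vp : ℝ} {V V1 V2 : ℝ → ℝ}

/-- A barrier argument: where `V` touches `2 vp`, the upper bound on the first integral makes the
slope strictly negative, by the pressure gap in `hsmall`. -/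
theorem le_two_mul (P : Profile N μ γ K m vp V V1 V2) (hμ : 0 < μ) (hm : 0 < m) (hvp : 0 < vp)
    (h1 : V 1 ≤ 2 * vp) (hsmall : m ^ 2 * (2 * vp) < pressureV K γ vp - pressureV K γ (2 * vp))
    {r : ℝ} (hr : r ∈ Ici (1:ℝ)) : V r ≤ 2 * vp := by
  refine image_le_of_deriv_right_lt_deriv_boundary (a := 1) (b := r) (f' := V1)
    (B := fun _ => 2 * vp) (B' := fun _ => 0)
    (P.continuousOn.mono Icc_subset_Ici_self)
    (fun x hx => (P.hasDeriv x hx.1).mono (Ici_subset_Ici.2 hx.1)) h1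
    (fun x => hasDerivAt_const x _) ?_ (right_mem_Icc.2 hr)
  intro x hx hV
  have hx1 : 1 ≤ x := hx.1
  have hJ := P.firstIntegral_le hμ hm hvp (r := x) hx.1
  rw [hV] at hJ
  have hle : m ^ 2 * (2 * vp * (x ^ (2 * N))⁻¹) ≤ m ^ 2 * (2 * vp) := by
    have : (x ^ (2 * N))⁻¹ ≤ 1 := inv_le_one_of_one_le₀ (one_le_pow₀ hx1)
    have h2 : 2 * vp * (x ^ (2 * N))⁻¹ ≤ 2 * vp * 1 := by gcongr
    rw [mul_one] at h2
    gcongr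
  have hneg : μ * m * (V1 x * (x ^ N)⁻¹) < 0 := by linarith
  by_contra hcon
  have hcon' : 0 ≤ V1 x := not_lt.1 hcon
  have : 0 ≤ μ * m * (V1 x * (x ^ N)⁻¹) := by positivity
  linarith

/-- The mirror image of `le_two_mul`: at a contact with `vp / 2` the lower bound on the first
integral forces a positive slope. -/
theorem half_le (P : Profile N μ γ K m vp V V1 V2) (hμ : 0 < μ) (hm : 0 < m) (hvp : 0 < vp)
    (hN : 1 ≤ N) (hle : ∀ r ∈ Ici (1:ℝ), V r ≤ 2 * vp) (h1 : vp / 2 ≤ V 1)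
    (hsmall : m ^ 2 * vp < pressureV K γ (vp / 2) - pressureV K γ vp)
    {r : ℝ} (hr : r ∈ Ici (1:ℝ)) : vp / 2 ≤ V r := by
  have := image_le_of_deriv_right_lt_deriv_boundary (a := 1) (b := r) (f := fun x => -V x)
    (f' := fun x => -V1 x)
    (B := fun _ => -(vp / 2)) (B' := fun _ => 0)
    (P.continuousOn.mono Icc_subset_Ici_self).neg
    (fun x hx => ((P.hasDeriv x hx.1).mono (Ici_subset_Ici.2 hx.1)).neg) (by simpa using h1)
    (fun x => hasDerivAt_const x _) ?_ (right_mem_Icc.2 hr)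
  · simpa using this
  intro x hx hV
  have hV : V x = vp / 2 := by simpa using hV
  have hx1 : 1 ≤ x := hx.1
  have hJ := P.le_firstIntegral hμ hm hvp hN hle (r := x) hx.1
  rw [hV] at hJ
  have hle : 0 ≤ m ^ 2 * (vp / 2 * (x ^ (2 * N))⁻¹) := by positivity
  have hpos : 0 < μ * m * (V1 x * (x ^ N)⁻¹) := by linarith
  by_contra hcon
  have hcon' : V1 x ≤ 0 := by linarith
  have hx0 : (0:ℝ) ≤ (x ^ N)⁻¹ := by positivity
  have : V1 x * (x ^ N)⁻¹ ≤ 0 := mul_nonpos_of_nonpos_of_nonneg hcon' hx0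
  have : μ * m * (V1 x * (x ^ N)⁻¹) ≤ 0 := mul_nonpos_of_nonneg_of_nonpos (by positivity) this
  linarith

/-- At r = 1 the two bounds on the first integral differ by O(m²), and so do p(V(1)) and p(vp) by
the closeness of the data. This pins μ m V'(1) to O(m²); dividing by m gives the height of the
boundary layer. -/
theorem abs_slope_one_le (P : Profile N μ γ K m vp V V1 V2) (hμ : 0 < μ) (hm : 0 < m)
    (hvp : 0 < vp) (hN : 1 ≤ N) {c C C1 : ℝ}
    (hp : PressureBounds K γ (vp / 2) (2 * vp) c C)
    (hV : ∀ r ∈ Ici (1:ℝ), V r ∈ Icc (vp / 2) (2 * vp)) (h1 : |V 1 - vp| ≤ C1 * m ^ 2) :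
    |V1 1| ≤ (C * C1 + 3 * vp) / μ * m := by
  have one : (1:ℝ) ∈ Ici (1:ℝ) := self_mem_Ici
  have u := P.firstIntegral_le hμ hm hvp one
  have l := P.le_firstIntegral hμ hm hvp hN (fun r hr => (hV r hr).2) one
  have hC : 0 < C := hp.pos.trans_le hp.le
  have hpd := hp.abs_sub_le (by positivity) (hV 1 one)
    (⟨by linarith, by linarith⟩ : vp ∈ Icc (vp / 2) (2 * vp))
  have hpd2 : C * |V 1 - vp| ≤ C * (C1 * m ^ 2) := by gcongr
  simp only [one_pow, inv_one, mul_one] at u l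
  have hV1 := (hV 1 one)
  have e1 : m ^ 2 * V 1 ≤ m ^ 2 * (2 * vp) := by have := hV1.2; gcongr
  have e0 : 0 ≤ m ^ 2 * V 1 := by have := P.pos 1 one; positivity
  have e2 : 0 ≤ m ^ 2 * vp := by positivity
  obtain ⟨p1, p2⟩ := abs_le.1 (hpd.trans hpd2)
  have : |μ * m * V1 1| ≤ (C * C1 + 3 * vp) * m ^ 2 := by
    rw [abs_le]; constructor <;> nlinarith
  rw [abs_mul, abs_of_pos (by positivity : 0 < μ * m)] at this
  rw [div_mul_eq_mul_div, le_div_iff₀ hμ]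
  have h3 : m * (|V1 1| * μ) ≤ m * ((C * C1 + 3 * vp) * m) := by nlinarith
  exact le_of_mul_le_mul_left h3 hm

theorem hasDerivWithinAt_slope (P : Profile N μ γ K m vp V V1 V2) {r : ℝ} (hr : r ∈ Ici (1:ℝ)) :
    HasDerivWithinAt (fun r => V1 r * (r ^ N)⁻¹) (V2 r / r ^ N - N * V1 r / r ^ (N + 1))
      (Ici 1) r :=
  ((P.hasDeriv_one r hr).mul (hasDerivWithinAt_inv_pow N hr (Ici 1))).congr_deriv (by ring)

theorem hasDerivAt_exp_layer (k m r : ℝ) :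
    HasDerivAt (fun r => Real.exp (-(k * (r - 1) / m))) (-(k / m) * Real.exp (-(k * (r - 1) / m))) r := by
  have h : HasDerivAt (fun r => -(k * (r - 1) / m)) (-(k / m)) r := by
    have := ((((hasDerivAt_id r).sub_const 1).const_mul k).div_const m).neg
    exact this.congr_deriv (by ring)
  exact h.exp.congr_deriv (by ring)

/-- Boundary layer plus algebraic tail bound for the slope of a stationary profile. -/
theorem abs_slope_le (P : Profile N μ γ K m vp V V1 V2) (hμ : 0 < μ) (hm : 0 < m)
    (hvp : 0 < vp) (hN : 1 ≤ N) {c C C2 : ℝ}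
    (hp : PressureBounds K γ (vp / 2) (2 * vp) c C)
    (hV : ∀ r ∈ Ici (1:ℝ), V r ∈ Icc (vp / 2) (2 * vp)) (h1 : |V1 1| ≤ C2 * m) (hC2 : 0 < C2)
    (hm1 : m ^ 2 ≤ c / 2) (hm2 : μ * m * (3 * N + 1) ≤ c / 4) {r : ℝ} (hr : r ∈ Ici (1:ℝ)) :
    |V1 r * (r ^ N)⁻¹| ≤ C2 * m * Real.exp (-(c / (4 * μ) * (r - 1) / m))
      + 16 * N * vp / c * m ^ 2 * (r ^ (3 * N + 1))⁻¹ := by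
  have hc := hp.pos
  have hNp : (0:ℝ) < N := by exact_mod_cast hN
  -- With this rate the exponential part of the barrier satisfies μ m B' = -(c/4) B exactly. `C3` is
  -- the value for which the algebraic part makes the forcing at most a quarter of the damping term.
  set k := c / (4 * μ) with hk
  set C3 := 16 * N * vp / c with hC3
  have hC3p : 0 < C3 := by positivity
  set B : ℝ → ℝ := fun r => C2 * m * Real.exp (-(k * (r - 1) / m)) + C3 * m ^ 2 * (r ^ (3 * N + 1))⁻¹
    with hB
  set B' : ℝ → ℝ := fun r => C2 * m * (-(k / m) * Real.exp (-(k * (r - 1) / m)))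
    + C3 * m ^ 2 * (-((3 * N + 1 : ℕ) : ℝ) / r ^ (3 * N + 1 + 1)) with hB'
  have dB : ∀ x ∈ Ici (1:ℝ), ∀ s, HasDerivWithinAt B (B' x) s x := fun x hx s =>
    ((hasDerivAt_exp_layer k m x).hasDerivWithinAt.const_mul _).add
      ((hasDerivWithinAt_inv_pow (3 * N + 1) hx s).const_mul _)
  have cB : ContinuousOn B (Icc 1 r) := fun x hx =>
    (dB x hx.1 (Icc 1 r)).continuousWithinAt
  have cw : ContinuousOn (fun r => V1 r * (r ^ N)⁻¹) (Icc 1 r) := fun x hx =>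
    (P.hasDerivWithinAt_slope hx.1).continuousWithinAt.mono Icc_subset_Ici_self
  -- pointwise comparison of the derivatives
  have key : ∀ x ∈ Ici (1:ℝ), 0 < B x ∧ -(c / 4) * B x ≤ μ * m * B' x ∧
      ∃ a f, (c / 2) * 1 ≤ a ∧ 0 ≤ f ∧ f ≤ a * (B x / 4) ∧
      μ * m * (V2 x / x ^ N - N * V1 x / x ^ (N + 1)) = -a * (V1 x * (x ^ N)⁻¹) - f := by
    intro x hx
    have hx1 : (1:ℝ) ≤ x := hx
    have hx0 : 0 < x := by linarith
    have hxN : 1 ≤ x ^ N := one_le_pow₀ hx1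
    have hE : 0 < Real.exp (-(k * (x - 1) / m)) := Real.exp_pos _
    have hT : 0 < (x ^ (3 * N + 1))⁻¹ := by positivity
    have hBpos : 0 < B x := by simp only [hB]; positivity
    refine ⟨hBpos, ?_, ?_⟩
    · have e1 : μ * m * (C2 * m * (-(k / m) * Real.exp (-(k * (x - 1) / m))))
          = -(c / 4) * (C2 * m * Real.exp (-(k * (x - 1) / m))) := by
        rw [hk]; field_simp
      have e2 : μ * m * (C3 * m ^ 2 * (-((3 * N + 1 : ℕ) : ℝ) / x ^ (3 * N + 1 + 1)))
          = -(μ * m * (3 * N + 1)) * (C3 * m ^ 2 * ((x ^ (3 * N + 1))⁻¹ * x⁻¹)) := by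
        push_cast
        rw [pow_succ x (3 * N + 1)]
        field_simp
      have e3 : (x ^ (3 * N + 1))⁻¹ * x⁻¹ ≤ (x ^ (3 * N + 1))⁻¹ := by
        have : x⁻¹ ≤ 1 := inv_le_one_of_one_le₀ hx1
        nlinarith
      have e4 : μ * m * (3 * N + 1) * (C3 * m ^ 2 * ((x ^ (3 * N + 1))⁻¹ * x⁻¹))
          ≤ (c / 4) * (C3 * m ^ 2 * (x ^ (3 * N + 1))⁻¹) := by gcongr
      simp only [hB, hB', mul_add]
      rw [e1, e2]
      linarith
    · have hVx := hV x hx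
      set d := -deriv (pressureV K γ) (V x) with hd
      have hdl := hp.lower (V x) hVx
      have h2N : (x ^ (2 * N))⁻¹ ≤ 1 := inv_le_one_of_one_le₀ (one_le_pow₀ hx1)
      have hmm : m ^ 2 * (x ^ (2 * N))⁻¹ ≤ c / 2 := by
        calc m ^ 2 * (x ^ (2 * N))⁻¹ ≤ m ^ 2 * 1 := by gcongr
          _ ≤ c / 2 := by linarith
      have hfac : c / 2 ≤ d - m ^ 2 * (x ^ (2 * N))⁻¹ := by linarith
      have hfac0 : 0 ≤ d - m ^ 2 * (x ^ (2 * N))⁻¹ := by linarith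
      have hfac1 : 0 ≤ (d - m ^ 2 * (x ^ (2 * N))⁻¹) * x ^ N := by positivity
      refine ⟨(d - m ^ 2 * (x ^ (2 * N))⁻¹) * x ^ N, N * m ^ 2 * V x / x ^ (2 * N + 1), ?_, ?_, ?_, ?_⟩
      · gcongr
      · have := P.pos x hx; positivity
      · have h5 : (c / 2 * x ^ N) * (C3 * m ^ 2 * (x ^ (3 * N + 1))⁻¹ / 4)
            ≤ ((d - m ^ 2 * (x ^ (2 * N))⁻¹) * x ^ N) * (B x / 4) := by
          have : C3 * m ^ 2 * (x ^ (3 * N + 1))⁻¹ ≤ B x := by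
            simp only [hB]
            have : 0 < C2 * m * Real.exp (-(k * (x - 1) / m)) := by positivity
            linarith
          gcongr
        refine le_trans ?_ h5
        have e : (c / 2 * x ^ N) * (C3 * m ^ 2 * (x ^ (3 * N + 1))⁻¹ / 4)
            = N * m ^ 2 * (2 * vp) / x ^ (2 * N + 1) := by
          rw [hC3, show 3 * N + 1 = N + (2 * N + 1) by ring, pow_add]
          field_simp
          ring
        rw [e]
        have := hVx.2
        gcongr
      · rw [P.ode x hx]
        have : deriv (pressureV K γ) (V x) = -d := by rw [hd, neg_neg]
        rw [this, show 2 * N + 1 = N + N + 1 by ring, show 2 * N = N + N by ring]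
        simp only [pow_add, pow_one]
        field_simp
        ring
  have hinit : |V1 1| ≤ B 1 := by
    simp only [hB, sub_self, mul_zero, zero_div, neg_zero, Real.exp_zero, mul_one, one_pow, inv_one]
    have : 0 < C3 * m ^ 2 := by positivity
    linarith
  -- At a contact point the damping coefficient is at least c/2 and the forcing takes away at most a
  -- quarter of it, which leaves decay at rate 3c/8, while the barrier decays at rate at most c/4.
  -- Hence the solution cannot cross.
  have hcmp : ∀ x ∈ Ici (1:ℝ), ∀ w', (∃ a f, (c / 2) * 1 ≤ a ∧ f ≤ a * (B x / 4) ∧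
      μ * m * w' = -a * B x + f) → w' < B' x := by
    rintro x hx w' ⟨a, f, ha, hf, he⟩
    obtain ⟨hBp, hB1, -⟩ := key x hx
    have : μ * m * w' < μ * m * B' x := by
      have h3 : (c / 2 * 1) * B x ≤ a * B x := by gcongr
      have h4 : 0 < c * B x := by positivity
      nlinarith
    exact lt_of_mul_lt_mul_left this (by positivity)
  have up : V1 r * (r ^ N)⁻¹ ≤ B r := by
    refine image_le_of_deriv_right_lt_deriv_boundary' (a := 1) (b := r) cw
      (fun x hx => (P.hasDerivWithinAt_slope hx.1).mono (Ici_subset_Ici.2 hx.1))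
      (by simpa using (le_abs_self _).trans hinit) cB
      (fun x hx => dB x hx.1 _) ?_ (right_mem_Icc.2 hr)
    intro x hx heq
    obtain ⟨hBp, -, a, f, ha, hf0, hf, he⟩ := key x hx.1
    rw [heq] at he
    refine hcmp x hx.1 _ ⟨a, -f, ha, ?_, by linarith⟩
    have : 0 ≤ a := by linarith
    have : 0 ≤ a * (B x / 4) := by positivity
    linarith
  have down : -(V1 r * (r ^ N)⁻¹) ≤ B r := by
    refine image_le_of_deriv_right_lt_deriv_boundary' (a := 1) (b := r)
      (f := fun r => -(V1 r * (r ^ N)⁻¹)) cw.neg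
      (fun x hx => ((P.hasDerivWithinAt_slope hx.1).mono (Ici_subset_Ici.2 hx.1)).neg)
      (by simpa using (neg_le_abs _).trans hinit) cB
      (fun x hx => dB x hx.1 _) ?_ (right_mem_Icc.2 hr)
    intro x hx heq
    obtain ⟨hBp, -, a, f, ha, hf0, hf, he⟩ := key x hx.1
    have heq' : V1 x * (x ^ N)⁻¹ = -B x := by linarith
    rw [heq'] at he
    exact hcmp x hx.1 _ ⟨a, f, ha, hf, by linarith⟩
  exact abs_le.2 ⟨by linarith, up⟩

end Profile

/-! ### Weighted bounds for the profile and its derivatives. -/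

/-- The weight `σ` controlling the coefficients of a stationary profile: a boundary layer of
width `m` and an algebraic tail. -/
noncomputable def layerWeight (N : ℕ) (k m r : ℝ) : ℝ :=
  (m ^ 2 * Real.exp (-(k * (r - 1) / m)) + m ^ 3) / r ^ (2 * N + 2)

/-- Smallness and decay of the coefficients of a stationary profile. -/
structure ProfileBounds (N : ℕ) (m vp k L : ℝ) (V V1 V2 : ℝ → ℝ) : Prop where
  mem : ∀ r ∈ Ici (1:ℝ), V r ∈ Icc (vp / 2) (2 * vp)
  slope_sq : ∀ r ∈ Ici (1:ℝ), (r * V1 r) ^ 2 ≤ L * layerWeight N k m r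
  slope_mul : ∀ r ∈ Ici (1:ℝ), |V1 r| * m / r ≤ L * layerWeight N k m r
  slope_le : ∀ r ∈ Ici (1:ℝ), |V1 r| ≤ L
  vel : ∀ r ∈ Ici (1:ℝ), m * V r / r ^ N ≤ L * m / r
  vel_slope : ∀ r ∈ Ici (1:ℝ), |m * V1 r / r ^ N - N * m * V r / r ^ (N + 1)| ≤ L * m / r ^ 2
  vel_sq : ∀ r ∈ Ici (1:ℝ),
    (r * ((m * V1 r / r ^ N - N * m * V r / r ^ (N + 1)) * (m * V r / r ^ N))) ^ 2
      ≤ L * layerWeight N k m r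
  curv_sq : ∀ r ∈ Ici (1:ℝ),
    (r * (m * (V2 r / r ^ N - N * V1 r / r ^ (N + 1)))) ^ 2 ≤ L * layerWeight N k m r
  curv_le : ∀ r ∈ Ici (1:ℝ), r ^ N * |V2 r / r ^ N - N * V1 r / r ^ (N + 1)| ≤ L / r ^ 2

/-- Since r ≤ e^{r-1}, an exponential of rate k/m ≥ j beats r^{-j}. A thin layer can therefore pay
for any fixed power of the radius. -/
theorem one_div_pow_layer {k m r : ℝ} {j : ℕ} (hm : 0 < m) (hj : (j : ℝ) * m ≤ k) (hr : 1 ≤ r) :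
    Real.exp (-(k * (r - 1) / m)) ≤ (r⁻¹) ^ j := by
  have h1 : r ≤ Real.exp (r - 1) := by linarith [Real.add_one_le_exp (r - 1)]
  have h2 : r ^ j ≤ Real.exp (j * (r - 1)) := by
    rw [Real.exp_nat_mul]; gcongr
  have h3 : Real.exp (j * (r - 1)) ≤ Real.exp (k * (r - 1) / m) := by
    apply Real.exp_le_exp.2
    rw [le_div_iff₀ hm]
    nlinarith [sub_nonneg.2 hr]
  rw [Real.exp_neg, inv_pow]
  exact inv_anti₀ (by positivity) (h2.trans h3)

-- Everything follows from the bound on V_r / r^N: the velocity and its slope are explicit in `V`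
-- and `V1`, and the curvature is expressed through them by the ODE, at the price of one factor m.
-- What remains is bookkeeping of powers of m and 1/r.
set_option maxHeartbeats 1000000 in
theorem profileBounds_of_slope {N : ℕ} {μ γ K m vp k A C c : ℝ} {V V1 V2 : ℝ → ℝ}
    (P : Profile N μ γ K m vp V V1 V2) (hμ : 0 < μ) (hm : 0 < m) (hm1 : m ≤ 1) (hvp : 0 < vp)
    (hN : 1 ≤ N) (hA : 0 < A) (hp : PressureBounds K γ (vp / 2) (2 * vp) c C)
    (hk : ((4 * N + 4 : ℕ) : ℝ) * m ≤ k)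
    (hV : ∀ r ∈ Ici (1:ℝ), V r ∈ Icc (vp / 2) (2 * vp))
    (hw : ∀ r ∈ Ici (1:ℝ), |V1 r * (r ^ N)⁻¹| ≤ A * (m * Real.exp (-(2 * k * (r - 1) / m))
      + m ^ 2 * (r ^ (3 * N + 1))⁻¹)) :
    ProfileBounds N m vp k (2 * A ^ 2 + A + 2 * A + 2 * vp + (2 * A + 2 * N * vp)
      + ((2 * A + 2 * N * vp) * (2 * vp)) ^ 2 + 2 * ((C + 1 + 2 * N * vp) / μ * (A + 1)) ^ 2
      + 2 * ((C + 1 + 2 * N * vp) / μ * (A + 1))) V V1 V2 := by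
  have hC : 0 < C := hp.pos.trans_le hp.le
  set L1 := (C + 1 + 2 * N * vp) / μ with hL1
  have hL1p : 0 < L1 := by positivity
  set L := (2 * A ^ 2 + A + 2 * A + 2 * vp + (2 * A + 2 * N * vp)
      + ((2 * A + 2 * N * vp) * (2 * vp)) ^ 2 + 2 * (L1 * (A + 1)) ^ 2 + 2 * (L1 * (A + 1))) with hL
  have p1 : 0 < A ^ 2 := by positivity
  have p2 : 0 ≤ (2 * A + 2 * N * vp) := by positivity
  have p3 : 0 ≤ ((2 * A + 2 * N * vp) * (2 * vp)) ^ 2 := by positivity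
  have p4 : 0 < (L1 * (A + 1)) ^ 2 := by positivity
  have p5 : 0 < L1 * (A + 1) := by positivity
  have p6 : 0 ≤ 2 * N * vp := by positivity
  have l1 : 2 * A ^ 2 ≤ L := by rw [hL]; linarith
  have l2 : A ≤ L := by rw [hL]; linarith
  have l3 : 2 * A ≤ L := by rw [hL]; linarith
  have l4 : 2 * vp ≤ L := by rw [hL]; linarith
  have l5 : 2 * A + 2 * N * vp ≤ L := by rw [hL]; linarith
  have l6 : ((2 * A + 2 * N * vp) * (2 * vp)) ^ 2 ≤ L := by rw [hL]; linarith
  have l7 : 2 * (L1 * (A + 1)) ^ 2 ≤ L := by rw [hL]; linarith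
  have l8 : 2 * (L1 * (A + 1)) ≤ L := by rw [hL]; linarith
  have l0 : 0 ≤ L := hA.le.trans l2
  clear_value L
  -- everything in terms of `i = 1 / r`
  have main : ∀ r ∈ Ici (1:ℝ), ∃ i e w w1, 0 < i ∧ i ≤ 1 ∧ r * i = 1 ∧ r⁻¹ = i ∧ 0 < e ∧ e ≤ 1 ∧
      w = V1 r / r ^ N ∧ w1 = V2 r / r ^ N - N * V1 r / r ^ (N + 1) ∧
      |w| ≤ A * (m * e * i ^ (4 * N + 4) + m ^ 2 * i ^ (3 * N + 1)) ∧
      r * |V1 r| ≤ A * (m * e * i ^ (3 * N + 3) + m ^ 2 * i ^ (2 * N)) ∧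
      layerWeight N k m r = (m ^ 2 * e + m ^ 3) * i ^ (2 * N + 2) ∧
      (m * e * i ^ (3 * N + 3) + m ^ 2 * i ^ (2 * N)) ^ 2 ≤ 2 * layerWeight N k m r ∧
      r * (m * |w1|) ≤ L1 * (A + 1) * (m * e * i ^ (3 * N + 3) + m ^ 2 * i ^ (2 * N)) := by
    intro r hr
    have hr1 : 1 ≤ r := hr
    have hr0 : 0 < r := by linarith
    set i := r⁻¹ with hi
    have hi0 : 0 < i := by positivity
    have hi1 : i ≤ 1 := inv_le_one_of_one_le₀ hr1
    have hri : r * i = 1 := mul_inv_cancel₀ hr0.ne'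
    set e := Real.exp (-(k * (r - 1) / m)) with he
    have he0 : 0 < e := Real.exp_pos _
    have hei : e ≤ i ^ (4 * N + 4) := one_div_pow_layer hm hk hr1
    have he1 : e ≤ 1 := hei.trans (pow_le_one₀ hi0.le hi1)
    -- Half of the exponential rate is kept as the factor `e` that appears in the weight; the other
    -- half is spent on the power `i ^ (4 * N + 4)`.
    have hee : Real.exp (-(2 * k * (r - 1) / m)) = e * e := by
      rw [he, ← Real.exp_add]; congr 1; ring
    have hrpow : ∀ a b : ℕ, r ^ a * i ^ (a + b) = i ^ b := fun a b => by
      rw [pow_add, ← mul_assoc, ← mul_pow, hri, one_pow, one_mul]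
    have hwb : |V1 r / r ^ N| ≤ A * (m * e * i ^ (4 * N + 4) + m ^ 2 * i ^ (3 * N + 1)) := by
      have := hw r hr
      rw [hee, ← div_eq_mul_inv, ← inv_pow, ← hi] at this
      refine this.trans ?_
      rw [mul_assoc m e]
      gcongr
    have hV1 : r * |V1 r| = r ^ (N + 1) * |V1 r / r ^ N| := by
      rw [abs_div, abs_of_pos (by positivity : 0 < r ^ N), pow_succ]; field_simp
    have hV1b : r * |V1 r| ≤ A * (m * e * i ^ (3 * N + 3) + m ^ 2 * i ^ (2 * N)) := by
      rw [hV1]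
      calc r ^ (N + 1) * |V1 r / r ^ N|
          ≤ r ^ (N + 1) * (A * (m * e * i ^ (4 * N + 4) + m ^ 2 * i ^ (3 * N + 1))) := by gcongr
        _ = A * (m * e * (r ^ (N + 1) * i ^ (N + 1 + (3 * N + 3)))
            + m ^ 2 * (r ^ (N + 1) * i ^ (N + 1 + 2 * N))) := by
          rw [show N + 1 + (3 * N + 3) = 4 * N + 4 by ring, show N + 1 + 2 * N = 3 * N + 1 by ring]
          ring
        _ = _ := by rw [hrpow, hrpow]
    have hσ : layerWeight N k m r = (m ^ 2 * e + m ^ 3) * i ^ (2 * N + 2) := by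
      unfold layerWeight; rw [hi, inv_pow, div_eq_mul_inv]
    have q1 : i ^ (3 * N + 3) ≤ 1 := pow_le_one₀ hi0.le hi1
    have q2 : (i ^ (2 * N)) ^ 2 ≤ i ^ (2 * N + 2) := by
      rw [← pow_mul]; exact pow_le_pow_of_le_one hi0.le hi1 (by omega)
    have q3 : (i ^ (3 * N + 3)) ^ 2 ≤ i ^ (2 * N + 2) := by
      rw [← pow_mul]; exact pow_le_pow_of_le_one hi0.le hi1 (by omega)
    have q4 : e ^ 2 ≤ e := by rw [sq]; exact mul_le_of_le_one_left he0.le he1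
    have q5 : m ^ 4 ≤ m ^ 3 := pow_le_pow_of_le_one hm.le hm1 (by omega)
    have hZ : (m * e * i ^ (3 * N + 3) + m ^ 2 * i ^ (2 * N)) ^ 2 ≤ 2 * layerWeight N k m r := by
      rw [hσ]
      have a1 : (m * e * i ^ (3 * N + 3)) ^ 2 ≤ m ^ 2 * e * i ^ (2 * N + 2) := by
        calc (m * e * i ^ (3 * N + 3)) ^ 2 = m ^ 2 * e ^ 2 * (i ^ (3 * N + 3)) ^ 2 := by ring
          _ ≤ _ := by gcongr
      have a2 : (m ^ 2 * i ^ (2 * N)) ^ 2 ≤ m ^ 3 * i ^ (2 * N + 2) := by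
        calc (m ^ 2 * i ^ (2 * N)) ^ 2 = m ^ 4 * (i ^ (2 * N)) ^ 2 := by ring
          _ ≤ _ := by gcongr
      calc _ ≤ 2 * ((m * e * i ^ (3 * N + 3)) ^ 2 + (m ^ 2 * i ^ (2 * N)) ^ 2) := add_sq_le
        _ ≤ 2 * (m ^ 2 * e * i ^ (2 * N + 2) + m ^ 3 * i ^ (2 * N + 2)) := by gcongr
        _ = _ := by ring
    refine ⟨i, e, V1 r / r ^ N, _, hi0, hi1, hri, rfl, he0, he1, rfl, rfl, hwb, hV1b, hσ, hZ, ?_⟩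
    set w1 := V2 r / r ^ N - N * V1 r / r ^ (N + 1)
    -- The second derivative enters only in the combination `w1`, which the ODE bounds by `|V1|` and
    -- a tail term of order m².
    have hode := P.ode r hr
    have hVr := hV r hr
    have hup := hp.upper _ hVr
    have hlow := hp.lower _ hVr
    have hpos := P.pos r hr
    have hc := hp.pos
    have d1 : |deriv (pressureV K γ) (V r) * V1 r| ≤ C * |V1 r| := by
      rw [abs_mul]; gcongr; rw [abs_le]; constructor <;> linarith
    have e2 : m / r ^ N * (m * V1 r / r ^ N - N * m * V r / r ^ (N + 1))
        = m ^ 2 * (i ^ (2 * N)) * V1 r - N * V r * (m ^ 2 * i ^ (2 * N + 1)) := by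
      rw [hi, inv_pow, inv_pow, show 2 * N + 1 = N + (N + 1) by ring, show 2 * N = N + N by ring,
        pow_add r N N, pow_add r N (N + 1)]
      field_simp
    have d2 : |m ^ 2 * (i ^ (2 * N)) * V1 r| ≤ 1 * |V1 r| := by
      rw [abs_mul, abs_of_pos (by positivity)]
      gcongr
      calc m ^ 2 * i ^ (2 * N) ≤ 1 * 1 := by
            gcongr
            · exact pow_le_one₀ hm.le hm1
            · exact pow_le_one₀ hi0.le hi1
        _ = 1 := one_mul 1
    have d3 : |N * V r * (m ^ 2 * i ^ (2 * N + 1))| ≤ 2 * N * vp * (m ^ 2 * i ^ (2 * N + 1)) := by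
      rw [abs_of_nonneg (by positivity)]
      have := hVr.2
      have : N * V r ≤ 2 * N * vp := by rw [mul_comm 2, mul_assoc]; gcongr
      gcongr
    have tot : μ * (m * |w1|) ≤ (C + 1) * |V1 r| + 2 * N * vp * (m ^ 2 * i ^ (2 * N + 1)) := by
      have : μ * (m * |w1|) = |μ * m * w1| := by
        rw [abs_mul, abs_of_pos (by positivity : 0 < μ * m)]; ring
      rw [this, hode, e2]
      have t1 := abs_add_le (deriv (pressureV K γ) (V r) * V1 r)
        (m ^ 2 * (i ^ (2 * N)) * V1 r - N * V r * (m ^ 2 * i ^ (2 * N + 1)))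
      have t2 := abs_sub (m ^ 2 * (i ^ (2 * N)) * V1 r) (N * V r * (m ^ 2 * i ^ (2 * N + 1)))
      linarith
    have tot2 : μ * (r * (m * |w1|)) ≤ (C + 1) * (r * |V1 r|) + 2 * N * vp * (m ^ 2 * i ^ (2 * N)) := by
      have := mul_le_mul_of_nonneg_left tot hr0.le
      have e3 : r * i ^ (2 * N + 1) = i ^ (2 * N) := by
        rw [pow_succ, mul_comm (i ^ (2 * N)), ← mul_assoc, hri, one_mul]
      have e4 : r * ((C + 1) * |V1 r| + 2 * N * vp * (m ^ 2 * i ^ (2 * N + 1)))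
          = (C + 1) * (r * |V1 r|) + 2 * N * vp * (m ^ 2 * (r * i ^ (2 * N + 1))) := by ring
      rw [e4, e3] at this
      linarith
    set Z := m * e * i ^ (3 * N + 3) + m ^ 2 * i ^ (2 * N) with hZd
    have hZ1 : m ^ 2 * i ^ (2 * N) ≤ Z := by
      have : 0 < m * e * i ^ (3 * N + 3) := by positivity
      linarith
    have hZ0 : 0 < Z := by positivity
    have hb : μ * (r * (m * |w1|)) ≤ (C + 1) * (A * Z) + 2 * N * vp * Z := by
      have s1 : (C + 1) * (r * |V1 r|) ≤ (C + 1) * (A * Z) := by gcongr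
      have s2 : 2 * N * vp * (m ^ 2 * i ^ (2 * N)) ≤ 2 * N * vp * Z := by gcongr
      linarith
    have : L1 * (A + 1) * Z = ((C + 1 + 2 * N * vp) * (A + 1) * Z) / μ := by rw [hL1]; ring
    rw [this, le_div_iff₀ hμ]
    have x1 : 0 ≤ (C + 1) * Z := by positivity
    have x2 : 0 ≤ 2 * N * vp * A * Z := by positivity
    have x3 : (C + 1 + 2 * N * vp) * (A + 1) * Z
        = ((C + 1) * (A * Z) + 2 * N * vp * Z) + ((C + 1) * Z + 2 * N * vp * A * Z) := by ring
    rw [x3, mul_comm]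
    linarith
  have wpos : ∀ r ∈ Ici (1:ℝ), 0 ≤ layerWeight N k m r := by
    intro r hr
    obtain ⟨i, e, w, w1, h0, h1, -, -, h2, -, -, -, -, -, h3, -⟩ := main r hr
    rw [h3]; positivity
  have usl : ∀ r ∈ Ici (1:ℝ), |m * V1 r / r ^ N - N * m * V r / r ^ (N + 1)|
      ≤ (2 * A + 2 * N * vp) * m * (r⁻¹) ^ (N + 1) := by
    intro r hr
    obtain ⟨i, e, w, w1, hi0, hi1, hri, hir, he0, he1, hwd, -, hw', -⟩ := main r hr
    rw [hir]
    have hVr := hV r hr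
    have hr1 : 1 ≤ r := hr
    have hpos := P.pos r hr
    have e1 : m * V1 r / r ^ N - N * m * V r / r ^ (N + 1) = m * w - N * V r * (m * i ^ (N + 1)) := by
      rw [hwd, ← hir, inv_pow]; ring
    rw [e1]
    have t1 := abs_sub (m * w) (N * V r * (m * i ^ (N + 1)))
    have t2 : |m * w| ≤ 2 * A * (m * i ^ (N + 1)) := by
      rw [abs_mul, abs_of_pos hm]
      have a1 : m * e * i ^ (4 * N + 4) ≤ 1 * 1 * i ^ (N + 1) := by
        gcongr ?_ * ?_ * ?_
        exact pow_le_pow_of_le_one hi0.le hi1 (by omega)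
      have a2 : m ^ 2 * i ^ (3 * N + 1) ≤ 1 * i ^ (N + 1) := by
        gcongr ?_ * ?_
        · exact pow_le_one₀ hm.le hm1
        · exact pow_le_pow_of_le_one hi0.le hi1 (by omega)
      have a3 : A * (m * e * i ^ (4 * N + 4) + m ^ 2 * i ^ (3 * N + 1)) ≤ A * (2 * i ^ (N + 1)) := by
        gcongr; linarith
      calc m * |w| ≤ m * (A * (2 * i ^ (N + 1))) := by gcongr; exact hw'.trans a3
        _ = _ := by ring
    have t3 : |N * V r * (m * i ^ (N + 1))| ≤ 2 * N * vp * (m * i ^ (N + 1)) := by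
      rw [abs_of_nonneg (by positivity)]
      have := hVr.2
      have : N * V r ≤ 2 * N * vp := by rw [mul_comm 2, mul_assoc]; gcongr
      gcongr
    linarith
  refine ⟨hV, ?_, ?_, ?_, ?_, ?_, ?_, ?_, ?_⟩
  · intro r hr
    obtain ⟨i, e, w, w1, hi0, hi1, hri, hir, he0, he1, -, -, -, h1, h2, h3, -⟩ := main r hr
    have hr1 : 1 ≤ r := hr
    have hσ := wpos r hr
    calc (r * V1 r) ^ 2 = (r * |V1 r|) ^ 2 := by rw [mul_pow, mul_pow, sq_abs]
      _ ≤ (A * (m * e * i ^ (3 * N + 3) + m ^ 2 * i ^ (2 * N))) ^ 2 := by gcongr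
      _ = A ^ 2 * (m * e * i ^ (3 * N + 3) + m ^ 2 * i ^ (2 * N)) ^ 2 := by ring
      _ ≤ A ^ 2 * (2 * layerWeight N k m r) := by gcongr
      _ = (2 * A ^ 2) * layerWeight N k m r := by ring
      _ ≤ L * layerWeight N k m r := by gcongr
  · intro r hr
    obtain ⟨i, e, w, w1, hi0, hi1, hri, hir, he0, he1, -, -, -, h1, h2, -⟩ := main r hr
    have hr1 : 1 ≤ r := hr
    have hσ := wpos r hr
    have e1 : |V1 r| * m / r = (r * |V1 r|) * (m * i ^ 2) := by
      rw [← hir]; field_simp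
    rw [e1]
    calc (r * |V1 r|) * (m * i ^ 2)
        ≤ (A * (m * e * i ^ (3 * N + 3) + m ^ 2 * i ^ (2 * N))) * (m * i ^ 2) := by gcongr
      _ = A * (m ^ 2 * e * i ^ (3 * N + 5) + m ^ 3 * i ^ (2 * N + 2)) := by ring
      _ ≤ A * (m ^ 2 * e * i ^ (2 * N + 2) + m ^ 3 * i ^ (2 * N + 2)) := by
        gcongr A * (m ^ 2 * e * ?_ + _)
        exact pow_le_pow_of_le_one hi0.le hi1 (by omega)
      _ = A * layerWeight N k m r := by rw [h2]; ring
      _ ≤ L * layerWeight N k m r := by gcongr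
  · intro r hr
    obtain ⟨i, e, w, w1, hi0, hi1, hri, hir, he0, he1, -, -, -, h1, h2, -⟩ := main r hr
    have hr1 : 1 ≤ r := hr
    have b1 : |V1 r| ≤ r * |V1 r| := le_mul_of_one_le_left (abs_nonneg _) hr1
    have b2 : m * e * i ^ (3 * N + 3) ≤ 1 * 1 * 1 := by
      gcongr ?_ * ?_ * ?_; exact pow_le_one₀ hi0.le hi1
    have b3 : m ^ 2 * i ^ (2 * N) ≤ 1 * 1 := by
      gcongr ?_ * ?_
      · exact pow_le_one₀ hm.le hm1
      · exact pow_le_one₀ hi0.le hi1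
    have b4 : A * (m * e * i ^ (3 * N + 3) + m ^ 2 * i ^ (2 * N)) ≤ A * 2 := by gcongr; linarith
    linarith
  · intro r hr
    have hr1 : 1 ≤ r := hr
    have hVr := (hV r hr).2
    have hrN : r ≤ r ^ N := le_self_pow₀ hr1 (by omega)
    have hpos := P.pos r hr
    calc m * V r / r ^ N ≤ m * (2 * vp) / r := by gcongr
      _ = (2 * vp) * m / r := by ring
      _ ≤ L * m / r := by gcongr
  · intro r hr
    have hr1 : 1 ≤ r := hr
    have hi0 : 0 < r⁻¹ := by positivity
    have hi1 : r⁻¹ ≤ 1 := inv_le_one_of_one_le₀ hr1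
    refine (usl r hr).trans ?_
    rw [div_eq_mul_inv, ← inv_pow]
    gcongr ?_ * _ * ?_
    exact pow_le_pow_of_le_one hi0.le hi1 (by omega)
  · intro r hr
    have hu := usl r hr
    obtain ⟨i, e, w, w1, hi0, hi1, hri, hir, he0, he1, -, -, -, h1, h2, -⟩ := main r hr
    rw [hir] at hu
    have hr1 : 1 ≤ r := hr
    have hσ := wpos r hr
    have hVr := (hV r hr).2
    have hpos := P.pos r hr
    set U1 := m * V1 r / r ^ N - N * m * V r / r ^ (N + 1)
    have hU : m * V r / r ^ N ≤ 2 * vp * m * i ^ N := by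
      rw [div_eq_mul_inv, ← inv_pow, hir]
      rw [mul_comm (2 * vp) m]; gcongr
    have hUp : 0 ≤ m * V r / r ^ N := by positivity
    have hq : m ^ 4 * i ^ (4 * N) ≤ layerWeight N k m r := by
      rw [h2]
      have q5 : m ^ 4 ≤ m ^ 3 := pow_le_pow_of_le_one hm.le hm1 (by omega)
      have q6 : i ^ (4 * N) ≤ i ^ (2 * N + 2) := pow_le_pow_of_le_one hi0.le hi1 (by omega)
      have q7 : 0 ≤ m ^ 2 * e := by positivity
      gcongr; linarith
    calc (r * (U1 * (m * V r / r ^ N))) ^ 2 = (r * (|U1| * (m * V r / r ^ N))) ^ 2 := by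
          rw [mul_pow, mul_pow, mul_pow, mul_pow, sq_abs]
      _ ≤ (r * (((2 * A + 2 * N * vp) * m * i ^ (N + 1)) * (2 * vp * m * i ^ N))) ^ 2 := by gcongr
      _ = ((2 * A + 2 * N * vp) * (2 * vp)) ^ 2 * (m ^ 4 * i ^ (4 * N)) * (r * i) ^ 2 := by
        rw [show 4 * N = N * 4 by ring, pow_mul, pow_succ]; ring
      _ = ((2 * A + 2 * N * vp) * (2 * vp)) ^ 2 * (m ^ 4 * i ^ (4 * N)) := by
        rw [hri]; ring
      _ ≤ ((2 * A + 2 * N * vp) * (2 * vp)) ^ 2 * layerWeight N k m r := by gcongr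
      _ ≤ L * layerWeight N k m r := by gcongr
  · intro r hr
    obtain ⟨i, e, w, w1, hi0, hi1, hri, hir, he0, he1, -, hw1, -, h1, h2, h3, h4⟩ := main r hr
    rw [← hw1]
    have hr1 : 1 ≤ r := hr
    have hσ := wpos r hr
    calc (r * (m * w1)) ^ 2 = (r * (m * |w1|)) ^ 2 := by
          rw [mul_pow, mul_pow, mul_pow, mul_pow, sq_abs]
      _ ≤ (L1 * (A + 1) * (m * e * i ^ (3 * N + 3) + m ^ 2 * i ^ (2 * N))) ^ 2 := by gcongr
      _ = (L1 * (A + 1)) ^ 2 * (m * e * i ^ (3 * N + 3) + m ^ 2 * i ^ (2 * N)) ^ 2 := by ring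
      _ ≤ (L1 * (A + 1)) ^ 2 * (2 * layerWeight N k m r) := by gcongr
      _ = (2 * (L1 * (A + 1)) ^ 2) * layerWeight N k m r := by ring
      _ ≤ L * layerWeight N k m r := by gcongr
  · intro r hr
    obtain ⟨i, e, w, w1, hi0, hi1, hri, hir, he0, he1, -, hw1, -, h1, h2, h3, h4⟩ := main r hr
    rw [← hw1]
    have hr1 : 1 ≤ r := hr
    have e1 : m * (e * i ^ (3 * N + 3) + m * i ^ (2 * N))
        = m * e * i ^ (3 * N + 3) + m ^ 2 * i ^ (2 * N) := by ring
    rw [← e1] at h4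
    have h5 : r * |w1| ≤ L1 * (A + 1) * (e * i ^ (3 * N + 3) + m * i ^ (2 * N)) := by
      have : m * (r * |w1|) ≤ m * (L1 * (A + 1) * (e * i ^ (3 * N + 3) + m * i ^ (2 * N))) := by
        linarith
      exact le_of_mul_le_mul_left this hm
    have h6 : e * i ^ (3 * N + 3) + m * i ^ (2 * N) ≤ 2 * i ^ (2 * N) := by
      have a1 : e * i ^ (3 * N + 3) ≤ 1 * i ^ (2 * N) := by
        gcongr ?_ * ?_; exact pow_le_pow_of_le_one hi0.le hi1 (by omega)
      have a2 : m * i ^ (2 * N) ≤ 1 * i ^ (2 * N) := by gcongr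
      linarith
    obtain ⟨M, rfl⟩ : ∃ M, N = M + 1 := ⟨N - 1, by omega⟩
    have e3 : r ^ (M + 1) * |w1| = r ^ M * (r * |w1|) := by ring
    have e4 : r ^ M * i ^ (2 * (M + 1)) = i ^ (M + 2) := by
      rw [show 2 * (M + 1) = M + (M + 2) by ring, pow_add, ← mul_assoc, ← mul_pow, hri, one_pow,
        one_mul]
    rw [e3, div_eq_mul_inv, ← inv_pow, hir]
    calc r ^ M * (r * |w1|) ≤ r ^ M * (L1 * (A + 1) * (2 * i ^ (2 * (M + 1)))) := by
          exact mul_le_mul_of_nonneg_left (h5.trans (mul_le_mul_of_nonneg_left h6 p5.le))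
            (by positivity)
      _ = 2 * (L1 * (A + 1)) * (r ^ M * i ^ (2 * (M + 1))) := by ring
      _ = 2 * (L1 * (A + 1)) * i ^ (M + 2) := by rw [e4]
      _ ≤ L * i ^ 2 := by
        gcongr ?_ * ?_
        exact pow_le_pow_of_le_one hi0.le hi1 (by omega)

/-- Uniform bounds for stationary profiles with small mass flux. -/
theorem exists_profileBounds {N : ℕ} (hN : 1 ≤ N) {μ γ K vp C1 : ℝ} (hμ : 0 < μ) (hγ : 1 < γ)
    (hK : 0 < K) (hvp : 0 < vp) (hC1 : 0 < C1) :
    ∃ m0 k L : ℝ, 0 < m0 ∧ 0 < k ∧ 1 ≤ L ∧ ∀ m, 0 < m → m ≤ m0 → ∀ V V1 V2,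
      Profile N μ γ K m vp V V1 V2 → |V 1 - vp| ≤ C1 * m ^ 2 →
      ProfileBounds N m vp k L V V1 V2 := by
  obtain ⟨c, C, hp⟩ := exists_pressureBounds hK hγ (by positivity : 0 < vp / 2)
    (by linarith : vp / 2 ≤ 2 * vp)
  have hc := hp.pos
  have hC : 0 < C := hc.trans_le hp.le
  have hNp : (0:ℝ) < N := by exact_mod_cast hN
  have g1 : 0 < pressureV K γ vp - pressureV K γ (2 * vp) :=
    sub_pos.2 (pressureV_strictAnti hK hγ hvp (by linarith))
  have g2 : 0 < pressureV K γ (vp / 2) - pressureV K γ vp :=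
    sub_pos.2 (pressureV_strictAnti hK hγ (by positivity) (by linarith))
  set g1' := pressureV K γ vp - pressureV K γ (2 * vp)
  set g2' := pressureV K γ (vp / 2) - pressureV K γ vp
  -- Half of the decay rate c/(4μ) of the slope estimate, as the preceding lemma expects a slope
  -- decaying at rate `2 * k`.
  set k := c / (8 * μ) with hk
  set C2 := (C * C1 + 3 * vp) / μ with hC2
  set A := C2 + 16 * N * vp / c with hA
  have hC2p : 0 < C2 := by positivity
  have hAp : 0 < A := by positivity
  -- all smallness requirements are of the form `m ≤ const`
  obtain ⟨m0, hm0, hm0s⟩ : ∃ m0 : ℝ, 0 < m0 ∧ ∀ m, 0 < m → m ≤ m0 → m ≤ 1 ∧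
      m * (2 * vp) < g1' ∧ m * vp < g2' ∧ C1 * m ≤ vp / 2 ∧ m ≤ c / 2 ∧
      μ * m * (3 * N + 1) ≤ c / 4 ∧ ((4 * N + 4 : ℕ) : ℝ) * m ≤ k := by
    refine ⟨min (min (min 1 (g1' / (4 * vp))) (min (g2' / (2 * vp)) (vp / (2 * C1))))
      (min (c / 2) (min (c / (4 * (μ * (3 * N + 1)))) (k / (4 * N + 4)))), by positivity, ?_⟩
    intro m hm h
    simp only [le_min_iff] at h
    obtain ⟨⟨⟨a1, a2⟩, a3, a4⟩, a5, a6, a7⟩ := h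
    rw [le_div_iff₀ (by positivity)] at a2 a3 a4 a6 a7
    refine ⟨a1, by linarith, by linarith, by linarith, a5, by linarith, ?_⟩
    push_cast; linarith
  refine ⟨m0, k, max 1 (2 * A ^ 2 + A + 2 * A + 2 * vp + (2 * A + 2 * N * vp)
      + ((2 * A + 2 * N * vp) * (2 * vp)) ^ 2 + 2 * ((C + 1 + 2 * N * vp) / μ * (A + 1)) ^ 2
      + 2 * ((C + 1 + 2 * N * vp) / μ * (A + 1))), hm0, by positivity, le_max_left _ _, ?_⟩
  intro m hm hmm V V1 V2 P h1
  obtain ⟨a1, a2, a3, a4, a5, a6, a7⟩ := hm0s m hm hmm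
  have hmsq : m ^ 2 ≤ m := by nlinarith
  have hC1m : C1 * m ^ 2 ≤ vp / 2 := by nlinarith
  obtain ⟨b1, b2⟩ := abs_le.1 (h1.trans hC1m)
  have up : ∀ r ∈ Ici (1:ℝ), V r ≤ 2 * vp := fun r hr =>
    P.le_two_mul hμ hm hvp (by linarith) (by nlinarith) hr
  have hV : ∀ r ∈ Ici (1:ℝ), V r ∈ Icc (vp / 2) (2 * vp) := fun r hr =>
    ⟨P.half_le hμ hm hvp hN up (by linarith) (by nlinarith) hr, up r hr⟩
  have s1 := P.abs_slope_one_le hμ hm hvp hN hp hV h1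
  have B := profileBounds_of_slope P hμ hm a1 hvp hN hAp hp a7 hV (by
    intro r hr
    have := P.abs_slope_le hμ hm hvp hN hp hV s1 hC2p (by linarith) a6 hr
    refine this.trans ?_
    have hr1 : (1:ℝ) ≤ r := hr
    have e1 : c / (4 * μ) = 2 * k := by rw [hk]; ring
    rw [e1, mul_add]
    have t1 : C2 ≤ A := by rw [hA]; linarith [show 0 < 16 * N * vp / c by positivity]
    have t2 : 16 * N * vp / c ≤ A := by rw [hA]; linarith
    rw [← mul_assoc A m, ← mul_assoc A (m ^ 2)]
    gcongr)
  have wpos : ∀ r ∈ Ici (1:ℝ), 0 ≤ layerWeight N k m r := by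
    intro r hr
    have hr1 : (1:ℝ) ≤ r := hr
    unfold layerWeight; positivity
  set L0 := (2 * A ^ 2 + A + 2 * A + 2 * vp + (2 * A + 2 * N * vp)
      + ((2 * A + 2 * N * vp) * (2 * vp)) ^ 2 + 2 * ((C + 1 + 2 * N * vp) / μ * (A + 1)) ^ 2
      + 2 * ((C + 1 + 2 * N * vp) / μ * (A + 1)))
  have hle : L0 ≤ max 1 L0 := le_max_right _ _
  refine ⟨B.mem, fun r hr => (B.slope_sq r hr).trans ?_, fun r hr => (B.slope_mul r hr).trans ?_,
    fun r hr => (B.slope_le r hr).trans hle, fun r hr => (B.vel r hr).trans ?_,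
    fun r hr => (B.vel_slope r hr).trans ?_, fun r hr => (B.vel_sq r hr).trans ?_,
    fun r hr => (B.curv_sq r hr).trans ?_, fun r hr => (B.curv_le r hr).trans ?_⟩
  all_goals
    have := wpos r hr
    have hr1 : (1:ℝ) ≤ r := hr
    gcongr


/-! ### From a classical stationary solution to a profile. -/

theorem hasDerivWithinAt_dr {f : ℝ → ℝ} (hf : DifferentiableOn ℝ f (Ici 1)) {r : ℝ}
    (hr : r ∈ Ici (1:ℝ)) : HasDerivWithinAt f (dr f r) (Ici 1) r :=
  (hf r hr).hasDerivWithinAt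

theorem dr_eq {f : ℝ → ℝ} {f' r : ℝ} (hr : r ∈ Ici (1:ℝ)) (h : HasDerivWithinAt f f' (Ici 1) r) :
    dr f r = f' := h.derivWithin (uniqueDiffOn_Ici 1 r hr)

theorem dr_congr {f g : ℝ → ℝ} {r : ℝ} (hr : r ∈ Ici (1:ℝ)) (h : EqOn f g (Ici 1)) :
    dr f r = dr g r := derivWithin_congr h (h hr)

namespace IsStationary

variable {N : ℕ} {μ γ K ρp ρb ub : ℝ} {ρs us : ℝ → ℝ}

theorem flux_eq (S : IsStationary (N + 1) μ γ K ρp ρb ub ρs us) {r : ℝ} (hr : r ∈ Ici (1:ℝ)) :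
    r ^ N * ρs r * us r = ρb * ub := by
  have hd : DifferentiableOn ℝ (fun s => s ^ N * ρs s * us s) (Ici 1) := by
    have h1 := S.contDiffOn_density.differentiableOn (by norm_num)
    have h2 := S.contDiffOn_velocity.differentiableOn (by norm_num)
    have h3 : DifferentiableOn ℝ (fun s : ℝ => s ^ N) (Ici 1) := by fun_prop
    exact (h3.mul h1).mul h2
  have h := constant_of_has_deriv_right_zero (a := 1) (b := r)
    (f := fun s => s ^ N * ρs s * us s)
    (hd.continuousOn.mono Icc_subset_Ici_self) (fun x hx => by
      have hx1 : (1:ℝ) ≤ x := hx.1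
      have h0 := S.mass x hx.1
      simp only [Nat.add_sub_cancel] at h0
      have h1 : dr (fun s => s ^ N * ρs s * us s) x = 0 :=
        (mul_eq_zero.1 h0).resolve_left (by positivity)
      have h2 := hasDerivWithinAt_dr hd hx.1
      rw [h1] at h2
      exact h2.mono (Ici_subset_Ici.2 hx1)) r (right_mem_Icc.2 hr)
  rw [h, S.density_boundary, S.velocity_boundary]
  ring

theorem velocity_eq (S : IsStationary (N + 1) μ γ K ρp ρb ub ρs us) {r : ℝ} (hr : r ∈ Ici (1:ℝ)) :
    us r = ρb * ub * (ρs r)⁻¹ / r ^ N := by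
  have h := S.flux_eq hr
  have h1 : (1:ℝ) ≤ r := hr
  have h2 := S.density_pos r hr
  rw [← h]; field_simp

/-- The density is assumed only C¹, but constancy of the mass flux gives V = r^N ũ / m, and the
velocity is C². Thus `V` is C² and the momentum equation becomes a second order ODE for `V` alone.
-/
theorem profile (S : IsStationary (N + 1) μ γ K ρp ρb ub ρs us) (hρp : 0 < ρp)
    (hm : 0 < ρb * ub) :
    Profile N μ γ K (ρb * ub) ρp⁻¹ (fun r => (ρs r)⁻¹) (dr fun r => (ρs r)⁻¹)
      (dr (dr fun r => (ρs r)⁻¹)) ∧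
    ∀ r ∈ Ici (1:ℝ), HasDerivWithinAt us (ρb * ub * dr (fun r => (ρs r)⁻¹) r / r ^ N
      - N * (ρb * ub) * (ρs r)⁻¹ / r ^ (N + 1)) (Ici 1) r := by
  set m := ρb * ub with hmdef
  set V : ℝ → ℝ := fun r => (ρs r)⁻¹ with hVdef
  have hV2 : ContDiffOn ℝ 2 V (Ici 1) := by
    have h1 : ContDiffOn ℝ 2 (fun r : ℝ => m⁻¹ * (r ^ N * us r)) (Ici 1) :=
      contDiffOn_const.mul ((contDiff_id.pow N).contDiffOn.mul S.contDiffOn_velocity)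
    refine h1.congr fun r hr => ?_
    have hr1 : (1:ℝ) ≤ r := hr
    rw [S.velocity_eq hr, ← hmdef]
    simp only [hVdef]
    field_simp
  have hV1 : ContDiffOn ℝ 1 (dr V) (Ici 1) :=
    hV2.derivWithin (uniqueDiffOn_Ici 1) (by norm_num)
  have d0 : ∀ r ∈ Ici (1:ℝ), HasDerivWithinAt V (dr V r) (Ici 1) r := fun r hr =>
    hasDerivWithinAt_dr (hV2.differentiableOn (by norm_num)) hr
  have d1 : ∀ r ∈ Ici (1:ℝ), HasDerivWithinAt (dr V) (dr (dr V) r) (Ici 1) r := fun r hr =>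
    hasDerivWithinAt_dr (hV1.differentiableOn (by norm_num)) hr
  have c2 : ContinuousOn (dr (dr V)) (Ici 1) :=
    hV1.continuousOn_derivWithin (uniqueDiffOn_Ici 1) (by norm_num)
  have dus : ∀ r ∈ Ici (1:ℝ), HasDerivWithinAt us (m * dr V r / r ^ N
      - N * m * V r / r ^ (N + 1)) (Ici 1) r := by
    intro r hr
    have h := ((d0 r hr).mul (Profile.hasDerivWithinAt_inv_pow N hr (Ici 1))).const_mul m
    have h' := h.congr_of_mem (f₁ := us) (fun x hx => by
      rw [S.velocity_eq hx]; simp only [Pi.mul_apply, hVdef]; ring) hr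
    exact h'.congr_deriv (by ring)
  refine ⟨⟨d0, d1, c2, fun r hr => inv_pos.2 (S.density_pos r hr), ?_,
    S.density_farField.inv₀ hρp.ne'⟩, dus⟩
  intro r hr
  have hr1 : (1:ℝ) ≤ r := hr
  have hmom := S.momentum r hr
  simp only [Nat.add_sub_cancel] at hmom
  have e1 : dr us r = m * dr V r / r ^ N - N * m * V r / r ^ (N + 1) := dr_eq hr (dus r hr)
  have e2 : dr (fun s => pressure K γ (ρs s)) r = deriv (pressureV K γ) (V r) * dr V r := by
    have hc : (fun s => pressure K γ (ρs s)) = fun s => pressureV K γ (V s) := by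
      ext s; simp [pressureV, hVdef]
    rw [hc]
    have hp : HasDerivAt (pressureV K γ) (deriv (pressureV K γ) (V r)) (V r) :=
      hasDerivAt_pressureV K γ (inv_pos.2 (S.density_pos r hr))
    have hcomp : HasDerivWithinAt (pressureV K γ ∘ V) _ (Ici 1) r :=
      hp.comp_hasDerivWithinAt r (d0 r hr)
    exact dr_eq hr hcomp
  have e3 : ∀ s ∈ Ici (1:ℝ), dr (fun q => q ^ N * us q) s = m * dr V s := by
    intro s hs
    have hc : EqOn (fun q => q ^ N * us q) (fun q => m * V q) (Ici 1) := fun q hq => by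
      have hq1 : (1:ℝ) ≤ q := hq
      simp only [S.velocity_eq hq, ← hmdef, hVdef]; field_simp
    rw [dr_congr hs hc]
    exact dr_eq hs ((d0 s hs).const_mul m)
  have e4 : dr (fun s => dr (fun q => q ^ N * us q) s / s ^ N) r
      = m * (dr (dr V) r / r ^ N - N * dr V r / r ^ (N + 1)) := by
    have hc : EqOn (fun s => dr (fun q => q ^ N * us q) s / s ^ N)
        (fun s => m * (dr V s * (s ^ N)⁻¹)) (Ici 1) := fun s hs => by
      simp only [e3 s hs]; ring
    rw [dr_congr hr hc]
    apply dr_eq hr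
    exact (((d1 r hr).mul (Profile.hasDerivWithinAt_inv_pow N hr (Ici 1))).const_mul m).congr_deriv
      (by ring)
  rw [e1, e2, e4] at hmom
  have e5 : ρs r * us r = m / r ^ N := by
    rw [hmdef, ← S.flux_eq hr]; field_simp
  rw [e5] at hmom
  linarith

end IsStationary

/-! ### Partial derivatives up to the boundary of the moving domain. -/

/-- The interior points of `dom m T`. -/
def domInt (m T : ℝ) : Set (ℝ × ℝ) := {z | 0 < z.2 ∧ z.2 < T ∧ -(m * z.2) < z.1}

theorem isOpen_domInt (m T : ℝ) : IsOpen (domInt m T) := by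
  have h1 : IsOpen {z : ℝ × ℝ | 0 < z.2} := isOpen_lt (by fun_prop) (by fun_prop)
  have h2 : IsOpen {z : ℝ × ℝ | z.2 < T} := isOpen_lt (by fun_prop) (by fun_prop)
  have h3 : IsOpen {z : ℝ × ℝ | -(m * z.2) < z.1} := isOpen_lt (by fun_prop) (by fun_prop)
  exact h1.inter (h2.inter h3)

theorem domInt_subset (m T : ℝ) : domInt m T ⊆ dom m T :=
  fun _ h => ⟨⟨h.1.le, h.2.1.le⟩, h.2.2.le⟩

theorem dom_mem_nhds {m T : ℝ} {z : ℝ × ℝ} (hz : z ∈ domInt m T) : dom m T ∈ 𝓝 z :=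
  mem_of_superset ((isOpen_domInt m T).mem_nhds hz) (domInt_subset m T)

theorem convex_dom (m T : ℝ) : Convex ℝ (dom m T) := by
  intro x hx y hy a b ha hb hab
  refine ⟨convex_Icc 0 T hx.1 hy.1 ha hb hab, ?_⟩
  have h1 := mul_le_mul_of_nonneg_left hx.2 ha
  have h2 := mul_le_mul_of_nonneg_left hy.2 hb
  simp only [Prod.fst_add, Prod.snd_add, Prod.smul_fst, Prod.smul_snd, smul_eq_mul]
  linarith

theorem interior_dom_nonempty {m T : ℝ} (hm : 0 < m) (hT : 0 < T) :
    (interior (dom m T)).Nonempty := by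
  refine ⟨(1, T / 2), interior_maximal (domInt_subset m T) (isOpen_domInt m T) ⟨?_, ?_, ?_⟩⟩
  · simpa using hT
  · simpa using hT
  · have : 0 < m * (T / 2) := by positivity
    simp only; linarith

theorem uniqueDiffOn_dom {m T : ℝ} (hm : 0 < m) (hT : 0 < T) : UniqueDiffOn ℝ (dom m T) :=
  uniqueDiffOn_convex (convex_dom m T) (interior_dom_nonempty hm hT)

theorem dom_subset_closure_domInt {m T : ℝ} (hm : 0 < m) (hT : 0 < T) :
    dom m T ⊆ closure (domInt m T) := by
  intro z hz
  obtain ⟨⟨h1, h2⟩, h3⟩ := hz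
  rw [mem_closure_iff_seq_limit]
  -- move towards an interior point
  refine ⟨fun k => (z.1 + (1 / ((k:ℝ) + 1)) * (m * T + 1),
    z.2 + (1 / ((k:ℝ) + 1)) * (T / 2 - z.2)), fun k => ?_, ?_⟩
  · have hk : 0 < 1 / ((k:ℝ) + 1) := by positivity
    have hk1 : 1 / ((k:ℝ) + 1) ≤ 1 := by
      rw [div_le_one (by positivity)]; linarith [(Nat.cast_nonneg k : (0:ℝ) ≤ k)]
    set e := 1 / ((k:ℝ) + 1)
    have heT : 0 < e * T := by positivity
    refine ⟨?_, ?_, ?_⟩ <;> simp only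
    · nlinarith
    · nlinarith
    · have hmT : 0 < m * T := by positivity
      have : m * (z.2 + e * (T / 2 - z.2)) + e * (m * T + 1) = m * z.2 + e * (m * (T / 2 - z.2) + m * T + 1) := by ring
      have h4 : 0 < m * (T / 2 - z.2) + m * T + 1 := by nlinarith
      have : 0 < e * (m * (T / 2 - z.2) + m * T + 1) := by positivity
      linarith
  · have h0 : Tendsto (fun k : ℕ => 1 / ((k:ℝ) + 1)) atTop (𝓝 0) :=
      tendsto_one_div_add_atTop_nhds_zero_nat
    have e1 : Tendsto (fun k : ℕ => z.1 + (1 / ((k:ℝ) + 1)) * (m * T + 1)) atTop (𝓝 (z.1 + 0 * (m * T + 1))) :=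
      tendsto_const_nhds.add (h0.mul tendsto_const_nhds)
    have e2 : Tendsto (fun k : ℕ => z.2 + (1 / ((k:ℝ) + 1)) * (T / 2 - z.2)) atTop (𝓝 (z.2 + 0 * (T / 2 - z.2))) :=
      tendsto_const_nhds.add (h0.mul tendsto_const_nhds)
    simp only [zero_mul, add_zero] at e1 e2
    exact e1.prodMk_nhds e2

theorem eqOn_dom_of_eqOn_domInt {m T : ℝ} (hm : 0 < m) (hT : 0 < T) {f g : ℝ × ℝ → ℝ}
    (hf : ContinuousOn f (dom m T)) (hg : ContinuousOn g (dom m T)) (h : EqOn f g (domInt m T)) :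
    EqOn f g (dom m T) :=
  h.of_subset_closure hf hg (domInt_subset m T) (dom_subset_closure_domInt hm hT)

theorem HasDx.dx_eq {m T : ℝ} {f f' : ℝ × ℝ → ℝ} (h : HasDx m T f f') {z : ℝ × ℝ}
    (hz : z ∈ dom m T) : dx m f z = f' z :=
  (h z.1 z.2 hz).derivWithin (uniqueDiffOn_Ici _ z.1 hz.2)

theorem HasDx.congr {m T : ℝ} {f g f' : ℝ × ℝ → ℝ} (h : HasDx m T f f')
    (hfg : EqOn g f (dom m T)) : HasDx m T g f' := fun x t hz =>
  (h x t hz).congr_of_mem (fun _ hy => hfg ⟨hz.1, hy⟩) hz.2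

theorem HasDt.congr_deriv {m T : ℝ} {f f' g' : ℝ × ℝ → ℝ} (h : HasDt m T f f')
    (hfg : EqOn f' g' (dom m T)) : HasDt m T f g' := fun x t hz hT =>
  (h x t hz hT).congr_deriv (hfg hz)

theorem HasDx.comp_radial {m T : ℝ} {f f' : ℝ → ℝ} {R Rx : ℝ × ℝ → ℝ}
    (hf : ∀ r ∈ Ici (1:ℝ), HasDerivWithinAt f (f' r) (Ici 1) r) (hR : HasDx m T R Rx)
    (h1 : ∀ z ∈ dom m T, 1 ≤ R z) :
    HasDx m T (fun z => f (R z)) (fun z => f' (R z) * Rx z) := fun x t hz =>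
  (hf (R (x, t)) (h1 _ hz)).comp x (hR x t hz) (fun _ hy => h1 _ ⟨hz.1, hy⟩)

theorem HasDt.comp_radial {m T : ℝ} (hm : 0 < m) {f f' : ℝ → ℝ} {R Rt : ℝ × ℝ → ℝ}
    (hf : ∀ r ∈ Ici (1:ℝ), HasDerivWithinAt f (f' r) (Ici 1) r) (hR : HasDt m T R Rt)
    (h1 : ∀ z ∈ dom m T, 1 ≤ R z) :
    HasDt m T (fun z => f (R z)) (fun z => f' (R z) * Rt z) := fun x t hz hT =>
  ((hf (R (x, t)) (h1 _ hz)).comp t ((hR x t hz hT).mono (fun _ (hs : _ ∈ Icc t T) => hs.1))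
    (fun _ hs => h1 _ (mem_dom_of_le hm hz hs.1 hs.2))).mono_of_mem_nhdsWithin (Icc_mem_nhdsGE hT)

theorem continuousOn_comp_radial {m T : ℝ} {f : ℝ → ℝ} {R : ℝ × ℝ → ℝ}
    (hf : ContinuousOn f (Ici 1)) (hR : ContinuousOn R (dom m T))
    (h1 : ∀ z ∈ dom m T, 1 ≤ R z) : ContinuousOn (fun z => f (R z)) (dom m T) :=
  hf.comp hR h1

theorem contDiffOn_hasDx {m T : ℝ} (hm : 0 < m) (hT : 0 < T) {f : ℝ × ℝ → ℝ}
    (hf : ContDiffOn ℝ 1 f (dom m T)) :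
    ContinuousOn (fun z => fderivWithin ℝ f (dom m T) z (1, 0)) (dom m T) ∧
    HasDx m T f (fun z => fderivWithin ℝ f (dom m T) z (1, 0)) := by
  refine ⟨(hf.continuousOn_fderivWithin (uniqueDiffOn_dom hm hT) (by norm_num)).clm_apply
    continuousOn_const, fun x t hz => ?_⟩
  have h1 := ((hf.differentiableOn (by norm_num)) (x, t) hz).hasFDerivWithinAt
  have h2 : HasDerivWithinAt (fun y : ℝ => (y, t)) ((1:ℝ), (0:ℝ)) (Ici (-(m * t))) x :=
    ((hasDerivAt_id x).prodMk (hasDerivAt_const x t)).hasDerivWithinAt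
  exact HasFDerivWithinAt.comp_hasDerivWithinAt (f := fun y : ℝ => (y, t)) x h1 h2
    (fun _ hy => ⟨hz.1, hy⟩)

theorem contDiffOn_hasDt {m T : ℝ} (hm : 0 < m) (hT : 0 < T) {f : ℝ × ℝ → ℝ}
    (hf : ContDiffOn ℝ 1 f (dom m T)) :
    ContinuousOn (dt m T f) (dom m T) ∧ HasDt m T f (dt m T f) := by
  refine ⟨(hf.continuousOn_fderivWithin (uniqueDiffOn_dom hm hT) (by norm_num)).clm_apply
    continuousOn_const, fun x t hz ht => ?_⟩
  have h1 := ((hf.differentiableOn (by norm_num)) (x, t) hz).hasFDerivWithinAt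
  have h2 : HasDerivWithinAt (fun s : ℝ => (x, s)) ((0:ℝ), (1:ℝ)) (Icc t T) t :=
    ((hasDerivAt_const t x).prodMk (hasDerivAt_id t)).hasDerivWithinAt
  exact (HasFDerivWithinAt.comp_hasDerivWithinAt (f := fun s : ℝ => (x, s)) t h1 h2
    (fun s hs => mem_dom_of_le hm hz hs.1 hs.2)).mono_of_mem_nhdsWithin (Icc_mem_nhdsGE ht)

/-- If a `C¹` function is constant on the moving boundary, its material derivative along the
boundary vanishes. -/
theorem boundary_deriv_eq {m T : ℝ} (hT : 0 < T) {f : ℝ × ℝ → ℝ} {c : ℝ}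
    (hf : ContDiffOn ℝ 1 f (dom m T)) (hc : ∀ t ∈ Icc 0 T, f (-(m * t), t) = c) {t : ℝ}
    (ht : t ∈ Icc 0 T) :
    dt m T f (-(m * t), t) = m * fderivWithin ℝ f (dom m T) (-(m * t), t) (1, 0) := by
  have h1 := ((hf.differentiableOn (by norm_num)) _ (boundary_mem ht)).hasFDerivWithinAt
  have h2 : HasDerivWithinAt (fun s : ℝ => (-(m * s), s)) (-m, (1:ℝ)) (Icc 0 T) t := by
    have := (((hasDerivAt_id t).const_mul m).neg.prodMk (hasDerivAt_id t)).hasDerivWithinAt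
      (s := Icc 0 T)
    simpa using this
  have h3 := HasFDerivWithinAt.comp_hasDerivWithinAt (f := fun s : ℝ => (-(m * s), s)) t h1 h2
    (fun s hs => boundary_mem hs)
  have h4 : HasDerivWithinAt (f ∘ fun s : ℝ => (-(m * s), s)) 0 (Icc 0 T) t :=
    (hasDerivWithinAt_const t (Icc 0 T) c).congr_of_mem (fun s hs => hc s hs) ht
  have h5 := (uniqueDiffOn_Icc hT t ht).eq_deriv _ h3 h4
  have e : ((-m, 1) : ℝ × ℝ) = (-m) • ((1:ℝ), (0:ℝ)) + ((0:ℝ), (1:ℝ)) := by simp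
  rw [e, map_add, map_smul, smul_eq_mul] at h5
  simp only [dt]
  linarith

/-- At an interior point the segment can be started at an earlier admissible time `t1`; the integral
formula with a continuous integrand then upgrades the right derivative to a two-sided one. -/
theorem HasDt.hasDerivAt {m T : ℝ} (hm : 0 < m) {f f' : ℝ × ℝ → ℝ}
    (hf : ContinuousOn f (dom m T)) (hf' : ContinuousOn f' (dom m T)) (h : HasDt m T f f')
    {x t : ℝ} (hz : (x, t) ∈ domInt m T) : HasDerivAt (fun s => f (x, s)) (f' (x, t)) t := by
  obtain ⟨h1, h2, h3⟩ := hz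
  simp only at h1 h2 h3
  have hT : 0 ≤ T := (h1.trans h2).le
  obtain ⟨t1, ht1, ht1', ht1''⟩ : ∃ t1, t1 < t ∧ 0 ≤ t1 ∧ -(m * t1) ≤ x := by
    refine ⟨max 0 (-x / m), max_lt h1 ?_, le_max_left _ _, ?_⟩
    · rw [div_lt_iff₀ hm]; linarith
    · have : -x / m ≤ max 0 (-x / m) := le_max_right _ _
      rw [div_le_iff₀ hm] at this
      linarith
  have hz1 : (x, t1) ∈ dom m T := ⟨⟨ht1', (ht1.trans h2).le⟩, ht1''⟩
  have hH : Continuous (fun τ => f' (retr m T (x, τ))) :=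
    (continuous_comp_retr hT hf').comp (by fun_prop)
  have d := (intervalIntegral.integral_hasDerivAt_right (hH.intervalIntegrable t1 t)
      (hH.stronglyMeasurableAtFilter _ _) hH.continuousAt).const_add (f (x, t1))
  rw [retr_eq (mem_dom_of_le hm hz1 ht1.le h2.le)] at d
  refine d.congr_of_eventuallyEq ?_
  filter_upwards [Ioo_mem_nhds ht1 h2] with s hs
  have := h.sub_eq_integral hm hf hf' hz1 hs.1.le hs.2.le
  rw [intervalIntegral.integral_congr (g := fun τ => f' (retr m T (x, τ)))] at this
  · linarith
  · intro τ hτ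
    rw [uIcc_of_le hs.1.le] at hτ
    simp only [retr_eq (mem_dom_of_le hm hz1 hτ.1 (hτ.2.trans hs.2.le))]

/-- `dt` is a Fréchet derivative within the domain, whereas the perturbations are known only through
their partial derivatives. In the interior, continuous partials produce a strict derivative.
Identities obtained there extend to the whole domain by `eqOn_dom_of_eqOn_domInt`. -/
theorem dt_eq_of_partials {m T : ℝ} (hm : 0 < m) {f fx ft : ℝ × ℝ → ℝ}
    (hf : ContinuousOn f (dom m T)) (hfx : ContinuousOn fx (dom m T))
    (hft : ContinuousOn ft (dom m T)) (hx : HasDx m T f fx) (ht : HasDt m T f ft)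
    {z : ℝ × ℝ} (hz : z ∈ domInt m T) : dt m T f z = ft z := by
  have key := hasStrictFDerivAt_uncurry_coprod (𝕜 := ℝ) (u := z) (f := fun x t => f (x, t))
    (f₁ := fun x t => ContinuousLinearMap.toSpanSingleton ℝ (fx (x, t)))
    (f₂ := fun x t => ContinuousLinearMap.toSpanSingleton ℝ (ft (x, t)))
    (by
      filter_upwards [(isOpen_domInt m T).mem_nhds hz] with w hw
      exact ((hx w.1 w.2 (domInt_subset m T hw)).hasDerivAt (Ici_mem_nhds hw.2.2)).hasFDerivAt)
    (by
      filter_upwards [(isOpen_domInt m T).mem_nhds hz] with w hw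
      exact (ht.hasDerivAt hm hf hft hw).hasFDerivAt)
    (by
      have := (hfx.continuousAt (dom_mem_nhds hz))
      exact (ContinuousLinearMap.toSpanSingletonCLE (𝕜 := ℝ) (E := ℝ)).continuous.continuousAt.comp this)
    (by
      have := (hft.continuousAt (dom_mem_nhds hz))
      exact (ContinuousLinearMap.toSpanSingletonCLE (𝕜 := ℝ) (E := ℝ)).continuous.continuousAt.comp this)
  have k2 : HasFDerivAt f _ z := key.hasFDerivAt
  unfold dt
  rw [fderivWithin_of_mem_nhds (dom_mem_nhds hz), k2.fderiv]
  simp [Function.HasUncurry.uncurry]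


/-! ### Primitives in the mass coordinate and the Lagrangian radius. -/

theorem continuousOn_primitive {m T : ℝ} (hT : 0 < T) {f : ℝ × ℝ → ℝ}
    (hf : ContinuousOn f (dom m T)) :
    ContinuousOn (fun z : ℝ × ℝ => ∫ y in -(m * z.2)..z.1, f (y, z.2)) (dom m T) := by
  have hF := continuous_comp_retr hT.le hf
  have hF' : Continuous (fun w : (ℝ × ℝ) × ℝ => f (retr m T (w.2, w.1.2))) :=
    hF.comp (by fun_prop : Continuous fun w : (ℝ × ℝ) × ℝ => (w.2, w.1.2))
  have h1 : Continuous (fun z : ℝ × ℝ => ∫ y in (0:ℝ)..z.1, f (retr m T (y, z.2))) :=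
    intervalIntegral.continuous_parametric_intervalIntegral_of_continuous
      (f := fun (z : ℝ × ℝ) y => f (retr m T (y, z.2))) hF' (by fun_prop)
  have h2 : Continuous (fun z : ℝ × ℝ => ∫ y in (0:ℝ)..-(m * z.2), f (retr m T (y, z.2))) :=
    intervalIntegral.continuous_parametric_intervalIntegral_of_continuous
      (f := fun (z : ℝ × ℝ) y => f (retr m T (y, z.2))) hF' (by fun_prop)
  refine (h1.sub h2).continuousOn.congr fun z hz => ?_
  have hi : ∀ c d, IntervalIntegrable (fun y => f (retr m T (y, z.2))) volume c d := fun c d =>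
    (hF.comp (by fun_prop : Continuous fun y : ℝ => (y, z.2))).intervalIntegrable _ _
  rw [Pi.sub_apply, intervalIntegral.integral_interval_sub_left (hi _ _) (hi _ _)]
  exact integral_slice_congr f hz.1 le_rfl hz.2

theorem hasDx_primitive {m T : ℝ} (hT : 0 < T) {f : ℝ × ℝ → ℝ}
    (hf : ContinuousOn f (dom m T)) :
    HasDx m T (fun z : ℝ × ℝ => ∫ y in -(m * z.2)..z.1, f (y, z.2)) f := by
  intro x t hz
  have hF : Continuous (fun y => f (retr m T (y, t))) :=
    (continuous_comp_retr hT.le hf).comp (by fun_prop)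
  have d := (intervalIntegral.integral_hasDerivAt_right (hF.intervalIntegrable (-(m * t)) x)
      (hF.stronglyMeasurableAtFilter _ _) hF.continuousAt).hasDerivWithinAt (s := Ici (-(m * t)))
  rw [retr_eq hz] at d
  exact d.congr_of_mem (fun y hy => integral_slice_congr f hz.1 le_rfl hy) hz.2

theorem hasDt_primitive {m T : ℝ} (hm : 0 < m) {f ft : ℝ × ℝ → ℝ}
    (hf : ContinuousOn f (dom m T)) (hft : ContinuousOn ft (dom m T)) (hd : HasDt m T f ft) :
    HasDt m T (fun z : ℝ × ℝ => ∫ y in -(m * z.2)..z.1, f (y, z.2))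
      (fun z => (∫ y in -(m * z.2)..z.1, ft (y, z.2)) + m * f (-(m * z.2), z.2)) :=
  fun _ _ hz hT => hd.hasDerivWithinAt_integral hm hf hft ⟨hz.1.1, hT⟩ hz.2

theorem continuousOn_boundary_comp {m T : ℝ} {f : ℝ × ℝ → ℝ} (hf : ContinuousOn f (dom m T)) :
    ContinuousOn (fun z : ℝ × ℝ => f (-(m * z.2), z.2)) (dom m T) :=
  hf.comp (by fun_prop) (fun _ hz => boundary_mem hz.1)

section Radius

variable {N : ℕ} {m T : ℝ} {v vt : ℝ × ℝ → ℝ}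

theorem one_le_radius_base (hv : ∀ z ∈ dom m T, 0 < v z) {z : ℝ × ℝ} (hz : z ∈ dom m T) :
    1 ≤ 1 + ((N + 1 : ℕ) : ℝ) * ∫ y in -(m * z.2)..z.1, v (y, z.2) := by
  have : 0 ≤ ∫ y in -(m * z.2)..z.1, v (y, z.2) :=
    intervalIntegral.integral_nonneg hz.2 (fun y hy => (hv (y, z.2) ⟨hz.1, hy.1⟩).le)
  have h2 : (0:ℝ) ≤ ((N + 1 : ℕ) : ℝ) := Nat.cast_nonneg _
  nlinarith [mul_nonneg h2 this]

theorem one_le_radius (hv : ∀ z ∈ dom m T, 0 < v z) {z : ℝ × ℝ} (hz : z ∈ dom m T) :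
    1 ≤ radius (N + 1) m v z :=
  Real.one_le_rpow (one_le_radius_base hv hz) (by positivity)

theorem radius_pow (hv : ∀ z ∈ dom m T, 0 < v z) {z : ℝ × ℝ} (hz : z ∈ dom m T) :
    radius (N + 1) m v z ^ (N + 1) = 1 + ((N + 1 : ℕ) : ℝ) * ∫ y in -(m * z.2)..z.1, v (y, z.2) := by
  have h := one_le_radius_base (N := N) hv hz
  unfold radius
  rw [← Real.rpow_natCast, ← Real.rpow_mul (by linarith)]
  rw [one_div, inv_mul_cancel₀ (by positivity), Real.rpow_one]

theorem radius_boundary (t : ℝ) : radius (N + 1) m v (-(m * t), t) = 1 := by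
  simp [radius]

theorem hasDerivWithinAt_radius {s : Set ℝ} {x I' : ℝ} {I : ℝ → ℝ}
    (h1 : 1 ≤ 1 + ((N + 1 : ℕ) : ℝ) * I x) (hI : HasDerivWithinAt I I' s x) :
    HasDerivWithinAt (fun y => (1 + ((N + 1 : ℕ) : ℝ) * I y) ^ ((1:ℝ) / ((N + 1 : ℕ) : ℝ)))
      (I' / ((1 + ((N + 1 : ℕ) : ℝ) * I x) ^ ((1:ℝ) / ((N + 1 : ℕ) : ℝ))) ^ N) s x := by
  set n : ℝ := ((N + 1 : ℕ) : ℝ) with hn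
  have hnp : 0 < n := by positivity
  have d := ((hI.const_mul n).const_add 1).rpow_const (p := 1 / n) (Or.inl (by linarith))
  refine d.congr_deriv ?_
  set P := 1 + n * I x with hP
  have hP0 : 0 < P := by linarith
  have hR0 : 0 < P ^ (1 / n) := Real.rpow_pos_of_pos hP0 _
  have hpow : (P ^ (1 / n)) ^ (N + 1) = P := by
    rw [← Real.rpow_natCast, ← Real.rpow_mul hP0.le, ← hn, one_div, inv_mul_cancel₀ hnp.ne',
      Real.rpow_one]
  rw [Real.rpow_sub hP0, Real.rpow_one, eq_div_iff (by positivity)]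
  have : n * I' * (1 / n) * (P ^ (1 / n) / P) * (P ^ (1 / n)) ^ N
      = I' * ((P ^ (1 / n)) ^ (N + 1) / P) := by
    rw [pow_succ]; field_simp
  rw [this, hpow, div_self hP0.ne', mul_one]

theorem continuousOn_radius (hT : 0 < T) (hv : ∀ z ∈ dom m T, 0 < v z)
    (hvc : ContinuousOn v (dom m T)) : ContinuousOn (radius (N + 1) m v) (dom m T) := by
  unfold radius
  apply ContinuousOn.rpow_const
  · exact continuousOn_const.add (continuousOn_const.mul (continuousOn_primitive hT hvc))
  · intro z hz
    exact Or.inl (by linarith [one_le_radius_base (N := N) hv hz])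

theorem hasDx_radius (hT : 0 < T) (hv : ∀ z ∈ dom m T, 0 < v z)
    (hvc : ContinuousOn v (dom m T)) :
    HasDx m T (radius (N + 1) m v) (fun z => v z / radius (N + 1) m v z ^ N) := fun x t hz =>
  hasDerivWithinAt_radius (I := fun x => ∫ y in -(m * t)..x, v (y, t))
    (one_le_radius_base (N := N) hv hz) (hasDx_primitive hT hvc x t hz)

theorem hasDt_radius (hm : 0 < m) (hv : ∀ z ∈ dom m T, 0 < v z)
    (hvc : ContinuousOn v (dom m T)) (hvt : ContinuousOn vt (dom m T)) (hd : HasDt m T v vt) :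
    HasDt m T (radius (N + 1) m v) (fun z => ((∫ y in -(m * z.2)..z.1, vt (y, z.2))
      + m * v (-(m * z.2), z.2)) / radius (N + 1) m v z ^ N) := fun x t hz htT =>
  hasDerivWithinAt_radius (I := fun s => ∫ y in -(m * s)..x, v (y, s))
    (one_le_radius_base (N := N) hv hz) (hasDt_primitive hm hvc hvt hd x t hz htT)

/-- On bounded ranges of the mass coordinate the area factor grows slower than linearly. -/
theorem radius_pow_le_mul (hm : 0 < m) (hT : 0 < T) (hv : ∀ z ∈ dom m T, 0 < v z)
    (hvc : ContinuousOn v (dom m T)) {b : ℝ} (hvb : ∀ z ∈ dom m T, v z ≤ b) {η : ℝ} (hη : 0 < η) :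
    ∃ X0, ∀ X, X0 ≤ X → ∀ z ∈ dom m T, z.1 ≤ X → radius (N + 1) m v z ^ N ≤ η * X := by
  set n : ℝ := ((N + 1 : ℕ) : ℝ) with hn
  have hnp : 0 < n := by positivity
  have hb : 0 < b := (hv (0, 0) ⟨⟨le_rfl, hT.le⟩, by simp⟩).trans_le
    (hvb (0, 0) ⟨⟨le_rfl, hT.le⟩, by simp⟩)
  have hmT : 0 < m * T := by positivity
  -- A dichotomy: if R ≤ lam then R^N is bounded, and otherwise R^N ≤ R^{N+1} / lam, where R^{N+1} =
  -- 1 + n ∫ v is at most 2 n b X for large X.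
  set lam := 2 * (n * b) / η + 1 with hlam
  have hlp : 0 < lam := by positivity
  refine ⟨max (lam ^ N / η) (max 1 (m * T + 1 / (n * b))), fun X hX z hz hzX => ?_⟩
  have hX1 : lam ^ N / η ≤ X := (le_max_left _ _).trans hX
  have hX3 : m * T + 1 / (n * b) ≤ X := (le_max_right _ _).trans ((le_max_right _ _).trans hX)
  have hX0 : 0 < X := lt_of_lt_of_le zero_lt_one ((le_max_left _ _).trans ((le_max_right _ _).trans hX))
  set R := radius (N + 1) m v z with hR
  have hR1 : 1 ≤ R := one_le_radius hv hz
  rcases le_total R lam with h | h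
  · calc R ^ N ≤ lam ^ N := by gcongr
      _ ≤ η * X := by rw [div_le_iff₀ hη] at hX1; linarith
  · have hpow := radius_pow (N := N) hv hz
    rw [← hR, ← hn] at hpow
    have hI : ∫ y in -(m * z.2)..z.1, v (y, z.2) ≤ b * (X + m * T) := by
      have h1 : ∫ y in -(m * z.2)..z.1, v (y, z.2) ≤ ∫ y in -(m * z.2)..z.1, b := by
        apply intervalIntegral.integral_mono_on hz.2
        · exact intervalIntegrable_slice hvc hz.1 le_rfl hz.2
        · exact intervalIntegrable_const
        · exact fun y hy => hvb (y, z.2) ⟨hz.1, hy.1⟩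
      rw [intervalIntegral.integral_const, smul_eq_mul] at h1
      refine h1.trans ?_
      rw [mul_comm]
      have hz2 : m * z.2 ≤ m * T := by have := hz.1.2; gcongr
      gcongr
      linarith
    have h2 : R ^ (N + 1) ≤ 2 * (n * b) * X := by
      rw [hpow]
      have h3 : n * ∫ y in -(m * z.2)..z.1, v (y, z.2) ≤ n * (b * (X + m * T)) := by gcongr
      have h4 : n * b * (m * T + 1 / (n * b)) ≤ n * b * X := by gcongr
      have h5 : n * b * (m * T + 1 / (n * b)) = n * b * (m * T) + 1 := by field_simp
      nlinarith
    have h6 : lam * R ^ N ≤ R ^ (N + 1) := by rw [pow_succ']; gcongr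
    have h7 : (2 * (n * b)) / η * R ^ N ≤ 2 * (n * b) * X := by
      have : 0 ≤ R ^ N := by positivity
      nlinarith
    rw [div_mul_eq_mul_div, div_le_iff₀ hη] at h7
    have h8 : 0 < 2 * (n * b) := by positivity
    nlinarith

end Radius

/-! ### The perturbed flow in Lagrangian coordinates. -/

/-- The radial derivative of `V_r / r ^ N`. -/
noncomputable def curv (N : ℕ) (V1 V2 : ℝ → ℝ) (r : ℝ) : ℝ :=
  V2 r / r ^ N - N * V1 r / r ^ (N + 1)

/-- The radial derivative of the stationary velocity `m V / r ^ N`. -/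
noncomputable def velSlope (N : ℕ) (m : ℝ) (V V1 : ℝ → ℝ) (r : ℝ) : ℝ :=
  m * V1 r / r ^ N - N * m * V r / r ^ (N + 1)

/-- The `x`-derivative of `R ^ N ψ`. -/
noncomputable def divg (N : ℕ) (R v ψ ψx : ℝ × ℝ → ℝ) (z : ℝ × ℝ) : ℝ :=
  R z ^ N * ψx z + N * v z * ψ z / R z

/-- The second `x`-derivative of `R ^ N ψ`. -/
noncomputable def divgx (N : ℕ) (R v vx ψ ψx ψxx : ℝ × ℝ → ℝ) (z : ℝ × ℝ) : ℝ :=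
  R z ^ N * ψxx z + 2 * N * v z * ψx z / R z + N * vx z * ψ z / R z
    - N * v z ^ 2 * ψ z / R z ^ (N + 2)

/-- The `x`-derivative of `(R ^ N ψ)_x / v`. -/
noncomputable def fluxx (N : ℕ) (R v vx ψ ψx ψxx : ℝ × ℝ → ℝ) (z : ℝ × ℝ) : ℝ :=
  (divgx N R v vx ψ ψx ψxx z * v z - divg N R v ψ ψx z * vx z) / v z ^ 2

/-- The scaled gradient `R ^ N φ_x / v` of the volume perturbation. -/
noncomputable def gradG (N : ℕ) (V1 : ℝ → ℝ) (R v vx : ℝ × ℝ → ℝ) (z : ℝ × ℝ) : ℝ :=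
  R z ^ N * vx z / v z - V1 (R z)

/-- The non-principal source terms of the momentum equation. -/
noncomputable def srcMom (N : ℕ) (γ K m : ℝ) (V V1 : ℝ → ℝ) (r v ψ : ℝ) : ℝ :=
  velSlope N m V V1 r * (m * V r / r ^ N) / V r * (v - V r)
    - V1 r * (deriv (pressureV K γ) v - deriv (pressureV K γ) (V r)) * v
    - velSlope N m V V1 r * ψ

/-- A perturbed flow in Lagrangian mass coordinates, around the profile `V`. -/
structure Flow (N : ℕ) (μ γ K m T : ℝ) (V V1 V2 : ℝ → ℝ) (R v vx u ψ ψx ψxx ψt : ℝ × ℝ → ℝ) :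
    Prop where
  contR : ContinuousOn R (dom m T)
  contv : ContinuousOn v (dom m T)
  contvx : ContinuousOn vx (dom m T)
  contψ : ContinuousOn ψ (dom m T)
  contψx : ContinuousOn ψx (dom m T)
  contψxx : ContinuousOn ψxx (dom m T)
  contψt : ContinuousOn ψt (dom m T)
  one_le : ∀ z ∈ dom m T, 1 ≤ R z
  vpos : ∀ z ∈ dom m T, 0 < v z
  u_eq : ∀ z ∈ dom m T, u z = m * V (R z) / R z ^ N + ψ z
  dxR : HasDx m T R (fun z => v z / R z ^ N)
  dtR : HasDt m T R u
  dxv : HasDx m T v vx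
  dtv : HasDt m T v (fun z => divg N R v ψ ψx z + m * (V1 (R z) / R z ^ N) * v z)
  dtG : HasDt m T (gradG N V1 R v vx) (fun z => R z ^ N * fluxx N R v vx ψ ψx ψxx z
    + (m * curv N V1 V2 (R z) * (v z - V (R z)) - R z ^ N * curv N V1 V2 (R z) * ψ z
      + N * (u z / R z) * gradG N V1 R v vx z))
  dxψ : HasDx m T ψ ψx
  dxψx : HasDx m T ψx ψxx
  dtψ : HasDt m T ψ ψt
  momentum : ∀ z ∈ dom m T, ψt z = μ * R z ^ N * fluxx N R v vx ψ ψx ψxx z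
    - deriv (pressureV K γ) (v z) * v z * gradG N V1 R v vx z
    + srcMom N γ K m V V1 (R z) (v z) (ψ z)
  R_bdry : ∀ t ∈ Icc 0 T, R (-(m * t), t) = 1
  v_bdry : ∀ t ∈ Icc 0 T, v (-(m * t), t) = V 1
  ψ_bdry : ∀ t ∈ Icc 0 T, ψ (-(m * t), t) = 0
  vx_bdry : ∀ t ∈ Icc 0 T, m * (vx (-(m * t), t) - V1 1 * V 1) = ψx (-(m * t), t)
  ψt_bdry : ∀ t ∈ Icc 0 T, ψt (-(m * t), t) = m * ψx (-(m * t), t)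

section Calculus

variable {N : ℕ} {m T : ℝ} {R v vx ψ ψx ψxx : ℝ × ℝ → ℝ}

theorem HasDx.pow_mul (hN : 1 ≤ N) (h1 : ∀ z ∈ dom m T, 1 ≤ R z)
    (hR : HasDx m T R (fun z => v z / R z ^ N)) (hψ : HasDx m T ψ ψx) :
    HasDx m T (fun z => R z ^ N * ψ z) (divg N R v ψ ψx) := by
  intro x t hz
  obtain ⟨M, rfl⟩ : ∃ M, N = M + 1 := ⟨N - 1, by omega⟩
  have hR0 : 0 < R (x, t) := by linarith [h1 _ hz]
  refine (((hR x t hz).pow (M + 1)).mul (hψ x t hz)).congr_deriv ?_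
  simp only [divg, Nat.add_sub_cancel, Pi.pow_apply]
  push_cast
  field_simp
  ring

theorem HasDx.divg (hN : 1 ≤ N) (h1 : ∀ z ∈ dom m T, 1 ≤ R z)
    (hR : HasDx m T R (fun z => v z / R z ^ N)) (hv : HasDx m T v vx) (hψ : HasDx m T ψ ψx)
    (hψx : HasDx m T ψx ψxx) : HasDx m T (divg N R v ψ ψx) (divgx N R v vx ψ ψx ψxx) := by
  intro x t hz
  have hR0 : 0 < R (x, t) := by linarith [h1 _ hz]
  have a := HasDx.pow_mul hN h1 hR hψx x t hz
  have b := (((hv x t hz).const_mul (N : ℝ)).mul (hψ x t hz)).div (hR x t hz) hR0.ne'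
  refine (a.add b).congr_deriv ?_
  simp only [InflowNS.divg, divgx, Pi.mul_apply]
  field_simp
  ring

theorem HasDx.divg_div (hN : 1 ≤ N) (h1 : ∀ z ∈ dom m T, 1 ≤ R z) (hv0 : ∀ z ∈ dom m T, 0 < v z)
    (hR : HasDx m T R (fun z => v z / R z ^ N)) (hv : HasDx m T v vx) (hψ : HasDx m T ψ ψx)
    (hψx : HasDx m T ψx ψxx) :
    HasDx m T (fun z => InflowNS.divg N R v ψ ψx z / v z) (fluxx N R v vx ψ ψx ψxx) :=
  fun x t hz => (HasDx.divg hN h1 hR hv hψ hψx x t hz).div (hv x t hz) (hv0 _ hz).ne'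

theorem continuousOn_inv_pow (k : ℕ) (hR : ContinuousOn R (dom m T))
    (h1 : ∀ z ∈ dom m T, 1 ≤ R z) : ContinuousOn (fun z => (R z ^ k)⁻¹) (dom m T) :=
  (hR.pow k).inv₀ (fun z hz => pow_ne_zero _ (by linarith [h1 z hz]))

theorem continuousOn_divg (hR : ContinuousOn R (dom m T)) (h1 : ∀ z ∈ dom m T, 1 ≤ R z)
    (hv : ContinuousOn v (dom m T)) (hψ : ContinuousOn ψ (dom m T))
    (hψx : ContinuousOn ψx (dom m T)) : ContinuousOn (divg N R v ψ ψx) (dom m T) :=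
  ((hR.pow N).mul hψx).add (((continuousOn_const.mul hv).mul hψ).div hR
    (fun z hz => by linarith [h1 z hz]))

theorem continuousOn_divgx (hR : ContinuousOn R (dom m T)) (h1 : ∀ z ∈ dom m T, 1 ≤ R z)
    (hv : ContinuousOn v (dom m T)) (hvx : ContinuousOn vx (dom m T))
    (hψ : ContinuousOn ψ (dom m T))
    (hψx : ContinuousOn ψx (dom m T)) (hψxx : ContinuousOn ψxx (dom m T)) :
    ContinuousOn (divgx N R v vx ψ ψx ψxx) (dom m T) := by
  have h0 : ∀ z ∈ dom m T, R z ≠ 0 := fun z hz => by linarith [h1 z hz]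
  have h2 : ∀ z ∈ dom m T, R z ^ (N + 2) ≠ 0 := fun z hz => pow_ne_zero _ (h0 z hz)
  exact ((((hR.pow N).mul hψxx).add (((continuousOn_const.mul hv).mul hψx).div hR h0)).add
    (((continuousOn_const.mul hvx).mul hψ).div hR h0)).sub
    (((continuousOn_const.mul (hv.pow 2)).mul hψ).div (hR.pow _) h2)

theorem continuousOn_fluxx (hR : ContinuousOn R (dom m T)) (h1 : ∀ z ∈ dom m T, 1 ≤ R z)
    (hv : ContinuousOn v (dom m T)) (hv0 : ∀ z ∈ dom m T, 0 < v z)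
    (hvx : ContinuousOn vx (dom m T)) (hψ : ContinuousOn ψ (dom m T))
    (hψx : ContinuousOn ψx (dom m T)) (hψxx : ContinuousOn ψxx (dom m T)) :
    ContinuousOn (fluxx N R v vx ψ ψx ψxx) (dom m T) :=
  (((continuousOn_divgx hR h1 hv hvx hψ hψx hψxx).mul hv).sub
    ((continuousOn_divg hR h1 hv hψ hψx).mul hvx)).div (hv.pow 2)
    (fun z hz => pow_ne_zero _ (hv0 z hz).ne')

end Calculus

section Radial

variable {N : ℕ} {μ γ K m vp : ℝ} {V V1 V2 : ℝ → ℝ}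

theorem Profile.continuousOn_curv (P : Profile N μ γ K m vp V V1 V2) :
    ContinuousOn (curv N V1 V2) (Ici 1) := by
  have h : ∀ k : ℕ, ∀ r ∈ Ici (1:ℝ), r ^ k ≠ 0 := fun k r hr =>
    pow_ne_zero _ (by have : (1:ℝ) ≤ r := hr; linarith)
  exact (P.continuousOn_two.div (continuousOn_pow N) (h N)).sub
    ((continuousOn_const.mul P.continuousOn_one).div (continuousOn_pow _) (h _))

/-- The radial derivative of `velSlope`. -/
noncomputable def velCurv (N : ℕ) (m : ℝ) (V V1 V2 : ℝ → ℝ) (r : ℝ) : ℝ :=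
  m * V2 r / r ^ N - 2 * N * m * V1 r / r ^ (N + 1) + N * (N + 1) * m * V r / r ^ (N + 2)

theorem Profile.hasDerivWithinAt_velSlope (P : Profile N μ γ K m vp V V1 V2) {r : ℝ}
    (hr : r ∈ Ici (1:ℝ)) :
    HasDerivWithinAt (velSlope N m V V1) (velCurv N m V V1 V2 r) (Ici 1) r := by
  have h1 := ((P.hasDeriv_one r hr).mul (Profile.hasDerivWithinAt_inv_pow N hr (Ici 1))).const_mul m
  have h2 := ((P.hasDeriv r hr).mul
    (Profile.hasDerivWithinAt_inv_pow (N + 1) hr (Ici 1))).const_mul (N * m)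
  refine ((h1.sub h2).congr_of_mem (f₁ := velSlope N m V V1)
    (fun x _ => by simp only [Pi.mul_apply, Pi.sub_apply, velSlope]; ring) hr).congr_deriv ?_
  unfold velCurv; push_cast; ring

theorem Profile.continuousOn_velSlope (P : Profile N μ γ K m vp V V1 V2) :
    ContinuousOn (velSlope N m V V1) (Ici 1) :=
  fun _ hr => (P.hasDerivWithinAt_velSlope hr).continuousWithinAt

theorem Profile.continuousOn_velCurv (P : Profile N μ γ K m vp V V1 V2) :
    ContinuousOn (velCurv N m V V1 V2) (Ici 1) := by
  have h : ∀ k : ℕ, ∀ r ∈ Ici (1:ℝ), r ^ k ≠ 0 := fun k r hr =>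
    pow_ne_zero _ (by have : (1:ℝ) ≤ r := hr; linarith)
  exact (((continuousOn_const.mul P.continuousOn_two).div (continuousOn_pow N) (h N)).sub
    ((continuousOn_const.mul P.continuousOn_one).div (continuousOn_pow _) (h _))).add
    ((continuousOn_const.mul P.continuousOn).div (continuousOn_pow _) (h _))

end Radial

/-- A function with `D_x = a D` that vanishes on the boundary `x = -m t` vanishes identically. -/
theorem HasDx.eq_zero_of_linear {m T : ℝ} {D a : ℝ × ℝ → ℝ} (ha : ContinuousOn a (dom m T))
    (hD : HasDx m T D (fun z => a z * D z)) (h0 : ∀ t ∈ Icc 0 T, D (-(m * t), t) = 0) :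
    ∀ z ∈ dom m T, D z = 0 := by
  rintro ⟨x, t⟩ hz
  have hsub : Icc (-(m * t)) x ⊆ Ici (-(m * t)) := Icc_subset_Ici_self
  obtain ⟨M, hM⟩ := isCompact_Icc.exists_bound_of_continuousOn
    ((continuousOn_slice ha hz.1).mono hsub)
  have key := norm_le_gronwallBound_of_norm_deriv_right_le (f := fun y => D (y, t))
    (f' := fun y => a (y, t) * D (y, t)) (δ := 0) (K := M) (ε := 0) (a := -(m * t)) (b := x)
    (fun y hy => (hD y t ⟨hz.1, hy.1⟩).continuousWithinAt.mono hsub)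
    (fun y hy => (hD y t ⟨hz.1, hy.1⟩).mono (Ici_subset_Ici.2 hy.1))
    (by simp [h0 t hz.1])
    (fun y hy => by
      rw [norm_mul, add_zero]
      exact mul_le_mul_of_nonneg_right (hM y ⟨hy.1, hy.2.le⟩) (norm_nonneg _))
  have := key x ⟨hz.2, le_rfl⟩
  rw [gronwallBound_ε0_δ0] at this
  simpa using this

/-! ### The material derivatives of the radius and of the effective gradient. -/

section

variable {N : ℕ} {μ γ K m T : ℝ} {V V1 V2 us : ℝ → ℝ} {R v vx vt u ψ ψx ψxx : ℝ × ℝ → ℝ}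

/-- Here `I / R ^ N` plays the part of R_t before it is known. The defect D = I - (R^N ψ + m V(R))
satisfies D_x = (V1(R) / R^N) D by the mass equation, and D = 0 on the boundary, so it vanishes. -/
theorem mass_to_radius (hN : 1 ≤ N) {vp : ℝ} (P : Profile N μ γ K m vp V V1 V2)
    (contR : ContinuousOn R (dom m T)) (one_le : ∀ z ∈ dom m T, 1 ≤ R z)
    (dxR : HasDx m T R (fun z => v z / R z ^ N)) (dxψ : HasDx m T ψ ψx)
    (u_eq : ∀ z ∈ dom m T, u z = m * V (R z) / R z ^ N + ψ z)
    {I : ℝ × ℝ → ℝ} (hI : HasDx m T I vt)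
    (hmass : ∀ z ∈ dom m T, vt z = divg N R v ψ ψx z + m * (V1 (R z) / R z ^ N) * v z
      + V1 (R z) * (I z / R z ^ N - u z))
    (hb : ∀ t ∈ Icc 0 T, I (-(m * t), t) = m * V 1)
    (R_bdry : ∀ t ∈ Icc 0 T, R (-(m * t), t) = 1)
    (ψ_bdry : ∀ t ∈ Icc 0 T, ψ (-(m * t), t) = 0) :
    ∀ z ∈ dom m T, I z / R z ^ N = u z := by
  have hR0 : ∀ z ∈ dom m T, R z ^ N ≠ 0 := fun z hz => pow_ne_zero _ (by linarith [one_le z hz])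
  have hz0 := HasDx.eq_zero_of_linear (D := fun z => I z - (R z ^ N * ψ z + m * V (R z)))
    (a := fun z => V1 (R z) / R z ^ N)
    ((continuousOn_comp_radial P.continuousOn_one contR one_le).div (contR.pow N) hR0)
    (fun x t hz => by
      have d := (hI x t hz).sub ((HasDx.pow_mul hN one_le dxR dxψ x t hz).add
        ((HasDx.comp_radial P.hasDeriv dxR one_le x t hz).const_mul m))
      refine d.congr_deriv ?_
      have h0 := hR0 _ hz
      rw [hmass _ hz, u_eq _ hz]
      field_simp
      ring)
    (fun t ht => by rw [hb t ht, R_bdry t ht, ψ_bdry t ht]; simp)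
  intro z hz
  have h := hz0 z hz
  have h0 := hR0 _ hz
  rw [u_eq z hz]
  field_simp
  linarith

/-- The time derivative of v_x is the x-derivative of the mass equation, by `HasDt.of_mixed`.
Division by v then makes the leading part exactly R^N times the x-derivative of (R^N ψ)_x / v, the
viscous term of the momentum equation; the rest contains no second derivative of ψ. -/
theorem hasDt_gradG (P : ∃ vp, Profile N μ γ K m vp V V1 V2) (hm : 0 < m) (hN : 1 ≤ N)
    (contR : ContinuousOn R (dom m T)) (contv : ContinuousOn v (dom m T))
    (contvx : ContinuousOn vx (dom m T)) (contψ : ContinuousOn ψ (dom m T))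
    (contψx : ContinuousOn ψx (dom m T)) (contψxx : ContinuousOn ψxx (dom m T))
    (one_le : ∀ z ∈ dom m T, 1 ≤ R z) (vpos : ∀ z ∈ dom m T, 0 < v z)
    (u_eq : ∀ z ∈ dom m T, u z = m * V (R z) / R z ^ N + ψ z)
    (dxR : HasDx m T R (fun z => v z / R z ^ N)) (dtR : HasDt m T R u)
    (dxv : HasDx m T v vx)
    (dtv : HasDt m T v (fun z => divg N R v ψ ψx z + m * (V1 (R z) / R z ^ N) * v z))
    (dxψ : HasDx m T ψ ψx) (dxψx : HasDx m T ψx ψxx) :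
    HasDt m T (gradG N V1 R v vx) (fun z => R z ^ N * fluxx N R v vx ψ ψx ψxx z
    + (m * curv N V1 V2 (R z) * (v z - V (R z)) - R z ^ N * curv N V1 V2 (R z) * ψ z
      + N * (u z / R z) * gradG N V1 R v vx z)) := by
  obtain ⟨vp, P⟩ := P
  have hR0 : ∀ k : ℕ, ∀ z ∈ dom m T, R z ^ k ≠ 0 := fun k z hz =>
    pow_ne_zero _ (by linarith [one_le z hz])
  have hw : ∀ r ∈ Ici (1:ℝ), HasDerivWithinAt (fun r => V1 r / r ^ N) (curv N V1 V2 r) (Ici 1) r := by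
    intro r hr
    have h := ((P.hasDeriv_one r hr).mul (Profile.hasDerivWithinAt_inv_pow N hr (Ici 1)))
    exact (h.congr_of_mem (f₁ := fun r => V1 r / r ^ N)
      (fun x _ => by simp only [Pi.mul_apply]; ring) hr).congr_deriv (by unfold curv; ring)
  have cV1 := continuousOn_comp_radial P.continuousOn_one contR one_le
  have ccurv := continuousOn_comp_radial P.continuousOn_curv contR one_le
  have cw := cV1.div (contR.pow N) (hR0 N)
  have cRx := contv.div (contR.pow N) (hR0 N)
  have hvtx : HasDx m T (fun z => divg N R v ψ ψx z + m * (V1 (R z) / R z ^ N) * v z)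
      (fun z => divgx N R v vx ψ ψx ψxx z + m * (curv N V1 V2 (R z) * (v z / R z ^ N) * v z
        + V1 (R z) / R z ^ N * vx z)) := by
    intro x t hz
    have d := (HasDx.divg hN one_le dxR dxv dxψ dxψx x t hz).add
      (((HasDx.comp_radial hw dxR one_le x t hz).const_mul m).mul (dxv x t hz))
    exact d.congr_deriv (by ring)
  have dtvx : HasDt m T vx (fun z => divgx N R v vx ψ ψx ψxx z
      + m * (curv N V1 V2 (R z) * (v z / R z ^ N) * v z + V1 (R z) / R z ^ N * vx z)) :=
    HasDt.of_mixed hm contv ((continuousOn_divg contR one_le contv contψ contψx).add ((continuousOn_const.mul cw).mul contv))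
    ((continuousOn_divgx contR one_le contv contvx contψ contψx contψxx).add
      (continuousOn_const.mul (((ccurv.mul cRx).mul contv).add (cw.mul contvx)))) dxv dtv hvtx
  intro x t hz hT
  obtain ⟨M, rfl⟩ : ∃ M, N = M + 1 := ⟨N - 1, by omega⟩
  have d := ((((dtR x t hz hT).pow (M + 1)).mul (dtvx x t hz hT)).div (dtv x t hz hT)
    (vpos _ hz).ne').sub (HasDt.comp_radial hm P.hasDeriv_one dtR one_le x t hz hT)
  refine d.congr_deriv ?_
  have h1 : R (x, t) ≠ 0 := by linarith [one_le _ hz]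
  have h2 := (vpos _ hz).ne'
  simp only [Pi.mul_apply, Pi.pow_apply, Nat.add_sub_cancel, gradG, fluxx, curv]
  rw [u_eq _ hz]
  generalize divgx (M + 1) R v vx ψ ψx ψxx (x, t) = A
  generalize divg (M + 1) R v ψ ψx (x, t) = B
  push_cast
  field_simp
  ring

/-- The second `x`-derivative of the velocity perturbation. -/
noncomputable def psixx (N : ℕ) (m : ℝ) (V V1 V2 : ℝ → ℝ) (R v vx uxx : ℝ × ℝ → ℝ) (z : ℝ × ℝ) : ℝ :=
  uxx z - (velCurv N m V V1 V2 (R z) * (v z / R z ^ N) * (v z / R z ^ N)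
    + velSlope N m V V1 (R z) * (vx z / R z ^ N - N * v z ^ 2 / R z ^ (2 * N + 1)))

theorem hasDx_psix {vp : ℝ} (P : Profile N μ γ K m vp V V1 V2) {ux uxx : ℝ × ℝ → ℝ}
    (one_le : ∀ z ∈ dom m T, 1 ≤ R z) (dxR : HasDx m T R (fun z => v z / R z ^ N))
    (dxv : HasDx m T v vx) (dxu : HasDx m T ux uxx) :
    HasDx m T (fun z => ux z - velSlope N m V V1 (R z) * (v z / R z ^ N))
      (psixx N m V V1 V2 R v vx uxx) := by
  intro x t hz
  have hR := one_le _ hz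
  have h0 : R (x, t) ≠ 0 := by linarith
  have hp : HasDerivWithinAt (fun y => (R (y, t) ^ N)⁻¹)
      (-(N : ℝ) / R (x, t) ^ (N + 1) * (v (x, t) / R (x, t) ^ N)) (Ici (-(m * t))) x := by
    have h : ∀ r ∈ Ici (1:ℝ), HasDerivWithinAt (fun r : ℝ => (r ^ N)⁻¹) (-(N : ℝ) / r ^ (N + 1))
        (Ici 1) r := fun r hr => by
      exact (Profile.hasDerivWithinAt_inv_pow N hr (Ici 1)).congr_deriv (by ring)
    exact HasDx.comp_radial h dxR one_le x t hz
  have d := (dxu x t hz).sub ((HasDx.comp_radial (fun r hr => P.hasDerivWithinAt_velSlope hr)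
    dxR one_le x t hz).mul ((dxv x t hz).mul hp))
  refine d.congr_deriv ?_
  simp only [psixx, Pi.mul_apply]
  field_simp
  ring

theorem continuousOn_psixx {vp : ℝ} (P : Profile N μ γ K m vp V V1 V2) {uxx : ℝ × ℝ → ℝ}
    (contR : ContinuousOn R (dom m T)) (contv : ContinuousOn v (dom m T))
    (contvx : ContinuousOn vx (dom m T)) (one_le : ∀ z ∈ dom m T, 1 ≤ R z)
    (contuxx : ContinuousOn uxx (dom m T)) :
    ContinuousOn (psixx N m V V1 V2 R v vx uxx) (dom m T) := by
  have hR0 : ∀ k : ℕ, ∀ z ∈ dom m T, R z ^ k ≠ 0 := fun k z hz =>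
    pow_ne_zero _ (by linarith [one_le z hz])
  have cRx := contv.div (contR.pow N) (hR0 N)
  exact contuxx.sub ((((continuousOn_comp_radial P.continuousOn_velCurv contR one_le).mul cRx).mul
    cRx).add ((continuousOn_comp_radial P.continuousOn_velSlope contR one_le).mul
      ((contvx.div (contR.pow N) (hR0 N)).sub ((continuousOn_const.mul (contv.pow 2)).div
        (contR.pow _) (hR0 _)))))

end

theorem source2_eq {N : ℕ} {γ K m : ℝ} {V V1 ρs us : ℝ → ℝ} {r : ℝ}
    (hV : V r = (ρs r)⁻¹) (hV1 : V1 r = dr (fun s => (ρs s)⁻¹) r)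
    (hus : us r = m * V r / r ^ N) (hdus : dr us r = velSlope N m V V1 r) (v ψ : ℝ) :
    source2 K γ ρs us r v (v - (ρs r)⁻¹) ψ = srcMom N γ K m V V1 r v ψ := by
  unfold source2 srcMom
  rw [← hV, ← hV1, hus, hdus]
  by_cases h : v = V r
  · subst h; simp
  · have : v - V r ≠ 0 := sub_ne_zero.2 h
    field_simp

/-- A solution of the perturbation equations is a flow in the sense of `Flow`. -/
theorem IsSolution.flow {N : ℕ} (hN : 1 ≤ N) {μ γ K ρp ρb ub T : ℝ}
    (hρp : 0 < ρp) (hm : 0 < ρb * ub) (hT : 0 < T) {ρs us : ℝ → ℝ} {v u : ℝ × ℝ → ℝ}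
    (S : IsStationary (N + 1) μ γ K ρp ρb ub ρs us)
    (U : IsSolution (N + 1) μ γ K (ρb * ub) T ρs us v u)
    (vpos : ∀ z ∈ dom (ρb * ub) T, 0 < v z) :
    ∃ vx ψx ψxx ψt : ℝ × ℝ → ℝ,
      Flow N μ γ K (ρb * ub) T (fun r => (ρs r)⁻¹) (dr fun r => (ρs r)⁻¹)
        (dr (dr fun r => (ρs r)⁻¹)) (radius (N + 1) (ρb * ub) v) v vx u
        (psi (N + 1) (ρb * ub) us v u) ψx ψxx ψt ∧
      (∀ z ∈ dom (ρb * ub) T, dx (ρb * ub) (phi (N + 1) (ρb * ub) ρs v) z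
        = vx z - dr (fun r => (ρs r)⁻¹) (radius (N + 1) (ρb * ub) v z)
          * (v z / radius (N + 1) (ρb * ub) v z ^ N)) ∧
      (∀ z ∈ dom (ρb * ub) T, dx (ρb * ub) (psi (N + 1) (ρb * ub) us v u) z = ψx z) ∧
      (∀ z ∈ dom (ρb * ub) T,
        dx (ρb * ub) (dx (ρb * ub) (psi (N + 1) (ρb * ub) us v u)) z = ψxx z) := by
  obtain ⟨P, hus'⟩ := S.profile hρp hm
  have hus : ∀ r ∈ Ici (1:ℝ), us r = ρb * ub * (ρs r)⁻¹ / r ^ N := fun r hr => S.velocity_eq hr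
  set m := ρb * ub with hmdef
  set V : ℝ → ℝ := fun r => (ρs r)⁻¹ with hVdef
  set V1 := dr V with hV1def
  set V2 := dr V1 with hV2def
  set R := radius (N + 1) m v with hRdef
  have contv := U.contDiffOn_v.continuousOn
  have contu := U.contDiffOn_u.continuousOn
  have one_le : ∀ z ∈ dom m T, 1 ≤ R z := fun z hz => one_le_radius vpos hz
  have contR : ContinuousOn R (dom m T) := continuousOn_radius hT vpos contv
  have dxR : HasDx m T R (fun z => v z / R z ^ N) := hasDx_radius hT vpos contv
  have hR0 : ∀ k : ℕ, ∀ z ∈ dom m T, R z ^ k ≠ 0 := fun k z hz =>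
    pow_ne_zero _ (by linarith [one_le z hz])
  have R_bdry : ∀ t ∈ Icc 0 T, R (-(m * t), t) = 1 := fun t _ => radius_boundary t
  obtain ⟨contvx, dxv⟩ := contDiffOn_hasDx hm hT U.contDiffOn_v
  obtain ⟨contux, dxu⟩ := contDiffOn_hasDx hm hT U.contDiffOn_u
  obtain ⟨contvt, dtv⟩ := contDiffOn_hasDt hm hT U.contDiffOn_v
  obtain ⟨contut, dtu⟩ := contDiffOn_hasDt hm hT U.contDiffOn_u
  set vx : ℝ × ℝ → ℝ := fun z => fderivWithin ℝ v (dom m T) z (1, 0) with hvxdef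
  set ux : ℝ × ℝ → ℝ := fun z => fderivWithin ℝ u (dom m T) z (1, 0) with huxdef
  set vt := dt m T v with hvtdef
  set ut := dt m T u with hutdef
  have dxux : HasDx m T ux (dx m (dx m u)) := by
    intro x t hz
    have h : HasDerivWithinAt (fun y => dx m u (y, t)) (dx m (dx m u) (x, t)) (Ici (-(m * t))) x :=
      (U.differentiableOn_dx_u t hz.1 x hz.2).hasDerivWithinAt
    exact h.congr_of_mem (fun y hy => (dxu.dx_eq (z := (y, t)) ⟨hz.1, hy⟩).symm) hz.2
  set φ := phi (N + 1) m ρs v with hφdef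
  set ψ := psi (N + 1) m us v u with hψdef
  have hvel : ∀ r ∈ Ici (1:ℝ), HasDerivWithinAt us (velSlope N m V V1 r) (Ici 1) r := fun r hr =>
    hus' r hr
  have contus : ContinuousOn us (Ici 1) := fun r hr => (hvel r hr).continuousWithinAt
  set ψx : ℝ × ℝ → ℝ := fun z => ux z - velSlope N m V V1 (R z) * (v z / R z ^ N) with hψxdef
  have dxψ : HasDx m T ψ ψx := fun x t hz =>
    (dxu x t hz).sub (HasDx.comp_radial hvel dxR one_le x t hz)
  have dxψx : HasDx m T ψx (psixx N m V V1 V2 R v vx (dx m (dx m u))) :=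
    hasDx_psix P one_le dxR dxv dxux
  have contψ : ContinuousOn ψ (dom m T) := contu.sub (continuousOn_comp_radial contus contR one_le)
  have cvs := continuousOn_comp_radial P.continuousOn_velSlope contR one_le
  have cRx : ContinuousOn (fun z => v z / R z ^ N) (dom m T) := contv.div (contR.pow N) (hR0 N)
  have cV1 := continuousOn_comp_radial P.continuousOn_one contR one_le
  have cV := continuousOn_comp_radial P.continuousOn contR one_le
  have contψx : ContinuousOn ψx (dom m T) := contux.sub (cvs.mul cRx)
  have contψxx := continuousOn_psixx P contR contv contvx one_le U.continuousOn_dxx_u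
  set ψxx := psixx N m V V1 V2 R v vx (dx m (dx m u)) with hψxxdef
  have u_eq : ∀ z ∈ dom m T, u z = m * V (R z) / R z ^ N + ψ z := fun z hz => by
    have h := hus (R z) (one_le z hz)
    simp only [hψdef, psi]
    rw [← hRdef, h]; ring
  have hφ : ∀ z, φ z = v z - V (R z) := fun z => rfl
  have dxφ : HasDx m T φ (fun z => vx z - V1 (R z) * (v z / R z ^ N)) := fun x t hz =>
    (dxv x t hz).sub (HasDx.comp_radial P.hasDeriv dxR one_le x t hz)
  have ψ_bdry : ∀ t ∈ Icc 0 T, ψ (-(m * t), t) = 0 := U.psi_boundary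
  have v_bdry : ∀ t ∈ Icc 0 T, v (-(m * t), t) = V 1 := fun t ht => by
    have h := U.phi_boundary t ht
    rw [← hφdef, hφ, R_bdry t ht] at h
    linarith
  have u_bdry : ∀ t ∈ Icc 0 T, u (-(m * t), t) = m * V 1 := fun t ht => by
    rw [u_eq _ (boundary_mem ht), R_bdry t ht, ψ_bdry t ht]; simp
  -- the time derivative of the radius
  set I : ℝ × ℝ → ℝ := fun z => (∫ y in -(m * z.2)..z.1, vt (y, z.2)) + m * v (-(m * z.2), z.2)
    with hIdef
  have dtR0 : HasDt m T R (fun z => I z / R z ^ N) := hasDt_radius hm vpos contv contvt dtv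
  have contI : ContinuousOn I (dom m T) :=
    (continuousOn_primitive hT contvt).add (continuousOn_const.mul (continuousOn_boundary_comp contv))
  have cRt : ContinuousOn (fun z => I z / R z ^ N) (dom m T) := contI.div (contR.pow N) (hR0 N)
  have dtφ : HasDt m T φ (fun z => vt z - V1 (R z) * (I z / R z ^ N)) := fun x t hz hT =>
    (dtv x t hz hT).sub (HasDt.comp_radial hm P.hasDeriv dtR0 one_le x t hz hT)
  have hpm := HasDx.pow_mul hN one_le dxR dxψ
  -- The mass equation is first read with R_t unknown, in the form `I z / R z ^ N`; the defect V_r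
  -- (R_t - u) is removed afterwards by `mass_to_radius`.
  have hmass : ∀ z ∈ dom m T, vt z = divg N R v ψ ψx z + m * (V1 (R z) / R z ^ N) * v z
      + V1 (R z) * (I z / R z ^ N - u z) := by
    refine eqOn_dom_of_eqOn_domInt hm hT contvt
      (((continuousOn_divg contR one_le contv contψ contψx).add ((continuousOn_const.mul
        (cV1.div (contR.pow N) (hR0 N))).mul contv)).add (cV1.mul (cRt.sub contu))) ?_
    intro z hz
    have hz' := domInt_subset m T hz
    have h := U.mass z hz'
    rw [← hφdef, ← hψdef, dt_eq_of_partials (f := φ) (fx := fun z => vx z - V1 (R z) * (v z / R z ^ N))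
      (ft := fun z => vt z - V1 (R z) * (I z / R z ^ N)) hm (contv.sub cV) (contvx.sub (cV1.mul cRx))
      (contvt.sub (cV1.mul cRt)) dxφ dtφ hz] at h
    simp only [Nat.add_sub_cancel, ← hRdef] at h
    rw [hpm.dx_eq hz'] at h
    have hR1 := hR0 N z hz'
    have hVp := (P.pos (R z) (one_le z hz')).ne'
    have hs : source1 ρs us (R z) (φ z) (ψ z)
        = V1 (R z) * (m * V (R z) / R z ^ N) / V (R z) * (v z - V (R z)) - V1 (R z) * ψ z := by
      rw [← hus _ (one_le z hz')]; rfl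
    rw [hs] at h
    simp only
    rw [u_eq z hz']
    have e : V1 (R z) * (m * V (R z) / R z ^ N) / V (R z) * (v z - V (R z)) - V1 (R z) * ψ z
      = m * (V1 (R z) / R z ^ N) * v z - V1 (R z) * (m * V (R z) / R z ^ N + ψ z) := by
      field_simp; ring
    rw [e] at h
    linarith
  have hRt : ∀ z ∈ dom m T, I z / R z ^ N = u z :=
    mass_to_radius hN P contR one_le dxR dxψ u_eq
      (fun x t hz => (hasDx_primitive hT contvt x t hz).add_const (m * v (-(m * t), t)))
      hmass (fun t ht => by simp [hIdef, v_bdry t ht]) R_bdry ψ_bdry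
  have dtR : HasDt m T R u := dtR0.congr_deriv hRt
  have hvt : ∀ z ∈ dom m T, vt z = divg N R v ψ ψx z + m * (V1 (R z) / R z ^ N) * v z :=
    fun z hz => by rw [hmass z hz, hRt z hz]; ring
  have dtv' := dtv.congr_deriv hvt
  have dtψ : HasDt m T ψ (fun z => ut z - velSlope N m V V1 (R z) * u z) := fun x t hz hT =>
    (dtu x t hz hT).sub (HasDt.comp_radial hm hvel dtR one_le x t hz hT)
  have contψt : ContinuousOn (fun z => ut z - velSlope N m V V1 (R z) * u z) (dom m T) :=
    contut.sub (cvs.mul contu)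
  have hmom : ∀ z ∈ dom m T, ut z - velSlope N m V V1 (R z) * u z
      = μ * R z ^ N * fluxx N R v vx ψ ψx ψxx z
        - deriv (pressureV K γ) (v z) * v z * gradG N V1 R v vx z
        + srcMom N γ K m V V1 (R z) (v z) (ψ z) := by
    have cp : ContinuousOn (fun z => deriv (pressureV K γ) (v z)) (dom m T) :=
      (continuousOn_deriv_pressureV (K := K) (γ := γ)).comp contv (fun z hz => vpos z hz)
    have cpV : ContinuousOn (fun z => deriv (pressureV K γ) (V (R z))) (dom m T) :=
      (continuousOn_deriv_pressureV (K := K) (γ := γ)).comp cV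
        (fun z hz => P.pos _ (one_le z hz))
    have cG : ContinuousOn (gradG N V1 R v vx) (dom m T) :=
      (((contR.pow N).mul contvx).div contv (fun z hz => (vpos z hz).ne')).sub cV1
    refine eqOn_dom_of_eqOn_domInt hm hT contψt
      ((((continuousOn_const.mul (contR.pow N)).mul
        (continuousOn_fluxx contR one_le contv vpos contvx contψ contψx contψxx)).sub
        ((cp.mul contv).mul cG)).add
        (((((cvs.mul ((continuousOn_const.mul cV).div (contR.pow N) (hR0 N))).div cV
          (fun z hz => (P.pos _ (one_le z hz)).ne')).mul (contv.sub cV)).sub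
          ((cV1.mul (cp.sub cpV)).mul contv)).sub (cvs.mul contψ))) ?_
    intro z hz
    have hz' := domInt_subset m T hz
    have h := U.momentum z hz'
    simp only [Nat.add_sub_cancel, ← hφdef, ← hψdef, ← hRdef] at h
    have hflux : HasDx m T (fun w => dx m (fun y => R y ^ N * ψ y) w / v w)
        (fluxx N R v vx ψ ψx ψxx) :=
      (HasDx.divg_div hN one_le vpos dxR dxv dxψ dxψx).congr
        (fun w hw => by simp only; rw [hpm.dx_eq hw])
    rw [dt_eq_of_partials hm contψ contψx contψt dxψ dtψ hz, hflux.dx_eq hz', dxφ.dx_eq hz',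
      hφ z, source2_eq (N := N) (m := m) (V := V) (V1 := V1) rfl rfl (hus _ (one_le z hz'))
        (dr_eq (one_le z hz') (hvel _ (one_le z hz')))] at h
    have e : R z ^ N * deriv (pressureV K γ) (v z) * (vx z - V1 (R z) * (v z / R z ^ N))
        = deriv (pressureV K γ) (v z) * v z * gradG N V1 R v vx z := by
      have hR1 := hR0 N z hz'
      have hv1 := (vpos z hz').ne'
      unfold gradG; field_simp
    simp only at h ⊢
    rw [e] at h
    linarith
  refine ⟨vx, ψx, ψxx, _, ⟨contR, contv, contvx, contψ, contψx, contψxx, contψt, one_le, vpos, u_eq,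
    dxR, dtR, dxv, dtv', hasDt_gradG ⟨_, P⟩ hm hN contR contv contvx contψ contψx contψxx one_le vpos
      u_eq dxR dtR dxv dtv' dxψ dxψx, dxψ, dxψx, dtψ, hmom, R_bdry, v_bdry, ψ_bdry, ?_, ?_⟩,
    fun z hz => dxφ.dx_eq hz, fun z hz => dxψ.dx_eq hz, fun z hz =>
      (dxψx.congr (fun w hw => dxψ.dx_eq hw)).dx_eq hz⟩
  -- v equals V(1) along the boundary, so v_t = m v_x there, and the mass equation turns this into a
  -- relation between v_x and ψ_x.
  · intro t ht
    have h : vt (-(m * t), t) = m * vx (-(m * t), t) :=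
      boundary_deriv_eq hT U.contDiffOn_v v_bdry ht
    rw [hvt _ (boundary_mem ht)] at h
    simp only [divg, R_bdry t ht, ψ_bdry t ht, v_bdry t ht] at h
    simp only [one_pow, mul_zero, add_zero, one_mul, div_one] at h
    linarith
  · intro t ht
    have h : ut (-(m * t), t) = m * ux (-(m * t), t) :=
      boundary_deriv_eq hT U.contDiffOn_u u_bdry ht
    simp only [hψxdef, R_bdry t ht, u_bdry t ht, v_bdry t ht, h]
    simp only [one_pow, div_one]
    ring


/-! ### Truncated integrals, the cutoff, and the abstract energy estimate. -/

/-- The integral of `f (·, t)` over `[-m t, X]`. -/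
noncomputable def sl (m : ℝ) (f : ℝ × ℝ → ℝ) (X t : ℝ) : ℝ := ∫ x in -(m * t)..X, f (x, t)

/-- The integral of `f` over `{(x, τ) : 0 ≤ τ ≤ t, -m τ ≤ x ≤ X}`. -/
noncomputable def dbl (m : ℝ) (f : ℝ × ℝ → ℝ) (X t : ℝ) : ℝ := ∫ τ in (0:ℝ)..t, sl m f X τ

section Slices

variable {m T : ℝ} {f g : ℝ × ℝ → ℝ} {X Y t : ℝ}

theorem sl_mono (hm : 0 < m) (hf : ContinuousOn f (dom m T)) (hg : ContinuousOn g (dom m T))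
    (ht : t ∈ Icc 0 T) (hX : 0 ≤ X) (h : ∀ z ∈ dom m T, z.1 ≤ X → f z ≤ g z) :
    sl m f X t ≤ sl m g X t := by
  have hb := neg_mul_le hm ht.1 hX
  exact intervalIntegral.integral_mono_on hb (intervalIntegrable_slice hf ht le_rfl hb)
    (intervalIntegrable_slice hg ht le_rfl hb) (fun x hx => h (x, t) ⟨ht, hx.1⟩ hx.2)

theorem sl_nonneg (hm : 0 < m) (ht : t ∈ Icc 0 T) (hX : 0 ≤ X) (h : ∀ z ∈ dom m T, 0 ≤ f z) :
    0 ≤ sl m f X t :=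
  intervalIntegral.integral_nonneg (neg_mul_le hm ht.1 hX) (fun x hx => h (x, t) ⟨ht, hx.1⟩)

theorem sl_mono_right (hm : 0 < m) (hf : ContinuousOn f (dom m T)) (ht : t ∈ Icc 0 T) (hY : 0 ≤ Y)
    (hYX : Y ≤ X) (h : ∀ z ∈ dom m T, 0 ≤ f z) : sl m f Y t ≤ sl m f X t := by
  have hb := neg_mul_le hm ht.1 hY
  have e := intervalIntegral.integral_add_adjacent_intervals
    (intervalIntegrable_slice hf ht le_rfl hb) (intervalIntegrable_slice hf ht hb (hb.trans hYX))
  have : 0 ≤ ∫ x in Y..X, f (x, t) :=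
    intervalIntegral.integral_nonneg hYX (fun x hx => h (x, t) ⟨ht, hb.trans hx.1⟩)
  unfold sl
  linarith

theorem sl_add (hm : 0 < m) (hf : ContinuousOn f (dom m T)) (hg : ContinuousOn g (dom m T))
    (ht : t ∈ Icc 0 T) (hX : 0 ≤ X) :
    sl m (fun z => f z + g z) X t = sl m f X t + sl m g X t := by
  have hb := neg_mul_le hm ht.1 hX
  exact intervalIntegral.integral_add (intervalIntegrable_slice hf ht le_rfl hb)
    (intervalIntegrable_slice hg ht le_rfl hb)

theorem sl_sub (hm : 0 < m) (hf : ContinuousOn f (dom m T)) (hg : ContinuousOn g (dom m T))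
    (ht : t ∈ Icc 0 T) (hX : 0 ≤ X) :
    sl m (fun z => f z - g z) X t = sl m f X t - sl m g X t := by
  have hb := neg_mul_le hm ht.1 hX
  exact intervalIntegral.integral_sub (intervalIntegrable_slice hf ht le_rfl hb)
    (intervalIntegrable_slice hg ht le_rfl hb)

theorem sl_const_mul (c : ℝ) : sl m (fun z => c * f z) X t = c * sl m f X t :=
  intervalIntegral.integral_const_mul _ _

theorem continuousOn_sl (hm : 0 < m) (hX : 0 ≤ X) (hf : ContinuousOn f (dom m T)) :
    ContinuousOn (sl m f X) (Icc 0 T) := continuousOn_integral_slice hm hX hf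

theorem intervalIntegrable_of_continuousOn_Icc {h : ℝ → ℝ} (hh : ContinuousOn h (Icc 0 T))
    (ht : t ∈ Icc 0 T) : IntervalIntegrable h volume 0 t :=
  (hh.mono (Icc_subset_Icc_right ht.2)).intervalIntegrable_of_Icc ht.1

theorem integral_time_mono {h k : ℝ → ℝ} (hh : ContinuousOn h (Icc 0 T))
    (hk : ContinuousOn k (Icc 0 T)) (ht : t ∈ Icc 0 T) (hle : ∀ τ ∈ Icc 0 T, h τ ≤ k τ) :
    ∫ τ in (0:ℝ)..t, h τ ≤ ∫ τ in (0:ℝ)..t, k τ :=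
  intervalIntegral.integral_mono_on ht.1 (intervalIntegrable_of_continuousOn_Icc hh ht)
    (intervalIntegrable_of_continuousOn_Icc hk ht) (fun τ hτ => hle τ ⟨hτ.1, hτ.2.trans ht.2⟩)

theorem continuousOn_bdry (hf : ContinuousOn f (dom m T)) :
    ContinuousOn (fun τ => f (-(m * τ), τ)) (Icc 0 T) :=
  hf.comp (by fun_prop) (fun _ hτ => boundary_mem hτ)

theorem dbl_mono (hm : 0 < m) (hf : ContinuousOn f (dom m T)) (hg : ContinuousOn g (dom m T))
    (ht : t ∈ Icc 0 T) (hX : 0 ≤ X) (h : ∀ z ∈ dom m T, z.1 ≤ X → f z ≤ g z) :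
    dbl m f X t ≤ dbl m g X t :=
  integral_time_mono (continuousOn_sl hm hX hf) (continuousOn_sl hm hX hg) ht
    (fun _ hτ => sl_mono hm hf hg hτ hX h)

theorem dbl_nonneg (hm : 0 < m) (ht : t ∈ Icc 0 T) (hX : 0 ≤ X) (h : ∀ z ∈ dom m T, 0 ≤ f z) :
    0 ≤ dbl m f X t :=
  intervalIntegral.integral_nonneg ht.1
    (fun _ hτ => sl_nonneg hm (T := T) ⟨hτ.1, hτ.2.trans ht.2⟩ hX h)

theorem dbl_mono_right (hm : 0 < m) (hf : ContinuousOn f (dom m T)) (ht : t ∈ Icc 0 T) (hY : 0 ≤ Y)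
    (hYX : Y ≤ X) (h : ∀ z ∈ dom m T, 0 ≤ f z) : dbl m f Y t ≤ dbl m f X t :=
  integral_time_mono (continuousOn_sl hm hY hf) (continuousOn_sl hm (hY.trans hYX) hf) ht
    (fun _ hτ => sl_mono_right hm hf hτ hY hYX h)

theorem dbl_add (hm : 0 < m) (hf : ContinuousOn f (dom m T)) (hg : ContinuousOn g (dom m T))
    (ht : t ∈ Icc 0 T) (hX : 0 ≤ X) :
    dbl m (fun z => f z + g z) X t = dbl m f X t + dbl m g X t := by
  unfold dbl
  rw [← intervalIntegral.integral_add
    (intervalIntegrable_of_continuousOn_Icc (continuousOn_sl hm hX hf) ht)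
    (intervalIntegrable_of_continuousOn_Icc (continuousOn_sl hm hX hg) ht)]
  apply intervalIntegral.integral_congr
  intro τ hτ
  rw [uIcc_of_le ht.1] at hτ
  exact sl_add hm hf hg ⟨hτ.1, hτ.2.trans ht.2⟩ hX

theorem dbl_const_mul (c : ℝ) : dbl m (fun z => c * f z) X t = c * dbl m f X t := by
  unfold dbl
  simp only [sl_const_mul]
  exact intervalIntegral.integral_const_mul _ _

theorem integral_time_mono_right {h : ℝ → ℝ} (hh : ContinuousOn h (Icc 0 T))
    (ht : t ∈ Icc 0 T) (h0 : ∀ τ ∈ Icc 0 T, 0 ≤ h τ) :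
    ∫ τ in (0:ℝ)..t, h τ ≤ ∫ τ in (0:ℝ)..T, h τ := by
  have hTT : T ∈ Icc 0 T := ⟨ht.1.trans ht.2, le_rfl⟩
  have h1 := intervalIntegrable_of_continuousOn_Icc hh ht
  have h2 := intervalIntegrable_of_continuousOn_Icc hh hTT
  have e := intervalIntegral.integral_add_adjacent_intervals h1 (h1.symm.trans h2)
  have : 0 ≤ ∫ τ in t..T, h τ := intervalIntegral.integral_nonneg ht.2
    (fun τ hτ => h0 τ ⟨ht.1.trans hτ.1, hτ.2⟩)
  linarith

theorem dbl_mono_time (hm : 0 < m) (hf : ContinuousOn f (dom m T)) (ht : t ∈ Icc 0 T) (hX : 0 ≤ X)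
    (h : ∀ z ∈ dom m T, 0 ≤ f z) : dbl m f X t ≤ dbl m f X T :=
  integral_time_mono_right (continuousOn_sl hm hX hf) ht (fun _ hτ => sl_nonneg hm hτ hX h)

end Slices

/-- The cutoff `(1 - x / X) ^ 2`, used on `x ≤ X`. -/
noncomputable def cut (X : ℝ) (z : ℝ × ℝ) : ℝ := (1 - z.1 / X) ^ 2

theorem continuous_cut (X : ℝ) : Continuous (cut X) := by unfold cut; fun_prop

theorem cut_nonneg (X : ℝ) (z : ℝ × ℝ) : 0 ≤ cut X z := sq_nonneg _

theorem one_sub_div_mem {m T X : ℝ} (hm : 0 < m) (hX : 0 < X) {z : ℝ × ℝ} (hz : z ∈ dom m T)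
    (hzX : z.1 ≤ X) : 0 ≤ 1 - z.1 / X ∧ 1 - z.1 / X ≤ 1 + m * T / X := by
  constructor
  · rw [sub_nonneg, div_le_one hX]; exact hzX
  · have h1 : -(m * T) ≤ z.1 := le_trans (neg_le_neg (by gcongr; exact hz.1.2)) hz.2
    have : -(m * T) / X ≤ z.1 / X := by gcongr
    rw [neg_div] at this
    linarith

theorem cut_le {m T X : ℝ} (hm : 0 < m) (hX : 0 < X) {z : ℝ × ℝ} (hz : z ∈ dom m T)
    (hzX : z.1 ≤ X) : cut X z ≤ (1 + m * T / X) ^ 2 := by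
  obtain ⟨h1, h2⟩ := one_sub_div_mem hm hX hz hzX
  unfold cut; gcongr

/-- For fixed `Y` the cutoff is at least (1 - Y/X)² on x ≤ Y, which tends to 1 as X grows; outside,
the integrands are nonnegative and can be dropped. -/
theorem cutoff_limit {m T : ℝ} (hm : 0 < m) {g D : ℝ × ℝ → ℝ}
    (hg : ContinuousOn g (dom m T)) (hD : ContinuousOn D (dom m T)) (g0 : ∀ z ∈ dom m T, 0 ≤ g z)
    (D0 : ∀ z ∈ dom m T, 0 ≤ D z) {t B : ℝ} (ht : t ∈ Icc 0 T)
    (h : ∀ η > 0, ∃ X0, ∀ X, X0 ≤ X →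
      sl m (fun z => cut X z * g z) X t + dbl m (fun z => cut X z * D z) X t ≤ B + η)
    {Y : ℝ} (hY : 0 ≤ Y) : sl m g Y t + dbl m D Y t ≤ B := by
  refine le_of_forall_pos_le_add fun η hη => ?_
  obtain ⟨X0, hX0⟩ := h η hη
  have hlim : Tendsto (fun X : ℝ => (1 - Y / X) ^ 2 * (sl m g Y t + dbl m D Y t)) atTop
      (𝓝 ((1 - 0) ^ 2 * (sl m g Y t + dbl m D Y t))) :=
    ((tendsto_const_nhds.sub (tendsto_const_nhds.div_atTop tendsto_id)).pow 2).mul_const _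
  have hev : ∀ᶠ X in atTop, (1 - Y / X) ^ 2 * (sl m g Y t + dbl m D Y t) ≤ B + η := by
    filter_upwards [eventually_ge_atTop X0, eventually_gt_atTop Y, eventually_gt_atTop 0]
      with X h1 h2 h3
    refine le_trans ?_ (hX0 X h1)
    have key : ∀ f : ℝ × ℝ → ℝ, (∀ z ∈ dom m T, 0 ≤ f z) → ∀ z ∈ dom m T, z.1 ≤ Y →
        (1 - Y / X) ^ 2 * f z ≤ cut X z * f z := by
      intro f hf z hz hzY
      have : 0 ≤ 1 - Y / X := by rw [sub_nonneg, div_le_one h3]; exact h2.le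
      unfold cut
      have h4 : z.1 / X ≤ Y / X := by gcongr
      have := hf z hz
      gcongr
    have hc := (continuous_cut X).continuousOn (s := dom m T)
    rw [mul_add, ← sl_const_mul, ← dbl_const_mul]
    apply add_le_add
    · exact (sl_mono hm (continuousOn_const.mul hg) (hc.mul hg) ht hY (key g g0)).trans
        (sl_mono_right hm (hc.mul hg) ht hY h2.le (fun z hz => mul_nonneg (cut_nonneg _ _) (g0 z hz)))
    · exact (dbl_mono hm (continuousOn_const.mul hD) (hc.mul hD) ht hY (key D D0)).trans
        (dbl_mono_right hm (hc.mul hD) ht hY h2.le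
          (fun z hz => mul_nonneg (cut_nonneg _ _) (D0 z hz)))
  have := le_of_tendsto hlim hev
  simpa using this

/-- Integration by parts against the cutoff, with the flux controlled by a subquadratic weight. -/
theorem sl_cut_flux_le {m T : ℝ} (hm : 0 < m) {Fl Flx E Rp : ℝ × ℝ → ℝ}
    (hFl : ContinuousOn Fl (dom m T)) (hFlx : ContinuousOn Flx (dom m T))
    (hE : ContinuousOn E (dom m T))
    (dFl : HasDx m T Fl Flx) (Fl_bdry : ∀ t ∈ Icc 0 T, Fl (-(m * t), t) = 0)
    {L η X Einf t : ℝ} (hL : 0 ≤ L) (hη : 0 ≤ η) (hX : 0 < X) (hXm : m * T ≤ X)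
    (E0 : ∀ z ∈ dom m T, 0 ≤ E z) (Fl_le : ∀ z ∈ dom m T, |Fl z| ≤ L * Rp z * E z)
    (hRp : ∀ z ∈ dom m T, z.1 ≤ X → Rp z ≤ η * X) (ht : t ∈ Icc 0 T)
    (hEinf : sl m E X t ≤ Einf) :
    sl m (fun z => cut X z * Flx z) X t ≤ 4 * L * η * Einf := by
  have hb := neg_mul_le hm ht.1 hX.le
  have dcut : HasDx m T (fun z => cut X z * Fl z)
      (fun z => cut X z * Flx z - 2 / X * (1 - z.1 / X) * Fl z) := by
    intro x t hz
    have h1 : HasDerivAt (fun y : ℝ => (1 - y / X) ^ 2) (2 * (1 - x / X) * (-(1 / X))) x := by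
      have := (((hasDerivAt_id x).div_const X).const_sub 1).pow 2
      exact this.congr_deriv (by simp)
    exact (h1.hasDerivWithinAt.mul (dFl x t hz)).congr_deriv (by simp only [cut]; ring)
  have hlin : Continuous (fun z : ℝ × ℝ => 2 / X * (1 - z.1 / X)) := by fun_prop
  have hc := (continuous_cut X).continuousOn (s := dom m T)
  have hI := HasDx.integral_eq_sub (f' := fun z => cut X z * Flx z - 2 / X * (1 - z.1 / X) * Fl z)
    ((hc.mul hFlx).sub (hlin.continuousOn.mul hFl)) dcut ht le_rfl hb
  rw [Fl_bdry t ht] at hI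
  have hsub := sl_sub hm (hc.mul hFlx) (hlin.continuousOn.mul hFl) ht hX.le
  -- The cutoff vanishes at X and the flux at the moving boundary, so integration by parts leaves
  -- only the derivative of the cutoff, of size 1/X.
  have hz : cut X (X, t) = 0 := by simp [cut, hX.ne']
  rw [hz] at hI
  have e : sl m (fun z => cut X z * Flx z) X t
      = sl m (fun z => 2 / X * (1 - z.1 / X) * Fl z) X t := by
    have : sl m (fun z => cut X z * Flx z - 2 / X * (1 - z.1 / X) * Fl z) X t = 0 := by
      unfold sl; rw [hI]; ring
    have h2 := hsub.symm.trans this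
    exact sub_eq_zero.1 h2
  rw [e]
  calc sl m (fun z => 2 / X * (1 - z.1 / X) * Fl z) X t
      ≤ sl m (fun z => 4 * L * η * E z) X t := by
        refine sl_mono hm (hlin.continuousOn.mul hFl) (continuousOn_const.mul hE) ht hX.le ?_
        intro z hz hzX
        obtain ⟨h1, h2⟩ := one_sub_div_mem hm hX hz hzX
        have h3 : m * T / X ≤ 1 := by rw [div_le_one hX]; exact hXm
        have h4 : |Fl z| ≤ L * (η * X) * E z := (Fl_le z hz).trans (by
          have := E0 z hz
          have := hRp z hz hzX
          gcongr)
        calc 2 / X * (1 - z.1 / X) * Fl z ≤ 2 / X * (1 - z.1 / X) * |Fl z| := by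
              gcongr; exact le_abs_self _
          _ ≤ 2 / X * 2 * (L * (η * X) * E z) := by
              gcongr; linarith
          _ = 4 * L * η * E z := by field_simp; ring
    _ = 4 * L * η * sl m E X t := sl_const_mul _
    _ ≤ 4 * L * η * Einf := by gcongr

/-- From a pointwise differential inequality `g_t ≤ Fl_x - D + H` to an integrated estimate. -/
theorem energy_estimate {m T : ℝ} (hm : 0 < m) {g gt Fl Flx D H E Rp gl gn gu : ℝ × ℝ → ℝ}
    (cg : ContinuousOn g (dom m T)) (cgt : ContinuousOn gt (dom m T))
    (hFl : ContinuousOn Fl (dom m T)) (hFlx : ContinuousOn Flx (dom m T))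
    (cD : ContinuousOn D (dom m T)) (cH : ContinuousOn H (dom m T))
    (hE : ContinuousOn E (dom m T)) (cgl : ContinuousOn gl (dom m T))
    (cgn : ContinuousOn gn (dom m T)) (cgu : ContinuousOn gu (dom m T))
    (dg : HasDt m T g gt) (dFl : HasDx m T Fl Flx)
    (Fl_bdry : ∀ t ∈ Icc 0 T, Fl (-(m * t), t) = 0)
    (g_bdry : ∀ t ∈ Icc 0 T, 0 ≤ g (-(m * t), t))
    (hle : ∀ z ∈ dom m T, gt z ≤ Flx z - D z + H z)
    (D0 : ∀ z ∈ dom m T, 0 ≤ D z) (H0 : ∀ z ∈ dom m T, 0 ≤ H z)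
    (E0 : ∀ z ∈ dom m T, 0 ≤ E z) (gl0 : ∀ z ∈ dom m T, 0 ≤ gl z)
    (gn0 : ∀ z ∈ dom m T, 0 ≤ gn z) (gu0 : ∀ z ∈ dom m T, 0 ≤ gu z)
    (hgl : ∀ z ∈ dom m T, gl z - gn z ≤ g z) (hgu : ∀ z ∈ dom m T, g z ≤ gu z)
    {L Einf : ℝ} (hL : 0 ≤ L) (Fl_le : ∀ z ∈ dom m T, |Fl z| ≤ L * Rp z * E z)
    (hgrow : ∀ η > 0, ∃ X0, ∀ X, X0 ≤ X → ∀ z ∈ dom m T, z.1 ≤ X → Rp z ≤ η * X)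
    (hEinf : ∀ t ∈ Icc 0 T, ∀ X, 0 ≤ X → sl m E X t ≤ Einf)
    {N1 N2 N3 N4 : ℝ} {t : ℝ} (ht : t ∈ Icc 0 T) (hN1 : ∀ X, 0 ≤ X → sl m gn X t ≤ N1)
    (hN2 : ∀ X, 0 ≤ X → sl m gu X 0 ≤ N2) (hN3 : ∀ X, 0 ≤ X → dbl m H X t ≤ N3)
    (hN4 : m * ∫ τ in (0:ℝ)..t, g (-(m * τ), τ) ≤ N4) {Y : ℝ} (hY : 0 ≤ Y) :
    sl m gl Y t + dbl m D Y t ≤ N1 + N2 + N3 + N4 := by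
  have hT : 0 ≤ T := ht.1.trans ht.2
  have h0T : (0:ℝ) ∈ Icc 0 T := ⟨le_rfl, hT⟩
  have n1 : 0 ≤ N1 := (sl_nonneg hm ht le_rfl gn0).trans (hN1 0 le_rfl)
  have n2 : 0 ≤ N2 := (sl_nonneg hm h0T le_rfl gu0).trans (hN2 0 le_rfl)
  have n3 : 0 ≤ N3 := (dbl_nonneg hm ht le_rfl H0).trans (hN3 0 le_rfl)
  have n4 : 0 ≤ N4 := (mul_nonneg hm.le (intervalIntegral.integral_nonneg ht.1
    (fun τ hτ => g_bdry τ ⟨hτ.1, hτ.2.trans ht.2⟩))).trans hN4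
  have nE : 0 ≤ Einf := (sl_nonneg hm ht le_rfl E0).trans (hEinf t ht 0 le_rfl)
  set B := N1 + N2 + N3 + N4 with hB
  refine cutoff_limit hm cgl cD gl0 D0 ht (B := B) ?_ hY
  intro ε hε
  -- The flux error over [0, T] is at most T · 4 L Einf · η; this η makes it at most ε/2.
  obtain ⟨X1, hX1⟩ := hgrow (ε / (2 * (T * (4 * L * Einf) + 1))) (by positivity)
  have hlim : Tendsto (fun X : ℝ => (1 + m * T / X) ^ 2 * B) atTop (𝓝 ((1 + 0) ^ 2 * B)) :=
    ((tendsto_const_nhds.add (tendsto_const_nhds.div_atTop tendsto_id)).pow 2).mul_const _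
  have hev := hlim.eventually_lt_const (show (1 + 0) ^ 2 * B < B + ε / 2 by linarith)
  obtain ⟨X2, hX2⟩ := eventually_atTop.1 hev
  refine ⟨max (max X1 X2) (max 1 (m * T)), fun X hX => ?_⟩
  have hXX1 : X1 ≤ X := le_trans (le_trans (le_max_left _ _) (le_max_left _ _)) hX
  have hXX2 : X2 ≤ X := le_trans (le_trans (le_max_right _ _) (le_max_left _ _)) hX
  have hXpos : 0 < X := lt_of_lt_of_le one_pos (le_trans (le_trans (le_max_left _ _) (le_max_right _ _)) hX)
  have hXm : m * T ≤ X := le_trans (le_trans (le_max_right _ _) (le_max_right _ _)) hX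
  have hB2 := (hX2 X hXX2).le
  set η := ε / (2 * (T * (4 * L * Einf) + 1)) with hη
  have hη0 : 0 < η := by positivity
  -- The domain reaches down to x = -m T, where the cutoff exceeds 1. Its maximum κ tends to 1, so
  -- the data terms are multiplied by κ and the excess is part of ε.
  set κ := (1 + m * T / X) ^ 2 with hκ
  have hκ0 : 0 ≤ κ := sq_nonneg _
  have hc := (continuous_cut X).continuousOn (s := dom m T)
  have dcg : HasDt m T (fun z => cut X z * g z) (fun z => cut X z * gt z) := fun x t hz hT =>
    (dg x t hz hT).const_mul ((1 - x / X) ^ 2)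
  have hI := HasDt.integral_sub_eq hm (hc.mul cg) (hc.mul cgt) dcg ht hXpos.le
  have cutmul : ∀ f : ℝ × ℝ → ℝ, (∀ z ∈ dom m T, 0 ≤ f z) → ∀ z ∈ dom m T, z.1 ≤ X →
      cut X z * f z ≤ κ * f z := fun f hf z hz hzX =>
    mul_le_mul_of_nonneg_right (cut_le hm hXpos hz hzX) (hf z hz)
  -- the time-derivative term
  have hstep : ∀ τ ∈ Icc 0 T, sl m (fun z => cut X z * gt z) X τ + m * (cut X (-(m * τ), τ) * g (-(m * τ), τ))
      ≤ (4 * L * η * Einf - sl m (fun z => cut X z * D z) X τ + κ * sl m H X τ)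
        + κ * (m * g (-(m * τ), τ)) := by
    intro τ hτ
    have h1 : sl m (fun z => cut X z * gt z) X τ
        ≤ sl m (fun z => (cut X z * Flx z - cut X z * D z) + κ * H z) X τ := by
      refine sl_mono hm (hc.mul cgt) (((hc.mul hFlx).sub (hc.mul cD)).add (continuousOn_const.mul cH))
        hτ hXpos.le ?_
      intro z hz hzX
      have a1 := mul_le_mul_of_nonneg_left (hle z hz) (cut_nonneg X z)
      have a2 := cutmul H H0 z hz hzX
      linarith
    rw [sl_add (f := fun z => cut X z * Flx z - cut X z * D z) (g := fun z => κ * H z) hm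
      ((hc.mul hFlx).sub (hc.mul cD)) (continuousOn_const.mul cH) hτ hXpos.le, sl_const_mul] at h1
    have h1' := sl_sub hm (hc.mul hFlx) (hc.mul cD) hτ hXpos.le
    have h2 := sl_cut_flux_le hm hFl hFlx hE dFl Fl_bdry hL hη0.le hXpos hXm E0 Fl_le
      (fun z hz hzX => hX1 X hXX1 z hz hzX) hτ (hEinf τ hτ X hXpos.le)
    have h3 := mul_le_mul_of_nonneg_right (cut_le hm hXpos (boundary_mem hτ)
      (neg_mul_le hm hτ.1 hXpos.le)) (g_bdry τ hτ)
    have h4 := mul_le_mul_of_nonneg_left h3 hm.le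
    have h1'' : sl m (fun z => cut X z * Flx z - cut X z * D z) X τ
      = sl m (fun z => cut X z * Flx z) X τ - sl m (fun z => cut X z * D z) X τ := h1'
    rw [h1''] at h1
    linarith
  have cs1 := continuousOn_sl hm hXpos.le (hc.mul cgt)
  have cs2 : ContinuousOn (sl m (fun z => cut X z * D z) X) (Icc 0 T) :=
    continuousOn_sl hm hXpos.le (hc.mul cD)
  have cs3 := continuousOn_sl hm hXpos.le cH
  have cb := continuousOn_bdry cg
  have cbc : ContinuousOn (fun τ => cut X (-(m * τ), τ) * g (-(m * τ), τ)) (Icc 0 T) :=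
    continuousOn_bdry (hc.mul cg)
  have hint := integral_time_mono (cs1.add (continuousOn_const.mul cbc))
    (((continuousOn_const.sub cs2).add (continuousOn_const.mul cs3)).add
      (continuousOn_const.mul (continuousOn_const.mul cb))) ht hstep
  have i1 := intervalIntegrable_of_continuousOn_Icc cs2 ht
  have i2 := (intervalIntegrable_of_continuousOn_Icc cs3 ht).const_mul κ
  have i3 := ((intervalIntegrable_of_continuousOn_Icc cb ht).const_mul m).const_mul κ
  have ic : IntervalIntegrable (fun _ : ℝ => 4 * L * η * Einf) volume 0 t := intervalIntegrable_const
  have hexp : ∫ τ in (0:ℝ)..t, ((4 * L * η * Einf - sl m (fun z => cut X z * D z) X τ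
      + κ * sl m H X τ) + κ * (m * g (-(m * τ), τ)))
      = t * (4 * L * η * Einf) - dbl m (fun z => cut X z * D z) X t + κ * dbl m H X t
        + κ * (m * ∫ τ in (0:ℝ)..t, g (-(m * τ), τ)) := by
    rw [intervalIntegral.integral_add ((ic.sub i1).add i2) i3,
      intervalIntegral.integral_add (ic.sub i1) i2, intervalIntegral.integral_sub ic i1,
      intervalIntegral.integral_const, intervalIntegral.integral_const_mul,
      intervalIntegral.integral_const_mul, intervalIntegral.integral_const_mul]
    simp [dbl]
  have hint' : (∫ x in -(m * t)..X, cut X (x, t) * g (x, t)) - ∫ x in (0:ℝ)..X, cut X (x, 0) * g (x, 0)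
      ≤ t * (4 * L * η * Einf) - dbl m (fun z => cut X z * D z) X t + κ * dbl m H X t
        + κ * (m * ∫ τ in (0:ℝ)..t, g (-(m * τ), τ)) := by
    rw [← hexp]; exact hI.trans_le hint
  have hini : ∫ x in (0:ℝ)..X, cut X (x, 0) * g (x, 0) ≤ κ * N2 := by
    have h := sl_mono hm (hc.mul cg) (continuousOn_const.mul cgu) h0T hXpos.le
      (f := fun z => cut X z * g z) (g := fun z => κ * gu z) (fun z hz hzX => by
        have a1 := mul_le_mul_of_nonneg_left (hgu z hz) (cut_nonneg X z)
        exact a1.trans (cutmul gu gu0 z hz hzX))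
    rw [sl_const_mul] at h
    have h' : sl m (fun z => cut X z * g z) X 0 = ∫ x in (0:ℝ)..X, cut X (x, 0) * g (x, 0) := by
      simp [sl]
    rw [← h']
    exact h.trans (mul_le_mul_of_nonneg_left (hN2 X hXpos.le) hκ0)
  have hlow : sl m (fun z => cut X z * gl z) X t - κ * N1
      ≤ ∫ x in -(m * t)..X, cut X (x, t) * g (x, t) := by
    have h := sl_mono hm ((hc.mul cgl).sub (continuousOn_const.mul cgn)) (hc.mul cg) ht hXpos.le
      (f := fun z => cut X z * gl z - κ * gn z) (g := fun z => cut X z * g z) (fun z hz hzX => by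
        have a1 := mul_le_mul_of_nonneg_left (hgl z hz) (cut_nonneg X z)
        have a2 := cutmul gn gn0 z hz hzX
        linarith)
    have h2 := sl_sub hm (hc.mul cgl) (continuousOn_const.mul cgn) ht hXpos.le (f := fun z => cut X z * gl z)
      (g := fun z => κ * gn z)
    rw [h2, sl_const_mul] at h
    have h3 := mul_le_mul_of_nonneg_left (hN1 X hXpos.le) hκ0
    have h4 : sl m (fun z => cut X z * g z) X t = ∫ x in -(m * t)..X, cut X (x, t) * g (x, t) := rfl
    rw [← h4]
    linarith
  have b1 := mul_le_mul_of_nonneg_left (hN3 X hXpos.le) hκ0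
  have b2 := mul_le_mul_of_nonneg_left hN4 hκ0
  have b3 : t * (4 * L * η * Einf) ≤ ε / 2 := by
    have e1 : t * (4 * L * η * Einf) ≤ T * (4 * L * Einf) * η := by
      have := mul_le_mul_of_nonneg_right ht.2 (show 0 ≤ 4 * L * η * Einf by positivity)
      linarith
    have e2 : (T * (4 * L * Einf) + 1) * η = ε / 2 := by
      rw [hη]; field_simp
    linarith
  have e3 : κ * B = κ * N1 + κ * N2 + κ * N3 + κ * N4 := by rw [hB]; ring
  linarith


/-! ### Pointwise, Hardy and trace inequalities for the flow. -/

/-- A function vanishing on the boundary is bounded by the integral of a majorant of the modulus of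
its derivative. -/
theorem HasDx.le_sl_of_boundary {m T : ℝ} (hm : 0 < m) {f f' h : ℝ × ℝ → ℝ}
    (cf' : ContinuousOn f' (dom m T)) (ch : ContinuousOn h (dom m T)) (hd : HasDx m T f f')
    (hle : ∀ z ∈ dom m T, f' z ≤ h z) {x t : ℝ} (hz : (x, t) ∈ dom m T) {c : ℝ}
    (h0 : ∀ z ∈ dom m T, 0 ≤ h z) (hc : ∀ X, 0 ≤ X → sl m h X t ≤ c)
    (hb : f (-(m * t), t) = 0) : f (x, t) ≤ c := by
  have h1 := HasDx.integral_eq_sub cf' hd hz.1 le_rfl hz.2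
  rw [hb, sub_zero] at h1
  rw [← h1]
  have hX := neg_mul_le hm hz.1.1 (le_max_right x 0)
  calc ∫ y in -(m * t)..x, f' (y, t) ≤ ∫ y in -(m * t)..x, h (y, t) :=
        intervalIntegral.integral_mono_on hz.2 (intervalIntegrable_slice cf' hz.1 le_rfl hz.2)
          (intervalIntegrable_slice ch hz.1 le_rfl hz.2) (fun y hy => hle (y, t) ⟨hz.1, hy.1⟩)
    _ ≤ sl m h (max x 0) t := by
        have e := intervalIntegral.integral_add_adjacent_intervals
          (intervalIntegrable_slice ch hz.1 le_rfl hz.2) (intervalIntegrable_slice ch hz.1 hz.2 hX)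
        have : 0 ≤ ∫ y in x..max x 0, h (y, t) := intervalIntegral.integral_nonneg (le_max_left _ _)
          (fun y hy => h0 (y, t) ⟨hz.1, hz.2.trans hy.1⟩)
        unfold sl; linarith
    _ ≤ c := hc _ (le_max_right _ _)

/-- A function vanishing at `x = X` is bounded by the integral of a majorant of minus its
derivative. -/
theorem HasDx.le_sl_of_right {m T : ℝ} {f f' h : ℝ × ℝ → ℝ}
    (cf' : ContinuousOn f' (dom m T)) (ch : ContinuousOn h (dom m T)) (hd : HasDx m T f f')
    {x t X : ℝ} (hle : ∀ z ∈ dom m T, z.1 ≤ X → -f' z ≤ h z) (hz : (x, t) ∈ dom m T) (hxX : x ≤ X)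
    (h0 : ∀ z ∈ dom m T, 0 ≤ h z) (hb : f (X, t) = 0) : f (x, t) ≤ sl m h X t := by
  have h1 := HasDx.integral_eq_sub cf' hd hz.1 hz.2 hxX
  rw [hb, zero_sub] at h1
  have h2 : f (x, t) = ∫ y in x..X, -f' (y, t) := by
    rw [intervalIntegral.integral_neg, h1]; ring
  rw [h2]
  have hbX := hz.2.trans hxX
  calc ∫ y in x..X, -f' (y, t) ≤ ∫ y in x..X, h (y, t) :=
        intervalIntegral.integral_mono_on hxX (intervalIntegrable_slice cf' hz.1 hz.2 hbX).neg
          (intervalIntegrable_slice ch hz.1 hz.2 hbX)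
          (fun y hy => hle (y, t) ⟨hz.1, hz.2.trans hy.1⟩ hy.2)
    _ ≤ sl m h X t := by
        have e := intervalIntegral.integral_add_adjacent_intervals
          (intervalIntegrable_slice ch hz.1 le_rfl hz.2) (intervalIntegrable_slice ch hz.1 hz.2 hbX)
        have : 0 ≤ ∫ y in -(m * t)..x, h (y, t) := intervalIntegral.integral_nonneg hz.2
          (fun y hy => h0 (y, t) ⟨hz.1, hy.1⟩)
        unfold sl; linarith

theorem hasDx_cut_mul {m T X : ℝ} {f f' : ℝ × ℝ → ℝ} (hd : HasDx m T f f') :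
    HasDx m T (fun z => cut X z * f z)
      (fun z => cut X z * f' z - 2 / X * (1 - z.1 / X) * f z) := by
  intro x t hz
  have h1 : HasDerivAt (fun y : ℝ => (1 - y / X) ^ 2) (2 * (1 - x / X) * (-(1 / X))) x := by
    have := (((hasDerivAt_id x).div_const X).const_sub 1).pow 2
    exact this.congr_deriv (by simp)
  exact (h1.hasDerivWithinAt.mul (hd x t hz)).congr_deriv (by simp only [cut]; ring)

theorem cut_le_four {m T X : ℝ} (hm : 0 < m) (hX : 0 < X) (hXm : m * T ≤ X) {z : ℝ × ℝ}
    (hz : z ∈ dom m T) (hzX : z.1 ≤ X) : 1 - z.1 / X ≤ 2 ∧ cut X z ≤ 4 := by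
  obtain ⟨h1, h2⟩ := one_sub_div_mem hm hX hz hzX
  have h3 : m * T / X ≤ 1 := by rw [div_le_one hX]; exact hXm
  refine ⟨by linarith, ?_⟩
  unfold cut
  nlinarith

theorem one_le_cut_boundary {m X t : ℝ} (hm : 0 < m) (hX : 0 < X) (ht : 0 ≤ t) :
    1 ≤ cut X (-(m * t), t) := by
  unfold cut
  have : 0 ≤ m * t / X := by positivity
  simp only [neg_div, sub_neg_eq_add]
  nlinarith

namespace Flow

variable {N : ℕ} {μ γ K m T : ℝ} {V V1 V2 : ℝ → ℝ} {R v vx u ψ ψx ψxx ψt : ℝ × ℝ → ℝ}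

theorem pow_ne (F : Flow N μ γ K m T V V1 V2 R v vx u ψ ψx ψxx ψt) (k : ℕ) :
    ∀ z ∈ dom m T, R z ^ k ≠ 0 := fun z hz => pow_ne_zero _ (by linarith [F.one_le z hz])

theorem one_le_pow (F : Flow N μ γ K m T V V1 V2 R v vx u ψ ψx ψxx ψt) (k : ℕ) :
    ∀ z ∈ dom m T, 1 ≤ R z ^ k := fun z hz => one_le_pow₀ (F.one_le z hz)

theorem contGradG (F : Flow N μ γ K m T V V1 V2 R v vx u ψ ψx ψxx ψt) {vp : ℝ}
    (P : Profile N μ γ K m vp V V1 V2) : ContinuousOn (gradG N V1 R v vx) (dom m T) :=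
  (((F.contR.pow N).mul F.contvx).div F.contv (fun z hz => (F.vpos z hz).ne')).sub
    (continuousOn_comp_radial P.continuousOn_one F.contR F.one_le)

theorem contPhi (F : Flow N μ γ K m T V V1 V2 R v vx u ψ ψx ψxx ψt) {vp : ℝ}
    (P : Profile N μ γ K m vp V V1 V2) : ContinuousOn (fun z => v z - V (R z)) (dom m T) :=
  F.contv.sub (continuousOn_comp_radial P.continuousOn F.contR F.one_le)

theorem dxPhi (F : Flow N μ γ K m T V V1 V2 R v vx u ψ ψx ψxx ψt) {vp : ℝ}
    (P : Profile N μ γ K m vp V V1 V2) :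
    HasDx m T (fun z => v z - V (R z)) (fun z => v z * gradG N V1 R v vx z / R z ^ N) := by
  intro x t hz
  refine ((F.dxv x t hz).sub (HasDx.comp_radial P.hasDeriv F.dxR F.one_le x t hz)).congr_deriv ?_
  have h1 := F.pow_ne N _ hz
  have h2 := (F.vpos _ hz).ne'
  unfold gradG
  field_simp

/-- ψ² vanishes on the boundary and its derivative 2 ψ ψ_x is at most ψ² + ψ_x²; the weight R^{2N} ≥
1 only helps. -/
theorem psi_sq_le (F : Flow N μ γ K m T V V1 V2 R v vx u ψ ψx ψxx ψt) (hm : 0 < m) {t c : ℝ}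
    (hc : ∀ X, 0 ≤ X → sl m (fun z => ψ z ^ 2 + (R z ^ N * ψx z) ^ 2) X t ≤ c) {x : ℝ}
    (hz : (x, t) ∈ dom m T) : ψ (x, t) ^ 2 ≤ c := by
  have cR := F.contR; have cψ := F.contψ; have cψx := F.contψx
  refine HasDx.le_sl_of_boundary (f := fun z => ψ z ^ 2) (f' := fun z => 2 * ψ z * ψx z)
    (h := fun z => ψ z ^ 2 + (R z ^ N * ψx z) ^ 2) hm (by fun_prop) (by fun_prop)
    (fun x t hz => ((F.dxψ x t hz).pow 2).congr_deriv (by simp)) ?_ hz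
    (fun z _ => by positivity) hc (by simp [F.ψ_bdry t hz.1])
  intro z hz
  have h1 := F.one_le_pow N z hz
  have h2 : ψx z ^ 2 ≤ (R z ^ N * ψx z) ^ 2 := by
    rw [mul_pow]; exact le_mul_of_one_le_left (sq_nonneg _) (one_le_pow₀ h1)
  nlinarith [sq_nonneg (ψ z - ψx z)]

/-- Cauchy–Schwarz for φ = ∫ v G / R^N with respect to v dx: the second factor is at most ∫ v / R^N
= R - 1, since R_x = v / R^N and R ≥ 1. -/
theorem phi_sq_le (F : Flow N μ γ K m T V V1 V2 R v vx u ψ ψx ψxx ψt) {vp : ℝ}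
    (P : Profile N μ γ K m vp V V1 V2) {t X x : ℝ}
    (hz : (x, t) ∈ dom m T) (hxX : x ≤ X) :
    (v (x, t) - V (R (x, t))) ^ 2
      ≤ (R (x, t) - 1) * sl m (fun z => v z * gradG N V1 R v vx z ^ 2) X t := by
  set S := sl m (fun z => v z * gradG N V1 R v vx z ^ 2) X t with hS
  have cR := F.contR; have cv := F.contv; have cG := F.contGradG P; have cφ := F.contPhi P
  have cRi : ContinuousOn (fun z => (R z ^ N)⁻¹) (dom m T) := continuousOn_inv_pow N cR F.one_le
  -- Cauchy–Schwarz through the discriminant: the integrand v (l² G² - 2 l G i + i), with i = R^{-N}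
  -- ≤ 1, equals v ((l G - i)² + i (1 - i)) ≥ 0.
  have key : ∀ l : ℝ, 0 ≤ S * (l * l) + (-2 * (v (x, t) - V (R (x, t)))) * l + (R (x, t) - 1) := by
    intro l
    have hbX := hz.2.trans hxX
    have cvG : ContinuousOn (fun z => v z * gradG N V1 R v vx z ^ 2) (dom m T) := cv.mul (cG.pow 2)
    have h1 : ∫ y in -(m * t)..x, (fun z => v z * gradG N V1 R v vx z ^ 2) (y, t) ≤ S := by
      have e := intervalIntegral.integral_add_adjacent_intervals
        (intervalIntegrable_slice cvG hz.1 le_rfl hz.2) (intervalIntegrable_slice cvG hz.1 hz.2 hbX)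
      have : 0 ≤ ∫ y in x..X, (fun z => v z * gradG N V1 R v vx z ^ 2) (y, t) :=
        intervalIntegral.integral_nonneg hxX (fun y hy => by
          have := F.vpos (y, t) ⟨hz.1, hz.2.trans hy.1⟩
          positivity)
      rw [hS]; unfold sl; linarith
    have c2 : ContinuousOn (fun z => v z * gradG N V1 R v vx z / R z ^ N) (dom m T) :=
      (cv.mul cG).div (cR.pow N) (F.pow_ne N)
    have c3 : ContinuousOn (fun z => v z / R z ^ N) (dom m T) := cv.div (cR.pow N) (F.pow_ne N)
    have h2 := HasDx.integral_eq_sub c2 (F.dxPhi P) hz.1 le_rfl hz.2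
    have h3 := HasDx.integral_eq_sub c3 F.dxR hz.1 le_rfl hz.2
    rw [F.v_bdry t hz.1, F.R_bdry t hz.1, sub_self, sub_zero] at h2
    rw [F.R_bdry t hz.1] at h3
    have i1 := intervalIntegrable_slice cvG hz.1 le_rfl hz.2
    have i2 := intervalIntegrable_slice c2 hz.1 le_rfl hz.2
    have i3 := intervalIntegrable_slice c3 hz.1 le_rfl hz.2
    have h4 : 0 ≤ ∫ y in -(m * t)..x, ((l * l) * (fun z => v z * gradG N V1 R v vx z ^ 2) (y, t)
        + (-2 * l) * (fun z => v z * gradG N V1 R v vx z / R z ^ N) (y, t)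
        + (fun z => v z / R z ^ N) (y, t)) := by
      refine intervalIntegral.integral_nonneg hz.2 fun y hy => ?_
      have hy' : (y, t) ∈ dom m T := ⟨hz.1, hy.1⟩
      have hv := F.vpos _ hy'
      have hR := F.one_le_pow N _ hy'
      set g := gradG N V1 R v vx (y, t)
      set i := (R (y, t) ^ N)⁻¹ with hi
      have hi0 : 0 < i := by positivity
      have hi1 : i ≤ 1 := inv_le_one_of_one_le₀ hR
      simp only [div_eq_mul_inv, ← hi]
      have e : l * l * (v (y, t) * g ^ 2) + -2 * l * (v (y, t) * g * i) + v (y, t) * i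
        = v (y, t) * ((l * g - i) ^ 2 + i * (1 - i)) := by ring
      rw [e]
      have : 0 ≤ i * (1 - i) := mul_nonneg hi0.le (by linarith)
      positivity
    rw [intervalIntegral.integral_add ((i1.const_mul _).add (i2.const_mul _)) i3,
      intervalIntegral.integral_add (i1.const_mul _) (i2.const_mul _),
      intervalIntegral.integral_const_mul, intervalIntegral.integral_const_mul, h2, h3] at h4
    nlinarith [mul_le_mul_of_nonneg_left h1 (mul_self_nonneg l)]
  have := discrim_le_zero key
  unfold discrim at this
  nlinarith

/-- Insert φ² ≤ (R - 1) S with S = ∫ v G². It remains to integrate σ(R)(R - 1) in x. Because σ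
contains r^{-2N-2}, this is dominated by Θ'(R) R^{-N} ≤ (1/a) Θ'(R) R_x, an exact derivative. Layer
and tail contribute m⁴/k² and m³: the layer is not only small but also sits where R - 1 is of order
m. -/
theorem hardy (F : Flow N μ γ K m T V V1 V2 R v vx u ψ ψx ψxx ψt) {vp k a : ℝ}
    (P : Profile N μ γ K m vp V V1 V2) (hm : 0 < m) (hN : 1 ≤ N) (hk : 0 < k) (ha : 0 < a)
    (hva : ∀ z ∈ dom m T, a ≤ v z) {t X : ℝ} (ht : t ∈ Icc 0 T) (hX : 0 ≤ X) :
    sl m (fun z => layerWeight N k m (R z) * (v z - V (R z)) ^ 2) X t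
      ≤ (m ^ 3 + m ^ 4 / k ^ 2) / a * sl m (fun z => v z * gradG N V1 R v vx z ^ 2) X t := by
  set S := sl m (fun z => v z * gradG N V1 R v vx z ^ 2) X t with hS
  have hS0 : 0 ≤ S := sl_nonneg hm ht hX (fun z hz => by have := F.vpos z hz; positivity)
  have cR := F.contR; have cv := F.contv; have cφ := F.contPhi P
  have hbX := neg_mul_le hm ht.1 hX
  have cE : ContinuousOn (fun z => Real.exp (-(k * (R z - 1) / m))) (dom m T) := by fun_prop
  have cσ : ContinuousOn (fun z => layerWeight N k m (R z)) (dom m T) :=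
    ((continuousOn_const.mul cE).add continuousOn_const).div (cR.pow _) (F.pow_ne _)
  -- An explicit primitive of m³/r² + m² (r - 1) e^{-k(r-1)/m}, normalized to be nonpositive, so
  -- that the integral is at most -Θ(1) = m³ + m⁴/k².
  set Θ : ℝ → ℝ := fun r => -(m ^ 3 * r⁻¹) - m ^ 3 / k * ((r - 1) * Real.exp (-(k * (r - 1) / m)))
    - m ^ 4 / k ^ 2 * Real.exp (-(k * (r - 1) / m)) with hΘ
  set Θ' : ℝ → ℝ := fun r => m ^ 3 / r ^ 2 + m ^ 2 * ((r - 1) * Real.exp (-(k * (r - 1) / m)))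
    with hΘ'
  have dΘ : ∀ r ∈ Ici (1:ℝ), HasDerivWithinAt Θ (Θ' r) (Ici 1) r := by
    intro r hr
    have hr1 : (1:ℝ) ≤ r := hr
    have hr0 : r ≠ 0 := by linarith
    have he : HasDerivAt (fun r => Real.exp (-(k * (r - 1) / m)))
        (Real.exp (-(k * (r - 1) / m)) * (-(k * 1 / m))) r :=
      (((((hasDerivAt_id r).sub_const 1).const_mul k).div_const m).neg).exp
    have d := ((((hasDerivAt_inv hr0).const_mul (m ^ 3)).neg).sub
      ((((hasDerivAt_id r).sub_const 1).mul he).const_mul (m ^ 3 / k))).sub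
      (he.const_mul (m ^ 4 / k ^ 2))
    refine HasDerivAt.hasDerivWithinAt (d.congr_deriv ?_)
    simp only [hΘ', id]
    field_simp
    ring
  have cΘ' : ContinuousOn (fun z => Θ' (R z)) (dom m T) :=
    (continuousOn_const.div (cR.pow 2) (F.pow_ne 2)).add
      (continuousOn_const.mul ((cR.sub continuousOn_const).mul cE))
  have cRx : ContinuousOn (fun z => v z / R z ^ N) (dom m T) := cv.div (cR.pow N) (F.pow_ne N)
  have hΘint := HasDx.integral_eq_sub (cΘ'.mul cRx) (HasDx.comp_radial dΘ F.dxR F.one_le) ht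
    le_rfl hbX
  have h1 : sl m (fun z => layerWeight N k m (R z) * (v z - V (R z)) ^ 2) X t
      ≤ sl m (fun z => S / a * (Θ' (R z) * (v z / R z ^ N))) X t := by
    have hb := neg_mul_le hm ht.1 hX
    refine intervalIntegral.integral_mono_on hb
      (intervalIntegrable_slice (cσ.mul (cφ.pow 2)) ht le_rfl hb)
      (intervalIntegrable_slice (f := fun z => S / a * (Θ' (R z) * (v z / R z ^ N)))
        (continuousOn_const.mul (cΘ'.mul cRx)) ht le_rfl hb) fun x hx => ?_
    have hz : (x, t) ∈ dom m T := ⟨ht, hx.1⟩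
    have h := F.phi_sq_le P hz hx.2
    rw [← hS] at h
    have hr := F.one_le _ hz
    have hav := hva _ hz
    simp only
    set r := R (x, t) with hrdef
    set E := Real.exp (-(k * (r - 1) / m)) with hE
    have hE0 : 0 < E := Real.exp_pos _
    have hσ0 : 0 ≤ layerWeight N k m r := by unfold layerWeight; positivity
    calc layerWeight N k m r * (v (x, t) - V r) ^ 2
        ≤ layerWeight N k m r * ((r - 1) * S) := mul_le_mul_of_nonneg_left h hσ0
      _ = S * (((m ^ 2 * E + m ^ 3) * (r - 1) / r ^ (N + 2)) / r ^ N) := by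
          unfold layerWeight; rw [show 2 * N + 2 = (N + 2) + N by ring, pow_add, ← hE]
          field_simp
      _ ≤ S * (Θ' r / r ^ N) := by
          gcongr
          have hp : r ^ 3 ≤ r ^ (N + 2) := pow_le_pow_right₀ hr (by omega)
          have hp1 : 1 ≤ r ^ (N + 2) := one_le_pow₀ hr
          have a1 : m ^ 2 * E * (r - 1) / r ^ (N + 2) ≤ m ^ 2 * ((r - 1) * E) := by
            rw [div_le_iff₀ (by positivity)]
            have : 0 ≤ m ^ 2 * ((r - 1) * E) :=
              mul_nonneg (by positivity) (mul_nonneg (by linarith) hE0.le)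
            nlinarith
          have a2 : m ^ 3 * (r - 1) / r ^ (N + 2) ≤ m ^ 3 / r ^ 2 := by
            rw [div_le_div_iff₀ (by positivity) (by positivity)]
            have : (r - 1) * r ^ 2 ≤ r ^ (N + 2) := le_trans (by nlinarith [sq_nonneg r]) hp
            nlinarith [pow_pos hm 3]
          have : (m ^ 2 * E + m ^ 3) * (r - 1) / r ^ (N + 2)
              = m ^ 3 * (r - 1) / r ^ (N + 2) + m ^ 2 * E * (r - 1) / r ^ (N + 2) := by ring
          rw [this]
          exact add_le_add a2 a1
      _ ≤ S / a * (Θ' r * (v (x, t) / r ^ N)) := by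
          have hΘ0 : 0 ≤ Θ' r := by
            have : 0 ≤ (r - 1) * E := mul_nonneg (by linarith) hE0.le
            simp only [hΘ', ← hE]
            positivity
          have e : S / a * (Θ' r * (v (x, t) / r ^ N)) = S * (Θ' r / r ^ N) * (v (x, t) / a) := by
            field_simp
          rw [e]
          have hone : 1 ≤ v (x, t) / a := by rw [le_div_iff₀ ha]; linarith
          exact le_mul_of_one_le_right (by positivity) hone
  rw [sl_const_mul] at h1
  refine h1.trans ?_
  have h2 : sl m (fun z => Θ' (R z) * (v z / R z ^ N)) X t ≤ m ^ 3 + m ^ 4 / k ^ 2 := by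
    have e : sl m (fun z => Θ' (R z) * (v z / R z ^ N)) X t = Θ (R (X, t)) - Θ (R (-(m * t), t)) :=
      hΘint
    rw [e, F.R_bdry t ht]
    have hr := F.one_le (X, t) ⟨ht, hbX⟩
    have e1 : Θ 1 = -(m ^ 3 + m ^ 4 / k ^ 2) := by simp [hΘ]; ring
    have e2 : Θ (R (X, t)) ≤ 0 := by
      have h1 : 0 ≤ m ^ 3 * (R (X, t))⁻¹ := by positivity
      have h2 : 0 ≤ m ^ 3 / k * ((R (X, t) - 1) * Real.exp (-(k * (R (X, t) - 1) / m))) :=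
        mul_nonneg (by positivity) (mul_nonneg (by linarith) (Real.exp_pos _).le)
      have h3 : 0 ≤ m ^ 4 / k ^ 2 * Real.exp (-(k * (R (X, t) - 1) / m)) := by positivity
      simp only [hΘ]; linarith
    linarith
  calc S / a * sl m (fun z => Θ' (R z) * (v z / R z ^ N)) X t ≤ S / a * (m ^ 3 + m ^ 4 / k ^ 2) := by
        gcongr
    _ = (m ^ 3 + m ^ 4 / k ^ 2) / a * S := by ring

/-- Integrates the derivative of cut · ψ_x² from the boundary to X, where the cutoff vanishes. The
free parameter θ splits 2 ψ_x ψ_xx; it will later be of order m, so that the top order term survives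
division by m. -/
theorem trace_le (F : Flow N μ γ K m T V V1 V2 R v vx u ψ ψx ψxx ψt) (hm : 0 < m) {t X θ : ℝ}
    (ht : t ∈ Icc 0 T) (hX : 1 ≤ X) (hXm : m * T ≤ X) (hθ : 0 < θ) :
    ψx (-(m * t), t) ^ 2 ≤ (4 + 16 / θ) * sl m (fun z => (R z ^ N * ψx z) ^ 2) X t
      + θ * sl m (fun z => (R z ^ (2 * N) * ψxx z) ^ 2) X t := by
  have hX0 : 0 < X := by linarith
  have cR := F.contR; have cψx := F.contψx; have cψxx := F.contψxx
  have hc := (continuous_cut X).continuousOn (s := dom m T)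
  have hlin : Continuous (fun z : ℝ × ℝ => 2 / X * (1 - z.1 / X)) := by fun_prop
  have d : HasDx m T (fun z => ψx z ^ 2) (fun z => 2 * ψx z * ψxx z) := fun x t hz =>
    ((F.dxψx x t hz).pow 2).congr_deriv (by simp)
  have cd : ContinuousOn (fun z => 2 * ψx z * ψxx z) (dom m T) := by fun_prop
  have h := HasDx.le_sl_of_right (f := fun z => cut X z * ψx z ^ 2)
    (h := fun z => (4 + 16 / θ) * (R z ^ N * ψx z) ^ 2 + θ * (R z ^ (2 * N) * ψxx z) ^ 2)
    ((hc.mul cd).sub (hlin.continuousOn.mul (cψx.pow 2))) (by fun_prop) (hasDx_cut_mul d) ?_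
    (boundary_mem ht) (neg_mul_le hm ht.1 hX0.le) (fun z _ => by positivity)
    (by simp [cut, hX0.ne'])
  · rw [sl_add (f := fun z => (4 + 16 / θ) * (R z ^ N * ψx z) ^ 2)
      (g := fun z => θ * (R z ^ (2 * N) * ψxx z) ^ 2) hm (by fun_prop) (by fun_prop) ht hX0.le,
      sl_const_mul, sl_const_mul] at h
    refine le_trans ?_ h
    exact le_mul_of_one_le_left (sq_nonneg _) (one_le_cut_boundary hm hX0 ht.1)
  · intro z hz hzX
    obtain ⟨h1, -⟩ := one_sub_div_mem hm hX0 hz hzX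
    obtain ⟨h2, h3⟩ := cut_le_four hm hX0 hXm hz hzX
    have hc0 := cut_nonneg X z
    have r1 := F.one_le_pow N z hz
    have r2 := F.one_le_pow (2 * N) z hz
    have p1 : ψx z ^ 2 ≤ (R z ^ N * ψx z) ^ 2 := by
      rw [mul_pow]; exact le_mul_of_one_le_left (sq_nonneg _) (one_le_pow₀ r1)
    have p2 : ψxx z ^ 2 ≤ (R z ^ (2 * N) * ψxx z) ^ 2 := by
      rw [mul_pow]; exact le_mul_of_one_le_left (sq_nonneg _) (one_le_pow₀ r2)
    have hX2 : 2 / X ≤ 2 := by rw [div_le_iff₀ hX0]; linarith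
    have t1 : 2 / X * (1 - z.1 / X) * ψx z ^ 2 ≤ 4 * ψx z ^ 2 := by
      have : 2 / X * (1 - z.1 / X) ≤ 2 * 2 := by gcongr
      nlinarith [sq_nonneg (ψx z)]
    have t2 : -(2 * ψx z * ψxx z) ≤ 4 / θ * ψx z ^ 2 + θ / 4 * ψxx z ^ 2 := by
      have : 0 ≤ (4 / θ) * (ψx z + θ / 4 * ψxx z) ^ 2 := by positivity
      have e : (4 / θ) * (ψx z + θ / 4 * ψxx z) ^ 2
        = 4 / θ * ψx z ^ 2 + 2 * ψx z * ψxx z + θ / 4 * ψxx z ^ 2 := by field_simp; ring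
      linarith
    have t3 : 0 ≤ 4 / θ * ψx z ^ 2 + θ / 4 * ψxx z ^ 2 := by positivity
    have t4 : cut X z * -(2 * ψx z * ψxx z) ≤ 4 * (4 / θ * ψx z ^ 2 + θ / 4 * ψxx z ^ 2) :=
      (mul_le_mul_of_nonneg_left t2 hc0).trans (mul_le_mul_of_nonneg_right h3 t3)
    have t5 : (4 + 16 / θ) * ψx z ^ 2 ≤ (4 + 16 / θ) * (R z ^ N * ψx z) ^ 2 := by gcongr
    have t6 : θ * ψxx z ^ 2 ≤ θ * (R z ^ (2 * N) * ψxx z) ^ 2 := by gcongr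
    have e : 4 * (4 / θ * ψx z ^ 2 + θ / 4 * ψxx z ^ 2) + 4 * ψx z ^ 2
      = (4 + 16 / θ) * ψx z ^ 2 + θ * ψxx z ^ 2 := by ring
    simp only [Pi.sub_apply, Pi.mul_apply, Pi.pow_apply]
    linarith

/-- The pointwise bound needed for the cubic term (R^N ψ_x)² G². The cutoff stays on both sides
because the uncut integral of ψ_xx² is not yet known to be finite. -/
theorem cut_sq_le (F : Flow N μ γ K m T V V1 V2 R v vx u ψ ψx ψxx ψt) (hm : 0 < m) (hN : 1 ≤ N)
    {b : ℝ} (hb : 0 ≤ b) (hvb : ∀ z ∈ dom m T, v z ≤ b) {x t X : ℝ} (hz : (x, t) ∈ dom m T)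
    (hxX : x ≤ X) (hX : 1 ≤ X) (hXm : m * T ≤ X) :
    cut X (x, t) * (R (x, t) ^ N * ψx (x, t)) ^ 2
      ≤ (8 + 8 * N * b) * sl m (fun z => (R z ^ N * ψx z) ^ 2) X t
        + sl m (fun z => cut X z * (R z ^ (2 * N) * ψxx z) ^ 2) X t := by
  have hX0 : 0 < X := by linarith
  have cR := F.contR; have cv := F.contv; have cψx := F.contψx; have cψxx := F.contψxx
  have hc := (continuous_cut X).continuousOn (s := dom m T)
  have hlin : Continuous (fun z : ℝ × ℝ => 2 / X * (1 - z.1 / X)) := by fun_prop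
  have dp := HasDx.pow_mul hN F.one_le F.dxR F.dxψx
  have cdp := continuousOn_divg (N := N) cR F.one_le cv cψx cψxx
  have d : HasDx m T (fun z => (R z ^ N * ψx z) ^ 2)
      (fun z => 2 * (R z ^ N * ψx z) * divg N R v ψx ψxx z) := fun x t hz =>
    ((dp x t hz).pow 2).congr_deriv (by simp)
  have cd : ContinuousOn (fun z => 2 * (R z ^ N * ψx z) * divg N R v ψx ψxx z) (dom m T) :=
    (continuousOn_const.mul ((cR.pow N).mul cψx)).mul cdp
  have h := HasDx.le_sl_of_right (f := fun z => cut X z * (R z ^ N * ψx z) ^ 2)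
    (h := fun z => (8 + 8 * N * b) * (R z ^ N * ψx z) ^ 2
      + cut X z * (R z ^ (2 * N) * ψxx z) ^ 2)
    ((hc.mul cd).sub (hlin.continuousOn.mul (((cR.pow N).mul cψx).pow 2)))
    (by fun_prop) (hasDx_cut_mul d) ?_ hz hxX
    (fun z _ => by have := cut_nonneg X z; positivity) (by simp [cut, hX0.ne'])
  · rw [sl_add (f := fun z => (8 + 8 * N * b) * (R z ^ N * ψx z) ^ 2)
      (g := fun z => cut X z * (R z ^ (2 * N) * ψxx z) ^ 2) hm (by fun_prop) (by fun_prop) hz.1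
        hX0.le, sl_const_mul] at h
    exact h
  · intro z hz hzX
    obtain ⟨h1, -⟩ := one_sub_div_mem hm hX0 hz hzX
    obtain ⟨h2, h3⟩ := cut_le_four hm hX0 hXm hz hzX
    have hc0 := cut_nonneg X z
    have hr := F.one_le z hz
    have r1 := F.one_le_pow N z hz
    have hv := F.vpos z hz
    have hvb' := hvb z hz
    set p := R z ^ N * ψx z with hp
    set q := R z ^ (2 * N) * ψxx z with hq
    have hX2 : 2 / X ≤ 2 := by rw [div_le_iff₀ hX0]; linarith
    have t1 : 2 / X * (1 - z.1 / X) * p ^ 2 ≤ 4 * p ^ 2 := by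
      have : 2 / X * (1 - z.1 / X) ≤ 2 * 2 := by gcongr
      nlinarith [sq_nonneg p]
    have e1 : divg N R v ψx ψxx z = q / R z ^ N + N * v z * p / R z ^ (N + 1) := by
      have := F.pow_ne N z hz
      unfold divg; rw [hq, hp, two_mul, pow_add]; field_simp; ring
    have a1 : |q / R z ^ N| ≤ |q| := by
      rw [abs_div, abs_of_pos (by positivity : 0 < R z ^ N)]
      exact div_le_self (abs_nonneg _) r1
    have a2 : |N * v z * p / R z ^ (N + 1)| ≤ N * b * |p| := by
      rw [abs_div, abs_of_pos (by positivity : 0 < R z ^ (N + 1)), abs_mul, abs_mul,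
        abs_of_pos hv, Nat.abs_cast]
      refine (div_le_self (by positivity) (F.one_le_pow (N + 1) z hz)).trans ?_
      gcongr
    have a3 : |divg N R v ψx ψxx z| ≤ |q| + N * b * |p| := by
      rw [e1]; exact (abs_add_le _ _).trans (add_le_add a1 a2)
    have t2 : -(2 * p * divg N R v ψx ψxx z) ≤ (1 + 2 * N * b) * p ^ 2 + q ^ 2 := by
      calc -(2 * p * divg N R v ψx ψxx z) ≤ |2 * p * divg N R v ψx ψxx z| := neg_le_abs _
        _ = 2 * |p| * |divg N R v ψx ψxx z| := by rw [abs_mul, abs_mul, abs_two]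
        _ ≤ 2 * |p| * (|q| + N * b * |p|) := by gcongr
        _ ≤ (1 + 2 * N * b) * p ^ 2 + q ^ 2 := by
            rw [← sq_abs p, ← sq_abs q]
            linarith [sq_nonneg (|p| - |q|)]
    have t3 := mul_le_mul_of_nonneg_left t2 hc0
    have t4 : cut X z * ((1 + 2 * N * b) * p ^ 2) ≤ 4 * ((1 + 2 * N * b) * p ^ 2) :=
      mul_le_mul_of_nonneg_right h3 (by positivity)
    simp only [Pi.sub_apply, Pi.mul_apply, Pi.pow_apply, ← hp]
    linarith

end Flow


/-! ### The relative potential energy. -/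

section Potential

/-- A primitive of the pressure. -/
noncomputable def pressPot (K γ v : ℝ) : ℝ := K * (v ^ (-γ + 1) / (-γ + 1))

theorem hasDerivAt_pressPot {K γ v : ℝ} (hγ : 1 < γ) (hv : 0 < v) :
    HasDerivAt (pressPot K γ) (pressureV K γ v) v := by
  have h := ((Real.hasDerivAt_rpow_const (p := -γ + 1) (Or.inl hv.ne')).div_const (-γ + 1)).const_mul K
  refine h.congr_deriv ?_
  have : -γ + 1 ≠ 0 := by linarith
  rw [pressureV_eq K γ hv, add_sub_cancel_right]
  field_simp

/-- The relative potential energy of `v` with respect to `w`. -/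
noncomputable def relPot (K γ v w : ℝ) : ℝ :=
  pressureV K γ w * (v - w) - (pressPot K γ v - pressPot K γ w)

theorem nonneg_of_deriv_mul_nonneg {f f' : ℝ → ℝ} {a b w v : ℝ}
    (hf : ∀ s ∈ Icc a b, HasDerivAt f (f' s) s) (hw : w ∈ Icc a b) (hv : v ∈ Icc a b)
    (h0 : f w = 0) (h : ∀ s ∈ Icc a b, 0 ≤ f' s * (s - w)) : 0 ≤ f v := by
  rcases lt_trichotomy w v with hlt | heq | hlt
  · obtain ⟨ξ, hξ, e⟩ := exists_hasDerivAt_eq_slope f f' hlt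
      (fun s hs => (hf s ⟨hw.1.trans hs.1, hs.2.trans hv.2⟩).continuousAt.continuousWithinAt)
      (fun s hs => hf s ⟨hw.1.trans hs.1.le, hs.2.le.trans hv.2⟩)
    have h1 := h ξ ⟨hw.1.trans hξ.1.le, hξ.2.le.trans hv.2⟩
    have h2 : 0 ≤ f' ξ := nonneg_of_mul_nonneg_left h1 (by linarith [hξ.1])
    rw [e, h0, sub_zero] at h2
    have h3 : 0 < v - w := by linarith
    have h4 := mul_nonneg h2 h3.le
    rwa [div_mul_cancel₀ _ h3.ne'] at h4
  · rw [← heq, h0]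
  · obtain ⟨ξ, hξ, e⟩ := exists_hasDerivAt_eq_slope f f' hlt
      (fun s hs => (hf s ⟨hv.1.trans hs.1, hs.2.trans hw.2⟩).continuousAt.continuousWithinAt)
      (fun s hs => hf s ⟨hv.1.trans hs.1.le, hs.2.le.trans hw.2⟩)
    have h1 := h ξ ⟨hv.1.trans hξ.1.le, hξ.2.le.trans hw.2⟩
    have h2 : f' ξ ≤ 0 := by
      by_contra hc
      push Not at hc
      have : f' ξ * (ξ - w) < 0 := mul_neg_of_pos_of_neg hc (by linarith [hξ.2])
      linarith
    rw [e, h0, zero_sub] at h2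
    have h3 : 0 < w - v := by linarith
    rw [div_le_iff₀ h3] at h2
    linarith

namespace PressureBounds

variable {K γ a b c C : ℝ}

theorem exists_sub_eq (K γ : ℝ) (ha : 0 < a) {v w : ℝ} (hv : v ∈ Icc a b)
    (hw : w ∈ Icc a b) : ∃ ξ ∈ Icc a b, |ξ - w| ≤ |v - w| ∧
      pressureV K γ v - pressureV K γ w = deriv (pressureV K γ) ξ * (v - w) := by
  have hd : ∀ s ∈ Icc a b, HasDerivAt (pressureV K γ) (deriv (pressureV K γ) s) s := fun s hs =>
    hasDerivAt_pressureV K γ (ha.trans_le hs.1)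
  rcases lt_trichotomy w v with hlt | heq | hlt
  · obtain ⟨ξ, hξ, e⟩ := exists_hasDerivAt_eq_slope (pressureV K γ) _ hlt
      (fun s hs => (hd s ⟨hw.1.trans hs.1, hs.2.trans hv.2⟩).continuousAt.continuousWithinAt)
      (fun s hs => hd s ⟨hw.1.trans hs.1.le, hs.2.le.trans hv.2⟩)
    refine ⟨ξ, ⟨hw.1.trans hξ.1.le, hξ.2.le.trans hv.2⟩, ?_, ?_⟩
    · rw [abs_of_pos (by linarith [hξ.1]), abs_of_pos (by linarith)]; linarith [hξ.2]
    · have : v - w ≠ 0 := by linarith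
      rw [e]; field_simp
  · exact ⟨w, hw, by simp, by simp [heq]⟩
  · obtain ⟨ξ, hξ, e⟩ := exists_hasDerivAt_eq_slope (pressureV K γ) _ hlt
      (fun s hs => (hd s ⟨hv.1.trans hs.1, hs.2.trans hw.2⟩).continuousAt.continuousWithinAt)
      (fun s hs => hd s ⟨hv.1.trans hs.1.le, hs.2.le.trans hw.2⟩)
    refine ⟨ξ, ⟨hv.1.trans hξ.1.le, hξ.2.le.trans hw.2⟩, ?_, ?_⟩
    · rw [abs_of_neg (by linarith [hξ.2]), abs_of_neg (by linarith)]; linarith [hξ.1]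
    · have : w - v ≠ 0 := by linarith
      rw [e]; field_simp; ring

theorem abs_deriv_le (h : PressureBounds K γ a b c C) {v : ℝ} (hv : v ∈ Icc a b) :
    |deriv (pressureV K γ) v| ≤ C := by
  rw [abs_le]
  constructor
  · linarith [h.upper v hv]
  · linarith [h.lower v hv, h.pos, h.le]

theorem abs_taylor_le (h : PressureBounds K γ a b c C) (ha : 0 < a) {v w : ℝ} (hv : v ∈ Icc a b)
    (hw : w ∈ Icc a b) :
    |pressureV K γ v - pressureV K γ w - deriv (pressureV K γ) w * (v - w)| ≤ C * (v - w) ^ 2 := by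
  obtain ⟨ξ, hξ, h1, h2⟩ := exists_sub_eq K γ ha hv hw
  have hC : 0 ≤ C := h.pos.le.trans h.le
  rw [h2, ← sub_mul, abs_mul, ← sq_abs, sq, ← mul_assoc]
  gcongr
  exact (h.lip ξ hξ w hw).trans (by gcongr)

/-- The derivative of the relative potential in its first argument is p(w) - p(s), which by the mean
value theorem lies between the c- and C-multiples of s - w in the appropriate sense. Subtracting l
(s - w)²/2 with l = c or l = C leaves a function with an extremum at w. -/
theorem relPot_bounds (h : PressureBounds K γ a b c C) (hγ : 1 < γ) (ha : 0 < a) {v w : ℝ}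
    (hv : v ∈ Icc a b) (hw : w ∈ Icc a b) :
    c / 2 * (v - w) ^ 2 ≤ relPot K γ v w ∧ relPot K γ v w ≤ C / 2 * (v - w) ^ 2 := by
  have hd : ∀ l : ℝ, ∀ s ∈ Icc a b, HasDerivAt (fun s => relPot K γ s w - l / 2 * (s - w) ^ 2)
      (pressureV K γ w - pressureV K γ s - l * (s - w)) s := by
    intro l s hs
    have h1 := (((hasDerivAt_id s).sub_const w).const_mul (pressureV K γ w)).sub
      ((hasDerivAt_pressPot (K := K) hγ (ha.trans_le hs.1)).sub_const (pressPot K γ w))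
    have h2 := (((hasDerivAt_id s).sub_const w).pow 2).const_mul (l / 2)
    refine (h1.sub h2).congr_deriv ?_
    simp only [id]
    push_cast
    ring
  have hs0 : ∀ s ∈ Icc a b, c * (s - w) ^ 2 ≤ (pressureV K γ w - pressureV K γ s) * (s - w) ∧
      (pressureV K γ w - pressureV K γ s) * (s - w) ≤ C * (s - w) ^ 2 := by
    intro s hs
    obtain ⟨ξ, hξ, -, e⟩ := exists_sub_eq K γ ha hs hw
    have e' : (pressureV K γ w - pressureV K γ s) * (s - w)
      = (-deriv (pressureV K γ) ξ) * (s - w) ^ 2 := by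
      have : pressureV K γ w - pressureV K γ s = -(deriv (pressureV K γ) ξ * (s - w)) := by
        rw [← e]; ring
      rw [this]; ring
    rw [e']
    exact ⟨mul_le_mul_of_nonneg_right (h.lower ξ hξ) (sq_nonneg _),
      mul_le_mul_of_nonneg_right (h.upper ξ hξ) (sq_nonneg _)⟩
  constructor
  · have := nonneg_of_deriv_mul_nonneg (hd c) hw hv (by simp [relPot]) (fun s hs => by
      have := (hs0 s hs).1
      linarith)
    linarith
  · have := nonneg_of_deriv_mul_nonneg (f := fun s => -(relPot K γ s w - C / 2 * (s - w) ^ 2))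
      (fun s hs => ((hd C) s hs).neg) hw hv (by simp [relPot]) (fun s hs => by
      have := (hs0 s hs).2
      linarith)
    linarith

end PressureBounds

end Potential

/-! ### The basic energy estimate. -/

/-- The energy density of the perturbation. -/
noncomputable def enDens (N : ℕ) (V V1 : ℝ → ℝ) (R v vx ψ ψx : ℝ × ℝ → ℝ) (z : ℝ × ℝ) : ℝ :=
  (v z - V (R z)) ^ 2 + ψ z ^ 2 + gradG N V1 R v vx z ^ 2 + (R z ^ N * ψx z) ^ 2

/-- A flow close to a profile, with all the quantitative information used in the estimates. -/
structure Setting (N : ℕ) (μ γ K m T vp k L cp Cp δ : ℝ) (V V1 V2 : ℝ → ℝ)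
    (R v vx u ψ ψx ψxx ψt : ℝ × ℝ → ℝ) : Prop where
  flow : Flow N μ γ K m T V V1 V2 R v vx u ψ ψx ψxx ψt
  prof : Profile N μ γ K m vp V V1 V2
  bounds : ProfileBounds N m vp k L V V1 V2
  press : PressureBounds K γ (vp / 2) (2 * vp) cp Cp
  one_le_N : 1 ≤ N
  hμ : 0 < μ
  hγ : 1 < γ
  hm : 0 < m
  hvp : 0 < vp
  hk : 0 < k
  hL : 1 ≤ L
  hδ : 0 ≤ δ
  mem : ∀ z ∈ dom m T, v z ∈ Icc (vp / 2) (2 * vp)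
  psi_le : ∀ z ∈ dom m T, |ψ z| ≤ δ
  grow : ∀ η > 0, ∃ X0, ∀ X, X0 ≤ X → ∀ z ∈ dom m T, z.1 ≤ X → R z ^ N ≤ η * X

namespace Setting

variable {N : ℕ} {μ γ K m T vp k L cp Cp δ : ℝ} {V V1 V2 : ℝ → ℝ}
  {R v vx u ψ ψx ψxx ψt : ℝ × ℝ → ℝ}

theorem contLayer (S : Setting N μ γ K m T vp k L cp Cp δ V V1 V2 R v vx u ψ ψx ψxx ψt) :
    ContinuousOn (fun z => layerWeight N k m (R z)) (dom m T) := by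
  have cR := S.flow.contR
  have cE : ContinuousOn (fun z => Real.exp (-(k * (R z - 1) / m))) (dom m T) := by fun_prop
  exact ((continuousOn_const.mul cE).add continuousOn_const).div (cR.pow _) (S.flow.pow_ne _)

theorem layer_nonneg (S : Setting N μ γ K m T vp k L cp Cp δ V V1 V2 R v vx u ψ ψx ψxx ψt)
    {z : ℝ × ℝ} (hz : z ∈ dom m T) : 0 ≤ layerWeight N k m (R z) := by
  have := S.flow.one_le z hz
  have := S.hm
  unfold layerWeight
  positivity

theorem contEnDens (S : Setting N μ γ K m T vp k L cp Cp δ V V1 V2 R v vx u ψ ψx ψxx ψt) :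
    ContinuousOn (enDens N V V1 R v vx ψ ψx) (dom m T) :=
  ((((S.flow.contPhi S.prof).pow 2).add (S.flow.contψ.pow 2)).add
    ((S.flow.contGradG S.prof).pow 2)).add (((S.flow.contR.pow N).mul S.flow.contψx).pow 2)

/-- The flux of the basic energy. -/
noncomputable def flux0 (N : ℕ) (μ γ K : ℝ) (V : ℝ → ℝ) (R v ψ ψx : ℝ × ℝ → ℝ) (z : ℝ × ℝ) : ℝ :=
  R z ^ N * ψ z * (μ * (divg N R v ψ ψx z / v z) - (pressureV K γ (v z) - pressureV K γ (V (R z))))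
    - μ * N * (R z ^ N * ψ z * (ψ z / R z))

/-- The `x`-derivative of `flux0`. -/
noncomputable def flux0x (N : ℕ) (μ γ K : ℝ) (V V1 : ℝ → ℝ) (R v vx ψ ψx ψxx : ℝ × ℝ → ℝ)
    (z : ℝ × ℝ) : ℝ :=
  divg N R v ψ ψx z * (μ * (divg N R v ψ ψx z / v z)
      - (pressureV K γ (v z) - pressureV K γ (V (R z))))
    + R z ^ N * ψ z * (μ * fluxx N R v vx ψ ψx ψxx z - (deriv (pressureV K γ) (v z) * vx z
      - deriv (pressureV K γ) (V (R z)) * (V1 (R z) * (v z / R z ^ N))))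
    - μ * N * (divg N R v ψ ψx z * (ψ z / R z) + R z ^ N * ψ z *
      ((ψx z * R z - ψ z * (v z / R z ^ N)) / R z ^ 2))

theorem hasDx_flux0 (S : Setting N μ γ K m T vp k L cp Cp δ V V1 V2 R v vx u ψ ψx ψxx ψt) :
    HasDx m T (flux0 N μ γ K V R v ψ ψx) (flux0x N μ γ K V V1 R v vx ψ ψx ψxx) := by
  intro x t hz
  have F := S.flow
  have hR0 : R (x, t) ≠ 0 := by linarith [F.one_le _ hz]
  have d1 := HasDx.pow_mul S.one_le_N F.one_le F.dxR F.dxψ x t hz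
  have d2 := HasDx.divg_div S.one_le_N F.one_le F.vpos F.dxR F.dxv F.dxψ F.dxψx x t hz
  have d3 : HasDerivWithinAt (fun y => pressureV K γ (v (y, t)))
      (deriv (pressureV K γ) (v (x, t)) * vx (x, t)) (Ici (-(m * t))) x :=
    HasDerivAt.comp_hasDerivWithinAt (h₂ := pressureV K γ) x (hasDerivAt_pressureV K γ (F.vpos _ hz)) (F.dxv x t hz)
  have d4 : HasDerivWithinAt (fun y => pressureV K γ (V (R (y, t))))
      (deriv (pressureV K γ) (V (R (x, t))) * (V1 (R (x, t)) * (v (x, t) / R (x, t) ^ N)))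
      (Ici (-(m * t))) x :=
    HasDerivAt.comp_hasDerivWithinAt (h₂ := pressureV K γ) x
      (hasDerivAt_pressureV K γ (S.prof.pos _ (F.one_le _ hz)))
      (HasDx.comp_radial S.prof.hasDeriv F.dxR F.one_le x t hz)
  exact (d1.mul ((d2.const_mul μ).sub (d3.sub d4))).sub
    ((d1.mul ((F.dxψ x t hz).div (F.dxR x t hz) hR0)).const_mul (μ * N))

/-- The density of the basic energy. -/
noncomputable def energy0 (γ K : ℝ) (V : ℝ → ℝ) (R v ψ : ℝ × ℝ → ℝ) (z : ℝ × ℝ) : ℝ :=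
  ψ z ^ 2 / 2 + relPot K γ (v z) (V (R z))

/-- The `t`-derivative of `energy0`. -/
noncomputable def energy0t (N : ℕ) (γ K m : ℝ) (V V1 : ℝ → ℝ) (R v u ψ ψx ψt : ℝ × ℝ → ℝ)
    (z : ℝ × ℝ) : ℝ :=
  ψ z * ψt z - (pressureV K γ (v z) - pressureV K γ (V (R z)))
      * (divg N R v ψ ψx z + m * (V1 (R z) / R z ^ N) * v z)
    + deriv (pressureV K γ) (V (R z)) * (v z - V (R z)) * (V1 (R z) * u z)

theorem hasDt_energy0 (S : Setting N μ γ K m T vp k L cp Cp δ V V1 V2 R v vx u ψ ψx ψxx ψt) :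
    HasDt m T (energy0 γ K V R v ψ) (energy0t N γ K m V V1 R v u ψ ψx ψt) := by
  intro x t hz hT
  have F := S.flow
  have hV := S.prof.pos _ (F.one_le _ hz)
  have dv := F.dtv x t hz hT
  have dV := HasDt.comp_radial S.hm S.prof.hasDeriv F.dtR F.one_le x t hz hT
  have d1 := HasDerivAt.comp_hasDerivWithinAt (h₂ := pressureV K γ) t (hasDerivAt_pressureV K γ hV) dV
  have d2 := HasDerivAt.comp_hasDerivWithinAt (h₂ := pressPot K γ) t (hasDerivAt_pressPot (K := K) S.hγ (F.vpos _ hz)) dv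
  have d3 := HasDerivAt.comp_hasDerivWithinAt (h₂ := pressPot K γ) t (hasDerivAt_pressPot (K := K) S.hγ hV) dV
  have d := (((F.dtψ x t hz hT).pow 2).div_const 2).add ((d1.mul (dv.sub dV)).sub (d2.sub d3))
  refine d.congr_deriv ?_
  simp only [energy0t, Function.comp_apply, Pi.sub_apply]
  push_cast
  ring

end Setting


theorem abs_le_mul_sqrt {x L s : ℝ} (hL : 1 ≤ L) (hs : 0 ≤ s) (h : x ^ 2 ≤ L * s) :
    |x| ≤ L * √s := by
  apply abs_le_of_sq_le_sq _ (by positivity)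
  rw [mul_pow, Real.sq_sqrt hs]
  exact h.trans (mul_le_mul_of_nonneg_right (by nlinarith) hs)

theorem young {x y θ : ℝ} (hθ : 0 < θ) : x * y ≤ θ * x ^ 2 + y ^ 2 / (4 * θ) := by
  have : 0 ≤ θ * (x - y / (2 * θ)) ^ 2 := by positivity
  have e : θ * (x - y / (2 * θ)) ^ 2 = θ * x ^ 2 - x * y + y ^ 2 / (4 * θ) := by field_simp; ring
  linarith

namespace Setting

variable {N : ℕ} {μ γ K m T vp k L cp Cp δ : ℝ} {V V1 V2 : ℝ → ℝ}
  {R v vx u ψ ψx ψxx ψt : ℝ × ℝ → ℝ}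

/-- The remainder in the balance of the basic energy. -/
noncomputable def err0 (N : ℕ) (γ K m : ℝ) (V V1 : ℝ → ℝ) (r v ψ : ℝ) : ℝ :=
  velSlope N m V V1 r * (m * V r / r ^ N) / V r * (v - V r) * ψ - velSlope N m V V1 r * ψ ^ 2
    - m * (V1 r / r ^ N) * ((pressureV K γ v - pressureV K γ (V r)) * v
      - deriv (pressureV K γ) (V r) * (v - V r) * V r)
    + deriv (pressureV K γ) (V r) * (v - V r) * (V1 r * ψ)

/-- With p = R^N ψ_x and y = ψ/R, the viscous term produces (p + N v y)² / v, whose cross term has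
no sign. The last term of `flux0` has derivative μ N (2 p y + (N - 1) v y²), and removing it leaves
the sum of squares p²/v + N v y². -/
theorem energy0t_eq (S : Setting N μ γ K m T vp k L cp Cp δ V V1 V2 R v vx u ψ ψx ψxx ψt)
    {z : ℝ × ℝ} (hz : z ∈ dom m T) :
    energy0t N γ K m V V1 R v u ψ ψx ψt z = flux0x N μ γ K V V1 R v vx ψ ψx ψxx z
      - μ * ((R z ^ N * ψx z) ^ 2 / v z + N * v z * (ψ z / R z) ^ 2)
      + err0 N γ K m V V1 (R z) (v z) (ψ z) := by
  have F := S.flow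
  have hR0 : R z ≠ 0 := by linarith [F.one_le _ hz]
  have hRN : R z ^ N ≠ 0 := F.pow_ne N z hz
  have hv0 := (F.vpos z hz).ne'
  have hd : divg N R v ψ ψx z = R z ^ N * ψx z + N * v z * ψ z / R z := rfl
  unfold energy0t flux0x err0
  rw [F.momentum z hz, F.u_eq z hz]
  unfold srcMom gradG
  generalize fluxx N R v vx ψ ψx ψxx z = fx at *
  generalize velSlope N m V V1 (R z) = vs at *
  generalize deriv (pressureV K γ) (v z) = p1 at *
  generalize deriv (pressureV K γ) (V (R z)) = p2 at *
  generalize pressureV K γ (v z) - pressureV K γ (V (R z)) = dp at *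
  rw [hd]
  generalize hVR : V (R z) = VR at *
  generalize V1 (R z) = V1R at *
  generalize hRn : R z ^ N = RN at *
  generalize R z = r at *
  generalize v z = w at *
  generalize ψ z = y at *
  generalize ψx z = yx at *
  have hVR0 : vs * (m * VR / RN) / VR * (w - VR) * y - y * (vs * (m * VR / RN) / VR * (w - VR)) = 0 := by
    ring
  generalize vs * (m * VR / RN) / VR = A at *
  field_simp
  ring

/-- Every coefficient multiplying φ is small through σ: the mixed terms φ ψ carry √σ with one factor
1/R transferred to ψ, and the pressure terms combine into a Taylor remainder quadratic in φ carrying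
σ. Only ũ_r ψ² has no φ, and it is small through m. -/
theorem abs_err0_le (S : Setting N μ γ K m T vp k L cp Cp δ V V1 V2 R v vx u ψ ψx ψxx ψt)
    {z : ℝ × ℝ} (hz : z ∈ dom m T) :
    |err0 N γ K m V V1 (R z) (v z) (ψ z)| ≤ L * m * (ψ z / R z) ^ 2
      + L * (2 / vp + Cp) * (|ψ z / R z| * (√(layerWeight N k m (R z)) * |v z - V (R z)|))
      + L * Cp * (2 * vp + 1) * (layerWeight N k m (R z) * (v z - V (R z)) ^ 2) := by
  have F := S.flow
  have hr := F.one_le z hz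
  have hr' : R z ∈ Ici (1:ℝ) := hr
  have hVm := S.bounds.mem _ hr'
  have hvm := S.mem z hz
  have hvp := S.hvp
  have hσ := S.layer_nonneg hz
  have hm := S.hm
  have hL := S.hL
  have hCp : 0 < Cp := S.press.pos.trans_le S.press.le
  have hvel : |velSlope N m V V1 (R z)| ≤ L * m / R z ^ 2 := S.bounds.vel_slope _ hr'
  have hvs : |R z * (velSlope N m V V1 (R z) * (m * V (R z) / R z ^ N))|
      ≤ L * √(layerWeight N k m (R z)) := abs_le_mul_sqrt hL hσ (S.bounds.vel_sq _ hr')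
  have hsl : |R z * V1 (R z)| ≤ L * √(layerWeight N k m (R z)) :=
    abs_le_mul_sqrt hL hσ (S.bounds.slope_sq _ hr')
  have hsm := S.bounds.slope_mul _ hr'
  have htay := S.press.abs_taylor_le (by linarith) hvm hVm
  have hp2 := S.press.abs_deriv_le hVm
  unfold err0
  set r := R z with hrdef
  set σ := layerWeight N k m r with hσdef
  set φ := v z - V r with hφ
  set y := ψ z / r with hy
  have hr0 : 0 < r := by linarith
  have hψ : ψ z = r * y := by rw [hy]; field_simp
  have hV0 : 0 < V r := by linarith [hVm.1]
  have t1 : |velSlope N m V V1 r * (m * V r / r ^ N) / V r * φ * ψ z|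
      ≤ L * (2 / vp) * (|y| * (√σ * |φ|)) := by
    have e : velSlope N m V V1 r * (m * V r / r ^ N) / V r * φ * ψ z
      = (r * (velSlope N m V V1 r * (m * V r / r ^ N))) * ((V r)⁻¹ * (φ * y)) := by
      rw [hψ]; field_simp
    rw [e, abs_mul, abs_mul (V r)⁻¹, abs_mul φ, abs_of_pos (inv_pos.2 hV0)]
    have hi : (V r)⁻¹ ≤ 2 / vp := by
      rw [inv_le_comm₀ hV0 (by positivity), inv_div]; exact hVm.1
    calc _ ≤ L * √σ * (2 / vp * (|φ| * |y|)) := by gcongr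
      _ = _ := by ring
  have t2 : |velSlope N m V V1 r * ψ z ^ 2| ≤ L * m * y ^ 2 := by
    rw [abs_mul, abs_of_nonneg (sq_nonneg (ψ z))]
    calc _ ≤ L * m / r ^ 2 * ψ z ^ 2 := by gcongr
      _ = _ := by rw [hψ]; field_simp
  have t3 : |m * (V1 r / r ^ N) * ((pressureV K γ (v z) - pressureV K γ (V r)) * v z
      - deriv (pressureV K γ) (V r) * φ * V r)| ≤ L * Cp * (2 * vp + 1) * (σ * φ ^ 2) := by
    rw [abs_mul]
    have a1 : |m * (V1 r / r ^ N)| ≤ L * σ := by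
      rw [abs_mul, abs_of_pos hm, abs_div, abs_of_pos (by positivity : 0 < r ^ N)]
      refine le_trans ?_ hsm
      rw [mul_comm, div_mul_eq_mul_div]
      have : r ^ 1 ≤ r ^ N := pow_le_pow_right₀ hr S.one_le_N
      rw [pow_one] at this
      gcongr
    have a2 : |(pressureV K γ (v z) - pressureV K γ (V r)) * v z
        - deriv (pressureV K γ) (V r) * φ * V r| ≤ Cp * (2 * vp + 1) * φ ^ 2 := by
      have e : (pressureV K γ (v z) - pressureV K γ (V r)) * v z
          - deriv (pressureV K γ) (V r) * φ * V r
        = (pressureV K γ (v z) - pressureV K γ (V r) - deriv (pressureV K γ) (V r) * φ) * v z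
          + deriv (pressureV K γ) (V r) * φ ^ 2 := by rw [hφ]; ring
      rw [e]
      refine (abs_add_le _ _).trans ?_
      rw [abs_mul, abs_mul, abs_of_pos (F.vpos z hz), abs_of_nonneg (sq_nonneg φ)]
      calc _ ≤ Cp * φ ^ 2 * (2 * vp) + Cp * φ ^ 2 := by have := (F.vpos z hz).le; gcongr; exact hvm.2
        _ = _ := by ring
    calc _ ≤ L * σ * (Cp * (2 * vp + 1) * φ ^ 2) := by gcongr
      _ = _ := by ring
  have t4 : |deriv (pressureV K γ) (V r) * φ * (V1 r * ψ z)| ≤ L * Cp * (|y| * (√σ * |φ|)) := by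
    have e : deriv (pressureV K γ) (V r) * φ * (V1 r * ψ z)
      = deriv (pressureV K γ) (V r) * ((r * V1 r) * (φ * y)) := by rw [hψ]; ring
    rw [e, abs_mul, abs_mul (r * V1 r), abs_mul φ]
    calc _ ≤ Cp * (L * √σ * (|φ| * |y|)) := by gcongr
      _ = _ := by ring
  have h1 := abs_add_le (velSlope N m V V1 r * (m * V r / r ^ N) / V r * φ * ψ z
    - velSlope N m V V1 r * ψ z ^ 2 - m * (V1 r / r ^ N) * ((pressureV K γ (v z)
      - pressureV K γ (V r)) * v z - deriv (pressureV K γ) (V r) * φ * V r))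
    (deriv (pressureV K γ) (V r) * φ * (V1 r * ψ z))
  have h2 := abs_sub (velSlope N m V V1 r * (m * V r / r ^ N) / V r * φ * ψ z
    - velSlope N m V V1 r * ψ z ^ 2) (m * (V1 r / r ^ N) * ((pressureV K γ (v z)
      - pressureV K γ (V r)) * v z - deriv (pressureV K γ) (V r) * φ * V r))
  have h3 := abs_sub (velSlope N m V V1 r * (m * V r / r ^ N) / V r * φ * ψ z)
    (velSlope N m V V1 r * ψ z ^ 2)
  linarith

/-- Differential inequality for the basic energy. -/
theorem exists_energy0_le (N : ℕ) {μ vp L : ℝ} (cp Cp : ℝ) (hμ : 0 < μ) (hvp : 0 < vp)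
    (hL : 1 ≤ L) (hCp : 0 < Cp) : ∃ c0 C0 m1, 0 < c0 ∧ 0 < C0 ∧ 0 < m1 ∧
      ∀ {γ K m T k δ : ℝ} {V V1 V2 : ℝ → ℝ} {R v vx u ψ ψx ψxx ψt : ℝ × ℝ → ℝ},
      Setting N μ γ K m T vp k L cp Cp δ V V1 V2 R v vx u ψ ψx ψxx ψt → m ≤ m1 →
      ∀ z ∈ dom m T, energy0t N γ K m V V1 R v u ψ ψx ψt z
        ≤ flux0x N μ γ K V V1 R v vx ψ ψx ψxx z
          - c0 * ((R z ^ N * ψx z) ^ 2 + (ψ z / R z) ^ 2)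
          + C0 * (layerWeight N k m (R z) * (v z - V (R z)) ^ 2) := by
  set A := L * (2 / vp + Cp) with hA
  have hA0 : 0 < A := by positivity
  -- The available multiple of (ψ/R)² is μ vp / 2: the restriction on m spends half of it on ũ_r ψ²,
  -- Young's inequality spends a quarter on the mixed terms, and the rest is the second entry of the
  -- minimum.
  refine ⟨min (μ / (2 * vp)) (μ * vp / 8), A ^ 2 * 2 / (μ * vp) + L * Cp * (2 * vp + 1),
    μ * vp / (4 * L), by positivity, by positivity, by positivity, ?_⟩
  intro γ K m T k δ V V1 V2 R v vx u ψ ψx ψxx ψt S hm1 z hz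
  rw [S.energy0t_eq hz]
  have he := (le_abs_self _).trans (S.abs_err0_le hz)
  have hσ := S.layer_nonneg hz
  have hv := S.mem z hz
  have hv0 := S.flow.vpos z hz
  set σ := layerWeight N k m (R z)
  set φ := v z - V (R z)
  set y := ψ z / R z
  set p := R z ^ N * ψx z
  have hN : (1:ℝ) ≤ N := by exact_mod_cast S.one_le_N
  have a1 : μ / (2 * vp) * p ^ 2 ≤ μ * (p ^ 2 / v z) := by
    rw [mul_div_assoc', div_mul_eq_mul_div]
    gcongr
    exact hv.2
  have a2 : μ * vp / 2 * y ^ 2 ≤ μ * (N * v z * y ^ 2) := by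
    have : vp / 2 ≤ N * v z := by nlinarith [hv.1]
    calc μ * vp / 2 * y ^ 2 = μ * (vp / 2 * y ^ 2) := by ring
      _ ≤ _ := by gcongr
  have a3 : L * m * y ^ 2 ≤ μ * vp / 4 * y ^ 2 := by
    gcongr
    rw [le_div_iff₀ (by positivity)] at hm1
    linarith
  have a4 : A * (|y| * (√σ * |φ|)) ≤ μ * vp / 8 * y ^ 2 + A ^ 2 * 2 / (μ * vp) * (σ * φ ^ 2) := by
    have := young (x := |y|) (y := A * (√σ * |φ|)) (θ := μ * vp / 8) (by positivity)
    rw [sq_abs, mul_pow A, mul_pow √σ, Real.sq_sqrt hσ, sq_abs] at this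
    have e : A ^ 2 * (σ * φ ^ 2) / (4 * (μ * vp / 8)) = A ^ 2 * 2 / (μ * vp) * (σ * φ ^ 2) := by
      field_simp; ring
    linarith
  have b1 : min (μ / (2 * vp)) (μ * vp / 8) * p ^ 2 ≤ μ / (2 * vp) * p ^ 2 := by
    gcongr; exact min_le_left _ _
  have b2 : min (μ / (2 * vp)) (μ * vp / 8) * y ^ 2 ≤ μ * vp / 8 * y ^ 2 := by
    gcongr; exact min_le_right _ _
  linarith

end Setting

namespace Setting

variable {N : ℕ} {μ γ K m T vp k L cp Cp δ : ℝ} {V V1 V2 : ℝ → ℝ}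
  {R v vx u ψ ψx ψxx ψt : ℝ × ℝ → ℝ}

theorem enDens_nonneg (z : ℝ × ℝ) : 0 ≤ enDens N V V1 R v vx ψ ψx z := by
  unfold enDens; positivity

theorem abs_divg_le (S : Setting N μ γ K m T vp k L cp Cp δ V V1 V2 R v vx u ψ ψx ψxx ψt)
    {z : ℝ × ℝ} (hz : z ∈ dom m T) :
    |divg N R v ψ ψx z| ≤ |R z ^ N * ψx z| + 2 * N * vp * |ψ z / R z| := by
  have hv := S.mem z hz
  have hv0 := S.flow.vpos z hz
  unfold divg
  refine (abs_add_le _ _).trans (add_le_add le_rfl ?_)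
  rw [mul_div_assoc, abs_mul, abs_mul, Nat.abs_cast, abs_of_pos hv0]
  have : (N:ℝ) * v z ≤ 2 * N * vp := by nlinarith [hv.2, (Nat.cast_nonneg N : (0:ℝ) ≤ N)]
  gcongr

theorem abs_div_radius_le (S : Setting N μ γ K m T vp k L cp Cp δ V V1 V2 R v vx u ψ ψx ψxx ψt)
    {z : ℝ × ℝ} (hz : z ∈ dom m T) (y : ℝ) : |y / R z| ≤ |y| := by
  have hr := S.flow.one_le z hz
  rw [abs_div, abs_of_pos (by linarith : 0 < R z)]
  exact div_le_self (abs_nonneg _) hr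

theorem psi_mul_divg_le (S : Setting N μ γ K m T vp k L cp Cp δ V V1 V2 R v vx u ψ ψx ψxx ψt)
    {z : ℝ × ℝ} (hz : z ∈ dom m T) :
    |ψ z * (divg N R v ψ ψx z / v z)| ≤ 2 / vp * (1 + 2 * N * vp) * enDens N V V1 R v vx ψ ψx z := by
  have hv := S.mem z hz
  have hv0 := S.flow.vpos z hz
  have hvp := S.hvp
  have h1 := S.abs_divg_le hz
  have h2 := S.abs_div_radius_le hz (ψ z)
  set p := R z ^ N * ψx z with hp
  have hi : (v z)⁻¹ ≤ 2 / vp := by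
    rw [inv_le_comm₀ hv0 (by positivity), inv_div]; exact hv.1
  have h3 : |divg N R v ψ ψx z| ≤ |p| + 2 * N * vp * |ψ z| := h1.trans (by gcongr)
  rw [div_eq_mul_inv, abs_mul, abs_mul, abs_of_pos (inv_pos.2 hv0)]
  calc |ψ z| * (|divg N R v ψ ψx z| * (v z)⁻¹)
      ≤ |ψ z| * ((|p| + 2 * N * vp * |ψ z|) * (2 / vp)) := by gcongr
    _ = 2 / vp * (|ψ z| * |p| + 2 * N * vp * |ψ z| ^ 2) := by ring
    _ ≤ 2 / vp * ((1 + 2 * N * vp) * enDens N V V1 R v vx ψ ψx z) := by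
        gcongr
        have e1 : |ψ z| * |p| ≤ enDens N V V1 R v vx ψ ψx z := by
          unfold enDens
          rw [← hp, ← sq_abs p, ← sq_abs (ψ z)]
          have := two_mul_le_add_sq |ψ z| |p|
          have := mul_nonneg (abs_nonneg (ψ z)) (abs_nonneg p)
          have := sq_nonneg (v z - V (R z))
          have := sq_nonneg (gradG N V1 R v vx z)
          linarith
        have e2 : |ψ z| ^ 2 ≤ enDens N V V1 R v vx ψ ψx z := by
          unfold enDens
          rw [sq_abs]
          have := sq_nonneg (v z - V (R z))
          have := sq_nonneg (gradG N V1 R v vx z)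
          have := sq_nonneg (R z ^ N * ψx z)
          linarith
        have e3 := mul_le_mul_of_nonneg_left e2 (by positivity : 0 ≤ 2 * N * vp)
        linarith
    _ = _ := by ring

theorem abs_flux0_le (S : Setting N μ γ K m T vp k L cp Cp δ V V1 V2 R v vx u ψ ψx ψxx ψt)
    {z : ℝ × ℝ} (hz : z ∈ dom m T) :
    |flux0 N μ γ K V R v ψ ψx z|
      ≤ (μ * (2 / vp * (1 + 2 * N * vp)) + Cp + μ * N) * R z ^ N
        * enDens N V V1 R v vx ψ ψx z := by
  have hR : 0 < R z ^ N := by linarith [S.flow.one_le_pow N z hz]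
  have h1 := S.psi_mul_divg_le hz
  have hμ := S.hμ
  have hvp := S.hvp
  have hCp : 0 < Cp := S.press.pos.trans_le S.press.le
  have h2 := S.press.abs_sub_le (by linarith) (S.mem z hz) (S.bounds.mem _ (S.flow.one_le z hz))
  have h3 := S.abs_div_radius_le hz (ψ z)
  set E := enDens N V V1 R v vx ψ ψx z with hE
  have e : flux0 N μ γ K V R v ψ ψx z = R z ^ N * (μ * (ψ z * (divg N R v ψ ψx z / v z))
      - ψ z * (pressureV K γ (v z) - pressureV K γ (V (R z))) - μ * N * (ψ z * (ψ z / R z))) := by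
    unfold flux0; ring
  have q0 := sq_nonneg (v z - V (R z))
  have q1 := sq_nonneg (gradG N V1 R v vx z)
  have q2 := sq_nonneg (R z ^ N * ψx z)
  have q3 := sq_nonneg (ψ z)
  have a2 : |ψ z * (pressureV K γ (v z) - pressureV K γ (V (R z)))| ≤ Cp * E := by
    rw [abs_mul]
    calc _ ≤ |ψ z| * (Cp * |v z - V (R z)|) := by gcongr
      _ = Cp * (|ψ z| * |v z - V (R z)|) := by ring
      _ ≤ Cp * E := by
          gcongr
          have := two_mul_le_add_sq |ψ z| |v z - V (R z)|
          have h5 := mul_nonneg (abs_nonneg (ψ z)) (abs_nonneg (v z - V (R z)))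
          rw [sq_abs, sq_abs] at this
          rw [hE]; unfold enDens; linarith
  have a3 : |ψ z * (ψ z / R z)| ≤ E := by
    rw [abs_mul]
    calc _ ≤ |ψ z| * |ψ z| := by gcongr
      _ = ψ z ^ 2 := by rw [← sq, sq_abs]
      _ ≤ E := by rw [hE]; unfold enDens; linarith
  rw [e, abs_mul, abs_of_pos hR]
  have t1 := abs_sub (μ * (ψ z * (divg N R v ψ ψx z / v z))
      - ψ z * (pressureV K γ (v z) - pressureV K γ (V (R z)))) (μ * N * (ψ z * (ψ z / R z)))
  have t2 := abs_sub (μ * (ψ z * (divg N R v ψ ψx z / v z)))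
    (ψ z * (pressureV K γ (v z) - pressureV K γ (V (R z))))
  rw [abs_mul μ, abs_of_pos hμ] at t2
  rw [abs_mul (μ * N), abs_of_nonneg (by positivity : 0 ≤ μ * N)] at t1
  have b1 := mul_le_mul_of_nonneg_left h1 hμ.le
  have b3 := mul_le_mul_of_nonneg_left a3 (by positivity : 0 ≤ μ * N)
  calc _ ≤ R z ^ N * (μ * (2 / vp * (1 + 2 * N * vp) * E) + Cp * E + μ * N * E) := by
        gcongr; linarith
    _ = _ := by ring

theorem cont_pressure (S : Setting N μ γ K m T vp k L cp Cp δ V V1 V2 R v vx u ψ ψx ψxx ψt) :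
    ContinuousOn (fun z => pressureV K γ (v z) - pressureV K γ (V (R z))) (dom m T) :=
  ((continuousOn_pressureV K γ).comp S.flow.contv (fun z hz => S.flow.vpos z hz)).sub
    ((continuousOn_pressureV K γ).comp
      (continuousOn_comp_radial S.prof.continuousOn S.flow.contR S.flow.one_le)
      (fun z hz => S.prof.pos _ (S.flow.one_le z hz)))

theorem cont_pressure_deriv (S : Setting N μ γ K m T vp k L cp Cp δ V V1 V2 R v vx u ψ ψx ψxx ψt) :
    ContinuousOn (fun z => deriv (pressureV K γ) (v z)) (dom m T) ∧
    ContinuousOn (fun z => deriv (pressureV K γ) (V (R z))) (dom m T) :=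
  ⟨(continuousOn_deriv_pressureV K γ).comp S.flow.contv (fun z hz => S.flow.vpos z hz),
    (continuousOn_deriv_pressureV K γ).comp
      (continuousOn_comp_radial S.prof.continuousOn S.flow.contR S.flow.one_le)
      (fun z hz => S.prof.pos _ (S.flow.one_le z hz))⟩

theorem cont_flux0 (S : Setting N μ γ K m T vp k L cp Cp δ V V1 V2 R v vx u ψ ψx ψxx ψt) :
    ContinuousOn (flux0 N μ γ K V R v ψ ψx) (dom m T) := by
  have F := S.flow
  have cR := F.contR; have cv := F.contv; have cψ := F.contψ
  have h0 : ∀ z ∈ dom m T, R z ≠ 0 := fun z hz => by linarith [F.one_le z hz]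
  exact (((cR.pow N).mul cψ).mul ((continuousOn_const.mul
    ((continuousOn_divg cR F.one_le cv cψ F.contψx).div cv (fun z hz => (F.vpos z hz).ne'))).sub
      S.cont_pressure)).sub (continuousOn_const.mul (((cR.pow N).mul cψ).mul (cψ.div cR h0)))

theorem cont_flux0x (S : Setting N μ γ K m T vp k L cp Cp δ V V1 V2 R v vx u ψ ψx ψxx ψt) :
    ContinuousOn (flux0x N μ γ K V V1 R v vx ψ ψx ψxx) (dom m T) := by
  have F := S.flow
  have cR := F.contR; have cv := F.contv; have cψ := F.contψ; have cψx := F.contψx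
  have h0 : ∀ z ∈ dom m T, R z ≠ 0 := fun z hz => by linarith [F.one_le z hz]
  have cd := continuousOn_divg (N := N) cR F.one_le cv cψ cψx
  have cV1 := continuousOn_comp_radial S.prof.continuousOn_one cR F.one_le
  have cRx := cv.div (cR.pow N) (F.pow_ne N)
  exact ((cd.mul ((continuousOn_const.mul (cd.div cv (fun z hz => (F.vpos z hz).ne'))).sub
      S.cont_pressure)).add (((cR.pow N).mul cψ).mul ((continuousOn_const.mul
        (continuousOn_fluxx cR F.one_le cv F.vpos F.contvx cψ cψx F.contψxx)).sub
        ((S.cont_pressure_deriv.1.mul F.contvx).sub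
          (S.cont_pressure_deriv.2.mul (cV1.mul cRx)))))).sub
    (continuousOn_const.mul ((cd.mul (cψ.div cR h0)).add (((cR.pow N).mul cψ).mul
      (((cψx.mul cR).sub (cψ.mul cRx)).div (cR.pow 2) (F.pow_ne 2)))))

theorem contU (S : Setting N μ γ K m T vp k L cp Cp δ V V1 V2 R v vx u ψ ψx ψxx ψt) :
    ContinuousOn u (dom m T) := by
  have F := S.flow
  exact (((continuousOn_const.mul (continuousOn_comp_radial S.prof.continuousOn F.contR
    F.one_le)).div (F.contR.pow N) (F.pow_ne N)).add F.contψ).congr F.u_eq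

theorem cont_energy0 (S : Setting N μ γ K m T vp k L cp Cp δ V V1 V2 R v vx u ψ ψx ψxx ψt) :
    ContinuousOn (energy0 γ K V R v ψ) (dom m T) := by
  have F := S.flow
  have cV := continuousOn_comp_radial S.prof.continuousOn F.contR F.one_le
  have cpot : ContinuousOn (pressPot K γ) (Ioi 0) := fun w hw =>
    (hasDerivAt_pressPot S.hγ hw).continuousAt.continuousWithinAt
  have hV : ∀ z ∈ dom m T, V (R z) ∈ Ioi (0:ℝ) := fun z hz => S.prof.pos _ (F.one_le z hz)
  exact ((F.contψ.pow 2).div_const 2).add ((((continuousOn_pressureV K γ).comp cV hV).mul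
    (F.contv.sub cV)).sub ((cpot.comp F.contv (fun z hz => F.vpos z hz)).sub (cpot.comp cV hV)))

theorem cont_energy0t (S : Setting N μ γ K m T vp k L cp Cp δ V V1 V2 R v vx u ψ ψx ψxx ψt) :
    ContinuousOn (energy0t N γ K m V V1 R v u ψ ψx ψt) (dom m T) := by
  have F := S.flow
  have cV1 := continuousOn_comp_radial S.prof.continuousOn_one F.contR F.one_le
  exact ((F.contψ.mul F.contψt).sub (S.cont_pressure.mul ((continuousOn_divg F.contR F.one_le F.contv
    F.contψ F.contψx).add ((continuousOn_const.mul (cV1.div (F.contR.pow N) (F.pow_ne N))).mul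
      F.contv)))).add ((S.cont_pressure_deriv.2.mul (F.contPhi S.prof)).mul (cV1.mul S.contU))

theorem contDivRadius (S : Setting N μ γ K m T vp k L cp Cp δ V V1 V2 R v vx u ψ ψx ψxx ψt) :
    ContinuousOn (fun z => ψ z / R z) (dom m T) :=
  S.flow.contψ.div S.flow.contR (fun z hz => by linarith [S.flow.one_le z hz])

theorem contP (S : Setting N μ γ K m T vp k L cp Cp δ V V1 V2 R v vx u ψ ψx ψxx ψt) :
    ContinuousOn (fun z => R z ^ N * ψx z) (dom m T) :=
  (S.flow.contR.pow N).mul S.flow.contψx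

theorem contLayerPhi (S : Setting N μ γ K m T vp k L cp Cp δ V V1 V2 R v vx u ψ ψx ψxx ψt) :
    ContinuousOn (fun z => layerWeight N k m (R z) * (v z - V (R z)) ^ 2) (dom m T) :=
  S.contLayer.mul ((S.flow.contPhi S.prof).pow 2)

/-- The basic energy estimate. -/
theorem energy0_bound (S : Setting N μ γ K m T vp k L cp Cp δ V V1 V2 R v vx u ψ ψx ψxx ψt)
    {c0 C0 Einf Ein S0 : ℝ} (hc0 : 0 < c0) (hC0 : 0 < C0)
    (hle : ∀ z ∈ dom m T, energy0t N γ K m V V1 R v u ψ ψx ψt z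
        ≤ flux0x N μ γ K V V1 R v vx ψ ψx ψxx z
          - c0 * ((R z ^ N * ψx z) ^ 2 + (ψ z / R z) ^ 2)
          + C0 * (layerWeight N k m (R z) * (v z - V (R z)) ^ 2))
    (hEinf : ∀ t ∈ Icc 0 T, ∀ X, 0 ≤ X → sl m (enDens N V V1 R v vx ψ ψx) X t ≤ Einf)
    (hEin : ∀ X, 0 ≤ X → sl m (enDens N V V1 R v vx ψ ψx) X 0 ≤ Ein) {t : ℝ} (ht : t ∈ Icc 0 T)
    (hS0 : ∀ X, 0 ≤ X →
      dbl m (fun z => layerWeight N k m (R z) * (v z - V (R z)) ^ 2) X t ≤ S0)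
    {Y : ℝ} (hY : 0 ≤ Y) :
    sl m (fun z => ψ z ^ 2 / 2 + cp / 2 * (v z - V (R z)) ^ 2) Y t
      + c0 * dbl m (fun z => (R z ^ N * ψx z) ^ 2 + (ψ z / R z) ^ 2) Y t
      ≤ (1 + Cp) * Ein + C0 * S0 := by
  have F := S.flow
  have hm := S.hm
  have hvp := S.hvp
  have hCp : 0 < Cp := S.press.pos.trans_le S.press.le
  have hcp : 0 < cp := S.press.pos
  have hμ := S.hμ
  have hpot : ∀ z ∈ dom m T, cp / 2 * (v z - V (R z)) ^ 2 ≤ relPot K γ (v z) (V (R z)) ∧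
      relPot K γ (v z) (V (R z)) ≤ Cp / 2 * (v z - V (R z)) ^ 2 := fun z hz =>
    S.press.relPot_bounds S.hγ (by linarith) (S.mem z hz) (S.bounds.mem _ (F.one_le z hz))
  have h := energy_estimate (m := m) (T := T) (g := energy0 γ K V R v ψ)
    (D := fun z => c0 * ((R z ^ N * ψx z) ^ 2 + (ψ z / R z) ^ 2))
    (H := fun z => C0 * (layerWeight N k m (R z) * (v z - V (R z)) ^ 2))
    (gl := fun z => ψ z ^ 2 / 2 + cp / 2 * (v z - V (R z)) ^ 2) (gn := fun _ => 0)
    (gu := fun z => (1 + Cp) * enDens N V V1 R v vx ψ ψx z)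
    (Rp := fun z => R z ^ N) (N1 := 0) (N2 := (1 + Cp) * Ein) (N3 := C0 * S0) (N4 := 0)
    hm S.cont_energy0 S.cont_energy0t S.cont_flux0 S.cont_flux0x
    (continuousOn_const.mul ((S.contP.pow 2).add (S.contDivRadius.pow 2)))
    (continuousOn_const.mul S.contLayerPhi) S.contEnDens
    (((F.contψ.pow 2).div_const 2).add (continuousOn_const.mul ((F.contPhi S.prof).pow 2)))
    continuousOn_const (continuousOn_const.mul S.contEnDens) S.hasDt_energy0 S.hasDx_flux0
    (fun t ht => by simp [flux0, F.ψ_bdry t ht])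
    (fun t ht => by simp [energy0, relPot, F.ψ_bdry t ht, F.v_bdry t ht, F.R_bdry t ht])
    hle (fun z _ => by positivity)
    (fun z hz => by have := S.layer_nonneg hz; positivity) (fun z _ => enDens_nonneg z)
    (fun z _ => by positivity) (fun _ _ => le_rfl)
    (fun z _ => mul_nonneg (by positivity) (enDens_nonneg z))
    (fun z hz => by have := (hpot z hz).1; unfold energy0; linarith)
    (fun z hz => by
      have h1 := (hpot z hz).2
      have e : enDens N V V1 R v vx ψ ψx z = (v z - V (R z)) ^ 2 + ψ z ^ 2
        + gradG N V1 R v vx z ^ 2 + (R z ^ N * ψx z) ^ 2 := rfl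
      rw [e]; unfold energy0
      have q0 := sq_nonneg (v z - V (R z))
      have q1 := sq_nonneg (gradG N V1 R v vx z)
      have q2 := sq_nonneg (R z ^ N * ψx z)
      have q3 := sq_nonneg (ψ z)
      have r0 := mul_nonneg hCp.le q0
      have r1 := mul_nonneg hCp.le q1
      have r2 := mul_nonneg hCp.le q2
      have r3 := mul_nonneg hCp.le q3
      linarith)
    (by positivity) (fun z hz => S.abs_flux0_le hz) S.grow hEinf ht (fun X _ => by simp [sl])
    (fun X hX => by rw [sl_const_mul]; exact mul_le_mul_of_nonneg_left (hEin X hX) (by positivity))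
    (fun X hX => by rw [dbl_const_mul]; exact mul_le_mul_of_nonneg_left (hS0 X hX) hC0.le)
    (by
      -- Both perturbations vanish on the boundary, so no basic energy enters the domain with the
      -- inflow.
      have : ∫ τ in (0:ℝ)..t, energy0 γ K V R v ψ (-(m * τ), τ) = 0 := by
        rw [intervalIntegral.integral_congr (g := fun _ => 0), intervalIntegral.integral_zero]
        intro τ hτ
        rw [uIcc_of_le ht.1] at hτ
        have hτ' : τ ∈ Icc 0 T := ⟨hτ.1, hτ.2.trans ht.2⟩
        simp [energy0, relPot, F.ψ_bdry τ hτ', F.v_bdry τ hτ', F.R_bdry τ hτ']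
      rw [this, mul_zero]) hY
  rw [dbl_const_mul] at h
  linarith

end Setting


/-! ### The gradient estimate for the specific volume. -/

theorem mul_le_sq_add_sq (x y : ℝ) : x * y ≤ x ^ 2 + y ^ 2 := by
  linarith [two_mul_le_add_sq x y, sq_nonneg (x + y)]

namespace Setting

variable {N : ℕ} {μ γ K m T vp k L cp Cp δ : ℝ} {V V1 V2 : ℝ → ℝ}
  {R v vx u ψ ψx ψxx ψt : ℝ × ℝ → ℝ}

/-- The lower order part of the time derivative of `gradG`. -/
noncomputable def gradRem (N : ℕ) (m : ℝ) (V V1 V2 : ℝ → ℝ) (R v vx u ψ : ℝ × ℝ → ℝ)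
    (z : ℝ × ℝ) : ℝ :=
  m * curv N V1 V2 (R z) * (v z - V (R z)) - R z ^ N * curv N V1 V2 (R z) * ψ z
    + N * (u z / R z) * gradG N V1 R v vx z

/-- The bounds on the coefficients at a point that enter the higher order estimates, in terms of
`y = |ψ| / R`, `s = √σ |φ|` and `G`. -/
theorem coeff_bounds (S : Setting N μ γ K m T vp k L cp Cp δ V V1 V2 R v vx u ψ ψx ψxx ψt)
    (hm1 : m ≤ 1) {z : ℝ × ℝ} (hz : z ∈ dom m T) :
    |u z / R z| ≤ L * m + δ ∧
    |gradRem N m V V1 V2 R v vx u ψ z| ≤ L * (√(layerWeight N k m (R z)) * |v z - V (R z)|)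
      + L * |ψ z / R z| + N * (L * m + δ) * |gradG N V1 R v vx z| ∧
    |ψ z * gradRem N m V V1 V2 R v vx u ψ z|
      ≤ L * (|ψ z / R z| * (√(layerWeight N k m (R z)) * |v z - V (R z)|))
      + L * |ψ z / R z| ^ 2 + N * (L * m + δ) * (|ψ z / R z| * |gradG N V1 R v vx z|) ∧
    |srcMom N γ K m V V1 (R z) (v z) (ψ z)|
      ≤ (2 * L / vp + 2 * vp * Cp * L) * (√(layerWeight N k m (R z)) * |v z - V (R z)|)
        + L * |ψ z / R z| := by
  have F := S.flow
  have hr := F.one_le z hz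
  have hr' : R z ∈ Ici (1:ℝ) := hr
  have hVm := S.bounds.mem _ hr'
  have hvm := S.mem z hz
  have hvp := S.hvp
  have hσ := S.layer_nonneg hz
  have hm := S.hm
  have hL := S.hL
  have hδ := S.hδ
  have hCp : 0 < Cp := S.press.pos.trans_le S.press.le
  have hvel : |velSlope N m V V1 (R z)| ≤ L * m / R z ^ 2 := S.bounds.vel_slope _ hr'
  have hvs : |R z * (velSlope N m V V1 (R z) * (m * V (R z) / R z ^ N))|
      ≤ L * √(layerWeight N k m (R z)) := abs_le_mul_sqrt hL hσ (S.bounds.vel_sq _ hr')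
  have hsl : |R z * V1 (R z)| ≤ L * √(layerWeight N k m (R z)) :=
    abs_le_mul_sqrt hL hσ (S.bounds.slope_sq _ hr')
  have hcv : |R z * (m * curv N V1 V2 (R z))| ≤ L * √(layerWeight N k m (R z)) :=
    abs_le_mul_sqrt hL hσ (S.bounds.curv_sq _ hr')
  have hcl : R z ^ N * |curv N V1 V2 (R z)| ≤ L / R z ^ 2 := S.bounds.curv_le _ hr'
  have hvl := S.bounds.vel _ hr'
  have hlip := S.press.lip _ hvm _ hVm
  have hψδ := S.psi_le z hz
  have hv0 := F.vpos z hz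
  have hu : |u z| ≤ L * m + δ := by
    have hV0 : 0 < V (R z) := by linarith [hVm.1]
    rw [F.u_eq z hz]
    refine (abs_add_le _ _).trans (add_le_add ?_ hψδ)
    have : 0 ≤ m * V (R z) / R z ^ N := by positivity
    rw [abs_of_nonneg this]
    exact hvl.trans (div_le_self (by positivity) hr)
  have huR : |u z / R z| ≤ L * m + δ := (S.abs_div_radius_le hz _).trans hu
  set r := R z with hrdef
  set σ := layerWeight N k m r with hσdef
  set φ := v z - V r with hφ
  set y := ψ z / r with hy
  set G := gradG N V1 R v vx z with hG
  have hr0 : 0 < r := by linarith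
  have hψ : ψ z = r * y := by rw [hy]; field_simp
  have hV0 : 0 < V r := by linarith [hVm.1]
  have hLm : 0 ≤ L * m + δ := by positivity
  -- multiplication by `r` only helps
  have drop : ∀ w B : ℝ, |r * w| ≤ B → |w| ≤ B := fun w B h => by
    rw [abs_mul, abs_of_pos hr0] at h
    exact le_trans (le_mul_of_one_le_left (abs_nonneg w) hr) h
  have hcψ : |r ^ N * curv N V1 V2 r| ≤ L / r ^ 2 := by
    rw [abs_mul, abs_of_pos (by positivity : 0 < r ^ N)]; exact hcl
  have hrr : L / r ^ 2 * r ≤ L := by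
    have : L / r ^ 2 * r = L / r := by field_simp
    rw [this]; exact div_le_self (by linarith) hr
  have hrr2 : L / r ^ 2 * r * r = L := by field_simp
  refine ⟨huR, ?_, ?_, ?_⟩
  · have t1 : |m * curv N V1 V2 r * φ| ≤ L * (√σ * |φ|) := by
      rw [abs_mul, ← mul_assoc]
      exact mul_le_mul_of_nonneg_right (drop _ _ hcv) (abs_nonneg _)
    have t2 : |r ^ N * curv N V1 V2 r * ψ z| ≤ L * |y| := by
      rw [hψ, abs_mul, abs_mul r, abs_of_pos hr0, ← mul_assoc]
      exact mul_le_mul_of_nonneg_right ((mul_le_mul_of_nonneg_right hcψ hr0.le).trans hrr)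
        (abs_nonneg _)
    have t3 : |N * (u z / r) * G| ≤ N * (L * m + δ) * |G| := by
      rw [abs_mul, abs_mul, Nat.abs_cast]; gcongr
    have e : gradRem N m V V1 V2 R v vx u ψ z
      = m * curv N V1 V2 r * φ - r ^ N * curv N V1 V2 r * ψ z + N * (u z / r) * G := rfl
    rw [e]
    have h1 := abs_add_le (m * curv N V1 V2 r * φ - r ^ N * curv N V1 V2 r * ψ z) (N * (u z / r) * G)
    have h2 := abs_sub (m * curv N V1 V2 r * φ) (r ^ N * curv N V1 V2 r * ψ z)
    linarith
  · have t1 : |ψ z * (m * curv N V1 V2 r * φ)| ≤ L * (|y| * (√σ * |φ|)) := by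
      have e : ψ z * (m * curv N V1 V2 r * φ) = (r * (m * curv N V1 V2 r)) * (y * φ) := by
        rw [hψ]; ring
      rw [e, abs_mul, abs_mul y]
      calc _ ≤ L * √σ * (|y| * |φ|) := by gcongr
        _ = _ := by ring
    have t2 : |ψ z * (r ^ N * curv N V1 V2 r * ψ z)| ≤ L * |y| ^ 2 := by
      have e : ψ z * (r ^ N * curv N V1 V2 r * ψ z) = (r ^ N * curv N V1 V2 r) * (r * r * y ^ 2) := by
        rw [hψ]; ring
      rw [e, abs_mul, sq_abs, abs_of_nonneg (by positivity : 0 ≤ r * r * y ^ 2)]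
      calc _ ≤ L / r ^ 2 * (r * r * y ^ 2) := by gcongr
        _ = L / r ^ 2 * r * r * y ^ 2 := by ring
        _ = _ := by rw [hrr2]
    have t3 : |ψ z * (N * (u z / r) * G)| ≤ N * (L * m + δ) * (|y| * |G|) := by
      have e : ψ z * (N * (u z / r) * G) = N * u z * (y * G) := by rw [hy]; field_simp
      rw [e, abs_mul, abs_mul (N:ℝ), Nat.abs_cast, abs_mul y]
      gcongr
    have e : ψ z * gradRem N m V V1 V2 R v vx u ψ z = ψ z * (m * curv N V1 V2 r * φ)
      - ψ z * (r ^ N * curv N V1 V2 r * ψ z) + ψ z * (N * (u z / r) * G) := by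
      unfold gradRem; rw [← hrdef, ← hφ, ← hG]; ring
    rw [e]
    have h1 := abs_add_le (ψ z * (m * curv N V1 V2 r * φ) - ψ z * (r ^ N * curv N V1 V2 r * ψ z))
      (ψ z * (N * (u z / r) * G))
    have h2 := abs_sub (ψ z * (m * curv N V1 V2 r * φ)) (ψ z * (r ^ N * curv N V1 V2 r * ψ z))
    linarith
  · have t1 : |velSlope N m V V1 r * (m * V r / r ^ N) / V r * φ| ≤ 2 * L / vp * (√σ * |φ|) := by
      have e : velSlope N m V V1 r * (m * V r / r ^ N) / V r * φ
        = (velSlope N m V V1 r * (m * V r / r ^ N)) * ((V r)⁻¹ * φ) := by field_simp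
      rw [e, abs_mul, abs_mul (V r)⁻¹, abs_of_pos (inv_pos.2 hV0)]
      have hi : (V r)⁻¹ ≤ 2 / vp := by
        rw [inv_le_comm₀ hV0 (by positivity), inv_div]; exact hVm.1
      calc _ ≤ L * √σ * (2 / vp * |φ|) := by
            apply mul_le_mul (drop _ _ hvs) _ (by positivity) (by positivity)
            gcongr
        _ = _ := by ring
    have t2 : |V1 r * (deriv (pressureV K γ) (v z) - deriv (pressureV K γ) (V r)) * v z|
        ≤ 2 * vp * Cp * L * (√σ * |φ|) := by
      rw [abs_mul, abs_mul, abs_of_pos hv0]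
      have h1 := drop _ _ hsl
      calc _ ≤ L * √σ * (Cp * |φ|) * (2 * vp) := by gcongr; exact hvm.2
        _ = _ := by ring
    have t3 : |velSlope N m V V1 r * ψ z| ≤ L * |y| := by
      rw [hψ, abs_mul, abs_mul r, abs_of_pos hr0, ← mul_assoc]
      refine mul_le_mul_of_nonneg_right ?_ (abs_nonneg _)
      refine (mul_le_mul_of_nonneg_right hvel hr0.le).trans ?_
      refine le_trans ?_ hrr
      have : L * m ≤ L := by nlinarith
      gcongr
    have e : srcMom N γ K m V V1 r (v z) (ψ z) = velSlope N m V V1 r * (m * V r / r ^ N) / V r * φ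
      - V1 r * (deriv (pressureV K γ) (v z) - deriv (pressureV K γ) (V r)) * v z
      - velSlope N m V V1 r * ψ z := rfl
    rw [e]
    have h1 := abs_sub (velSlope N m V V1 r * (m * V r / r ^ N) / V r * φ
      - V1 r * (deriv (pressureV K γ) (v z) - deriv (pressureV K γ) (V r)) * v z)
      (velSlope N m V V1 r * ψ z)
    have h2 := abs_sub (velSlope N m V V1 r * (m * V r / r ^ N) / V r * φ)
      (V1 r * (deriv (pressureV K γ) (v z) - deriv (pressureV K γ) (V r)) * v z)
    linarith

/-- The density of the gradient energy. -/
noncomputable def energy1 (N : ℕ) (μ : ℝ) (V1 : ℝ → ℝ) (R v vx ψ : ℝ × ℝ → ℝ) (z : ℝ × ℝ) : ℝ :=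
  μ * gradG N V1 R v vx z ^ 2 / 2 - ψ z * gradG N V1 R v vx z

/-- The `t`-derivative of `energy1`. -/
noncomputable def energy1t (N : ℕ) (μ γ K m : ℝ) (V V1 V2 : ℝ → ℝ)
    (R v vx u ψ ψx ψxx : ℝ × ℝ → ℝ) (z : ℝ × ℝ) : ℝ :=
  deriv (pressureV K γ) (v z) * v z * gradG N V1 R v vx z ^ 2
    + gradG N V1 R v vx z * (μ * gradRem N m V V1 V2 R v vx u ψ z
      - srcMom N γ K m V V1 (R z) (v z) (ψ z))
    - ψ z * (R z ^ N * fluxx N R v vx ψ ψx ψxx z) - ψ z * gradRem N m V V1 V2 R v vx u ψ z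

/-- μ G_t and ψ_t contain the same viscous term, so in G (μ G_t - ψ_t) it cancels and the pressure
leaves p'(v) v G². The remaining -ψ G_t is a flux derivative up to lower order terms and the square
of (R^N ψ)_x. -/
theorem hasDt_energy1 (S : Setting N μ γ K m T vp k L cp Cp δ V V1 V2 R v vx u ψ ψx ψxx ψt) :
    HasDt m T (energy1 N μ V1 R v vx ψ) (energy1t N μ γ K m V V1 V2 R v vx u ψ ψx ψxx) := by
  intro x t hz hT
  have F := S.flow
  have d := ((((F.dtG x t hz hT).pow 2).const_mul μ).div_const 2).sub
    ((F.dtψ x t hz hT).mul (F.dtG x t hz hT))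
  refine d.congr_deriv ?_
  simp only [energy1t, gradRem]
  rw [F.momentum _ hz]
  push_cast
  ring

theorem hasDx_flux1 (S : Setting N μ γ K m T vp k L cp Cp δ V V1 V2 R v vx u ψ ψx ψxx ψt) :
    HasDx m T (fun z => -(R z ^ N * ψ z * (divg N R v ψ ψx z / v z)))
      (fun z => -(divg N R v ψ ψx z * (divg N R v ψ ψx z / v z)
        + R z ^ N * ψ z * fluxx N R v vx ψ ψx ψxx z)) := by
  intro x t hz
  have F := S.flow
  exact ((HasDx.pow_mul S.one_le_N F.one_le F.dxR F.dxψ x t hz).mul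
    (HasDx.divg_div S.one_le_N F.one_le F.vpos F.dxR F.dxv F.dxψ F.dxψx x t hz)).neg

set_option maxHeartbeats 1000000 in
/-- Differential inequality for the gradient energy. -/
theorem exists_energy1_le (N : ℕ) {μ vp L cp Cp : ℝ} (hμ : 0 < μ) (hvp : 0 < vp)
    (hL : 1 ≤ L) (hcp : 0 < cp) (hCp : 0 < Cp) : ∃ C1 m1 δ1, 0 < C1 ∧ 0 < m1 ∧ 0 < δ1 ∧
      ∀ {γ K m T k δ : ℝ} {V V1 V2 : ℝ → ℝ} {R v vx u ψ ψx ψxx ψt : ℝ × ℝ → ℝ},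
      Setting N μ γ K m T vp k L cp Cp δ V V1 V2 R v vx u ψ ψx ψxx ψt → m ≤ m1 → δ ≤ δ1 →
      ∀ z ∈ dom m T, energy1t N μ γ K m V V1 V2 R v vx u ψ ψx ψxx z
        ≤ -(divg N R v ψ ψx z * (divg N R v ψ ψx z / v z)
            + R z ^ N * ψ z * fluxx N R v vx ψ ψx ψxx z)
          - cp * vp / 8 * gradG N V1 R v vx z ^ 2
          + C1 * ((R z ^ N * ψx z) ^ 2 + (ψ z / R z) ^ 2
            + layerWeight N k m (R z) * (v z - V (R z)) ^ 2) := by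
  set d := cp * vp with hd
  have hd0 : 0 < d := by positivity
  set A := μ * L + (2 * L / vp + 2 * vp * Cp * L) + L with hA
  have hA0 : 0 < A := by positivity
  -- The threshold for L m + δ that makes N (L m + δ)(μ + 1) ≤ d/8, so that the terms proportional
  -- to u/R are absorbed in the damping -(d/2) G².
  set B := d / (8 * (N + 1) * (μ + 1)) with hB
  have hB0 : 0 < B := by positivity
  refine ⟨4 / vp + 16 * N ^ 2 * vp + 4 * A ^ 2 / d + 2 * L + d / 8,
    min 1 (B / (2 * L)), B / 2, by positivity, by positivity, by positivity, ?_⟩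
  intro γ K m T k δ V V1 V2 R v vx u ψ ψx ψxx ψt S hm1 hδ1 z hz
  obtain ⟨hu, hG1, hG2, hs⟩ := S.coeff_bounds (hm1.trans (min_le_left _ _)) hz
  have hdiv := S.abs_divg_le hz
  have hσ := S.layer_nonneg hz
  have hvm := S.mem z hz
  have hv0 := S.flow.vpos z hz
  have hlow := S.press.lower _ hvm
  have hm := S.hm
  have hδ := S.hδ
  have hsm : L * m + δ ≤ B := by
    have h1 := hm1.trans (min_le_right _ _)
    rw [le_div_iff₀ (by positivity)] at h1
    linarith
  have hsm0 : 0 ≤ L * m + δ := by positivity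
  unfold energy1t
  set ω := L * m + δ with hω
  set G := gradG N V1 R v vx z with hG
  set rem := gradRem N m V V1 V2 R v vx u ψ z with hrem
  set src := srcMom N γ K m V V1 (R z) (v z) (ψ z) with hsrc
  set fx := fluxx N R v vx ψ ψx ψxx z
  set D := divg N R v ψ ψx z
  set p := R z ^ N * ψx z
  have hs2 : (√(layerWeight N k m (R z)) * |v z - V (R z)|) ^ 2
      = layerWeight N k m (R z) * (v z - V (R z)) ^ 2 := by
    rw [mul_pow, Real.sq_sqrt hσ, sq_abs]
  have hs0 : 0 ≤ √(layerWeight N k m (R z)) * |v z - V (R z)| := by positivity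
  rw [← hs2]
  set s := √(layerWeight N k m (R z)) * |v z - V (R z)|
  have hy2 : (ψ z / R z) ^ 2 = |ψ z / R z| ^ 2 := (sq_abs _).symm
  rw [hy2]
  have hy0 : 0 ≤ |ψ z / R z| := abs_nonneg _
  set y := |ψ z / R z|
  have hG2' : G ^ 2 = |G| ^ 2 := (sq_abs _).symm
  have hg0 : 0 ≤ |G| := abs_nonneg _
  have hNω : N * ω * (μ + 1) ≤ d / 8 := by
    calc N * ω * (μ + 1) ≤ (N + 1) * B * (μ + 1) := by gcongr; linarith
      _ = d / 8 := by rw [hB]; field_simp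
  have hNω0 : 0 ≤ N * ω := by positivity
  -- the good term
  have t1 : deriv (pressureV K γ) (v z) * v z * G ^ 2 ≤ -(d / 2) * G ^ 2 := by
    have h : d / 2 ≤ -deriv (pressureV K γ) (v z) * v z := by
      calc d / 2 = cp * (vp / 2) := by rw [hd]; ring
        _ ≤ _ := mul_le_mul hlow hvm.1 (by positivity) (hcp.le.trans hlow)
    have := mul_le_mul_of_nonneg_right h (sq_nonneg G)
    linarith
  have t2 : G * (μ * rem - src) ≤ |G| * (A * (s + y)) + μ * (N * ω) * G ^ 2 := by
    have a1 : |μ * rem - src| ≤ A * (s + y) + μ * (N * ω) * |G| := by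
      have h1 := abs_sub (μ * rem) src
      rw [abs_mul, abs_of_pos hμ] at h1
      have h2 := mul_le_mul_of_nonneg_left hG1 hμ.le
      have h3 : A * (s + y) = μ * L * s + μ * L * y + (2 * L / vp + 2 * vp * Cp * L) * s + L * y
          + (L * s + (2 * L / vp + 2 * vp * Cp * L) * y) := by rw [hA]; ring
      have h4 : 0 ≤ L * s + (2 * L / vp + 2 * vp * Cp * L) * y := by positivity
      linarith
    calc G * (μ * rem - src) ≤ |G| * |μ * rem - src| := by
          rw [← abs_mul]; exact le_abs_self _
      _ ≤ |G| * (A * (s + y) + μ * (N * ω) * |G|) := by gcongr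
      _ = _ := by rw [hG2']; ring
  have t3 : |G| * (A * (s + y)) ≤ d / 8 * G ^ 2 + 4 * A ^ 2 / d * (s ^ 2 + y ^ 2) := by
    have h := young (x := |G|) (y := A * (s + y)) (θ := d / 8) (by positivity)
    rw [sq_abs] at h
    have h2 : (A * (s + y)) ^ 2 / (4 * (d / 8)) ≤ 4 * A ^ 2 / d * (s ^ 2 + y ^ 2) := by
      have e : (A * (s + y)) ^ 2 / (4 * (d / 8)) = 2 * A ^ 2 / d * (s + y) ^ 2 := by
        field_simp; ring
      rw [e]
      have h3 : (s + y) ^ 2 ≤ 2 * (s ^ 2 + y ^ 2) := add_sq_le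
      calc _ ≤ 2 * A ^ 2 / d * (2 * (s ^ 2 + y ^ 2)) := by gcongr
        _ = _ := by ring
    linarith
  have t4 : -(ψ z * rem) ≤ L * (s ^ 2 + y ^ 2) + L * y ^ 2 + N * ω * (y ^ 2 + G ^ 2) := by
    have h1 := (neg_le_abs _).trans hG2
    have h2 : L * (y * s) ≤ L * (s ^ 2 + y ^ 2) := by
      gcongr; rw [mul_comm]; exact mul_le_sq_add_sq s y
    have h3 : N * ω * (y * |G|) ≤ N * ω * (y ^ 2 + G ^ 2) := by
      gcongr; rw [hG2']; exact mul_le_sq_add_sq y |G|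
    linarith
  -- The price of writing -ψ R^N ((R^N ψ)_x / v)_x as a flux derivative; it is controlled by the
  -- dissipation of the basic energy.
  have t5 : D * (D / v z) ≤ (4 / vp) * p ^ 2 + 16 * N ^ 2 * vp * y ^ 2 := by
    have hi : (v z)⁻¹ ≤ 2 / vp := by
      rw [inv_le_comm₀ hv0 (by positivity), inv_div]; exact hvm.1
    have h1 : D ^ 2 ≤ 2 * (p ^ 2 + (2 * N * vp * y) ^ 2) := by
      calc D ^ 2 = |D| ^ 2 := (sq_abs D).symm
        _ ≤ (|p| + 2 * N * vp * y) ^ 2 := by gcongr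
        _ ≤ 2 * (|p| ^ 2 + (2 * N * vp * y) ^ 2) := add_sq_le
        _ = _ := by rw [sq_abs]
    calc D * (D / v z) = D ^ 2 * (v z)⁻¹ := by rw [div_eq_mul_inv]; ring
      _ ≤ 2 * (p ^ 2 + (2 * N * vp * y) ^ 2) * (2 / vp) := by gcongr
      _ = _ := by field_simp; ring
  have t6 : μ * (N * ω) * G ^ 2 + N * ω * G ^ 2 ≤ d / 8 * G ^ 2 := by
    have := mul_le_mul_of_nonneg_right hNω (sq_nonneg G)
    linarith
  have t7 : N * ω * y ^ 2 ≤ d / 8 * y ^ 2 := by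
    gcongr
    have : 0 ≤ N * ω * μ := by positivity
    linarith
  have p0 := sq_nonneg p
  have y0 := sq_nonneg y
  have s0 := sq_nonneg s
  have g0 := mul_nonneg hd0.le (sq_nonneg G)
  have c1 : 0 ≤ 4 / vp := by positivity
  have c2 : 0 ≤ 16 * (N:ℝ) ^ 2 * vp := by positivity
  have c3 : 0 ≤ 4 * A ^ 2 / d := by positivity
  generalize 4 / vp = k1 at *
  generalize 16 * (N:ℝ) ^ 2 * vp = k2 at *
  generalize 4 * A ^ 2 / d = k3 at *
  have e1 := mul_nonneg c1 y0
  have e2 := mul_nonneg c1 s0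
  have e3 := mul_nonneg c2 p0
  have e4 := mul_nonneg c2 s0
  have e5 := mul_nonneg c3 p0
  have e6 := mul_nonneg hd0.le p0
  have e7 := mul_nonneg hd0.le s0
  have e8 := mul_nonneg (by linarith : 0 ≤ L) p0
  have e9 := mul_nonneg (by linarith : 0 ≤ L) s0
  linarith

end Setting

namespace Setting

variable {N : ℕ} {μ γ K m T vp k L cp Cp δ : ℝ} {V V1 V2 : ℝ → ℝ}
  {R v vx u ψ ψx ψxx ψt : ℝ × ℝ → ℝ}

theorem contG (S : Setting N μ γ K m T vp k L cp Cp δ V V1 V2 R v vx u ψ ψx ψxx ψt) :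
    ContinuousOn (gradG N V1 R v vx) (dom m T) := S.flow.contGradG S.prof

theorem cont_velSlope (S : Setting N μ γ K m T vp k L cp Cp δ V V1 V2 R v vx u ψ ψx ψxx ψt) :
    ContinuousOn (fun z => velSlope N m V V1 (R z)) (dom m T) :=
  continuousOn_comp_radial S.prof.continuousOn_velSlope S.flow.contR S.flow.one_le

theorem cont_srcMom (S : Setting N μ γ K m T vp k L cp Cp δ V V1 V2 R v vx u ψ ψx ψxx ψt) :
    ContinuousOn (fun z => srcMom N γ K m V V1 (R z) (v z) (ψ z)) (dom m T) := by
  have F := S.flow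
  have cV := continuousOn_comp_radial S.prof.continuousOn F.contR F.one_le
  have cV1 := continuousOn_comp_radial S.prof.continuousOn_one F.contR F.one_le
  exact ((((S.cont_velSlope.mul ((continuousOn_const.mul cV).div (F.contR.pow N) (F.pow_ne N))).div
    cV (fun z hz => (S.prof.pos _ (F.one_le z hz)).ne')).mul (F.contv.sub cV)).sub
    ((cV1.mul (S.cont_pressure_deriv.1.sub S.cont_pressure_deriv.2)).mul F.contv)).sub
    (S.cont_velSlope.mul F.contψ)

theorem cont_gradRem (S : Setting N μ γ K m T vp k L cp Cp δ V V1 V2 R v vx u ψ ψx ψxx ψt) :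
    ContinuousOn (gradRem N m V V1 V2 R v vx u ψ) (dom m T) := by
  have F := S.flow
  have cc := continuousOn_comp_radial S.prof.continuousOn_curv F.contR F.one_le
  exact (((continuousOn_const.mul cc).mul (F.contPhi S.prof)).sub
    (((F.contR.pow N).mul cc).mul F.contψ)).add ((continuousOn_const.mul (S.contU.div F.contR
      (fun z hz => by linarith [F.one_le z hz]))).mul S.contG)

theorem cont_fluxx (S : Setting N μ γ K m T vp k L cp Cp δ V V1 V2 R v vx u ψ ψx ψxx ψt) :
    ContinuousOn (fluxx N R v vx ψ ψx ψxx) (dom m T) :=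
  continuousOn_fluxx S.flow.contR S.flow.one_le S.flow.contv S.flow.vpos S.flow.contvx S.flow.contψ
    S.flow.contψx S.flow.contψxx

theorem cont_energy1t (S : Setting N μ γ K m T vp k L cp Cp δ V V1 V2 R v vx u ψ ψx ψxx ψt) :
    ContinuousOn (energy1t N μ γ K m V V1 V2 R v vx u ψ ψx ψxx) (dom m T) := by
  have F := S.flow
  exact ((((S.cont_pressure_deriv.1.mul F.contv).mul (S.contG.pow 2)).add
    (S.contG.mul ((continuousOn_const.mul S.cont_gradRem).sub S.cont_srcMom))).sub
    (F.contψ.mul ((F.contR.pow N).mul S.cont_fluxx))).sub (F.contψ.mul S.cont_gradRem)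

/-- v is constant along the moving boundary, so the mass equation there exchanges v_x for ψ_x / m.
This is where the negative powers of m enter the estimates. -/
theorem grad_boundary (S : Setting N μ γ K m T vp k L cp Cp δ V V1 V2 R v vx u ψ ψx ψxx ψt)
    {t : ℝ} (ht : t ∈ Icc 0 T) :
    gradG N V1 R v vx (-(m * t), t) = ψx (-(m * t), t) / (m * V 1) := by
  have F := S.flow
  have h := F.vx_bdry t ht
  have hV := (S.prof.pos 1 self_mem_Ici).ne'
  have hm := S.hm.ne'
  unfold gradG
  rw [F.R_bdry t ht, F.v_bdry t ht, ← h, one_pow]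
  field_simp

/-- The gradient estimate. -/
theorem energy1_bound (S : Setting N μ γ K m T vp k L cp Cp δ V V1 V2 R v vx u ψ ψx ψxx ψt)
    {C1 Einf Ein P1 A1 J : ℝ} (hC1 : 0 < C1)
    (hle : ∀ z ∈ dom m T, energy1t N μ γ K m V V1 V2 R v vx u ψ ψx ψxx z
        ≤ -(divg N R v ψ ψx z * (divg N R v ψ ψx z / v z)
            + R z ^ N * ψ z * fluxx N R v vx ψ ψx ψxx z)
          - cp * vp / 8 * gradG N V1 R v vx z ^ 2
          + C1 * ((R z ^ N * ψx z) ^ 2 + (ψ z / R z) ^ 2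
            + layerWeight N k m (R z) * (v z - V (R z)) ^ 2))
    (hEinf : ∀ t ∈ Icc 0 T, ∀ X, 0 ≤ X → sl m (enDens N V V1 R v vx ψ ψx) X t ≤ Einf)
    (hEin : ∀ X, 0 ≤ X → sl m (enDens N V V1 R v vx ψ ψx) X 0 ≤ Ein) {t : ℝ} (ht : t ∈ Icc 0 T)
    (hP1 : ∀ X, 0 ≤ X → sl m (fun z => ψ z ^ 2) X t ≤ P1)
    (hA1 : ∀ X, 0 ≤ X → dbl m (fun z => (R z ^ N * ψx z) ^ 2 + (ψ z / R z) ^ 2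
      + layerWeight N k m (R z) * (v z - V (R z)) ^ 2) X t ≤ A1)
    (hJ : ∫ τ in (0:ℝ)..t, ψx (-(m * τ), τ) ^ 2 ≤ J)
    {Y : ℝ} (hY : 0 ≤ Y) :
    μ / 4 * sl m (fun z => gradG N V1 R v vx z ^ 2) Y t
      + cp * vp / 8 * dbl m (fun z => gradG N V1 R v vx z ^ 2) Y t
      ≤ 1 / μ * P1 + (μ + 1 / μ) * Ein + C1 * A1 + 2 * μ / (vp ^ 2 * m) * J := by
  have F := S.flow
  have hm := S.hm
  have hvp := S.hvp
  have hcp : 0 < cp := S.press.pos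
  have hμ := S.hμ
  have cp' := S.contP
  have cy := S.contDivRadius
  have cs := S.contLayerPhi
  have cG := S.contG
  have cdiv := continuousOn_divg (N := N) F.contR F.one_le F.contv F.contψ F.contψx
  have cdv := cdiv.div F.contv (fun z hz => (F.vpos z hz).ne')
  -- Young's inequality keeps half of μ G²/2, so the mixed energy is coercive up to ψ²/μ, which the
  -- basic energy controls.
  have cross : ∀ z, ψ z * gradG N V1 R v vx z
      ≤ μ / 4 * gradG N V1 R v vx z ^ 2 + 1 / μ * ψ z ^ 2 := fun z => by
    have h := young (x := gradG N V1 R v vx z) (y := ψ z) (θ := μ / 4) (by positivity)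
    have e : ψ z ^ 2 / (4 * (μ / 4)) = 1 / μ * ψ z ^ 2 := by field_simp
    linarith
  have cross' : ∀ z, -(ψ z * gradG N V1 R v vx z)
      ≤ μ / 4 * gradG N V1 R v vx z ^ 2 + 1 / μ * ψ z ^ 2 := fun z => by
    have h := young (x := gradG N V1 R v vx z) (y := -ψ z) (θ := μ / 4) (by positivity)
    have e : (-ψ z) ^ 2 / (4 * (μ / 4)) = 1 / μ * ψ z ^ 2 := by field_simp
    linarith
  have hV1 := S.bounds.mem 1 self_mem_Ici
  -- The inflow term is m μ G²/2 with G = ψ_x / (m V(1)) and V(1) ≥ vp / 2, that is at most 2 μ /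
  -- (vp² m) times ψ_x².
  have hN4 : m * ∫ τ in (0:ℝ)..t, energy1 N μ V1 R v vx ψ (-(m * τ), τ)
      ≤ 2 * μ / (vp ^ 2 * m) * J := by
    have e : ∫ τ in (0:ℝ)..t, energy1 N μ V1 R v vx ψ (-(m * τ), τ)
        = μ / (2 * (m * V 1) ^ 2) * ∫ τ in (0:ℝ)..t, ψx (-(m * τ), τ) ^ 2 := by
      rw [← intervalIntegral.integral_const_mul]
      apply intervalIntegral.integral_congr
      intro τ hτ
      rw [uIcc_of_le ht.1] at hτ
      have hτ' : τ ∈ Icc 0 T := ⟨hτ.1, hτ.2.trans ht.2⟩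
      simp only [energy1, S.grad_boundary hτ', F.ψ_bdry τ hτ']
      have hV0 : V 1 ≠ 0 := by linarith [hV1.1]
      field_simp
      ring
    have hJ0 : 0 ≤ ∫ τ in (0:ℝ)..t, ψx (-(m * τ), τ) ^ 2 :=
      intervalIntegral.integral_nonneg ht.1 (fun τ _ => sq_nonneg _)
    have hV0 : 0 < V 1 := by linarith [hV1.1]
    rw [e, ← mul_assoc]
    refine mul_le_mul ?_ hJ hJ0 (by positivity)
    have e2 : m * (μ / (2 * (m * V 1) ^ 2)) = μ / (2 * m * V 1 ^ 2) := by field_simp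
    rw [e2, div_le_div_iff₀ (by positivity) (by positivity)]
    have : vp ^ 2 ≤ 4 * V 1 ^ 2 := by nlinarith [hV1.1]
    have h2 := mul_le_mul_of_nonneg_left this (by positivity : 0 ≤ μ * m)
    linarith
  have h := energy_estimate (m := m) (T := T) (g := energy1 N μ V1 R v vx ψ)
    (Fl := fun z => -(R z ^ N * ψ z * (divg N R v ψ ψx z / v z)))
    (D := fun z => cp * vp / 8 * gradG N V1 R v vx z ^ 2)
    (H := fun z => C1 * ((R z ^ N * ψx z) ^ 2 + (ψ z / R z) ^ 2
            + layerWeight N k m (R z) * (v z - V (R z)) ^ 2))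
    (gl := fun z => μ / 4 * gradG N V1 R v vx z ^ 2) (gn := fun z => 1 / μ * ψ z ^ 2)
    (gu := fun z => (μ + 1 / μ) * enDens N V V1 R v vx ψ ψx z)
    (Rp := fun z => R z ^ N) (N1 := 1 / μ * P1) (N2 := (μ + 1 / μ) * Ein) (N3 := C1 * A1)
    (N4 := 2 * μ / (vp ^ 2 * m) * J) (L := 2 / vp * (1 + 2 * N * vp))
    hm (((continuousOn_const.mul (cG.pow 2)).div_const 2).sub (F.contψ.mul cG)) S.cont_energy1t
    (((F.contR.pow N).mul F.contψ).mul cdv).neg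
    ((cdiv.mul cdv).add (((F.contR.pow N).mul F.contψ).mul S.cont_fluxx)).neg
    (continuousOn_const.mul (cG.pow 2))
    (continuousOn_const.mul (((cp'.pow 2).add (cy.pow 2)).add cs)) S.contEnDens
    (continuousOn_const.mul (cG.pow 2)) (continuousOn_const.mul (F.contψ.pow 2))
    (continuousOn_const.mul S.contEnDens) S.hasDt_energy1 S.hasDx_flux1
    (fun t ht => by simp [F.ψ_bdry t ht])
    (fun t ht => by
      simp only [energy1, F.ψ_bdry t ht, zero_mul, sub_zero]; positivity)
    hle (fun z _ => by positivity)
    (fun z hz => by have := S.layer_nonneg hz; positivity) (fun z _ => enDens_nonneg z)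
    (fun z _ => by positivity) (fun z _ => by positivity)
    (fun z _ => mul_nonneg (by positivity) (enDens_nonneg z))
    (fun z hz => by have := cross z; unfold energy1; linarith)
    (fun z hz => by
      have h1 := cross' z
      have e : enDens N V V1 R v vx ψ ψx z = (v z - V (R z)) ^ 2 + ψ z ^ 2
        + gradG N V1 R v vx z ^ 2 + (R z ^ N * ψx z) ^ 2 := rfl
      rw [e]; unfold energy1
      have i0 : 0 < 1 / μ := by positivity
      have q0 := mul_nonneg (add_pos hμ i0).le (sq_nonneg (v z - V (R z)))
      have q1 := mul_nonneg hμ.le (sq_nonneg (gradG N V1 R v vx z))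
      have q1' := mul_nonneg i0.le (sq_nonneg (gradG N V1 R v vx z))
      have q2 := mul_nonneg (add_pos hμ i0).le (sq_nonneg (R z ^ N * ψx z))
      have q3 := mul_nonneg hμ.le (sq_nonneg (ψ z))
      linarith)
    (by positivity)
    (fun z hz => by
      have hR : 0 < R z ^ N := by linarith [F.one_le_pow N z hz]
      have h1 := S.psi_mul_divg_le hz
      rw [abs_neg, mul_assoc, abs_mul, abs_of_pos hR]
      calc _ ≤ R z ^ N * (2 / vp * (1 + 2 * N * vp) * enDens N V V1 R v vx ψ ψx z) := by gcongr
        _ = _ := by ring) S.grow hEinf ht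
    (fun X hX => by rw [sl_const_mul]; exact mul_le_mul_of_nonneg_left (hP1 X hX) (by positivity))
    (fun X hX => by rw [sl_const_mul]; exact mul_le_mul_of_nonneg_left (hEin X hX) (by positivity))
    (fun X hX => by rw [dbl_const_mul]; exact mul_le_mul_of_nonneg_left (hA1 X hX) hC1.le)
    hN4 hY
  rw [dbl_const_mul, sl_const_mul] at h
  exact h

end Setting


/-! ### The second order estimate for the velocity. -/

/-- Young's inequality for the integrand of the second order estimate. -/
theorem second_order_pointwise {κ q p W A e1 e2 ρ c2 b1 D1 D2 η : ℝ} (hc2 : 0 < c2)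
    (hA : c2 / 2 ≤ A) (hAb : A ≤ b1) (he1 : |e1| ≤ D1) (he2 : |e2| ≤ D2)
    (hρ0 : 0 ≤ ρ) (hρ : ρ ≤ 2 * η) :
    κ ^ 2 * (e1 * p ^ 2 - 2 * (e2 * p + q) * (A * q + W)) + 2 * κ * ρ * p * (A * q + W)
      ≤ κ ^ 2 * (-(5 / 8 * c2) * q ^ 2
          + (D1 + 8 / c2 + 8 / c2 * (D2 * b1) ^ 2 + D2 ^ 2 + 2 + 32 / c2 * b1 ^ 2 + 4)
            * (p ^ 2 + W ^ 2))
        + (D1 + 8 / c2 + 8 / c2 * (D2 * b1) ^ 2 + D2 ^ 2 + 2 + 32 / c2 * b1 ^ 2 + 4)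
          * (η ^ 2 * p ^ 2) := by
  -- In the application κ = 1 - x/X, q = R^{2N} ψ_xx, p = R^N ψ_x, A = μ/v, W is the lower order
  -- part of ψ_t, e1 and e2 come from differentiating R^{2N}, and ρ = 2 R^N / X from the cutoff. Of
  -- the dissipation c2 q², three applications of Young's inequality take c2/8 each.
  have hA0 : 0 < A := by linarith
  have hD1 : 0 ≤ D1 := (abs_nonneg _).trans he1
  have yg : ∀ a b : ℝ, 2 * a * b ≤ c2 / 8 * a ^ 2 + 8 / c2 * b ^ 2 := fun a b => by
    have h := young (x := a) (y := 2 * b) (θ := c2 / 8) (by positivity)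
    have e : (2 * b) ^ 2 / (4 * (c2 / 8)) = 8 / c2 * b ^ 2 := by field_simp; ring
    linarith
  have sqA : A ^ 2 ≤ b1 ^ 2 := by gcongr
  have sqe2 : e2 ^ 2 ≤ D2 ^ 2 := by rw [← sq_abs e2]; gcongr
  have sqρ : ρ ^ 2 ≤ 4 * η ^ 2 := by nlinarith
  have i1 : e1 * p ^ 2 ≤ D1 * p ^ 2 := by
    gcongr; exact (le_abs_self _).trans he1
  have i2 : -(2 * A * q ^ 2) ≤ -(c2 * q ^ 2) := by nlinarith [sq_nonneg q]
  have i3 : -(2 * q * W) ≤ c2 / 8 * q ^ 2 + 8 / c2 * W ^ 2 := by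
    have := yg q (-W); rw [neg_sq] at this; linarith
  have i4 : -(2 * q * (e2 * A * p)) ≤ c2 / 8 * q ^ 2 + 8 / c2 * (D2 * b1) ^ 2 * p ^ 2 := by
    have h := yg q (-(e2 * A * p))
    rw [neg_sq] at h
    have h2 : (e2 * A * p) ^ 2 ≤ (D2 * b1) ^ 2 * p ^ 2 := by
      rw [mul_pow, mul_pow, mul_pow]; gcongr
    have h3 := mul_le_mul_of_nonneg_left h2 (by positivity : 0 ≤ 8 / c2)
    linarith
  have i5 : -(2 * (e2 * p) * W) ≤ W ^ 2 + D2 ^ 2 * p ^ 2 := by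
    have h2 : (e2 * p) ^ 2 ≤ D2 ^ 2 * p ^ 2 := by rw [mul_pow]; gcongr
    nlinarith [sq_nonneg (e2 * p + W)]
  have i6 : 2 * (κ * q) * (ρ * A * p) ≤ c2 / 8 * (κ * q) ^ 2 + 32 / c2 * b1 ^ 2 * (η ^ 2 * p ^ 2) := by
    have h := yg (κ * q) (ρ * A * p)
    have h2 : (ρ * A * p) ^ 2 ≤ 4 * η ^ 2 * b1 ^ 2 * p ^ 2 := by
      rw [mul_pow, mul_pow]; gcongr
    have h3 := mul_le_mul_of_nonneg_left h2 (by positivity : 0 ≤ 8 / c2)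
    have e : 8 / c2 * (4 * η ^ 2 * b1 ^ 2 * p ^ 2) = 32 / c2 * b1 ^ 2 * (η ^ 2 * p ^ 2) := by ring
    linarith
  have i7 : 2 * (κ * W) * (ρ * p) ≤ (κ * W) ^ 2 + 4 * (η ^ 2 * p ^ 2) := by
    have h := two_mul_le_add_sq (κ * W) (ρ * p)
    have h2 : (ρ * p) ^ 2 ≤ 4 * η ^ 2 * p ^ 2 := by rw [mul_pow]; gcongr
    linarith
  have j := mul_le_mul_of_nonneg_left (add_le_add (add_le_add (add_le_add (add_le_add i1 i2) i3) i4) i5)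
    (sq_nonneg κ)
  have hc8 : 0 ≤ 8 / c2 := by positivity
  have hk1 : 0 ≤ 8 / c2 * (D2 * b1) ^ 2 := by positivity
  have hk2 : 0 ≤ 32 / c2 * b1 ^ 2 := by positivity
  have hk3 : 0 ≤ D2 ^ 2 := sq_nonneg _
  generalize 8 / c2 * (D2 * b1) ^ 2 = k1 at *
  generalize 32 / c2 * b1 ^ 2 = k2 at *
  generalize 8 / c2 = k3 at *
  generalize D2 ^ 2 = k4 at *
  have P0 : 0 ≤ κ ^ 2 * p ^ 2 := by positivity
  have W0 : 0 ≤ κ ^ 2 * W ^ 2 := by positivity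
  have E0 : 0 ≤ η ^ 2 * p ^ 2 := by positivity
  have a1 := mul_nonneg hD1 W0
  have a2 := mul_nonneg hc8 P0
  have a3 := mul_nonneg hk1 W0
  have a4 := mul_nonneg hk3 W0
  have a5 := mul_nonneg hk2 W0
  have a6 := mul_nonneg hk2 P0
  have a7 := mul_nonneg hD1 E0
  have a8 := mul_nonneg hc8 E0
  have a9 := mul_nonneg hk1 E0
  have a10 := mul_nonneg hk3 E0
  linarith

namespace Setting

variable {N : ℕ} {μ γ K m T vp k L cp Cp δ : ℝ} {V V1 V2 : ℝ → ℝ}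
  {R v vx u ψ ψx ψxx ψt : ℝ × ℝ → ℝ}

/-- The part of `ψ_t` without the second derivative of `ψ`. -/
noncomputable def lowerOrder (N : ℕ) (μ : ℝ) (R v ψxx ψt : ℝ × ℝ → ℝ) (z : ℝ × ℝ) : ℝ :=
  ψt z - μ / v z * (R z ^ (2 * N) * ψxx z)

/-- Expanding the viscous term and replacing v_x by G + V_r, the only nonlinear contribution besides
the pressure and the source is the product (R^N ψ_x) G. -/
theorem lowerOrder_eq (S : Setting N μ γ K m T vp k L cp Cp δ V V1 V2 R v vx u ψ ψx ψxx ψt)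
    {z : ℝ × ℝ} (hz : z ∈ dom m T) :
    lowerOrder N μ R v ψxx ψt z = 2 * N * μ * (R z ^ N * ψx z) / R z - N * μ * v z * (ψ z / R z) / R z
      - μ / v z * ((R z ^ N * ψx z) * gradG N V1 R v vx z)
      - μ / v z * V1 (R z) * (R z ^ N * ψx z)
      - deriv (pressureV K γ) (v z) * v z * gradG N V1 R v vx z
      + srcMom N γ K m V V1 (R z) (v z) (ψ z) := by
  have F := S.flow
  have hR0 : R z ≠ 0 := by linarith [F.one_le _ hz]
  have hv0 := (F.vpos z hz).ne'
  unfold lowerOrder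
  rw [F.momentum z hz]
  generalize srcMom N γ K m V V1 (R z) (v z) (ψ z) = s
  unfold fluxx divgx divg
  have hG : vx z = v z * (gradG N V1 R v vx z + V1 (R z)) / R z ^ N := by
    have := F.pow_ne N z hz
    unfold gradG; field_simp; ring
  generalize deriv (pressureV K γ) (v z) * v z * gradG N V1 R v vx z = s2
  rw [hG]
  generalize gradG N V1 R v vx z = G
  have := F.pow_ne N z hz
  rw [two_mul N, pow_add (R z) N N]
  field_simp
  ring

/-- The constant in the bound for `lowerOrder`. -/
noncomputable def lowConst (N : ℕ) (μ vp L Cp : ℝ) : ℝ :=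
  2 * N * μ + 2 * N * μ * vp + 2 * μ / vp + 2 * μ / vp * L + 2 * vp * Cp
    + (2 * L / vp + 2 * vp * Cp * L) + L

set_option maxHeartbeats 1000000 in
theorem lowerOrder_sq_le (S : Setting N μ γ K m T vp k L cp Cp δ V V1 V2 R v vx u ψ ψx ψxx ψt)
    (hm1 : m ≤ 1) {z : ℝ × ℝ} (hz : z ∈ dom m T) :
    lowerOrder N μ R v ψxx ψt z ^ 2 ≤ 5 * lowConst N μ vp L Cp ^ 2
      * ((R z ^ N * ψx z) ^ 2 + (ψ z / R z) ^ 2 + gradG N V1 R v vx z ^ 2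
        + layerWeight N k m (R z) * (v z - V (R z)) ^ 2
        + (R z ^ N * ψx z) ^ 2 * gradG N V1 R v vx z ^ 2) := by
  have F := S.flow
  obtain ⟨-, -, -, hs⟩ := S.coeff_bounds hm1 hz
  have hr := F.one_le z hz
  have hσ := S.layer_nonneg hz
  have hvm := S.mem z hz
  have hv0 := F.vpos z hz
  have hμ := S.hμ
  have hvp := S.hvp
  have hL := S.hL
  have hCp : 0 < Cp := S.press.pos.trans_le S.press.le
  have hV1 := S.bounds.slope_le _ (show R z ∈ Ici (1:ℝ) from hr)
  have hpd := S.press.abs_deriv_le hvm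
  have hs2 : (√(layerWeight N k m (R z)) * |v z - V (R z)|) ^ 2
      = layerWeight N k m (R z) * (v z - V (R z)) ^ 2 := by
    rw [mul_pow, Real.sq_sqrt hσ, sq_abs]
  have hs0 : 0 ≤ √(layerWeight N k m (R z)) * |v z - V (R z)| := by positivity
  have heq := S.lowerOrder_eq hz
  rw [← hs2]
  set s := √(layerWeight N k m (R z)) * |v z - V (R z)|
  set p := R z ^ N * ψx z
  set y := ψ z / R z
  set G := gradG N V1 R v vx z
  set src := srcMom N γ K m V V1 (R z) (v z) (ψ z)
  set C := lowConst N μ vp L Cp with hC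
  have hμv : μ / v z ≤ 2 * μ / vp := by
    rw [div_le_div_iff₀ hv0 hvp]; nlinarith [hvm.1]
  have hμv0 : 0 < μ / v z := by positivity
  have t1 : |2 * N * μ * p / R z| ≤ 2 * N * μ * |p| := by
    refine (S.abs_div_radius_le hz _).trans ?_
    rw [abs_mul, abs_of_nonneg (by positivity : 0 ≤ 2 * N * μ)]
  have t2 : |N * μ * v z * y / R z| ≤ 2 * N * μ * vp * |y| := by
    refine (S.abs_div_radius_le hz _).trans ?_
    rw [abs_mul, abs_of_nonneg (by positivity : 0 ≤ N * μ * v z)]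
    refine mul_le_mul_of_nonneg_right ?_ (abs_nonneg _)
    have := mul_le_mul_of_nonneg_left hvm.2 (by positivity : 0 ≤ N * μ)
    linarith
  have t3 : |μ / v z * (p * G)| ≤ 2 * μ / vp * (|p| * |G|) := by
    rw [abs_mul, abs_of_pos hμv0, abs_mul]; gcongr
  have t4 : |μ / v z * V1 (R z) * p| ≤ 2 * μ / vp * L * |p| := by
    rw [abs_mul, abs_mul, abs_of_pos hμv0]; gcongr
  have t5 : |deriv (pressureV K γ) (v z) * v z * G| ≤ 2 * vp * Cp * |G| := by
    rw [abs_mul, abs_mul, abs_of_pos hv0]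
    calc _ ≤ Cp * (2 * vp) * |G| := by gcongr; exact hvm.2
      _ = _ := by ring
  have hW : |lowerOrder N μ R v ψxx ψt z| ≤ C * (|p| + |y| + |G| + s + |p| * |G|) := by
    rw [heq]
    have a1 := abs_add_le (2 * N * μ * p / R z - N * μ * v z * y / R z - μ / v z * (p * G)
      - μ / v z * V1 (R z) * p - deriv (pressureV K γ) (v z) * v z * G) src
    have a2 := abs_sub (2 * N * μ * p / R z - N * μ * v z * y / R z - μ / v z * (p * G)
      - μ / v z * V1 (R z) * p) (deriv (pressureV K γ) (v z) * v z * G)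
    have a3 := abs_sub (2 * N * μ * p / R z - N * μ * v z * y / R z - μ / v z * (p * G))
      (μ / v z * V1 (R z) * p)
    have a4 := abs_sub (2 * N * μ * p / R z - N * μ * v z * y / R z) (μ / v z * (p * G))
    have a5 := abs_sub (2 * N * μ * p / R z) (N * μ * v z * y / R z)
    have p0 := abs_nonneg p
    have y0 := abs_nonneg y
    have g0 := abs_nonneg G
    have b1 : 2 * N * μ * |p| + 2 * μ / vp * L * |p| ≤ C * |p| := by
      rw [← add_mul]; gcongr
      rw [hC]; unfold lowConst
      have : 0 ≤ 2 * N * μ * vp + 2 * μ / vp + 2 * vp * Cp + (2 * L / vp + 2 * vp * Cp * L) + L := by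
        positivity
      linarith
    have b2 : 2 * N * μ * vp * |y| + L * |y| ≤ C * |y| := by
      rw [← add_mul]; gcongr
      rw [hC]; unfold lowConst
      have : 0 ≤ 2 * N * μ + 2 * μ / vp + 2 * μ / vp * L + 2 * vp * Cp + (2 * L / vp + 2 * vp * Cp * L) := by
        positivity
      linarith
    have b3 : 2 * μ / vp * (|p| * |G|) ≤ C * (|p| * |G|) := by
      gcongr
      rw [hC]; unfold lowConst
      have : 0 ≤ 2 * N * μ + 2 * N * μ * vp + 2 * μ / vp * L + 2 * vp * Cp + (2 * L / vp + 2 * vp * Cp * L) + L := by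
        positivity
      linarith
    have b4 : 2 * vp * Cp * |G| ≤ C * |G| := by
      gcongr
      rw [hC]; unfold lowConst
      have : 0 ≤ 2 * N * μ + 2 * N * μ * vp + 2 * μ / vp + 2 * μ / vp * L + (2 * L / vp + 2 * vp * Cp * L) + L := by
        positivity
      linarith
    have b5 : (2 * L / vp + 2 * vp * Cp * L) * s ≤ C * s := by
      gcongr
      rw [hC]; unfold lowConst
      have : 0 ≤ 2 * N * μ + 2 * N * μ * vp + 2 * μ / vp + 2 * μ / vp * L + 2 * vp * Cp + L := by
        positivity
      linarith
    have e : C * (|p| + |y| + |G| + s + |p| * |G|)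
      = C * |p| + C * |y| + C * |G| + C * s + C * (|p| * |G|) := by ring
    rw [e]
    linarith
  calc lowerOrder N μ R v ψxx ψt z ^ 2 = |lowerOrder N μ R v ψxx ψt z| ^ 2 := (sq_abs _).symm
    _ ≤ (C * (|p| + |y| + |G| + s + |p| * |G|)) ^ 2 := by gcongr
    _ = C ^ 2 * (|p| + |y| + |G| + s + |p| * |G|) ^ 2 := by ring
    _ ≤ C ^ 2 * (5 * (|p| ^ 2 + |y| ^ 2 + |G| ^ 2 + s ^ 2 + (|p| * |G|) ^ 2)) := by
        gcongr
        generalize |p| * |G| = e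
        generalize |p| = a
        generalize |y| = b
        generalize |G| = c
        generalize s = d
        nlinarith [sq_nonneg (a - b), sq_nonneg (a - c), sq_nonneg (a - d), sq_nonneg (a - e),
          sq_nonneg (b - c), sq_nonneg (b - d), sq_nonneg (b - e), sq_nonneg (c - d),
          sq_nonneg (c - e), sq_nonneg (d - e)]
    _ = _ := by rw [mul_pow |p| |G|, sq_abs, sq_abs, sq_abs]; ring

end Setting


theorem sl_mono_slice {m T t X : ℝ} {f g : ℝ × ℝ → ℝ} (hm : 0 < m) (hf : ContinuousOn f (dom m T))
    (hg : ContinuousOn g (dom m T)) (ht : t ∈ Icc 0 T) (hX : 0 ≤ X)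
    (h : ∀ x, (x, t) ∈ dom m T → x ≤ X → f (x, t) ≤ g (x, t)) : sl m f X t ≤ sl m g X t := by
  have hb := neg_mul_le hm ht.1 hX
  exact intervalIntegral.integral_mono_on hb (intervalIntegrable_slice hf ht le_rfl hb)
    (intervalIntegrable_slice hg ht le_rfl hb) (fun x hx => h x ⟨ht, hx.1⟩ hx.2)

/-- The constant produced by `second_order_pointwise`. -/
noncomputable def secConst (N : ℕ) (μ vp L : ℝ) : ℝ :=
  2 * N * (L + 1) + 8 / (μ / vp) + 8 / (μ / vp) * (4 * N * vp * (2 * μ / vp)) ^ 2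
    + (4 * N * vp) ^ 2 + 2 + 32 / (μ / vp) * (2 * μ / vp) ^ 2 + 4

theorem secConst_pos (N : ℕ) {μ vp L : ℝ} (hμ : 0 < μ) (hvp : 0 < vp) (hL : 1 ≤ L) :
    0 < secConst N μ vp L := by
  have : 0 < L := by linarith
  unfold secConst; positivity

namespace Setting

variable {N : ℕ} {μ γ K m T vp k L cp Cp δ : ℝ} {V V1 V2 : ℝ → ℝ}
  {R v vx u ψ ψx ψxx ψt : ℝ × ℝ → ℝ}

/-- The lower order dissipation density. -/
noncomputable def lowDens (N : ℕ) (k m : ℝ) (V V1 : ℝ → ℝ) (R v vx ψ ψx : ℝ × ℝ → ℝ)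
    (z : ℝ × ℝ) : ℝ :=
  (R z ^ N * ψx z) ^ 2 + (ψ z / R z) ^ 2 + gradG N V1 R v vx z ^ 2
    + layerWeight N k m (R z) * (v z - V (R z)) ^ 2

theorem contLowDens (S : Setting N μ γ K m T vp k L cp Cp δ V V1 V2 R v vx u ψ ψx ψxx ψt) :
    ContinuousOn (lowDens N k m V V1 R v vx ψ ψx) (dom m T) :=
  (((S.contP.pow 2).add (S.contDivRadius.pow 2)).add (S.contG.pow 2)).add S.contLayerPhi

theorem lowDens_nonneg (S : Setting N μ γ K m T vp k L cp Cp δ V V1 V2 R v vx u ψ ψx ψxx ψt)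
    {z : ℝ × ℝ} (hz : z ∈ dom m T) : 0 ≤ lowDens N k m V V1 R v vx ψ ψx z := by
  have := S.layer_nonneg hz
  unfold lowDens; positivity

theorem hasDx_radius_sq (S : Setting N μ γ K m T vp k L cp Cp δ V V1 V2 R v vx u ψ ψx ψxx ψt) :
    HasDx m T (fun z => R z ^ (2 * N)) (fun z => 2 * N * (R z ^ (2 * N) / R z) * (v z / R z ^ N)) := by
  intro x t hz
  obtain ⟨M, hM⟩ : ∃ M, 2 * N = M + 1 := ⟨2 * N - 1, by have := S.one_le_N; omega⟩
  have hR0 : R (x, t) ≠ 0 := by linarith [S.flow.one_le _ hz]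
  refine ((S.flow.dxR x t hz).pow (2 * N)).congr_deriv ?_
  have e : R (x, t) ^ (2 * N) / R (x, t) = R (x, t) ^ (2 * N - 1) := by
    rw [hM, Nat.add_sub_cancel, pow_succ]; field_simp
  simp only [e]; push_cast; ring

theorem hasDt_radius_sq (S : Setting N μ γ K m T vp k L cp Cp δ V V1 V2 R v vx u ψ ψx ψxx ψt) :
    HasDt m T (fun z => R z ^ (2 * N)) (fun z => 2 * N * (R z ^ (2 * N) / R z) * u z) := by
  intro x t hz hT
  obtain ⟨M, hM⟩ : ∃ M, 2 * N = M + 1 := ⟨2 * N - 1, by have := S.one_le_N; omega⟩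
  have hR0 : R (x, t) ≠ 0 := by linarith [S.flow.one_le _ hz]
  refine ((S.flow.dtR x t hz hT).pow (2 * N)).congr_deriv ?_
  have e : R (x, t) ^ (2 * N) / R (x, t) = R (x, t) ^ (2 * N - 1) := by
    rw [hM, Nat.add_sub_cancel, pow_succ]; field_simp
  simp only [e]; push_cast; ring

/-- The integrand of the time derivative of `∫ cut R ^ (2 N) ψ_x ^ 2`. -/
noncomputable def rate2 (N : ℕ) (X : ℝ) (R v u ψx ψxx ψt : ℝ × ℝ → ℝ) (z : ℝ × ℝ) : ℝ :=
  cut X z * (2 * N * (R z ^ (2 * N) / R z) * u z) * ψx z ^ 2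
    - 2 * ((cut X z * (2 * N * (R z ^ (2 * N) / R z) * (v z / R z ^ N))
        - 2 / X * (1 - z.1 / X) * R z ^ (2 * N)) * ψx z
      + cut X z * R z ^ (2 * N) * ψxx z) * ψt z

theorem cont_rate2 (S : Setting N μ γ K m T vp k L cp Cp δ V V1 V2 R v vx u ψ ψx ψxx ψt) (X : ℝ) :
    ContinuousOn (rate2 N X R v u ψx ψxx ψt) (dom m T) := by
  have F := S.flow
  have hc := (continuous_cut X).continuousOn (s := dom m T)
  have hlin : Continuous (fun z : ℝ × ℝ => 2 / X * (1 - z.1 / X)) := by fun_prop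
  have h0 : ∀ z ∈ dom m T, R z ≠ 0 := fun z hz => by linarith [F.one_le z hz]
  have cRR := continuousOn_const (c := 2 * (N:ℝ)).mul ((F.contR.pow (2 * N)).div F.contR h0)
  exact ((hc.mul (cRR.mul S.contU)).mul (F.contψx.pow 2)).sub ((continuousOn_const.mul
    ((((hc.mul (cRR.mul (F.contv.div (F.contR.pow N) (F.pow_ne N)))).sub (hlin.continuousOn.mul
      (F.contR.pow (2 * N)))).mul F.contψx).add ((hc.mul (F.contR.pow (2 * N))).mul F.contψxx))).mul
        F.contψt)

/-- The term with η² is the derivative of the cutoff. It carries R^N / X ≤ η, and no cutoff factor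
is left on it, so it is paid for by the a priori finite energy. -/
theorem rate2_le (S : Setting N μ γ K m T vp k L cp Cp δ V V1 V2 R v vx u ψ ψx ψxx ψt)
    (hm1 : m ≤ 1) (hδ1 : δ ≤ 1) {X η : ℝ} (hX : 0 < X) {z : ℝ × ℝ} (hz : z ∈ dom m T)
    (hRX : R z ^ N ≤ η * X) :
    rate2 N X R v u ψx ψxx ψt z ≤ cut X z * (-(5 / 8 * (μ / vp)) * (R z ^ (2 * N) * ψxx z) ^ 2
        + secConst N μ vp L * ((R z ^ N * ψx z) ^ 2 + lowerOrder N μ R v ψxx ψt z ^ 2))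
      + secConst N μ vp L * (η ^ 2 * (R z ^ N * ψx z) ^ 2) := by
  have F := S.flow
  have hμ := S.hμ
  have hvp := S.hvp
  have hv0 := F.vpos z hz
  have hvm := S.mem z hz
  have hr := F.one_le z hz
  have hr0 : 0 < R z := by linarith
  have hm := S.hm
  have hL := S.hL
  obtain ⟨hu, -, -, -⟩ := S.coeff_bounds hm1 hz
  have hA1 : μ / vp / 2 ≤ μ / v z := by
    rw [div_div, div_le_div_iff₀ (by positivity) hv0]; nlinarith [hvm.2]
  have hA2 : μ / v z ≤ 2 * μ / vp := by
    rw [div_le_div_iff₀ hv0 hvp]; nlinarith [hvm.1]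
  have he1 : |2 * N * (u z / R z)| ≤ 2 * N * (L + 1) := by
    rw [abs_mul, abs_of_nonneg (by positivity : 0 ≤ 2 * (N:ℝ))]
    gcongr
    have : L * m ≤ L := by nlinarith
    linarith
  have he2 : |2 * N * (v z / R z)| ≤ 4 * N * vp := by
    rw [abs_mul, abs_of_nonneg (by positivity : 0 ≤ 2 * (N:ℝ))]
    have := S.abs_div_radius_le hz (v z)
    rw [abs_of_pos hv0] at this
    have h2 := mul_le_mul_of_nonneg_left (this.trans hvm.2) (by positivity : 0 ≤ 2 * (N:ℝ))
    linarith
  have hρ : 2 / X * R z ^ N ≤ 2 * η := by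
    calc 2 / X * R z ^ N ≤ 2 / X * (η * X) := by gcongr
      _ = 2 * η := by field_simp
  have h := second_order_pointwise (κ := 1 - z.1 / X) (q := R z ^ (2 * N) * ψxx z)
    (p := R z ^ N * ψx z) (W := lowerOrder N μ R v ψxx ψt z) (by positivity : 0 < μ / vp) hA1 hA2
    he1 he2 (by positivity : 0 ≤ 2 / X * R z ^ N) hρ
  have e : rate2 N X R v u ψx ψxx ψt z = (1 - z.1 / X) ^ 2 * (2 * N * (u z / R z) * (R z ^ N * ψx z) ^ 2
      - 2 * (2 * N * (v z / R z) * (R z ^ N * ψx z) + R z ^ (2 * N) * ψxx z)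
        * (μ / v z * (R z ^ (2 * N) * ψxx z) + lowerOrder N μ R v ψxx ψt z))
      + 2 * (1 - z.1 / X) * (2 / X * R z ^ N) * (R z ^ N * ψx z)
        * (μ / v z * (R z ^ (2 * N) * ψxx z) + lowerOrder N μ R v ψxx ψt z) := by
    have hψt : μ / v z * (R z ^ (2 * N) * ψxx z) + lowerOrder N μ R v ψxx ψt z = ψt z := by
      unfold lowerOrder; ring
    rw [hψt]
    unfold rate2 cut
    rw [two_mul N, pow_add (R z) N N]
    generalize ψt z = w
    have hN0 := F.pow_ne N z hz
    field_simp
    ring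
  rw [e]
  exact h

/-- The constant in front of the lower order terms in the second order estimate. -/
noncomputable def secLowConst (N : ℕ) (μ vp L Cp : ℝ) : ℝ :=
  4 * secConst N μ vp L * (1 + 5 * lowConst N μ vp L Cp ^ 2) + μ / vp * (1 + 2 * N * vp)

theorem secLowConst_pos (N : ℕ) {μ vp L : ℝ} (Cp : ℝ) (hμ : 0 < μ) (hvp : 0 < vp) (hL : 1 ≤ L) :
    0 < secLowConst N μ vp L Cp := by
  have := secConst_pos N hμ hvp hL
  unfold secLowConst; positivity

/-- The cubic term is handled by taking the supremum of cut · (R^N ψ_x)² and integrating G². The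
supremum costs the top order dissipation itself, but ∫ G² ≤ `Einf` is small, so it can be absorbed;
5/8 - 1/8 leaves one half of μ/vp. -/
theorem sl_rate2_le (S : Setting N μ γ K m T vp k L cp Cp δ V V1 V2 R v vx u ψ ψx ψxx ψt)
    (hm1 : m ≤ 1) (hδ1 : δ ≤ 1) {X η Einf t : ℝ} (hX : 1 ≤ X) (hXm : m * T ≤ X)
    (hRX : ∀ z ∈ dom m T, z.1 ≤ X → R z ^ N ≤ η * X) (ht : t ∈ Icc 0 T)
    (hEinf : sl m (enDens N V V1 R v vx ψ ψx) X t ≤ Einf)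
    (hsmall : 5 * secConst N μ vp L * lowConst N μ vp L Cp ^ 2 * Einf ≤ μ / vp / 8) :
    sl m (rate2 N X R v u ψx ψxx ψt) X t
      ≤ -(μ / vp / 2 * sl m (fun z => cut X z * (R z ^ (2 * N) * ψxx z) ^ 2) X t)
        + secLowConst N μ vp L Cp * sl m (lowDens N k m V V1 R v vx ψ ψx) X t
        + secConst N μ vp L * η ^ 2 * Einf := by
  have F := S.flow
  have hX0 : 0 < X := by linarith
  have hm := S.hm
  have hμ := S.hμ
  have hvp := S.hvp
  have hC3 := secConst_pos N hμ hvp S.hL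
  have hc := (continuous_cut X).continuousOn (s := dom m T)
  have cq : ContinuousOn (fun z => R z ^ (2 * N) * ψxx z) (dom m T) :=
    (F.contR.pow (2 * N)).mul F.contψxx
  have cqc : ContinuousOn (fun z => cut X z * (R z ^ (2 * N) * ψxx z) ^ 2) (dom m T) :=
    hc.mul (cq.pow 2)
  have cp2 : ContinuousOn (fun z => (R z ^ N * ψx z) ^ 2) (dom m T) := S.contP.pow 2
  have cG2 : ContinuousOn (fun z => gradG N V1 R v vx z ^ 2) (dom m T) := S.contG.pow 2
  have cl := S.contLowDens
  set C3 := secConst N μ vp L with hC3def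
  set C := lowConst N μ vp L Cp with hCdef
  set c2 := μ / vp with hc2def
  have hc2 : 0 < c2 := by positivity
  set Qc := sl m (fun z => cut X z * (R z ^ (2 * N) * ψxx z) ^ 2) X t with hQc
  set Pp := sl m (fun z => (R z ^ N * ψx z) ^ 2) X t with hPp
  set Gg := sl m (fun z => gradG N V1 R v vx z ^ 2) X t with hGg
  set Hh := sl m (lowDens N k m V V1 R v vx ψ ψx) X t with hHh
  set M := (8 + 8 * N * (2 * vp)) * Pp + Qc with hM
  have hQ0 : 0 ≤ Qc := sl_nonneg hm ht hX0.le
    (fun z _ => mul_nonneg (cut_nonneg X z) (sq_nonneg _))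
  have hP0 : 0 ≤ Pp := sl_nonneg hm ht hX0.le (fun z _ => sq_nonneg _)
  have hG0 : 0 ≤ Gg := sl_nonneg hm ht hX0.le (fun z _ => sq_nonneg _)
  have hM0 : 0 ≤ M := by positivity
  have hPH : Pp ≤ Hh := sl_mono hm cp2 cl ht hX0.le (fun z hz _ => by
    have h1 := S.layer_nonneg hz
    have h2 := mul_nonneg h1 (sq_nonneg (v z - V (R z)))
    have h3 := sq_nonneg (ψ z / R z)
    have h4 := sq_nonneg (gradG N V1 R v vx z)
    unfold lowDens; linarith)
  have hPE : Pp ≤ Einf := (sl_mono hm cp2 S.contEnDens ht hX0.le (fun z hz _ => by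
    have h2 := sq_nonneg (v z - V (R z))
    have h3 := sq_nonneg (ψ z)
    have h4 := sq_nonneg (gradG N V1 R v vx z)
    unfold enDens; linarith)).trans hEinf
  have hGE : Gg ≤ Einf := (sl_mono hm cG2 S.contEnDens ht hX0.le (fun z hz _ => by
    have h2 := sq_nonneg (v z - V (R z))
    have h3 := sq_nonneg (ψ z)
    have h4 := sq_nonneg (R z ^ N * ψx z)
    unfold enDens; linarith)).trans hEinf
  have key : sl m (rate2 N X R v u ψx ψxx ψt) X t
      ≤ sl m (fun z => (-(5 / 8 * c2) * (cut X z * (R z ^ (2 * N) * ψxx z) ^ 2)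
        + 4 * C3 * (1 + 5 * C ^ 2) * lowDens N k m V V1 R v vx ψ ψx z)
        + (5 * C3 * C ^ 2 * M * gradG N V1 R v vx z ^ 2
        + C3 * η ^ 2 * (R z ^ N * ψx z) ^ 2)) X t := by
    refine sl_mono_slice hm (S.cont_rate2 X) (((continuousOn_const.mul cqc).add
      (continuousOn_const.mul cl)).add ((continuousOn_const.mul cG2).add
        (continuousOn_const.mul cp2))) ht hX0.le ?_
    intro x hz hxX
    have h1 := S.rate2_le hm1 hδ1 hX0 hz (hRX _ hz hxX)
    have h2 := S.lowerOrder_sq_le hm1 hz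
    have h3 := F.cut_sq_le hm S.one_le_N (by positivity : 0 ≤ 2 * vp) (fun z hz => (S.mem z hz).2)
      hz hxX hX hXm
    obtain ⟨-, h4⟩ := cut_le_four hm hX0 hXm hz hxX
    have h5 := cut_nonneg X (x, t)
    have hl0 := S.lowDens_nonneg hz
    have hlp : (R (x, t) ^ N * ψx (x, t)) ^ 2 ≤ lowDens N k m V V1 R v vx ψ ψx (x, t) := by
      have h1 := S.layer_nonneg hz
      have h2 := mul_nonneg h1 (sq_nonneg (v (x, t) - V (R (x, t))))
      have h3 := sq_nonneg (ψ (x, t) / R (x, t))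
      have h4 := sq_nonneg (gradG N V1 R v vx (x, t))
      unfold lowDens; linarith
    have hld : (R (x, t) ^ N * ψx (x, t)) ^ 2 + (ψ (x, t) / R (x, t)) ^ 2
      + gradG N V1 R v vx (x, t) ^ 2
      + layerWeight N k m (R (x, t)) * (v (x, t) - V (R (x, t))) ^ 2
      = lowDens N k m V V1 R v vx ψ ψx (x, t) := rfl
    rw [hld] at h2
    rw [← hC3def, ← hc2def] at h1
    rw [← hCdef] at h2
    rw [← hQc, ← hPp, ← hM] at h3
    generalize rate2 N X R v u ψx ψxx ψt (x, t) = r at *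
    generalize lowerOrder N μ R v ψxx ψt (x, t) = W at *
    generalize cut X (x, t) = χ at *
    generalize gradG N V1 R v vx (x, t) = G at *
    generalize lowDens N k m V V1 R v vx ψ ψx (x, t) = l at *
    generalize (R (x, t) ^ (2 * N) * ψxx (x, t)) ^ 2 = q2 at *
    generalize (R (x, t) ^ N * ψx (x, t)) ^ 2 = p2 at *
    clear_value C3 C c2 M
    have a1 : χ * (p2 + W ^ 2) ≤ 4 * ((1 + 5 * C ^ 2) * l) + 5 * C ^ 2 * (M * G ^ 2) := by
      calc χ * (p2 + W ^ 2) ≤ χ * (l + 5 * C ^ 2 * (l + p2 * G ^ 2)) := by gcongr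
        _ = χ * ((1 + 5 * C ^ 2) * l) + 5 * C ^ 2 * ((χ * p2) * G ^ 2) := by ring
        _ ≤ 4 * ((1 + 5 * C ^ 2) * l) + 5 * C ^ 2 * (M * G ^ 2) := by gcongr
    have a2 := mul_le_mul_of_nonneg_left a1 hC3.le
    linarith
  rw [sl_add (f := fun z => -(5 / 8 * c2) * (cut X z * (R z ^ (2 * N) * ψxx z) ^ 2)
        + 4 * C3 * (1 + 5 * C ^ 2) * lowDens N k m V V1 R v vx ψ ψx z)
      (g := fun z => 5 * C3 * C ^ 2 * M * gradG N V1 R v vx z ^ 2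
        + C3 * η ^ 2 * (R z ^ N * ψx z) ^ 2) hm ((continuousOn_const.mul cqc).add
      (continuousOn_const.mul cl)) ((continuousOn_const.mul cG2).add
        (continuousOn_const.mul cp2)) ht hX0.le,
    sl_add (f := fun z => -(5 / 8 * c2) * (cut X z * (R z ^ (2 * N) * ψxx z) ^ 2))
      (g := fun z => 4 * C3 * (1 + 5 * C ^ 2) * lowDens N k m V V1 R v vx ψ ψx z) hm
      (continuousOn_const.mul cqc) (continuousOn_const.mul cl) ht hX0.le,
    sl_add (f := fun z => 5 * C3 * C ^ 2 * M * gradG N V1 R v vx z ^ 2)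
      (g := fun z => C3 * η ^ 2 * (R z ^ N * ψx z) ^ 2) hm
      (continuousOn_const.mul cG2) (continuousOn_const.mul cp2) ht hX0.le,
    sl_const_mul, sl_const_mul, sl_const_mul, sl_const_mul, ← hQc, ← hGg, ← hPp] at key
  have hHh' : sl m (fun z => lowDens N k m V V1 R v vx ψ ψx z) X t = Hh := rfl
  rw [hHh'] at key
  -- The smallness of the a priori energy is used only here in the second order estimate.
  have b1 : 5 * C3 * C ^ 2 * M * Gg ≤ c2 / 8 * M := by
    have h1 : 5 * C3 * C ^ 2 * Gg ≤ c2 / 8 :=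
      (mul_le_mul_of_nonneg_left hGE (by positivity)).trans hsmall
    calc 5 * C3 * C ^ 2 * M * Gg = 5 * C3 * C ^ 2 * Gg * M := by ring
      _ ≤ c2 / 8 * M := by gcongr
  have b2 : c2 / 8 * M ≤ c2 / 8 * Qc + c2 * (1 + 2 * N * vp) * Hh := by
    have h1 : c2 / 8 * M = c2 / 8 * Qc + c2 * (1 + 2 * N * vp) * Pp := by rw [hM]; ring
    rw [h1]; gcongr
  have b3 : C3 * η ^ 2 * Pp ≤ C3 * η ^ 2 * Einf := by gcongr
  have e : secLowConst N μ vp L Cp * Hh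
      = 4 * C3 * (1 + 5 * C ^ 2) * Hh + c2 * (1 + 2 * N * vp) * Hh := by
    unfold secLowConst; rw [← hC3def, ← hCdef, ← hc2def]; ring
  rw [e]
  linarith

end Setting


namespace Setting

variable {N : ℕ} {μ γ K m T vp k L cp Cp δ : ℝ} {V V1 V2 : ℝ → ℝ}
  {R v vx u ψ ψx ψxx ψt : ℝ × ℝ → ℝ}

/-- On the boundary ψ = 0 gives ψ_t = m ψ_x. The term -2 ψ_x ψ_t from integration by parts and the
inflow term + m ψ_x² then add up to - m ψ_x²: the trace appears with a good sign. -/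
theorem hasDerivWithinAt_sl_cut
    (S : Setting N μ γ K m T vp k L cp Cp δ V V1 V2 R v vx u ψ ψx ψxx ψt) {X t : ℝ} (hX : 0 < X)
    (ht : t ∈ Ico 0 T) :
    HasDerivWithinAt (sl m (fun z => cut X z * (R z ^ N * ψx z) ^ 2) X)
      (sl m (rate2 N X R v u ψx ψxx ψt) X t
        - m * (cut X (-(m * t), t) * ψx (-(m * t), t) ^ 2)) (Ici t) t := by
  have F := S.flow
  have hm := S.hm
  have hc := (continuous_cut X).continuousOn (s := dom m T)
  have hlin : Continuous (fun z : ℝ × ℝ => 2 / X * (1 - z.1 / X)) := by fun_prop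
  have h0 : ∀ z ∈ dom m T, R z ≠ 0 := fun z hz => by linarith [F.one_le z hz]
  have cR2 := F.contR.pow (2 * N)
  have cRR := continuousOn_const (c := 2 * (N:ℝ)).mul (cR2.div F.contR h0)
  have dcg : HasDt m T (fun z => cut X z * R z ^ (2 * N))
      (fun z => cut X z * (2 * N * (R z ^ (2 * N) / R z) * u z)) := fun x t hz hT =>
    (S.hasDt_radius_sq x t hz hT).const_mul ((1 - x / X) ^ 2)
  have ht' : t ∈ Icc 0 T := ⟨ht.1, ht.2.le⟩
  have h := hasDerivWithinAt_integral_mul_sq hm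
    (a := fun z => cut X z * R z ^ (2 * N))
    (ax := fun z => cut X z * (2 * N * (R z ^ (2 * N) / R z) * (v z / R z ^ N))
        - 2 / X * (1 - z.1 / X) * R z ^ (2 * N))
    (at' := fun z => cut X z * (2 * N * (R z ^ (2 * N) / R z) * u z))
    (hc.mul cR2)
    ((hc.mul (cRR.mul (F.contv.div (F.contR.pow N) (F.pow_ne N)))).sub
      (hlin.continuousOn.mul cR2)) (hc.mul (cRR.mul S.contU)) F.contψ F.contψx F.contψxx F.contψt
    (hasDx_cut_mul S.hasDx_radius_sq) dcg F.dxψ F.dxψx F.dtψ ht (neg_mul_le hm ht.1 hX.le)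
    (fun τ _ => by simp [cut, hX.ne'])
  have e : sl m (fun z => cut X z * (R z ^ N * ψx z) ^ 2) X
      = fun τ => ∫ x in -(m * τ)..X, cut X (x, τ) * R (x, τ) ^ (2 * N) * ψx (x, τ) ^ 2 := by
    funext τ
    unfold sl
    congr 1
    funext x
    show cut X (x, τ) * (R (x, τ) ^ N * ψx (x, τ)) ^ 2 = _
    rw [mul_pow, ← pow_mul, mul_comm N 2, mul_assoc]
  rw [e]
  refine h.congr_deriv ?_
  rw [F.ψt_bdry t ht', F.R_bdry t ht']
  unfold sl rate2
  simp only [one_pow, mul_one]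
  ring

/-- The cutoff inequality is integrated in time and the cutoff removed only at the end. Along with
the dissipation, m times the boundary integral of ψ_x² is obtained, which is the trace part of M².
-/
theorem energy2_bound (S : Setting N μ γ K m T vp k L cp Cp δ V V1 V2 R v vx u ψ ψx ψxx ψt)
    (hm1 : m ≤ 1) (hδ1 : δ ≤ 1) {Einf Ein A2 t : ℝ}
    (hEinf : ∀ t ∈ Icc 0 T, ∀ X, 0 ≤ X → sl m (enDens N V V1 R v vx ψ ψx) X t ≤ Einf)
    (hEin : ∀ X, 0 ≤ X → sl m (enDens N V V1 R v vx ψ ψx) X 0 ≤ Ein) (ht : t ∈ Icc 0 T)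
    (hsmall : 5 * secConst N μ vp L * lowConst N μ vp L Cp ^ 2 * Einf ≤ μ / vp / 8)
    (hA2 : ∀ X, 0 ≤ X → dbl m (lowDens N k m V V1 R v vx ψ ψx) X t ≤ A2) {Y : ℝ} (hY : 0 ≤ Y) :
    sl m (fun z => (R z ^ N * ψx z) ^ 2) Y t
      + μ / vp / 2 * dbl m (fun z => (R z ^ (2 * N) * ψxx z) ^ 2) Y t
      + m * ∫ τ in (0:ℝ)..t, ψx (-(m * τ), τ) ^ 2
      ≤ 4 * Ein + secLowConst N μ vp L Cp * A2 := by
  have F := S.flow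
  have hm := S.hm
  have hμ := S.hμ
  have hvp := S.hvp
  have hT : 0 ≤ T := ht.1.trans ht.2
  have h0T : (0:ℝ) ∈ Icc 0 T := ⟨le_rfl, hT⟩
  have hC3 := secConst_pos N hμ hvp S.hL
  have hC4 := secLowConst_pos N Cp hμ hvp S.hL
  have nE : 0 ≤ Einf := (sl_nonneg hm ht le_rfl (fun z _ => enDens_nonneg z)).trans
    (hEinf t ht 0 le_rfl)
  have cq2 : ContinuousOn (fun z => (R z ^ (2 * N) * ψxx z) ^ 2) (dom m T) :=
    ((F.contR.pow (2 * N)).mul F.contψxx).pow 2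
  have cp2 : ContinuousOn (fun z => (R z ^ N * ψx z) ^ 2) (dom m T) := S.contP.pow 2
  have cl := S.contLowDens
  set J := ∫ τ in (0:ℝ)..t, ψx (-(m * τ), τ) ^ 2 with hJdef
  set C3 := secConst N μ vp L with hC3def
  set C4 := secLowConst N μ vp L Cp with hC4def
  set c2 := μ / vp / 2 with hc2def
  have hc2 : 0 < c2 := by positivity
  have main : sl m (fun z => (R z ^ N * ψx z) ^ 2) Y t
      + dbl m (fun z => c2 * (R z ^ (2 * N) * ψxx z) ^ 2) Y t
      ≤ 4 * Ein + C4 * A2 - m * J := by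
    refine cutoff_limit (g := fun z => (R z ^ N * ψx z) ^ 2)
      (D := fun z => c2 * (R z ^ (2 * N) * ψxx z) ^ 2) hm cp2 (continuousOn_const.mul cq2)
      (fun z _ => sq_nonneg _) (fun z _ => mul_nonneg hc2.le (sq_nonneg _)) ht ?_ hY
    intro ε hε
    -- η ≤ 1 gives η² ≤ η, so the quadratic cutoff error T C3 η² Einf is at most ε.
    set η := min 1 (ε / (T * (C3 * Einf) + 1)) with hη
    have hη0 : 0 < η := by positivity
    have hη1 : η ≤ 1 := min_le_left _ _
    have hηε : T * (C3 * η ^ 2 * Einf) ≤ ε := by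
      have h1 : η ^ 2 ≤ ε / (T * (C3 * Einf) + 1) := by
        calc η ^ 2 = η * η := sq η
          _ ≤ 1 * (ε / (T * (C3 * Einf) + 1)) :=
            mul_le_mul hη1 (min_le_right _ _) hη0.le zero_le_one
          _ = _ := one_mul _
      rw [le_div_iff₀ (by positivity)] at h1
      have h2 := sq_nonneg η
      linarith
    obtain ⟨X1, hX1⟩ := S.grow η hη0
    refine ⟨max X1 (max 1 (m * T)), fun X hX => ?_⟩
    have hXX1 : X1 ≤ X := (le_max_left _ _).trans hX
    have hX1' : 1 ≤ X := ((le_max_left _ _).trans (le_max_right _ _)).trans hX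
    have hXm : m * T ≤ X := ((le_max_right _ _).trans (le_max_right _ _)).trans hX
    have hX0 : 0 < X := by linarith
    have hc := (continuous_cut X).continuousOn (s := dom m T)
    have cF : ContinuousOn (sl m (fun z => cut X z * (R z ^ N * ψx z) ^ 2) X) (Icc 0 T) :=
      continuousOn_sl hm hX0.le (hc.mul cp2)
    have cr : ContinuousOn (sl m (rate2 N X R v u ψx ψxx ψt) X) (Icc 0 T) :=
      continuousOn_sl hm hX0.le (S.cont_rate2 X)
    have cb : ContinuousOn (fun τ => cut X (-(m * τ), τ) * ψx (-(m * τ), τ) ^ 2) (Icc 0 T) :=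
      continuousOn_bdry (f := fun z => cut X z * ψx z ^ 2) (hc.mul (F.contψx.pow 2))
    have cb1 : ContinuousOn (fun τ => ψx (-(m * τ), τ) ^ 2) (Icc 0 T) :=
      continuousOn_bdry (f := fun z => ψx z ^ 2) (F.contψx.pow 2)
    have cQ : ContinuousOn (sl m (fun z => cut X z * (R z ^ (2 * N) * ψxx z) ^ 2) X) (Icc 0 T) :=
      continuousOn_sl hm hX0.le (hc.mul cq2)
    have cL : ContinuousOn (sl m (lowDens N k m V V1 R v vx ψ ψx) X) (Icc 0 T) :=
      continuousOn_sl hm hX0.le cl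
    have hftc := intervalIntegral.integral_eq_sub_of_hasDeriv_right_of_le ht.1
      (cF.mono (Icc_subset_Icc_right ht.2))
      (fun τ hτ => (S.hasDerivWithinAt_sl_cut hX0
        ⟨hτ.1.le, hτ.2.trans_le ht.2⟩).mono Ioi_subset_Ici_self)
      (intervalIntegrable_of_continuousOn_Icc (cr.sub (continuousOn_const.mul cb)) ht)
    have hint := integral_time_mono
      (h := fun τ => sl m (rate2 N X R v u ψx ψxx ψt) X τ
        - m * (cut X (-(m * τ), τ) * ψx (-(m * τ), τ) ^ 2))
      (k := fun τ => -(c2 * sl m (fun z => cut X z * (R z ^ (2 * N) * ψxx z) ^ 2) X τ)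
        + C4 * sl m (lowDens N k m V V1 R v vx ψ ψx) X τ + C3 * η ^ 2 * Einf
        - m * ψx (-(m * τ), τ) ^ 2) (cr.sub (continuousOn_const.mul cb))
      ((((continuousOn_const.mul cQ).neg.add (continuousOn_const.mul cL)).add
        continuousOn_const).sub (continuousOn_const.mul cb1)) ht
      (fun τ hτ => by
        have h1 := S.sl_rate2_le hm1 hδ1 hX1' hXm (hX1 X hXX1) hτ (hEinf τ hτ X hX0.le) hsmall
        rw [← hC3def, ← hC4def, ← hc2def] at h1
        have h2 := mul_le_mul_of_nonneg_right (one_le_cut_boundary hm hX0 hτ.1)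
          (sq_nonneg (ψx (-(m * τ), τ)))
        have h3 := mul_le_mul_of_nonneg_left h2 hm.le
        rw [one_mul] at h3
        linarith)
    have i1 : IntervalIntegrable (fun τ =>
        -(c2 * sl m (fun z => cut X z * (R z ^ (2 * N) * ψxx z) ^ 2) X τ)) volume 0 t := ((intervalIntegrable_of_continuousOn_Icc cQ ht).const_mul c2).neg
    have i2 := (intervalIntegrable_of_continuousOn_Icc cL ht).const_mul C4
    have ic : IntervalIntegrable (fun _ : ℝ => C3 * η ^ 2 * Einf) volume 0 t :=
      intervalIntegrable_const
    have i3 := (intervalIntegrable_of_continuousOn_Icc cb1 ht).const_mul m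
    have hexp : ∫ τ in (0:ℝ)..t, (-(c2 * sl m (fun z => cut X z * (R z ^ (2 * N) * ψxx z) ^ 2) X τ)
        + C4 * sl m (lowDens N k m V V1 R v vx ψ ψx) X τ + C3 * η ^ 2 * Einf
        - m * ψx (-(m * τ), τ) ^ 2)
        = -(c2 * dbl m (fun z => cut X z * (R z ^ (2 * N) * ψxx z) ^ 2) X t)
          + C4 * dbl m (lowDens N k m V V1 R v vx ψ ψx) X t + t * (C3 * η ^ 2 * Einf) - m * J := by
      rw [intervalIntegral.integral_sub ((i1.add i2).add ic) i3,
        intervalIntegral.integral_add (i1.add i2) ic, intervalIntegral.integral_add i1 i2,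
        intervalIntegral.integral_neg, intervalIntegral.integral_const,
        intervalIntegral.integral_const_mul, intervalIntegral.integral_const_mul,
        intervalIntegral.integral_const_mul]
      simp [dbl, hJdef]
    rw [hexp, hftc] at hint
    have hini : sl m (fun z => cut X z * (R z ^ N * ψx z) ^ 2) X 0 ≤ 4 * Ein := by
      have h := sl_mono hm (hc.mul cp2) (continuousOn_const.mul S.contEnDens) h0T hX0.le
        (f := fun z => cut X z * (R z ^ N * ψx z) ^ 2)
        (g := fun z => 4 * enDens N V V1 R v vx ψ ψx z) (fun z hz hzX => by
          have h2 := sq_nonneg (v z - V (R z))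
          have h3 := sq_nonneg (ψ z)
          have h4 := sq_nonneg (gradG N V1 R v vx z)
          have h5 := mul_le_mul_of_nonneg_right (cut_le_four hm hX0 hXm hz hzX).2
            (sq_nonneg (R z ^ N * ψx z))
          unfold enDens; linarith)
      rw [sl_const_mul] at h
      exact h.trans (mul_le_mul_of_nonneg_left (hEin X hX0.le) (by norm_num))
    have b1 := mul_le_mul_of_nonneg_left (hA2 X hX0.le) hC4.le
    have b2 : t * (C3 * η ^ 2 * Einf) ≤ T * (C3 * η ^ 2 * Einf) :=
      mul_le_mul_of_nonneg_right ht.2 (by positivity)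
    have e3 : dbl m (fun z => cut X z * (c2 * (R z ^ (2 * N) * ψxx z) ^ 2)) X t
        = c2 * dbl m (fun z => cut X z * (R z ^ (2 * N) * ψxx z) ^ 2) X t := by
      rw [← dbl_const_mul]
      congr 1
      funext z
      ring
    rw [e3]
    linarith
  rw [dbl_const_mul] at main
  linarith

end Setting


/-! ### Closing the estimates. -/

/-- The bootstrap inequality that closes the energy estimates. -/
theorem exists_bootstrap {μ vp c0 C0 C1 C4 h c1 Cp : ℝ} (hμ : 0 < μ) (hvp : 0 < vp) (hc0 : 0 < c0)
    (hC0 : 0 < C0) (hC1 : 0 < C1) (hC4 : 0 < C4) (hh : 0 < h) (hc1 : 0 < c1) (hCp : 0 < Cp) :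
    ∃ κ m1 C, 0 < κ ∧ 0 < m1 ∧ m1 ≤ 1 ∧ 0 < C ∧ ∀ m Ein B A0 Q0 J0 : ℝ, 0 < m → m ≤ m1 → 0 ≤ Ein →
      0 ≤ B → A0 = (1 + Cp) * Ein + C0 * (h * m ^ 3 * B) →
      Q0 = 2 * vp / μ * (4 * Ein + C4 * (A0 / c0 + B + h * m ^ 3 * B)) →
      J0 = (4 + 16 / (κ * m)) * (A0 / c0) + κ * m * Q0 →
      1 / μ * (2 * A0) + (μ + 1 / μ) * Ein + C1 * (A0 / c0 + h * m ^ 3 * B)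
        + 2 * μ / (vp ^ 2 * m) * J0 ≤ c1 * (C * ((1 + 1 / m ^ 2) * Ein) + B / 2) := by
  set K2 := 2 * μ / vp ^ 2 * (2 * vp / μ * (C4 * (C0 * h / c0 + 1 + h))) with hK2
  have hK20 : 0 < K2 := by positivity
  -- The trace parameter is θ = κ m. After division by m, the second order dissipation returns with
  -- coefficient κ and no power of m, and `K2` bounds its B-part; this κ makes it at most c1/4.
  set κ := c1 / (4 * K2) with hκ
  have hκ0 : 0 < κ := by positivity
  -- All other B-terms carry m³ from the Hardy inequality. At worst they lose m^{-2}, through 1/m in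
  -- the boundary term and 1/(κ m) in the trace, so they are bounded by m `K1`, and m is chosen
  -- after κ.
  set K1 := 2 / μ * (C0 * h) + C1 * (C0 * h / c0 + h)
    + 2 * μ / vp ^ 2 * ((4 + 16 / κ) * (C0 * h / c0)) with hK1
  have hK10 : 0 < K1 := by positivity
  -- The coefficient of the data; the same two losses produce 1/m² here, with nothing to compensate
  -- them.
  set K3 := 2 / μ * (1 + Cp) + (μ + 1 / μ) + C1 * ((1 + Cp) / c0)
    + 2 * μ / vp ^ 2 * ((4 + 16 / κ) * ((1 + Cp) / c0)
      + κ * (2 * vp / μ * (4 + C4 * ((1 + Cp) / c0)))) with hK3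
  have hK30 : 0 < K3 := by positivity
  refine ⟨κ, min 1 (c1 / (4 * K1)), K3 / c1, hκ0, by positivity, min_le_left _ _, by positivity, ?_⟩
  intro m Ein B A0 Q0 J0 hm hmm hE hB hA0 hQ0 hJ0
  have hm1 : m ≤ 1 := hmm.trans (min_le_left _ _)
  have hm2 : m * K1 ≤ c1 / 4 := by
    have := hmm.trans (min_le_right _ _)
    rw [le_div_iff₀ (by positivity)] at this
    linarith
  have hκK : κ * K2 = c1 / 4 := by rw [hκ]; field_simp
  have m3 : m ^ 3 ≤ m := by
    have : m ^ 3 ≤ m ^ 1 := pow_le_pow_of_le_one hm.le hm1 (by norm_num)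
    simpa using this
  have m31 : m ^ 3 ≤ 1 := m3.trans hm1
  have m2 : m ^ 2 ≤ m := by
    have : m ^ 2 ≤ m ^ 1 := pow_le_pow_of_le_one hm.le hm1 (by norm_num)
    simpa using this
  have i1 : 1 ≤ 1 / m := by rw [le_div_iff₀ hm]; linarith
  have i2 : 1 / m ≤ 1 / m ^ 2 := one_div_le_one_div_of_le (by positivity) m2
  set w := 1 / m ^ 2 with hw
  have hw1 : 1 ≤ w := i1.trans i2
  -- coefficients of the data and of the bootstrap quantity
  have e : 1 / μ * (2 * A0) + (μ + 1 / μ) * Ein + C1 * (A0 / c0 + h * m ^ 3 * B)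
        + 2 * μ / (vp ^ 2 * m) * J0
      = (2 / μ * (1 + Cp) + (μ + 1 / μ) + C1 * ((1 + Cp) / c0)
        + 2 * μ / vp ^ 2 * ((4 * (1 / m) + 16 / κ * w) * ((1 + Cp) / c0)
          + κ * (2 * vp / μ * (4 + C4 * ((1 + Cp) / c0))))) * Ein
      + ((2 / μ * (C0 * h) + C1 * (C0 * h / c0 + h)) * m ^ 3
        + 2 * μ / vp ^ 2 * ((4 * m ^ 2 + 16 / κ * m) * (C0 * h / c0))
        + κ * (2 * μ / vp ^ 2 * (2 * vp / μ * (C4 * (C0 * h / c0 * m ^ 3 + 1 + h * m ^ 3))))) * B := by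
    rw [hJ0, hQ0, hA0, hw]
    clear_value κ
    field_simp
    ring
  rw [e]
  have f1 : (2 / μ * (1 + Cp) + (μ + 1 / μ) + C1 * ((1 + Cp) / c0)
        + 2 * μ / vp ^ 2 * ((4 * (1 / m) + 16 / κ * w) * ((1 + Cp) / c0)
          + κ * (2 * vp / μ * (4 + C4 * ((1 + Cp) / c0))))) ≤ K3 * (1 + w) := by
    have g1 : 2 / μ * (1 + Cp) + (μ + 1 / μ) + C1 * ((1 + Cp) / c0)
        ≤ (2 / μ * (1 + Cp) + (μ + 1 / μ) + C1 * ((1 + Cp) / c0)) * (1 + w) :=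
      le_mul_of_one_le_right (by positivity) (by linarith)
    have g2 : 4 * (1 / m) + 16 / κ * w ≤ (4 + 16 / κ) * (1 + w) := by
      have : 0 < 16 / κ := by positivity
      linarith
    have g3 : κ * (2 * vp / μ * (4 + C4 * ((1 + Cp) / c0)))
        ≤ κ * (2 * vp / μ * (4 + C4 * ((1 + Cp) / c0))) * (1 + w) :=
      le_mul_of_one_le_right (by positivity) (by linarith)
    have g4 := mul_le_mul_of_nonneg_right g2 (by positivity : 0 ≤ (1 + Cp) / c0)
    have g5 := mul_le_mul_of_nonneg_left (add_le_add g4 g3) (by positivity : 0 ≤ 2 * μ / vp ^ 2)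
    rw [hK3]
    linarith
  have f2 : (2 / μ * (C0 * h) + C1 * (C0 * h / c0 + h)) * m ^ 3
        + 2 * μ / vp ^ 2 * ((4 * m ^ 2 + 16 / κ * m) * (C0 * h / c0))
        + κ * (2 * μ / vp ^ 2 * (2 * vp / μ * (C4 * (C0 * h / c0 * m ^ 3 + 1 + h * m ^ 3))))
      ≤ c1 / 2 := by
    have g1 := mul_le_mul_of_nonneg_left m3
      (by positivity : 0 ≤ 2 / μ * (C0 * h) + C1 * (C0 * h / c0 + h))
    have g2 : 4 * m ^ 2 + 16 / κ * m ≤ (4 + 16 / κ) * m := by linarith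
    have g3 := mul_le_mul_of_nonneg_left (mul_le_mul_of_nonneg_right g2
      (by positivity : 0 ≤ C0 * h / c0)) (by positivity : 0 ≤ 2 * μ / vp ^ 2)
    have g4 : κ * (2 * μ / vp ^ 2 * (2 * vp / μ * (C4 * (C0 * h / c0 * m ^ 3 + 1 + h * m ^ 3))))
        ≤ κ * K2 := by
      rw [hK2]
      gcongr
      · exact mul_le_of_le_one_right (by positivity) m31
      · exact mul_le_of_le_one_right hh.le m31
    have e1 : m * K1 = (2 / μ * (C0 * h) + C1 * (C0 * h / c0 + h)) * m
      + 2 * μ / vp ^ 2 * ((4 + 16 / κ) * m * (C0 * h / c0)) := by rw [hK1]; ring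
    linarith
  have h1 := mul_le_mul_of_nonneg_right f1 hE
  have h2 := mul_le_mul_of_nonneg_right f2 hB
  have e2 : c1 * (K3 / c1 * ((1 + w) * Ein) + B / 2) = K3 * (1 + w) * Ein + c1 / 2 * B := by
    field_simp
  rw [e2]
  linarith

namespace Setting

variable {N : ℕ} {μ γ K m T vp k L cp Cp δ : ℝ} {V V1 V2 : ℝ → ℝ}
  {R v vx u ψ ψx ψxx ψt : ℝ × ℝ → ℝ}

/-- The Hardy inequality with v between vp/2 and 2 vp: the ratio of the two bounds is the factor 4,
and m ≤ 1 merges m⁴ into m³. -/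
theorem sl_layer_le (S : Setting N μ γ K m T vp k L cp Cp δ V V1 V2 R v vx u ψ ψx ψxx ψt)
    (hm1 : m ≤ 1) {t X : ℝ} (ht : t ∈ Icc 0 T) (hX : 0 ≤ X) :
    sl m (fun z => layerWeight N k m (R z) * (v z - V (R z)) ^ 2) X t
      ≤ 4 * (1 + 1 / k ^ 2) * m ^ 3 * sl m (fun z => gradG N V1 R v vx z ^ 2) X t := by
  have F := S.flow
  have hm := S.hm
  have hvp := S.hvp
  have hk := S.hk
  have cG2 : ContinuousOn (fun z => gradG N V1 R v vx z ^ 2) (dom m T) := S.contG.pow 2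
  have h1 := F.hardy S.prof hm S.one_le_N hk (by positivity : 0 < vp / 2)
    (fun z hz => (S.mem z hz).1) ht hX
  have h2 : sl m (fun z => v z * gradG N V1 R v vx z ^ 2) X t
      ≤ 2 * vp * sl m (fun z => gradG N V1 R v vx z ^ 2) X t := by
    rw [← sl_const_mul]
    exact sl_mono hm (F.contv.mul cG2) (continuousOn_const.mul cG2) ht hX
      (fun z hz _ => mul_le_mul_of_nonneg_right (S.mem z hz).2 (sq_nonneg _))
  have hG0 : 0 ≤ sl m (fun z => gradG N V1 R v vx z ^ 2) X t :=
    sl_nonneg hm ht hX (fun z _ => sq_nonneg _)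
  calc _ ≤ _ := h1
    _ ≤ (m ^ 3 + m ^ 4 / k ^ 2) / (vp / 2)
        * (2 * vp * sl m (fun z => gradG N V1 R v vx z ^ 2) X t) := by gcongr
    _ = 4 * (1 + m * (1 / k ^ 2)) * m ^ 3 * sl m (fun z => gradG N V1 R v vx z ^ 2) X t := by
      field_simp; ring
    _ ≤ _ := by
      gcongr
      exact mul_le_of_le_one_left (by positivity) hm1

theorem integral_trace_le (S : Setting N μ γ K m T vp k L cp Cp δ V V1 V2 R v vx u ψ ψx ψxx ψt)
    {θ P Q t : ℝ} (hθ : 0 < θ) (ht : t ∈ Icc 0 T)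
    (hP : ∀ X, 0 ≤ X → dbl m (fun z => (R z ^ N * ψx z) ^ 2) X t ≤ P)
    (hQ : ∀ X, 0 ≤ X → dbl m (fun z => (R z ^ (2 * N) * ψxx z) ^ 2) X t ≤ Q) :
    ∫ τ in (0:ℝ)..t, ψx (-(m * τ), τ) ^ 2 ≤ (4 + 16 / θ) * P + θ * Q := by
  have F := S.flow
  have hm := S.hm
  set X := max 1 (m * T) with hX
  have hX1 : 1 ≤ X := le_max_left _ _
  have hX0 : 0 ≤ X := by linarith
  have cs1 : ContinuousOn (sl m (fun z => (R z ^ N * ψx z) ^ 2) X) (Icc 0 T) :=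
    continuousOn_sl hm hX0 (S.contP.pow 2)
  have cs2 : ContinuousOn (sl m (fun z => (R z ^ (2 * N) * ψxx z) ^ 2) X) (Icc 0 T) :=
    continuousOn_sl hm hX0 (((F.contR.pow (2 * N)).mul F.contψxx).pow 2)
  have cb : ContinuousOn (fun τ => ψx (-(m * τ), τ) ^ 2) (Icc 0 T) :=
    continuousOn_bdry (f := fun z => ψx z ^ 2) (F.contψx.pow 2)
  have h := integral_time_mono cb ((continuousOn_const.mul cs1).add (continuousOn_const.mul cs2)) ht
    (fun τ hτ => F.trace_le hm hτ hX1 (le_max_right _ _) hθ)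
  have e : ∫ τ in (0:ℝ)..t, ((4 + 16 / θ) * sl m (fun z => (R z ^ N * ψx z) ^ 2) X τ
      + θ * sl m (fun z => (R z ^ (2 * N) * ψxx z) ^ 2) X τ)
      = (4 + 16 / θ) * dbl m (fun z => (R z ^ N * ψx z) ^ 2) X t
        + θ * dbl m (fun z => (R z ^ (2 * N) * ψxx z) ^ 2) X t := by
    rw [intervalIntegral.integral_add
      ((intervalIntegrable_of_continuousOn_Icc cs1 ht).const_mul _)
      ((intervalIntegrable_of_continuousOn_Icc cs2 ht).const_mul _),
      intervalIntegral.integral_const_mul, intervalIntegral.integral_const_mul]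
    rfl
  have h' := h.trans_eq e
  have b1 := mul_le_mul_of_nonneg_left (hP X hX0) (by positivity : 0 ≤ 4 + 16 / θ)
  have b2 := mul_le_mul_of_nonneg_left (hQ X hX0) hθ.le
  linarith

end Setting


namespace Setting

variable {N : ℕ} {μ γ K m T vp k L cp Cp δ : ℝ} {V V1 V2 : ℝ → ℝ}
  {R v vx u ψ ψx ψxx ψt : ℝ × ℝ → ℝ}

/-- The constant of the layer-weighted Hardy inequality. -/
noncomputable def hardyConst (k : ℝ) : ℝ := 4 * (1 + 1 / k ^ 2)

theorem dbl_layer_le (S : Setting N μ γ K m T vp k L cp Cp δ V V1 V2 R v vx u ψ ψx ψxx ψt)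
    (hm1 : m ≤ 1) {t X B : ℝ} (ht : t ∈ Icc 0 T) (hX : 0 ≤ X)
    (hB : dbl m (fun z => gradG N V1 R v vx z ^ 2) X t ≤ B) :
    dbl m (fun z => layerWeight N k m (R z) * (v z - V (R z)) ^ 2) X t
      ≤ hardyConst k * m ^ 3 * B := by
  have hm := S.hm
  have hk := S.hk
  have cs1 : ContinuousOn (sl m (fun z => layerWeight N k m (R z) * (v z - V (R z)) ^ 2) X)
    (Icc 0 T) := continuousOn_sl hm hX S.contLayerPhi
  have cs2 : ContinuousOn (sl m (fun z => gradG N V1 R v vx z ^ 2) X) (Icc 0 T) :=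
    continuousOn_sl hm hX (S.contG.pow 2)
  have h := integral_time_mono
    (k := fun τ => hardyConst k * m ^ 3 * sl m (fun z => gradG N V1 R v vx z ^ 2) X τ)
    cs1 (continuousOn_const.mul cs2) ht (fun τ hτ => S.sl_layer_le hm1 hτ hX)
  rw [intervalIntegral.integral_const_mul] at h
  refine h.trans (mul_le_mul_of_nonneg_left hB ?_)
  unfold hardyConst; positivity

/-- Expresses everything by the data `Ein` and a bound `B` for ∬ G². The basic energy takes B
through Hardy (A0), the second order estimate takes A0 and B (Q0), the trace takes A0 and Q0 (J0),
and the gradient estimate takes A0 and J0 and returns a new bound for ∬ G². -/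
theorem energy_chain (S : Setting N μ γ K m T vp k L cp Cp δ V V1 V2 R v vx u ψ ψx ψxx ψt)
    (hm1 : m ≤ 1) (hδ1 : δ ≤ 1) {c0 C0 C1 Einf Ein B A0 Q0 J0 κ : ℝ}
    (hc0 : 0 < c0) (hC0 : 0 < C0) (hC1 : 0 < C1) (hκ : 0 < κ)
    (hle0 : ∀ z ∈ dom m T, energy0t N γ K m V V1 R v u ψ ψx ψt z
        ≤ flux0x N μ γ K V V1 R v vx ψ ψx ψxx z
          - c0 * ((R z ^ N * ψx z) ^ 2 + (ψ z / R z) ^ 2)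
          + C0 * (layerWeight N k m (R z) * (v z - V (R z)) ^ 2))
    (hle1 : ∀ z ∈ dom m T, energy1t N μ γ K m V V1 V2 R v vx u ψ ψx ψxx z
        ≤ -(divg N R v ψ ψx z * (divg N R v ψ ψx z / v z)
            + R z ^ N * ψ z * fluxx N R v vx ψ ψx ψxx z)
          - cp * vp / 8 * gradG N V1 R v vx z ^ 2
          + C1 * ((R z ^ N * ψx z) ^ 2 + (ψ z / R z) ^ 2
            + layerWeight N k m (R z) * (v z - V (R z)) ^ 2))
    (hEinf : ∀ t ∈ Icc 0 T, ∀ X, 0 ≤ X → sl m (enDens N V V1 R v vx ψ ψx) X t ≤ Einf)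
    (hEin : ∀ X, 0 ≤ X → sl m (enDens N V V1 R v vx ψ ψx) X 0 ≤ Ein)
    (hsmall : 5 * secConst N μ vp L * lowConst N μ vp L Cp ^ 2 * Einf ≤ μ / vp / 8)
    (hA0 : A0 = (1 + Cp) * Ein + C0 * (hardyConst k * m ^ 3 * B))
    (hQ0 : Q0 = 2 * vp / μ * (4 * Ein + secLowConst N μ vp L Cp
      * (A0 / c0 + B + hardyConst k * m ^ 3 * B)))
    (hJ0 : J0 = (4 + 16 / (κ * m)) * (A0 / c0) + κ * m * Q0)
    {t : ℝ} (ht : t ∈ Icc 0 T)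
    (hB : ∀ X, 0 ≤ X → dbl m (fun z => gradG N V1 R v vx z ^ 2) X t ≤ B) {Y : ℝ} (hY : 0 ≤ Y) :
    sl m (fun z => ψ z ^ 2 / 2 + cp / 2 * (v z - V (R z)) ^ 2) Y t ≤ A0
      ∧ dbl m (lowDens N k m V V1 R v vx ψ ψx) Y t ≤ A0 / c0 + B + hardyConst k * m ^ 3 * B
      ∧ sl m (fun z => (R z ^ N * ψx z) ^ 2) Y t
        + μ / vp / 2 * dbl m (fun z => (R z ^ (2 * N) * ψxx z) ^ 2) Y t
        + m * ∫ τ in (0:ℝ)..t, ψx (-(m * τ), τ) ^ 2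
        ≤ 4 * Ein + secLowConst N μ vp L Cp * (A0 / c0 + B + hardyConst k * m ^ 3 * B)
      ∧ μ / 4 * sl m (fun z => gradG N V1 R v vx z ^ 2) Y t
        + cp * vp / 8 * dbl m (fun z => gradG N V1 R v vx z ^ 2) Y t
        ≤ 1 / μ * (2 * A0) + (μ + 1 / μ) * Ein + C1 * (A0 / c0 + hardyConst k * m ^ 3 * B)
          + 2 * μ / (vp ^ 2 * m) * J0 := by
  have F := S.flow
  have hm := S.hm
  have hμ := S.hμ
  have hvp := S.hvp
  have hcp := S.press.pos
  have cp2 : ContinuousOn (fun z => (R z ^ N * ψx z) ^ 2) (dom m T) := S.contP.pow 2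
  have cy2 : ContinuousOn (fun z => (ψ z / R z) ^ 2) (dom m T) := S.contDivRadius.pow 2
  have cG2 : ContinuousOn (fun z => gradG N V1 R v vx z ^ 2) (dom m T) := S.contG.pow 2
  have cs := S.contLayerPhi
  have cpy : ContinuousOn (fun z => (R z ^ N * ψx z) ^ 2 + (ψ z / R z) ^ 2) (dom m T) := cp2.add cy2
  have ce : ContinuousOn (fun z => ψ z ^ 2 / 2 + cp / 2 * (v z - V (R z)) ^ 2) (dom m T) :=
    ((F.contψ.pow 2).div_const 2).add (continuousOn_const.mul ((F.contPhi S.prof).pow 2))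
  have hS : ∀ X, 0 ≤ X → dbl m (fun z => layerWeight N k m (R z) * (v z - V (R z)) ^ 2) X t
      ≤ hardyConst k * m ^ 3 * B := fun X hX => S.dbl_layer_le hm1 ht hX (hB X hX)
  set s := hardyConst k * m ^ 3 * B with hs
  have h0 : ∀ X, 0 ≤ X → sl m (fun z => ψ z ^ 2 / 2 + cp / 2 * (v z - V (R z)) ^ 2) X t
      + c0 * dbl m (fun z => (R z ^ N * ψx z) ^ 2 + (ψ z / R z) ^ 2) X t ≤ A0 := fun X hX => by
    rw [hA0]
    exact S.energy0_bound hc0 hC0 hle0 hEinf hEin ht hS hX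
  have he0 : ∀ X, 0 ≤ X → 0 ≤ sl m (fun z => ψ z ^ 2 / 2 + cp / 2 * (v z - V (R z)) ^ 2) X t :=
    fun X hX => sl_nonneg hm ht hX (fun z _ => by positivity)
  have hd0 : ∀ X, 0 ≤ X → 0 ≤ dbl m (fun z => (R z ^ N * ψx z) ^ 2 + (ψ z / R z) ^ 2) X t :=
    fun X hX => dbl_nonneg hm ht hX (fun z _ => by positivity)
  have hd : ∀ X, 0 ≤ X → dbl m (fun z => (R z ^ N * ψx z) ^ 2 + (ψ z / R z) ^ 2) X t ≤ A0 / c0 :=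
    fun X hX => by
      rw [le_div_iff₀ hc0]
      linarith [h0 X hX, he0 X hX]
  have he : ∀ X, 0 ≤ X → sl m (fun z => ψ z ^ 2 / 2 + cp / 2 * (v z - V (R z)) ^ 2) X t ≤ A0 :=
    fun X hX => by
      have := mul_nonneg hc0.le (hd0 X hX)
      linarith [h0 X hX]
  have hψ : ∀ X, 0 ≤ X → sl m (fun z => ψ z ^ 2) X t ≤ 2 * A0 := fun X hX => by
    have h := sl_mono hm (f := fun z => ψ z ^ 2)
      (g := fun z => 2 * (ψ z ^ 2 / 2 + cp / 2 * (v z - V (R z)) ^ 2)) (F.contψ.pow 2)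
      (continuousOn_const.mul ce) ht hX (fun z _ _ => by
        have := mul_nonneg hcp.le (sq_nonneg (v z - V (R z)))
        linarith)
    rw [sl_const_mul] at h
    linarith [he X hX]
  have hl : ∀ X, 0 ≤ X → dbl m (lowDens N k m V V1 R v vx ψ ψx) X t ≤ A0 / c0 + B + s :=
    fun X hX => by
      have e : dbl m (lowDens N k m V V1 R v vx ψ ψx) X t
          = dbl m (fun z => (R z ^ N * ψx z) ^ 2 + (ψ z / R z) ^ 2) X t
            + dbl m (fun z => gradG N V1 R v vx z ^ 2) X t
            + dbl m (fun z => layerWeight N k m (R z) * (v z - V (R z)) ^ 2) X t := by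
        rw [← dbl_add (f := fun z => (R z ^ N * ψx z) ^ 2 + (ψ z / R z) ^ 2)
            (g := fun z => gradG N V1 R v vx z ^ 2) hm cpy cG2 ht hX,
          ← dbl_add (f := fun z => (R z ^ N * ψx z) ^ 2 + (ψ z / R z) ^ 2
              + gradG N V1 R v vx z ^ 2)
            (g := fun z => layerWeight N k m (R z) * (v z - V (R z)) ^ 2) hm (cpy.add cG2) cs ht hX]
        rfl
      rw [e]
      linarith [hd X hX, hB X hX, hS X hX]
  have h2 := fun (X : ℝ) (hX : 0 ≤ X) =>
    S.energy2_bound hm1 hδ1 hEinf hEin ht hsmall hl (Y := X) hX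
  have hJnn : 0 ≤ ∫ τ in (0:ℝ)..t, ψx (-(m * τ), τ) ^ 2 :=
    intervalIntegral.integral_nonneg ht.1 (fun τ _ => sq_nonneg _)
  have hQ : ∀ X, 0 ≤ X → dbl m (fun z => (R z ^ (2 * N) * ψxx z) ^ 2) X t ≤ Q0 := fun X hX => by
    have a1 := h2 X hX
    have a2 : 0 ≤ sl m (fun z => (R z ^ N * ψx z) ^ 2) X t :=
      sl_nonneg hm ht hX (fun z _ => sq_nonneg _)
    have a3 := mul_nonneg hm.le hJnn
    set D := dbl m (fun z => (R z ^ (2 * N) * ψxx z) ^ 2) X t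
    have a4 : μ / vp / 2 * D ≤ 4 * Ein + secLowConst N μ vp L Cp * (A0 / c0 + B + s) := by linarith
    have a5 := mul_le_mul_of_nonneg_left a4 (by positivity : 0 ≤ 2 * vp / μ)
    have e : 2 * vp / μ * (μ / vp / 2 * D) = D := by field_simp
    rw [e] at a5
    rw [hQ0]
    exact a5
  have hP : ∀ X, 0 ≤ X → dbl m (fun z => (R z ^ N * ψx z) ^ 2) X t ≤ A0 / c0 := fun X hX =>
    (dbl_mono hm cp2 cpy ht hX (fun z _ _ => le_add_of_nonneg_right (sq_nonneg _))).trans (hd X hX)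
  have hJ : ∫ τ in (0:ℝ)..t, ψx (-(m * τ), τ) ^ 2 ≤ J0 := by
    rw [hJ0]
    exact S.integral_trace_le (mul_pos hκ hm) ht hP hQ
  refine ⟨he Y hY, hl Y hY, h2 Y hY, ?_⟩
  refine S.energy1_bound hC1 hle1 hEinf hEin ht hψ ?_ hJ hY
  intro X hX
  rw [dbl_add (f := fun z => (R z ^ N * ψx z) ^ 2 + (ψ z / R z) ^ 2)
    (g := fun z => layerWeight N k m (R z) * (v z - V (R z)) ^ 2) hm cpy cs ht hX]
  exact add_le_add (hd X hX) (hS X hX)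

end Setting


namespace Setting

theorem hardyConst_pos {k : ℝ} (hk : 0 < k) : 0 < hardyConst k := by
  unfold hardyConst; positivity

/-- The a priori estimate: data of size `Ein` control all energies and dissipations by
`C (1 + 1 / m ^ 2) Ein`. -/
theorem exists_apriori (N : ℕ) {μ vp k L cp Cp : ℝ} (hμ : 0 < μ) (hvp : 0 < vp) (hk : 0 < k)
    (hL : 1 ≤ L) (hcp : 0 < cp) (hCp : 0 < Cp) : ∃ C m1 e1, 0 < C ∧ 0 < m1 ∧ 0 < e1 ∧
      ∀ {γ K m T δ : ℝ} {V V1 V2 : ℝ → ℝ} {R v vx u ψ ψx ψxx ψt : ℝ × ℝ → ℝ},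
      Setting N μ γ K m T vp k L cp Cp δ V V1 V2 R v vx u ψ ψx ψxx ψt → 0 ≤ T → m ≤ m1 → δ ≤ e1 →
      ∀ Einf Ein : ℝ, Einf ≤ e1 →
      (∀ t ∈ Icc 0 T, ∀ X, 0 ≤ X → sl m (enDens N V V1 R v vx ψ ψx) X t ≤ Einf) →
      (∀ X, 0 ≤ X → sl m (enDens N V V1 R v vx ψ ψx) X 0 ≤ Ein) →
      (∀ t ∈ Icc 0 T, ∀ Y, 0 ≤ Y →
        sl m (enDens N V V1 R v vx ψ ψx) Y t ≤ C * ((1 + 1 / m ^ 2) * Ein))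
      ∧ (∀ Y, 0 ≤ Y → dbl m (lowDens N k m V V1 R v vx ψ ψx) Y T ≤ C * ((1 + 1 / m ^ 2) * Ein))
      ∧ (∀ Y, 0 ≤ Y → dbl m (fun z => (R z ^ (2 * N) * ψxx z) ^ 2) Y T
        ≤ C * ((1 + 1 / m ^ 2) * Ein))
      ∧ m * ∫ τ in (0:ℝ)..T, ψx (-(m * τ), τ) ^ 2 ≤ C * ((1 + 1 / m ^ 2) * Ein) := by
  obtain ⟨c0, C0, m0, hc0, hC0, hm0, h0⟩ := exists_energy0_le N cp Cp hμ hvp hL hCp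
  obtain ⟨C1, m1, δ1, hC1, hm1, hδ1, h1⟩ := exists_energy1_le N hμ hvp hL hcp hCp
  have hC4 := secLowConst_pos N Cp hμ hvp hL
  have hC3 := secConst_pos N hμ hvp hL
  have hh := hardyConst_pos hk
  obtain ⟨κ, m2, Cb, hκ, hm2, hm21, hCb, hboot⟩ := exists_bootstrap hμ hvp hc0 hC0 hC1 hC4 hh
    (by positivity : 0 < cp * vp / 8) hCp
  set h := hardyConst k with hhdef
  set C4 := secLowConst N μ vp L Cp with hC4def
  set C3 := secConst N μ vp L with hC3def
  set Cl := lowConst N μ vp L Cp with hCldef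
  -- With D = (1 + 1/m²) Ein and B ≤ 2 Cb D, the numbers a, b, d are the multiples of D that bound
  -- A0, the lower order dissipation and the right side of the second order estimate.
  set a := (1 + Cp) + C0 * (h * (2 * Cb)) with ha
  set b := a / c0 + 2 * Cb + h * (2 * Cb) with hb
  set d := 4 + C4 * b with hd
  have ha0 : 0 < a := by positivity
  have hb0 : 0 < b := by positivity
  have hd0 : 0 < d := by positivity
  have hx0 : 0 < 5 * C3 * Cl ^ 2 + 1 := by positivity
  refine ⟨(2 + 2 / cp) * a + cp * vp / μ * Cb + d + b + 2 * vp / μ * d,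
    min m0 (min m1 m2), min (min δ1 1) (μ / vp / 8 / (5 * C3 * Cl ^ 2 + 1)),
    by positivity, by positivity, by positivity, ?_⟩
  intro γ K m T δ V V1 V2 R v vx u ψ ψx ψxx ψt S hT hmm hδ Einf Ein hE1 hEinf hEin
  have hm := S.hm
  have F := S.flow
  have hTT : T ∈ Icc 0 T := ⟨hT, le_rfl⟩
  have h0T : (0:ℝ) ∈ Icc 0 T := ⟨le_rfl, hT⟩
  have hmm0 : m ≤ m0 := hmm.trans (min_le_left _ _)
  have hmm1 : m ≤ m1 := hmm.trans ((min_le_right _ _).trans (min_le_left _ _))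
  have hmm2 : m ≤ m2 := hmm.trans ((min_le_right _ _).trans (min_le_right _ _))
  have hm_one : m ≤ 1 := hmm2.trans hm21
  have hδ_1 : δ ≤ δ1 := hδ.trans ((min_le_left _ _).trans (min_le_left _ _))
  have hδ_one : δ ≤ 1 := hδ.trans ((min_le_left _ _).trans (min_le_right _ _))
  have hEinf0 : 0 ≤ Einf := (sl_nonneg hm h0T le_rfl (fun z _ => enDens_nonneg z)).trans
    (hEinf 0 h0T 0 le_rfl)
  have hEin0 : 0 ≤ Ein := (sl_nonneg hm h0T le_rfl (fun z _ => enDens_nonneg z)).trans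
    (hEin 0 le_rfl)
  have hsmall : 5 * C3 * Cl ^ 2 * Einf ≤ μ / vp / 8 := by
    have := hE1.trans (min_le_right _ _)
    rw [le_div_iff₀ hx0] at this
    linarith
  have cG2 : ContinuousOn (fun z => gradG N V1 R v vx z ^ 2) (dom m T) := S.contG.pow 2
  set dG := fun Y => dbl m (fun z => gradG N V1 R v vx z ^ 2) Y T with hdG
  -- Absorbing B/2 requires B finite. The a priori energy bound gives the crude value T · Einf,
  -- which does not enter the final constants.
  have hbd : BddAbove (dG '' Ici 0) := by
    refine ⟨T * Einf, ?_⟩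
    rintro _ ⟨Y, hY, rfl⟩
    have hY' : (0:ℝ) ≤ Y := hY
    have h := integral_time_mono (T := T) (k := fun _ => Einf) (continuousOn_sl hm hY' cG2)
      continuousOn_const hTT (fun τ hτ => (sl_mono hm (f := fun z => gradG N V1 R v vx z ^ 2)
        (g := enDens N V V1 R v vx ψ ψx) cG2 S.contEnDens hτ hY' (fun z _ _ => by
          have h2 := sq_nonneg (v z - V (R z))
          have h3 := sq_nonneg (ψ z)
          have h4 := sq_nonneg (R z ^ N * ψx z)
          unfold enDens; linarith)).trans (hEinf τ hτ Y hY'))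
    simpa [hdG, dbl] using h
  set B := sSup (dG '' Ici 0) with hBdef
  have hBle : ∀ Y, 0 ≤ Y → dG Y ≤ B := fun Y hY => le_csSup hbd ⟨Y, hY, rfl⟩
  have hB0 : 0 ≤ B := (dbl_nonneg hm hTT le_rfl (fun z _ => sq_nonneg _)).trans (hBle 0 le_rfl)
  have hBt : ∀ t ∈ Icc 0 T, ∀ X, 0 ≤ X → dbl m (fun z => gradG N V1 R v vx z ^ 2) X t ≤ B :=
    fun t ht X hX => (dbl_mono_time hm cG2 ht hX (fun z _ => sq_nonneg _)).trans (hBle X hX)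
  set A0 := (1 + Cp) * Ein + C0 * (h * m ^ 3 * B) with hA0
  set Q0 := 2 * vp / μ * (4 * Ein + C4 * (A0 / c0 + B + h * m ^ 3 * B)) with hQ0
  set J0 := (4 + 16 / (κ * m)) * (A0 / c0) + κ * m * Q0 with hJ0
  have chain := fun (t : ℝ) (ht : t ∈ Icc 0 T) (Y : ℝ) (hY : 0 ≤ Y) =>
    S.energy_chain hm_one hδ_one hc0 hC0 hC1 hκ (h0 S hmm0) (h1 S hmm1 hδ_1) hEinf hEin hsmall
      hA0 hQ0 hJ0 ht (hBt t ht) hY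
  have hbt := hboot m Ein B A0 Q0 J0 hm hmm2 hEin0 hB0 hA0 hQ0 hJ0
  set D := (1 + 1 / m ^ 2) * Ein with hD
  have hED : Ein ≤ D := le_mul_of_one_le_left hEin0 (by
    have : 0 < 1 / m ^ 2 := by positivity
    linarith)
  have hD0 : 0 ≤ D := hEin0.trans hED
  have slG0 : ∀ t ∈ Icc 0 T, ∀ Y, 0 ≤ Y → 0 ≤ sl m (fun z => gradG N V1 R v vx z ^ 2) Y t :=
    fun t ht Y hY => sl_nonneg hm ht hY (fun z _ => sq_nonneg _)
  -- Taking the supremum over Y in the gradient estimate at time T gives B ≤ Cb D + B/2.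
  have hB2 : B ≤ 2 * Cb * D := by
    have hle : B ≤ Cb * D + B / 2 := by
      refine csSup_le ⟨dG 0, 0, self_mem_Ici, rfl⟩ ?_
      rintro _ ⟨Y, hY, rfl⟩
      have c := (chain T hTT Y hY).2.2.2
      have s0 := mul_nonneg (by positivity : 0 ≤ μ / 4) (slG0 T hTT Y hY)
      have : cp * vp / 8 * dG Y ≤ cp * vp / 8 * (Cb * D + B / 2) := by
        have e : dG Y = dbl m (fun z => gradG N V1 R v vx z ^ 2) Y T := rfl
        rw [e]
        linarith
      exact le_of_mul_le_mul_left this (by positivity)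
    linarith
  have m31 : m ^ 3 ≤ 1 := pow_le_one₀ hm.le hm_one
  have hsB : h * m ^ 3 * B ≤ h * (2 * Cb) * D := by
    calc h * m ^ 3 * B ≤ h * 1 * (2 * Cb * D) := by gcongr
      _ = _ := by ring
  have hA0D : A0 ≤ a * D := by
    have t1 := mul_le_mul_of_nonneg_left hED (by positivity : 0 ≤ 1 + Cp)
    have t2 := mul_le_mul_of_nonneg_left hsB hC0.le
    rw [hA0, ha]
    linarith
  have hbD : A0 / c0 + B + h * m ^ 3 * B ≤ b * D := by
    have t1 : A0 / c0 ≤ a / c0 * D := by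
      rw [div_mul_eq_mul_div]; gcongr
    rw [hb]
    linarith
  have hdD : 4 * Ein + C4 * (A0 / c0 + B + h * m ^ 3 * B) ≤ d * D := by
    have t2 := mul_le_mul_of_nonneg_left hbD hC4.le
    rw [hd]
    linarith
  have ha2 : 0 ≤ (2 + 2 / cp) * a * D := by positivity
  have hg2 : 0 ≤ cp * vp / μ * Cb * D := by positivity
  have hb2 : 0 ≤ b * D := by positivity
  have hd2 : 0 ≤ d * D := by positivity
  have hq2 : 0 ≤ 2 * vp / μ * d * D := by positivity
  have hJnn : 0 ≤ ∫ τ in (0:ℝ)..T, ψx (-(m * τ), τ) ^ 2 :=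
    intervalIntegral.integral_nonneg hT (fun τ _ => sq_nonneg _)
  have cp2 : ContinuousOn (fun z => (R z ^ N * ψx z) ^ 2) (dom m T) := S.contP.pow 2
  have ce : ContinuousOn (fun z => ψ z ^ 2 / 2 + cp / 2 * (v z - V (R z)) ^ 2) (dom m T) :=
    ((F.contψ.pow 2).div_const 2).add (continuousOn_const.mul ((F.contPhi S.prof).pow 2))
  refine ⟨fun t ht Y hY => ?_, fun Y hY => ?_, fun Y hY => ?_, ?_⟩
  · obtain ⟨c1, -, c3, c4⟩ := chain t ht Y hY
    have e : sl m (enDens N V V1 R v vx ψ ψx) Y t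
        ≤ (2 + 2 / cp) * sl m (fun z => ψ z ^ 2 / 2 + cp / 2 * (v z - V (R z)) ^ 2) Y t
          + sl m (fun z => gradG N V1 R v vx z ^ 2) Y t
          + sl m (fun z => (R z ^ N * ψx z) ^ 2) Y t := by
      rw [← sl_const_mul, ← sl_add
          (f := fun z => (2 + 2 / cp) * (ψ z ^ 2 / 2 + cp / 2 * (v z - V (R z)) ^ 2))
          (g := fun z => gradG N V1 R v vx z ^ 2) hm (continuousOn_const.mul ce) cG2 ht hY,
        ← sl_add (f := fun z => (2 + 2 / cp) * (ψ z ^ 2 / 2 + cp / 2 * (v z - V (R z)) ^ 2)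
            + gradG N V1 R v vx z ^ 2) (g := fun z => (R z ^ N * ψx z) ^ 2) hm
          ((continuousOn_const.mul ce).add cG2) cp2 ht hY]
      refine sl_mono hm S.contEnDens (((continuousOn_const.mul ce).add cG2).add cp2) ht hY ?_
      intro z _ _
      have e2 : (2 + 2 / cp) * (ψ z ^ 2 / 2 + cp / 2 * (v z - V (R z)) ^ 2)
          = ψ z ^ 2 + (v z - V (R z)) ^ 2 + (1 / cp * ψ z ^ 2 + cp * (v z - V (R z)) ^ 2) := by
        field_simp; ring
      have e3 : 0 ≤ 1 / cp * ψ z ^ 2 + cp * (v z - V (R z)) ^ 2 := by positivity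
      unfold enDens
      linarith
    have b1 := mul_le_mul_of_nonneg_left (c1.trans hA0D) (by positivity : 0 ≤ 2 + 2 / cp)
    have q0 : 0 ≤ dbl m (fun z => (R z ^ (2 * N) * ψxx z) ^ 2) Y t :=
      dbl_nonneg hm ht hY (fun z _ => sq_nonneg _)
    have j0 : 0 ≤ ∫ τ in (0:ℝ)..t, ψx (-(m * τ), τ) ^ 2 :=
      intervalIntegral.integral_nonneg ht.1 (fun τ _ => sq_nonneg _)
    have q1 := mul_nonneg (by positivity : 0 ≤ μ / vp / 2) q0
    have j1 := mul_nonneg hm.le j0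
    have g0 : 0 ≤ dbl m (fun z => gradG N V1 R v vx z ^ 2) Y t :=
      dbl_nonneg hm ht hY (fun z _ => sq_nonneg _)
    have g1 := mul_nonneg (by positivity : 0 ≤ cp * vp / 8) g0
    have g2 : μ / 4 * sl m (fun z => gradG N V1 R v vx z ^ 2) Y t
        ≤ cp * vp / 8 * (2 * Cb * D) := by
      have : cp * vp / 8 * (Cb * D + B / 2) ≤ cp * vp / 8 * (2 * Cb * D) := by
        gcongr; linarith
      linarith
    have g3 : sl m (fun z => gradG N V1 R v vx z ^ 2) Y t ≤ cp * vp / μ * Cb * D := by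
      have := mul_le_mul_of_nonneg_left g2 (by positivity : 0 ≤ 4 / μ)
      have e1 : 4 / μ * (μ / 4 * sl m (fun z => gradG N V1 R v vx z ^ 2) Y t)
        = sl m (fun z => gradG N V1 R v vx z ^ 2) Y t := by field_simp
      have e2 : 4 / μ * (cp * vp / 8 * (2 * Cb * D)) = cp * vp / μ * Cb * D := by field_simp; ring
      rw [e1, e2] at this
      exact this
    have p1 : sl m (fun z => (R z ^ N * ψx z) ^ 2) Y t ≤ d * D := by linarith
    linarith
  · have c := (chain T hTT Y hY).2.1
    linarith
  · have c := (chain T hTT Y hY).2.2.1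
    have p0 : 0 ≤ sl m (fun z => (R z ^ N * ψx z) ^ 2) Y T :=
      sl_nonneg hm hTT hY (fun z _ => sq_nonneg _)
    have j1 := mul_nonneg hm.le hJnn
    have g2 : μ / vp / 2 * dbl m (fun z => (R z ^ (2 * N) * ψxx z) ^ 2) Y T ≤ d * D := by linarith
    have := mul_le_mul_of_nonneg_left g2 (by positivity : 0 ≤ 2 * vp / μ)
    have e1 : 2 * vp / μ * (μ / vp / 2 * dbl m (fun z => (R z ^ (2 * N) * ψxx z) ^ 2) Y T)
      = dbl m (fun z => (R z ^ (2 * N) * ψxx z) ^ 2) Y T := by field_simp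
    rw [e1] at this
    linarith
  · have c := (chain T hTT 0 le_rfl).2.2.1
    have p0 : 0 ≤ sl m (fun z => (R z ^ N * ψx z) ^ 2) 0 T :=
      sl_nonneg hm hTT le_rfl (fun z _ => sq_nonneg _)
    have q0 : 0 ≤ dbl m (fun z => (R z ^ (2 * N) * ψxx z) ^ 2) 0 T :=
      dbl_nonneg hm hTT le_rfl (fun z _ => sq_nonneg _)
    have q1 := mul_nonneg (by positivity : 0 ≤ μ / vp / 2) q0
    linarith

end Setting


/-! ### Passage between truncated integrals and extended-valued norms. -/

section LIntegral

variable {m T t : ℝ} {f : ℝ × ℝ → ℝ}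

theorem isClosed_dom (m T : ℝ) : IsClosed (dom m T) := by
  have h1 : IsClosed {z : ℝ × ℝ | z.2 ∈ Icc 0 T} := isClosed_Icc.preimage continuous_snd
  have h2 : IsClosed {z : ℝ × ℝ | -(m * z.2) ≤ z.1} := isClosed_le (by fun_prop) (by fun_prop)
  exact h1.inter h2

theorem lintegral_Icc_eq_ofReal {g : ℝ → ℝ} {a b : ℝ} (hab : a ≤ b) (hg : ContinuousOn g (Icc a b))
    (h0 : ∀ x ∈ Icc a b, 0 ≤ g x) :
    ∫⁻ x in Icc a b, ENNReal.ofReal (g x) = ENNReal.ofReal (∫ x in a..b, g x) := by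
  rw [intervalIntegral.integral_of_le hab, ← integral_Icc_eq_integral_Ioc,
    ofReal_integral_eq_lintegral_ofReal hg.integrableOn_Icc
      ((ae_restrict_iff' measurableSet_Icc).2 (Eventually.of_forall h0))]

theorem lintegral_slice_eq (hm : 0 < m) (hf : ContinuousOn f (dom m T)) (h0 : ∀ z ∈ dom m T, 0 ≤ f z)
    (ht : t ∈ Icc 0 T) {Y : ℝ} (hY : 0 ≤ Y) :
    ∫⁻ x in Icc (-(m * t)) Y, ENNReal.ofReal (f (x, t)) = ENNReal.ofReal (sl m f Y t) :=
  lintegral_Icc_eq_ofReal (g := fun x => f (x, t)) (neg_mul_le hm ht.1 hY)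
    (hf.comp (by fun_prop) (fun _ hx => ⟨ht, hx.1⟩)) (fun _ hx => h0 _ ⟨ht, hx.1⟩)

theorem sl_le_of_lintegral_le (hm : 0 < m) (hf : ContinuousOn f (dom m T))
    (h0 : ∀ z ∈ dom m T, 0 ≤ f z) (ht : t ∈ Icc 0 T) {E : ℝ} (hE : 0 ≤ E)
    (h : ∫⁻ x in snap m t, ENNReal.ofReal (f (x, t)) ≤ ENNReal.ofReal E) {Y : ℝ} (hY : 0 ≤ Y) :
    sl m f Y t ≤ E := by
  rw [← ENNReal.ofReal_le_ofReal_iff hE, ← lintegral_slice_eq hm hf h0 ht hY]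
  exact (lintegral_mono_set Icc_subset_Ici_self).trans h

theorem lintegral_le_of_sl_le (hm : 0 < m) (hf : ContinuousOn f (dom m T))
    (h0 : ∀ z ∈ dom m T, 0 ≤ f z) (ht : t ∈ Icc 0 T) {E : ℝ}
    (h : ∀ Y, 0 ≤ Y → sl m f Y t ≤ E) :
    ∫⁻ x in snap m t, ENNReal.ofReal (f (x, t)) ≤ ENNReal.ofReal E := by
  have e : snap m t = ⋃ j : ℕ, Icc (-(m * t)) (j : ℝ) := by
    ext x
    simp only [snap, mem_Ici, mem_iUnion, mem_Icc, exists_and_left]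
    exact ⟨fun hx => ⟨hx, exists_nat_ge x⟩, fun hx => hx.1⟩
  rw [e, setLIntegral_iUnion_of_directed]
  · refine iSup_le fun j => ?_
    rw [lintegral_slice_eq hm hf h0 ht (Nat.cast_nonneg j)]
    exact ENNReal.ofReal_le_ofReal (h j (Nat.cast_nonneg j))
  · exact Monotone.directed_le (fun i j hij => Icc_subset_Icc_right (Nat.cast_le.2 hij))

/-- Monotone convergence over the truncations x ≤ j, and Tonelli with the slices taken at fixed
time. -/
theorem lintegral_dom_le_of_dbl_le (hm : 0 < m) (hT : 0 ≤ T) (hf : ContinuousOn f (dom m T))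
    (h0 : ∀ z ∈ dom m T, 0 ≤ f z) {E : ℝ} (h : ∀ Y, 0 ≤ Y → dbl m f Y T ≤ E) :
    ∫⁻ z in dom m T, ENNReal.ofReal (f z) ≤ ENNReal.ofReal E := by
  have e : dom m T = ⋃ j : ℕ, dom m T ∩ {z | z.1 ≤ (j : ℝ)} := by
    ext z
    simp only [mem_iUnion, mem_inter_iff, mem_ofPred_eq, exists_and_left]
    exact ⟨fun hx => ⟨hx, exists_nat_ge z.1⟩, fun hx => hx.1⟩
  rw [e, setLIntegral_iUnion_of_directed]
  swap
  · exact Monotone.directed_le (fun i j hij => inter_subset_inter_right _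
      (fun z (hz : z.1 ≤ (i : ℝ)) => hz.trans (Nat.cast_le.2 hij)))
  refine iSup_le fun j => ?_
  set Y : ℝ := (j : ℝ) with hYdef
  have hY : 0 ≤ Y := Nat.cast_nonneg j
  set D := dom m T ∩ {z | z.1 ≤ Y} with hD
  have hDm : MeasurableSet D :=
    ((isClosed_dom m T).inter (isClosed_le continuous_fst continuous_const)).measurableSet
  have hmeas : AEMeasurable (D.indicator fun z => ENNReal.ofReal (f z))
      ((volume : Measure ℝ).prod volume) := by
    rw [aemeasurable_indicator_iff hDm]
    exact ((hf.mono inter_subset_left).aemeasurable hDm).ennreal_ofReal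
  rw [← lintegral_indicator hDm, Measure.volume_eq_prod, lintegral_prod_symm _ hmeas]
  have hin : ∀ t, ∫⁻ x, D.indicator (fun z => ENNReal.ofReal (f z)) (x, t)
      = (Icc 0 T).indicator (fun t => ENNReal.ofReal (sl m f Y t)) t := by
    intro t
    by_cases ht : t ∈ Icc 0 T
    · rw [indicator_of_mem ht, ← lintegral_slice_eq hm hf h0 ht hY,
        ← lintegral_indicator measurableSet_Icc]
      congr 1
      funext x
      by_cases hx : x ∈ Icc (-(m * t)) Y
      · rw [indicator_of_mem hx, indicator_of_mem (show (x, t) ∈ D from ⟨⟨ht, hx.1⟩, hx.2⟩)]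
      · rw [indicator_of_notMem hx,
          indicator_of_notMem (fun hz : (x, t) ∈ D => hx ⟨hz.1.2, hz.2⟩)]
    · rw [indicator_of_notMem ht]
      have : (fun x => D.indicator (fun z => ENNReal.ofReal (f z)) (x, t)) = fun _ => 0 := by
        funext x
        exact indicator_of_notMem (fun hz : (x, t) ∈ D => ht hz.1.1) _
      rw [this, lintegral_zero]
  rw [lintegral_congr hin, lintegral_indicator measurableSet_Icc,
    lintegral_Icc_eq_ofReal hT (continuousOn_sl hm hY hf) (fun τ hτ => sl_nonneg hm hτ hY h0)]
  exact ENNReal.ofReal_le_ofReal (h Y hY)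

theorem lintegral_le_of_rpow_half_le {I : ℝ≥0∞} {c : ℝ} (hc : 0 ≤ c)
    (h : I ^ ((1 : ℝ) / 2) ≤ ENNReal.ofReal c) : I ≤ ENNReal.ofReal (c ^ 2) := by
  have h2 := ENNReal.rpow_le_rpow h (by norm_num : (0:ℝ) ≤ 2)
  rw [← ENNReal.rpow_mul, ENNReal.ofReal_rpow_of_nonneg hc (by norm_num)] at h2
  norm_num at h2
  exact h2

theorem rpow_half_le_of_le {I : ℝ≥0∞} {c : ℝ} (hc : 0 ≤ c) (h : I ≤ ENNReal.ofReal c) :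
    I ^ ((1 : ℝ) / 2) ≤ ENNReal.ofReal (√c) := by
  have h2 := ENNReal.rpow_le_rpow h (by norm_num : (0:ℝ) ≤ 1 / 2)
  rwa [ENNReal.ofReal_rpow_of_nonneg hc (by norm_num), ← Real.sqrt_eq_rpow] at h2

end LIntegral


/-! ### Comparison of the energy densities with the norms of the statement. -/

section Norms

variable {N : ℕ} {μ γ K m T vp : ℝ} {ρs us : ℝ → ℝ} {V1 V2 : ℝ → ℝ}
  {v vx u ψx ψxx ψt : ℝ × ℝ → ℝ}

/-- The `H¹` part of the energy norm expressed by the effective gradient. -/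
theorem normL2_grad_eq {R : ℝ × ℝ → ℝ} {φx dψ : ℝ × ℝ → ℝ} {t : ℝ} (ht : t ∈ Icc 0 T)
    (hφx : ∀ z ∈ dom m T, R z ^ N * φx z = v z * gradG N V1 R v vx z)
    (hψx : ∀ z ∈ dom m T, dψ z = ψx z) :
    normL2 m (fun z => R z ^ (N + 1 - 1) * φx z) (fun z => R z ^ (N + 1 - 1) * dψ z) t
      = (∫⁻ x in snap m t, ENNReal.ofReal ((fun z => (v z * gradG N V1 R v vx z) ^ 2
          + (R z ^ N * ψx z) ^ 2) (x, t))) ^ ((1 : ℝ) / 2) := by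
  unfold normL2
  congr 1
  refine setLIntegral_congr_fun measurableSet_Ici (fun x hx => ?_)
  have hz : (x, t) ∈ dom m T := ⟨ht, hx⟩
  simp only [Nat.add_sub_cancel, hφx _ hz, hψx _ hz]

/-- R^N φ_x = v G with v ≥ vp/2 costs the factor 4/vp² for G². Each of the two norms is at most c,
whence c² + (1 + 4/vp²) c². -/
theorem Flow.sl_enDens_le {V : ℝ → ℝ} {R ψ φx dψ : ℝ × ℝ → ℝ}
    (F : Flow N μ γ K m T V V1 V2 R v vx u ψ ψx ψxx ψt) (P : Profile N μ γ K m vp V V1 V2)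
    (hm : 0 < m) (hvp : 0 < vp) (hv : ∀ z ∈ dom m T, vp / 2 ≤ v z)
    (hφx : ∀ z ∈ dom m T, R z ^ N * φx z = v z * gradG N V1 R v vx z)
    (hψx : ∀ z ∈ dom m T, dψ z = ψx z) {t c : ℝ} (ht : t ∈ Icc 0 T) (hc : 0 ≤ c)
    (h : normL2 m (fun z => v z - V (R z)) ψ t
      + normL2 m (fun z => R z ^ (N + 1 - 1) * φx z) (fun z => R z ^ (N + 1 - 1) * dψ z) t
        ≤ ENNReal.ofReal c) {X : ℝ} (hX : 0 ≤ X) :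
    sl m (enDens N V V1 R v vx ψ ψx) X t ≤ (2 + 4 / vp ^ 2) * c ^ 2 := by
  have cφ := F.contPhi P
  have cG := F.contGradG P
  have cp : ContinuousOn (fun z => R z ^ N * ψx z) (dom m T) := (F.contR.pow N).mul F.contψx
  have c1 : ContinuousOn (fun z => (v z - V (R z)) ^ 2 + ψ z ^ 2) (dom m T) :=
    (cφ.pow 2).add (F.contψ.pow 2)
  have c2 : ContinuousOn (fun z => (v z * gradG N V1 R v vx z) ^ 2 + (R z ^ N * ψx z) ^ 2)
    (dom m T) := ((F.contv.mul cG).pow 2).add (cp.pow 2)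
  have ce : ContinuousOn (enDens N V V1 R v vx ψ ψx) (dom m T) :=
    (((cφ.pow 2).add (F.contψ.pow 2)).add (cG.pow 2)).add (cp.pow 2)
  have h1 := lintegral_le_of_rpow_half_le hc ((le_add_of_nonneg_right zero_le).trans h)
  have h2 := (le_add_of_nonneg_left zero_le).trans h
  rw [normL2_grad_eq ht hφx hψx] at h2
  have h2' := lintegral_le_of_rpow_half_le hc h2
  have s1 := sl_le_of_lintegral_le hm c1 (fun z _ => by positivity) ht (sq_nonneg c) h1 hX
  have s2 := sl_le_of_lintegral_le hm c2 (fun z _ => by positivity) ht (sq_nonneg c) h2' hX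
  have h3 := sl_mono hm (f := enDens N V V1 R v vx ψ ψx)
    (g := fun z => ((v z - V (R z)) ^ 2 + ψ z ^ 2)
      + (1 + 4 / vp ^ 2) * ((v z * gradG N V1 R v vx z) ^ 2 + (R z ^ N * ψx z) ^ 2)) ce
    (c1.add (continuousOn_const.mul c2)) ht hX (fun z hz _ => by
      have hvz := hv z hz
      have g0 : vp ^ 2 / 4 * gradG N V1 R v vx z ^ 2 ≤ (v z * gradG N V1 R v vx z) ^ 2 := by
        rw [mul_pow]
        have : vp ^ 2 / 4 ≤ v z ^ 2 := by
          have := pow_le_pow_left₀ (by positivity) hvz 2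
          linarith
        gcongr
      have g1 : gradG N V1 R v vx z ^ 2 ≤ 4 / vp ^ 2 * (v z * gradG N V1 R v vx z) ^ 2 := by
        have := mul_le_mul_of_nonneg_left g0 (by positivity : 0 ≤ 4 / vp ^ 2)
        have e : 4 / vp ^ 2 * (vp ^ 2 / 4 * gradG N V1 R v vx z ^ 2) = gradG N V1 R v vx z ^ 2 := by
          field_simp
        linarith
      have g2 : 0 ≤ 4 / vp ^ 2 * (R z ^ N * ψx z) ^ 2 := by positivity
      have g3 := sq_nonneg (v z * gradG N V1 R v vx z)
      unfold enDens
      linarith)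
  rw [sl_add (f := fun z => (v z - V (R z)) ^ 2 + ψ z ^ 2)
    (g := fun z => (1 + 4 / vp ^ 2) * ((v z * gradG N V1 R v vx z) ^ 2 + (R z ^ N * ψx z) ^ 2))
    hm c1 (continuousOn_const.mul c2) ht hX, sl_const_mul] at h3
  have s3 := mul_le_mul_of_nonneg_left s2 (by positivity : 0 ≤ 1 + 4 / vp ^ 2)
  linarith

theorem Flow.norms_le {V : ℝ → ℝ} {R ψ φx dψ : ℝ × ℝ → ℝ}
    (F : Flow N μ γ K m T V V1 V2 R v vx u ψ ψx ψxx ψt) (P : Profile N μ γ K m vp V V1 V2)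
    (hm : 0 < m) (hv : ∀ z ∈ dom m T, v z ≤ 2 * vp)
    (hφx : ∀ z ∈ dom m T, R z ^ N * φx z = v z * gradG N V1 R v vx z)
    (hψx : ∀ z ∈ dom m T, dψ z = ψx z) {t E : ℝ} (ht : t ∈ Icc 0 T) (hE : 0 ≤ E)
    (h : ∀ X, 0 ≤ X → sl m (enDens N V V1 R v vx ψ ψx) X t ≤ E) :
    normL2 m (fun z => v z - V (R z)) ψ t
      + normL2 m (fun z => R z ^ (N + 1 - 1) * φx z) (fun z => R z ^ (N + 1 - 1) * dψ z) t
        ≤ ENNReal.ofReal (2 * √((1 + 4 * vp ^ 2) * E)) := by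
  have cφ := F.contPhi P
  have cG := F.contGradG P
  have cp : ContinuousOn (fun z => R z ^ N * ψx z) (dom m T) := (F.contR.pow N).mul F.contψx
  have c1 : ContinuousOn (fun z => (v z - V (R z)) ^ 2 + ψ z ^ 2) (dom m T) :=
    (cφ.pow 2).add (F.contψ.pow 2)
  have c2 : ContinuousOn (fun z => (v z * gradG N V1 R v vx z) ^ 2 + (R z ^ N * ψx z) ^ 2)
    (dom m T) := ((F.contv.mul cG).pow 2).add (cp.pow 2)
  have ce : ContinuousOn (enDens N V V1 R v vx ψ ψx) (dom m T) :=
    (((cφ.pow 2).add (F.contψ.pow 2)).add (cG.pow 2)).add (cp.pow 2)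
  have hE' : 0 ≤ (1 + 4 * vp ^ 2) * E := by positivity
  have bound : ∀ f : ℝ × ℝ → ℝ, ContinuousOn f (dom m T) → (∀ z ∈ dom m T, 0 ≤ f z) →
      (∀ z ∈ dom m T, f z ≤ (1 + 4 * vp ^ 2) * enDens N V V1 R v vx ψ ψx z) →
      (∫⁻ x in snap m t, ENNReal.ofReal (f (x, t))) ^ ((1 : ℝ) / 2)
        ≤ ENNReal.ofReal (√((1 + 4 * vp ^ 2) * E)) := by
    intro f cf f0 hf
    refine rpow_half_le_of_le hE' (lintegral_le_of_sl_le hm cf f0 ht (fun Y hY => ?_))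
    have h3 := sl_mono hm cf (continuousOn_const.mul ce)
      (g := fun z => (1 + 4 * vp ^ 2) * enDens N V V1 R v vx ψ ψx z) ht hY (fun z hz _ => hf z hz)
    rw [sl_const_mul] at h3
    exact h3.trans (mul_le_mul_of_nonneg_left (h Y hY) (by positivity))
  have b1 := bound _ c1 (fun z _ => by positivity) (fun z _ => by
    have g1 := sq_nonneg (gradG N V1 R v vx z)
    have g2 := sq_nonneg (R z ^ N * ψx z)
    have g3 : 0 ≤ 4 * vp ^ 2 * ((v z - V (R z)) ^ 2 + ψ z ^ 2 + gradG N V1 R v vx z ^ 2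
      + (R z ^ N * ψx z) ^ 2) := by positivity
    unfold enDens
    linarith)
  have b2 := bound _ c2 (fun z _ => by positivity) (fun z hz => by
    have hvz := hv z hz
    have hv0 := F.vpos z hz
    have g0 : (v z * gradG N V1 R v vx z) ^ 2 ≤ 4 * vp ^ 2 * gradG N V1 R v vx z ^ 2 := by
      rw [mul_pow]
      have : v z ^ 2 ≤ 4 * vp ^ 2 := by
        have := pow_le_pow_left₀ hv0.le hvz 2
        linarith
      gcongr
    have g1 := sq_nonneg (gradG N V1 R v vx z)
    have g4 := sq_nonneg (v z - V (R z))
    have g5 := sq_nonneg (ψ z)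
    have g3 : 0 ≤ 4 * vp ^ 2 * ((v z - V (R z)) ^ 2 + ψ z ^ 2 + (R z ^ N * ψx z) ^ 2) := by
      positivity
    unfold enDens
    linarith)
  rw [normL2_grad_eq ht hφx hψx, two_mul, ENNReal.ofReal_add (Real.sqrt_nonneg _) (Real.sqrt_nonneg _)]
  exact add_le_add b1 b2

/-- In the interior the exponents 2n - 4 and 4n - 6 are at most 2N and 4N, and R ≥ 1. On the
boundary m φ_x = ψ_x and u_b = m/ρ_b, so u_b ψ_x² + u_b³ φ_x² is ρ_b^{-1}(1 + ρ_b^{-2}) times m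
ψ_x², the trace from the second order estimate. -/
theorem Setting.dissipation_le {k L cp Cp δ ub ρb D1 D2 J : ℝ} {V : ℝ → ℝ}
    {R ψ φx dψ ddψ : ℝ × ℝ → ℝ}
    (S : Setting N μ γ K m T vp k L cp Cp δ V V1 V2 R v vx u ψ ψx ψxx ψt) (hT : 0 ≤ T)
    (hρb : 0 < ρb) (hmb : m = ρb * ub)
    (hφx : ∀ z ∈ dom m T, R z ^ N * φx z = v z * gradG N V1 R v vx z)
    (hψx : ∀ z ∈ dom m T, dψ z = ψx z) (hψxx : ∀ z ∈ dom m T, ddψ z = ψxx z)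
    (h1 : ∀ Y, 0 ≤ Y → dbl m (lowDens N k m V V1 R v vx ψ ψx) Y T ≤ D1)
    (h2 : ∀ Y, 0 ≤ Y → dbl m (fun z => (R z ^ (2 * N) * ψxx z) ^ 2) Y T ≤ D2)
    (hJ : m * ∫ τ in (0:ℝ)..T, ψx (-(m * τ), τ) ^ 2 ≤ J) :
    (∫⁻ z in dom m T, ENNReal.ofReal (ψ z ^ 2 / R z ^ 2 + R z ^ (2 * (N + 1 - 1)) * dψ z ^ 2
        + R z ^ (2 * (N + 1) - 4) * φx z ^ 2 + R z ^ (4 * (N + 1) - 6) * ddψ z ^ 2))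
      + ∫⁻ τ in Icc 0 T, ENNReal.ofReal (ub * dψ (-(m * τ), τ) ^ 2 + ub ^ 3 * φx (-(m * τ), τ) ^ 2)
      ≤ ENNReal.ofReal ((1 + 4 * vp ^ 2) * D1 + D2)
        + ENNReal.ofReal (ρb⁻¹ * (1 + (ρb⁻¹) ^ 2) * J) := by
  have F := S.flow
  have hm := S.hm
  have cl := S.contLowDens
  have cq : ContinuousOn (fun z => (R z ^ (2 * N) * ψxx z) ^ 2) (dom m T) :=
    ((F.contR.pow (2 * N)).mul F.contψxx).pow 2
  refine add_le_add ?_ ?_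
  · have hle := lintegral_dom_le_of_dbl_le hm hT (f := fun z => (1 + 4 * vp ^ 2)
      * lowDens N k m V V1 R v vx ψ ψx z + (R z ^ (2 * N) * ψxx z) ^ 2)
      ((continuousOn_const.mul cl).add cq)
      (fun z hz => by have := S.lowDens_nonneg hz; positivity)
      (E := (1 + 4 * vp ^ 2) * D1 + D2) (fun Y hY => by
        rw [dbl_add (f := fun z => (1 + 4 * vp ^ 2) * lowDens N k m V V1 R v vx ψ ψx z)
          (g := fun z => (R z ^ (2 * N) * ψxx z) ^ 2) hm (continuousOn_const.mul cl) cq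
          ⟨hT, le_rfl⟩ hY, dbl_const_mul]
        exact add_le_add (mul_le_mul_of_nonneg_left (h1 Y hY) (by positivity)) (h2 Y hY))
    refine le_trans (setLIntegral_mono' (isClosed_dom m T).measurableSet (fun z hz => ?_)) hle
    refine ENNReal.ofReal_le_ofReal ?_
    have hr := F.one_le z hz
    have hr0 : 0 < R z := by linarith
    have hv0 := F.vpos z hz
    have e1 : ψ z ^ 2 / R z ^ 2 = (ψ z / R z) ^ 2 := (div_pow _ _ _).symm
    have e2 : R z ^ (2 * (N + 1 - 1)) * dψ z ^ 2 = (R z ^ N * ψx z) ^ 2 := by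
      rw [hψx z hz, mul_pow, ← pow_mul, Nat.add_sub_cancel, mul_comm 2 N]
    have e3 : R z ^ (2 * (N + 1) - 4) * φx z ^ 2 ≤ 4 * vp ^ 2 * gradG N V1 R v vx z ^ 2 := by
      have hvs : v z ^ 2 ≤ 4 * vp ^ 2 := by
        have := pow_le_pow_left₀ hv0.le (S.mem z hz).2 2
        linarith
      calc R z ^ (2 * (N + 1) - 4) * φx z ^ 2 ≤ R z ^ (N * 2) * φx z ^ 2 := by
            gcongr
            omega
        _ = (v z * gradG N V1 R v vx z) ^ 2 := by rw [← hφx z hz, mul_pow, pow_mul]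
        _ = v z ^ 2 * gradG N V1 R v vx z ^ 2 := mul_pow _ _ _
        _ ≤ _ := by gcongr
    have e4 : R z ^ (4 * (N + 1) - 6) * ddψ z ^ 2 ≤ (R z ^ (2 * N) * ψxx z) ^ 2 := by
      rw [hψxx z hz, mul_pow, ← pow_mul]
      gcongr
      omega
    have l0 := mul_nonneg (S.layer_nonneg hz) (sq_nonneg (v z - V (R z)))
    have l1 : 0 ≤ 4 * vp ^ 2 * ((R z ^ N * ψx z) ^ 2 + (ψ z / R z) ^ 2
      + layerWeight N k m (R z) * (v z - V (R z)) ^ 2) := by positivity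
    have l2 := sq_nonneg (gradG N V1 R v vx z)
    rw [e1, e2]
    unfold lowDens
    linarith
  · have cb : ContinuousOn (fun τ => ψx (-(m * τ), τ) ^ 2) (Icc 0 T) :=
      continuousOn_bdry (f := fun z => ψx z ^ 2) (F.contψx.pow 2)
    have hρi : 0 < ρb⁻¹ := by positivity
    have e : ∀ τ ∈ Icc 0 T, ub * dψ (-(m * τ), τ) ^ 2 + ub ^ 3 * φx (-(m * τ), τ) ^ 2
        = ρb⁻¹ * (1 + (ρb⁻¹) ^ 2) * (m * ψx (-(m * τ), τ) ^ 2) := by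
      intro τ hτ
      have hz := boundary_mem (m := m) hτ
      have hφ : m * φx (-(m * τ), τ) = ψx (-(m * τ), τ) := by
        have a1 := hφx _ hz
        have a2 := S.grad_boundary hτ
        have a3 := F.v_bdry τ hτ
        have a4 : V 1 ≠ 0 := by
          rw [← a3]; exact (F.vpos _ hz).ne'
        rw [F.R_bdry τ hτ, one_pow, one_mul, a2, a3] at a1
        rw [a1]
        field_simp
      have hmb' : ub = m * ρb⁻¹ := by rw [hmb]; field_simp
      rw [hψx _ hz, ← hφ, hmb']
      ring
    rw [setLIntegral_congr_fun (g := fun τ => ENNReal.ofReal (ρb⁻¹ * (1 + (ρb⁻¹) ^ 2)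
        * (m * ψx (-(m * τ), τ) ^ 2))) measurableSet_Icc (fun τ hτ => by rw [e τ hτ]),
      lintegral_Icc_eq_ofReal (g := fun τ => ρb⁻¹ * (1 + (ρb⁻¹) ^ 2)
        * (m * ψx (-(m * τ), τ) ^ 2)) hT (continuousOn_const.mul (continuousOn_const.mul cb))
        (fun τ _ => by positivity), intervalIntegral.integral_const_mul,
      intervalIntegral.integral_const_mul]
    exact ENNReal.ofReal_le_ofReal (mul_le_mul_of_nonneg_left hJ (by positivity))

end Norms

end InflowNS

/-! ### Choice of constants and conclusion. -/

open InflowNS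

theorem theorem4p1 (n : ℕ) (hn : 2 ≤ n) (μ γ K : ℝ) (hμ : 0 < μ) (hγ : 1 < γ) (hK : 0 < K) :
    ∃ α : ℝ, 0 < α ∧
      ∀ ρp : ℝ, 0 < ρp → ρp ≤ α →
        ∃ ε₀ ε C : ℝ, 0 < ε₀ ∧ 0 < ε ∧ 0 < C ∧
          ∀ ρb ub T : ℝ, 0 < ρb → 0 < ub → 0 < T → |ρb - ρp| ≤ ub ^ 2 → ub < ε →
          ∀ ρs us : ℝ → ℝ, InflowNS.IsStationary n μ γ K ρp ρb ub ρs us →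
          ∀ v u : ℝ × ℝ → ℝ, InflowNS.IsSolution n μ γ K (ρb * ub) T ρs us v u →
            (∀ t ∈ Set.Icc 0 T,
              InflowNS.energyN n (ρb * ub) ρs us v u t ≤ ENNReal.ofReal (2 * ε₀)) →
            (∀ z ∈ InflowNS.dom (ρb * ub) T, 1 / (2 * ρp) ≤ v z ∧ v z ≤ 2 / ρp) →
            (⨆ t ∈ Set.Icc 0 T, InflowNS.energyN n (ρb * ub) ρs us v u t ^ 2)
                + InflowNS.dissipM2 n (ρb * ub) ub ρs us v u T
              ≤ ENNReal.ofReal (C * (1 + 1 / ub ^ 2))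
                * InflowNS.energyN n (ρb * ub) ρs us v u 0 ^ 2 := by
  obtain ⟨N, rfl⟩ : ∃ N, n = N + 1 := ⟨n - 1, by omega⟩
  have hN : 1 ≤ N := by omega
  -- The value of α plays no role: the argument works for every ρ_+ > 0, with constants depending on
  -- it.
  refine ⟨1, one_pos, fun ρp hρp _ => ?_⟩
  set vp := ρp⁻¹ with hvpdef
  have hvp : 0 < vp := by positivity
  -- 8 vp⁴ converts |ρ_b - ρ_+| ≤ u_b² into a bound on V(1) - vp by m²: 1/ρ_b ≤ 2 vp gives 2 vp² in
  -- front of |ρ_b - ρ_+|, and u_b² = m²/ρ_b² gives another 4 vp².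
  obtain ⟨m0, k, L, hm0, hk, hL, hprof⟩ :=
    exists_profileBounds (C1 := 8 * vp ^ 4) hN hμ hγ hK hvp (by positivity)
  obtain ⟨cp, Cp, hpress⟩ := exists_pressureBounds hK hγ (by positivity : 0 < vp / 2)
    (by linarith : vp / 2 ≤ 2 * vp)
  obtain ⟨C, m1, e1, hC, hm1, he1, hap⟩ := Setting.exists_apriori N hμ hvp hk hL hpress.pos
    (hpress.pos.trans_le hpress.le)
  set w := 2 + 4 / vp ^ 2 with hw
  have hw0 : 0 < w := by positivity
  -- The energy density is at most w (2 ε₀)². This must be below e1 for the a priori estimate and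
  -- below e1² for |ψ| ≤ e1; ε₀ ≤ 1 reduces both to a linear condition.
  set ε₀ := min 1 (min e1 (e1 ^ 2) / (4 * w)) with hε₀
  have hε₀0 : 0 < ε₀ := by positivity
  have hε₀1 : w * (2 * ε₀) ^ 2 ≤ min e1 (e1 ^ 2) := by
    have h1 : ε₀ ^ 2 ≤ ε₀ := by
      have := mul_le_mul_of_nonneg_left (min_le_left 1 (min e1 (e1 ^ 2) / (4 * w))) hε₀0.le
      rw [← hε₀] at this
      linarith
    have h2 := min_le_right 1 (min e1 (e1 ^ 2) / (4 * w))
    rw [← hε₀, le_div_iff₀ (by positivity)] at h2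
    have h3 := mul_le_mul_of_nonneg_left h1 (by positivity : 0 ≤ 4 * w)
    linarith
  set M := 4 * (1 + 4 * vp ^ 2) + ((1 + 4 * vp ^ 2) + 1) + 2 * vp * (1 + 4 * vp ^ 2) with hM
  -- The first two entries give |ρ_b - ρ_+| ≤ u_b² ≤ u_b ≤ ρ_+/2, hence ρ_+/2 ≤ ρ_b ≤ 2 ρ_+; the
  -- third then makes m = ρ_b u_b at most both thresholds.
  refine ⟨ε₀, min (min 1 (ρp / 2)) (min m0 m1 / (2 * ρp)), M * (C * (w * (1 + 4 * vp ^ 2))),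
    hε₀0, by positivity, by positivity, ?_⟩
  intro ρb ub T hρb hub hT hρ hε ρs us hS v u hU hEn hv
  have hub1 : ub < 1 := hε.trans_le ((min_le_left _ _).trans (min_le_left _ _))
  have hub2 : ub < ρp / 2 := hε.trans_le ((min_le_left _ _).trans (min_le_right _ _))
  have hub3 : ub * (2 * ρp) < min m0 m1 := by
    have := hε.trans_le (min_le_right _ _)
    rwa [lt_div_iff₀ (by positivity)] at this
  have hubsq : ub ^ 2 ≤ ub := by nlinarith
  have hρ1 := abs_le.1 (hρ.trans (hubsq.trans hub2.le))
  have hρlow : ρp / 2 ≤ ρb := by linarith [hρ1.1]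
  have hρup : ρb ≤ 2 * ρp := by linarith [hρ1.2]
  have hρbi : ρb⁻¹ ≤ 2 * vp := by
    have : ρb⁻¹ ≤ (ρp / 2)⁻¹ := inv_anti₀ (by positivity) hρlow
    rw [inv_div] at this
    rw [hvpdef]
    exact this.trans_eq (div_eq_mul_inv _ _)
  have hρbi0 : 0 < ρb⁻¹ := by positivity
  have hρbi2 : (ρb⁻¹) ^ 2 ≤ 4 * vp ^ 2 := by
    have := pow_le_pow_left₀ hρbi0.le hρbi 2
    linarith
  have hm : 0 < ρb * ub := by positivity
  obtain ⟨P, -⟩ := hS.profile hρp hm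
  have hvlow : ∀ z ∈ dom (ρb * ub) T, vp / 2 ≤ v z := fun z hz => by
    have h := (hv z hz).1
    have e : vp / 2 = 1 / (2 * ρp) := by rw [hvpdef]; field_simp
    rwa [e]
  have hvup : ∀ z ∈ dom (ρb * ub) T, v z ≤ 2 * vp := fun z hz => by
    have h := (hv z hz).2
    rwa [div_eq_mul_inv] at h
  have vpos : ∀ z ∈ dom (ρb * ub) T, 0 < v z := fun z hz => by linarith [hvlow z hz]
  obtain ⟨vx, ψx, ψxx, ψt, F, hφx', hψx, hψxx⟩ := hU.flow hN hρp hm hT hS vpos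
  have hV1 : |(ρs 1)⁻¹ - vp| ≤ 8 * vp ^ 4 * (ρb * ub) ^ 2 := by
    rw [hS.density_boundary]
    have e1 : ρb⁻¹ - vp = ρb⁻¹ * vp * (ρp - ρb) := by rw [hvpdef]; field_simp
    have e2 : ub ^ 2 = (ρb⁻¹) ^ 2 * (ρb * ub) ^ 2 := by field_simp
    rw [e1, abs_mul, abs_of_pos (by positivity : 0 < ρb⁻¹ * vp), abs_sub_comm]
    calc ρb⁻¹ * vp * |ρb - ρp| ≤ 2 * vp * vp * (4 * vp ^ 2 * (ρb * ub) ^ 2) := by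
          have : |ρb - ρp| ≤ 4 * vp ^ 2 * (ρb * ub) ^ 2 := by
            refine hρ.trans ?_
            rw [e2]
            gcongr
          gcongr
      _ = _ := by ring
  have hmle : ρb * ub ≤ min m0 m1 := by nlinarith
  have hbounds := hprof (ρb * ub) hm (hmle.trans (min_le_left _ _)) _ _ _ P hV1
  set m := ρb * ub with hmdef
  set R := radius (N + 1) m v with hR
  set ψ := psi (N + 1) m us v u with hψdef
  set V : ℝ → ℝ := fun r => (ρs r)⁻¹ with hVdef
  set V1 := dr V with hV1def
  set φx := dx m (phi (N + 1) m ρs v) with hφxdef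
  have hφx : ∀ z ∈ dom m T, R z ^ N * φx z = v z * gradG N V1 R v vx z := fun z hz => by
    have h1 := F.pow_ne N z hz
    have h2 := (vpos z hz).ne'
    rw [hφx' z hz]
    unfold gradG
    field_simp
  have hnorm : ∀ c : ℝ, 0 ≤ c → ∀ t ∈ Icc 0 T, energyN (N + 1) m ρs us v u t ≤ ENNReal.ofReal c →
      ∀ X, 0 ≤ X → sl m (enDens N V V1 R v vx ψ ψx) X t ≤ w * c ^ 2 := by
    intro c hc t ht h X hX
    refine F.sl_enDens_le P hm hvp hvlow hφx hψx ht hc (le_trans ?_ h) hX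
    exact le_iSup₂_of_le (f := fun τ (_ : τ ∈ Icc 0 t) => normL2 m (phi (N + 1) m ρs v) ψ τ
      + normL2 m (fun z => R z ^ (N + 1 - 1) * φx z)
        (fun z => R z ^ (N + 1 - 1) * dx m ψ z) τ) t ⟨ht.1, le_rfl⟩ le_rfl
  have h0T : (0:ℝ) ∈ Icc 0 T := ⟨le_rfl, hT.le⟩
  have hEinf : ∀ t ∈ Icc 0 T, ∀ X, 0 ≤ X →
      sl m (enDens N V V1 R v vx ψ ψx) X t ≤ w * (2 * ε₀) ^ 2 := fun t ht =>
    hnorm (2 * ε₀) (by positivity) t ht (hEn t ht)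
  -- The initial norm is finite by the smallness hypothesis at t = 0, so the estimate can be carried
  -- out with real numbers.
  set N0 := (energyN (N + 1) m ρs us v u 0).toReal with hN0
  have hN0fin : energyN (N + 1) m ρs us v u 0 = ENNReal.ofReal N0 :=
    (ENNReal.ofReal_toReal (ne_top_of_le_ne_top ENNReal.ofReal_ne_top (hEn 0 h0T))).symm
  have hN00 : 0 ≤ N0 := ENNReal.toReal_nonneg
  have hEin : ∀ X, 0 ≤ X → sl m (enDens N V V1 R v vx ψ ψx) X 0 ≤ w * N0 ^ 2 :=
    hnorm N0 hN00 0 h0T hN0fin.le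
  have hψle : ∀ z ∈ dom m T, |ψ z| ≤ e1 := by
    rintro ⟨x, t⟩ hz
    have h1 := F.psi_sq_le hm (c := w * (2 * ε₀) ^ 2) (fun X hX => by
      refine (sl_mono hm (g := enDens N V V1 R v vx ψ ψx) ((F.contψ.pow 2).add
        (((F.contR.pow N).mul F.contψx).pow 2)) ((((((F.contPhi P).pow 2).add
          (F.contψ.pow 2)).add ((F.contGradG P).pow 2)).add
            (((F.contR.pow N).mul F.contψx).pow 2))) hz.1 hX (fun z _ _ => ?_)).trans
              (hEinf t hz.1 X hX)
      have g1 := sq_nonneg (v z - V (R z))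
      have g2 := sq_nonneg (gradG N V1 R v vx z)
      show ψ z ^ 2 + (R z ^ N * ψx z) ^ 2 ≤ _
      unfold enDens
      linarith) hz
    exact abs_le_of_sq_le_sq (h1.trans (hε₀1.trans (min_le_right _ _))) he1.le
  have S : Setting N μ γ K m T vp k L cp Cp e1 V V1 (dr V1) R v vx u ψ ψx ψxx ψt :=
    { flow := F, prof := P, bounds := hbounds, press := hpress, one_le_N := hN, hμ := hμ, hγ := hγ,
      hm := hm, hvp := hvp, hk := hk, hL := hL, hδ := he1.le,
      mem := fun z hz => ⟨hvlow z hz, hvup z hz⟩, psi_le := hψle,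
      grow := fun η hη => radius_pow_le_mul hm hT vpos F.contv hvup hη }
  obtain ⟨r1, r2, r3, r4⟩ := hap S hT.le (hmle.trans (min_le_right _ _)) le_rfl _ _
    (hε₀1.trans (min_le_left _ _)) hEinf hEin
  set E := C * ((1 + 1 / m ^ 2) * (w * N0 ^ 2)) with hEdef
  have hE0 : 0 ≤ E := by positivity
  have hsup : (⨆ t ∈ Icc 0 T, energyN (N + 1) m ρs us v u t ^ 2)
      ≤ ENNReal.ofReal (4 * (1 + 4 * vp ^ 2) * E) := by
    refine iSup₂_le fun t ht => ?_
    have h1 : energyN (N + 1) m ρs us v u t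
        ≤ ENNReal.ofReal (2 * √((1 + 4 * vp ^ 2) * E)) := by
      refine iSup₂_le fun τ hτ => ?_
      have hτ' : τ ∈ Icc 0 T := ⟨hτ.1, hτ.2.trans ht.2⟩
      exact F.norms_le P hm hvup hφx hψx hτ' hE0 (r1 τ hτ')
    refine (pow_le_pow_left' h1 2).trans_eq ?_
    rw [← ENNReal.ofReal_pow (by positivity), mul_pow, Real.sq_sqrt (by positivity)]
    congr 1
    ring
  have hdis : dissipM2 (N + 1) m ub ρs us v u T ≤ ENNReal.ofReal ((1 + 4 * vp ^ 2) * E + E)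
        + ENNReal.ofReal (ρb⁻¹ * (1 + (ρb⁻¹) ^ 2) * E) :=
    S.dissipation_le hT.le hρb hmdef hφx hψx hψxx r2 r3 r4
  refine (add_le_add hsup hdis).trans ?_
  rw [hN0fin, ← ENNReal.ofReal_pow hN00, ← ENNReal.ofReal_mul (by positivity),
    ← ENNReal.ofReal_add (by positivity) (by positivity),
    ← ENNReal.ofReal_add (by positivity) (by positivity)]
  refine ENNReal.ofReal_le_ofReal ?_
  have f1 : ρb⁻¹ * (1 + (ρb⁻¹) ^ 2) * E ≤ 2 * vp * (1 + 4 * vp ^ 2) * E := by gcongr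
  -- Replaces 1/m² by 1/u_b²; ρ_b ≥ ρ_+/2 makes the constant depend on ρ_+ only.
  have f2 : 1 + 1 / m ^ 2 ≤ (1 + 4 * vp ^ 2) * (1 + 1 / ub ^ 2) := by
    have e : 1 / m ^ 2 = (ρb⁻¹) ^ 2 * (1 / ub ^ 2) := by rw [hmdef]; field_simp
    have g := mul_le_mul_of_nonneg_right hρbi2 (by positivity : 0 ≤ 1 / ub ^ 2)
    have g1 : 0 ≤ 1 / ub ^ 2 := by positivity
    have g2 : 0 ≤ 4 * vp ^ 2 := by positivity
    rw [e]
    linarith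
  have f3 : E ≤ C * (((1 + 4 * vp ^ 2) * (1 + 1 / ub ^ 2)) * (w * N0 ^ 2)) := by
    rw [hEdef]; gcongr
  have f4 := mul_le_mul_of_nonneg_left f3 (by positivity : 0 ≤ M)
  calc _ ≤ M * E := by rw [hM]; linarith
    _ ≤ _ := f4
    _ = _ := by ring
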